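/- **Setting.** Let $d\ge 5$, $\alpha>\tfrac14$, $\kappa\ge 0$. For $n\in\mathbb Z^d$ put $|n|=\max(\max_i|n_i|,1)$, $v_n=\kappa|n|^{-\alpha}$; let $\omega=(\omega_n)_{n\in\mathbb Z^d}$ be i.i.d. symmetric $\pm1$ Bernoulli variables and $V(n)=v_n\omega_n$. Functions on $\mathbb Z^d$ are also regarded as diagonal matrices. Let $\Delta(n,n')=\delta_{|n-n'|_1,1}-2d\,\delta_{n,n'}$, $\hat G_0(\xi)=(2d-2\sum_j\cos 2\pi\xi_j)^{-1}$, and let $$G_0(n,n')=\int_{\mathbb T^d}e^{-2\pi i(n-n')\cdot\xi}\,\hat G_0(\xi)\,d\xi$$ be the kernel of $(-\Delta)^{-1}$. Put $\sigma=G_0(0,0)$, $\widetilde G_0=G_0-\sigma I$, $\rho=2\sigma^3-(\hat G_0*\hat G_0*\hat G_0)(0)$, $\eta=(\hat G_0-\sigma)*\big((\hat G_0-\sigma)*(\hat G_0-\sigma)\big)^2(0)$, and $$M_4(n_1,n_2)=\widetilde G_0(n_1,n_2)^3,\quad M=M_4-(\sigma^3-\rho)I,\quad W=v^2Mv^2,$$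 $$D_4(n_1)=v_{n_1}^2\sum_{n_2}v_{n_2}^2\widetilde G_0(n_1,n_2)^4,\quad D_6^{(1)}(n_1)=v_{n_1}^2\sum_{n_2}v_{n_2}^4\widetilde G_0(n_1,n_2)^4,\quad R_6(n_1)=v_{n_1}^2(\widetilde G_0W\widetilde G_0)(n_1,n_1),$$ $$D_6^{(2)}(n_1)=v_{n_1}^2\sum_{n_2,n_3}v_{n_2}^2v_{n_3}^2\widetilde G_0(n_1,n_2)^2\widetilde G_0(n_1,n_3)^2\widetilde G_0(n_2,n_3)^2,\quad D_7(n_1)=v_{n_1}^4\sum_{n_2}v_{n_2}^3\omega_{n_2}\widetilde G_0(n_1,n_2)^6,$$ $$C(n_1,n_3)=v_{n_1}^2v_{n_3}^2\widetilde G_0(n_1,n_3)\sum_{n_2}\widetilde G_0(n_1,n_2)^2v_{n_2}^2\widetilde G_0(n_2,n_3)^2-\eta\,\delta_{n_1,n_3}v_{n_1}^6,$$ $$S(n_1,n_3)=v_{n_1}^2v_{n_3}^2\widetilde G_0(n_1,n_3)^2\sum_{n_2}\widetilde G_0(n_1,n_2)^3v_{n_2}^2\widetilde G_0(n_2,n_3).$$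 Let $H=-\Delta+V^{(6)}_\omega$ with $V^{(6)}_\omega=V+\Delta_2V+\Delta_4V+\Delta_6V$, where $\Delta_2V=\sigma v^2$, $\Delta_4V=-\rho v^4$, $\Delta_6V=(4\eta-3\sigma^5+5\sigma^2\rho)v^6+R_6$. A tuple $(n_1,\dots,n_s)$ is *admissible* if for all $1\le s_1<s_2\le s$ the product $\omega_{n_{s_1}}\cdots\omega_{n_{s_2}}$ is not almost surely equal to $1$. For non-random matrices $A_0,\dots,A_s$, $(A_0VA_1V\cdots VA_s)^{(*)}(n,n')$ denotes the sum of $A_0(n,n_1)V(n_1)A_1(n_1,n_2)\cdots V(n_s)A_s(n_s,n')$ over the admissible tuples of sites $(n_1,\dots,n_s)$ at which the factors $V$ stand, taken as an unconditionally convergent sum in $L^2(\mathbb P)$. A term with a single factor $V$ is read in the same way; products of non-random matrices are absolutely convergent sums. By $G=H^{-1}$ we mean the matrix of the inverse of $H$ on $\ell^2(\mathbb Z^d)$, i.e. $HG=GH=I$ with all rows and columns of $G$ in $\ell^2(\mathbb Z^d)$. Define $[G_0,0],\dots,[G_0,5]$ by - $[G_0,0]=G_0$, $\;[G_0,1]=-G_0VG_0$,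 $\;[G_0,2]=(G_0VG_0VG_0)^{(*)}$, $\;[G_0,3]=\sigma^2G_0v^2VG_0-(G_0VG_0VG_0VG_0)^{(*)}$, - $[G_0,4]=-\sigma^2(G_0v^2VG_0VG_0)^{(*)}-\sigma^2(G_0VG_0v^2VG_0)^{(*)}+(G_0VG_0VG_0VG_0VG_0)^{(*)}+G_0WG_0$, - $[G_0,5]=-2\sigma\rho\,G_0v^4VG_0+G_0VD_4G_0-G_0V\widetilde G_0WG_0-G_0W\widetilde G_0VG_0+\sigma^2(G_0v^2VG_0VG_0VG_0)^{(*)}+\sigma^2(G_0VG_0v^2VG_0VG_0)^{(*)}+\sigma^2(G_0VG_0VG_0v^2VG_0)^{(*)}-(G_0VG_0VG_0VG_0VG_0VG_0)^{(*)}$, and $\mathcal R_5=\sum_{i=0}^5[G_0,i]$. Define $$\begin{aligned} [G_0,6]={}&2\sigma\rho\big((G_0v^4VG_0VG_0)^{(*)}+(G_0VG_0v^4VG_0)^{(*)}\big)+\sigma^4(G_0v^2VG_0v^2VG_0)^{(*)}\\ &-\sigma^2\big((G_0v^2VG_0VG_0VG_0VG_0)^{(*)}+(G_0VG_0v^2VG_0VG_0VG_0)^{(*)}\\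 &\qquad+(G_0VG_0VG_0v^2VG_0VG_0)^{(*)}+(G_0VG_0VG_0VG_0v^2VG_0)^{(*)}\big)\\ &+(G_0VG_0VG_0VG_0VG_0VG_0VG_0)^{(*)}\\ &+(G_0W\widetilde G_0VG_0VG_0)^{(*)}+(G_0V\widetilde G_0W\widetilde G_0VG_0)^{(*)}+(G_0VG_0V\widetilde G_0WG_0)^{(*)}\\ &-(G_0VD_4G_0VG_0)^{(*)}-(G_0VG_0VD_4G_0)^{(*)}\\ &+4G_0CG_0-2\sigma^2(G_0v^2WG_0+G_0Wv^2G_0), \end{aligned}$$ $$\begin{aligned} [G_0,7]={}&2\sigma G_0VR_6G_0+(8\eta\sigma-7\sigma^6+12\sigma^3\rho)G_0v^6VG_0\\ &-2\sigma\rho\big((G_0v^4VG_0VG_0VG_0)^{(*)}+(G_0VG_0v^4VG_0VG_0)^{(*)}+(G_0VG_0VG_0v^4VG_0)^{(*)}\big)\\ &-\sigma^4\big((G_0v^2VG_0v^2VG_0VG_0)^{(*)}+(G_0v^2VG_0VG_0v^2VG_0)^{(*)}+(G_0VG_0v^2VG_0v^2VG_0)^{(*)}\big)\\ &+\sigma^2\big((G_0v^2VG_0VG_0VG_0VG_0VG_0)^{(*)}+(G_0VG_0v^2VG_0VG_0VG_0VG_0)^{(*)}\\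 &\qquad+(G_0VG_0VG_0v^2VG_0VG_0VG_0)^{(*)}+(G_0VG_0VG_0VG_0v^2VG_0VG_0)^{(*)}\\ &\qquad+(G_0VG_0VG_0VG_0VG_0v^2VG_0)^{(*)}\big)\\ &+\sigma^2(G_0W\widetilde G_0v^2VG_0+G_0v^2V\widetilde G_0WG_0)\\ &+2\sigma^2(G_0Wv^2\widetilde G_0VG_0+G_0v^2W\widetilde G_0VG_0+G_0V\widetilde G_0v^2WG_0+G_0V\widetilde G_0Wv^2G_0)\\ &-3\sigma^2G_0v^2VD_4G_0-2\sigma^2G_0VD_6^{(1)}G_0\\ &-(G_0VG_0VG_0VG_0VG_0VG_0VG_0VG_0)^{(*)}\\ &-\big((G_0W\widetilde G_0VG_0VG_0VG_0)^{(*)}+(G_0V\widetilde G_0W\widetilde G_0VG_0VG_0)^{(*)}\\ &\qquad+(G_0VG_0V\widetilde G_0W\widetilde G_0VG_0)^{(*)}+(G_0VG_0VG_0V\widetilde G_0WG_0)^{(*)}\big)\\ &+(G_0VD_4G_0VG_0VG_0)^{(*)}+(G_0VG_0VD_4G_0VG_0)^{(*)}+(G_0VG_0VG_0VD_4G_0)^{(*)}\\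 &+G_0v^2M_4v^2VM_4v^2G_0-G_0D_7G_0-4(G_0C\widetilde G_0VG_0+G_0V\widetilde G_0CG_0)\\ &+4G_0VD_6^{(2)}G_0+G_0VSG_0+G_0S^{\top}VG_0, \end{aligned}$$ $$A=\mathcal R_5+[G_0,6]+[G_0,7],\qquad B=-V[G_0,7]-\Delta_2V\sum_{i=6}^{7}[G_0,i]-\Delta_4V\sum_{i=4}^{7}[G_0,i]-\Delta_6V\sum_{i=2}^{7}[G_0,i].$$ **Theorem 4.2.** All series above converge: the non-random ones absolutely, the admissible sums unconditionally in $L^2(\mathbb P)$, and those in $D_7$ and $G_0D_7G_0$ absolutely, almost surely. Moreover, for almost every $\omega$ the following holds: if $G=H^{-1}$ exists (in the above sense), then $$G=A+GB,\qquad\text{that is,}\qquad G(n,n')=A(n,n')+\sum_{m\in\mathbb Z^d}G(n,m)B(m,n')\quad\text{for all }n,n'\in\mathbb Z^d,$$ where the sum over $m$ converges absolutely. -/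

import Mathlib

open MeasureTheory ProbabilityTheory Filter Topology
open scoped ENNReal

noncomputable section

namespace Renorm

/-! ## The lattice, kernels, and the free Green's function -/

/-- The lattice `ℤ^d`. -/
abbrev Site (d : ℕ) := Fin d → ℤ

/-- Infinite real matrices indexed by `ℤ^d`. -/
abbrev Kern (d : ℕ) := Site d → Site d → ℝ

/-- The diagonal matrix with entries `f n`. -/
def diag {d : ℕ} (f : Site d → ℝ) : Kern d := fun n n' => if n = n' then f n else 0

/-- The transposed matrix. -/
def transp {d : ℕ} (X : Kern d) : Kern d := fun n n' => X n' n

/-- `|n| = max (max_i |n_i|) 1` (the norm on `Fin d → ℤ` is the sup norm). -/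
def siteNorm {d : ℕ} (n : Site d) : ℝ := max ‖n‖ 1

/-- The discrete Laplacian: `1` between nearest neighbours, `-2d` on the diagonal. -/
def laplacian (d : ℕ) : Kern d := fun n n' =>
  (if ∑ i, |n i - n' i| = 1 then 1 else 0) - (if n = n' then 2 * (d : ℝ) else 0)

/-- The Fourier symbol of `G₀ = (-Δ)⁻¹`, a `ℤ^d`-periodic function on `ℝ^d`. -/
def G0hat (d : ℕ) (ξ : Fin d → ℝ) : ℝ :=
  (2 * (d : ℝ) - 2 * ∑ j, Real.cos (2 * Real.pi * ξ j))⁻¹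

/-- `G₀(n,n') = ∫_{𝕋^d} e^{-2πi(n-n')·ξ} / (2d - 2 ∑ cos 2πξ_j) dξ`; the torus is represented by
the unit cube, and the sine part of the integral vanishes because the symbol is even. -/
def G0 (d : ℕ) : Kern d := fun n n' =>
  ∫ ξ in Set.Icc (0 : Fin d → ℝ) 1,
    Real.cos (2 * Real.pi * ∑ j, ((n j - n' j : ℤ) : ℝ) * ξ j) * G0hat d ξ

/-- Convolution over the torus of two `ℤ^d`-periodic functions. -/
def torusConv {d : ℕ} (f g : (Fin d → ℝ) → ℝ) (ξ : Fin d → ℝ) : ℝ :=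
  ∫ θ in Set.Icc (0 : Fin d → ℝ) 1, f (ξ - θ) * g θ

/-- `σ = G₀(0,0)`. -/
def sigma (d : ℕ) : ℝ := G0 d 0 0

/-- `ρ = 2σ³ - (Ĝ₀ * Ĝ₀ * Ĝ₀)(0)`. -/
def rho (d : ℕ) : ℝ :=
  2 * sigma d ^ 3 - torusConv (torusConv (G0hat d) (G0hat d)) (G0hat d) 0

/-- `η = ((Ĝ₀ - σ) * ((Ĝ₀ - σ) * (Ĝ₀ - σ))²)(0)`, the square being pointwise. -/
def eta (d : ℕ) : ℝ :=
  torusConv (fun ξ => G0hat d ξ - sigma d)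
    (fun ξ => torusConv (fun θ => G0hat d θ - sigma d) (fun θ => G0hat d θ - sigma d) ξ ^ 2) 0

/-- `G̃₀ = G₀ - σ I`. -/
def Gt (d : ℕ) : Kern d := fun n n' => G0 d n n' - if n = n' then sigma d else 0

/-! ## Products of matrices as sums over paths -/

/-- The vertices `n, t₀, …, t_{s-1}, n'` of a path, numbered `0, 1, …, s + 1`. -/
def vertex {d s : ℕ} (n n' : Site d) (t : Fin s → Site d) (j : ℕ) : Site d :=
  if j = 0 then n else if h : j - 1 < s then t ⟨j - 1, h⟩ else n'

/-- For `L = [X₀, …, X_s]`: the number `X₀(n,t₀) X₁(t₀,t₁) ⋯ X_s(t_{s-1},n')`. -/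
def pathWeight {d : ℕ} (L : List (Kern d)) (n n' : Site d)
    (t : Fin (L.length - 1) → Site d) : ℝ :=
  ∏ j ∈ Finset.range L.length, L.getD j 0 (vertex n n' t j) (vertex n n' t (j + 1))

/-- The matrix product `X₀ X₁ ⋯ X_s`, entrywise the sum over all paths. -/
def kprod {d : ℕ} (L : List (Kern d)) : Kern d := fun n n' => ∑' t, pathWeight L n n' t

/-- All entries of the product `X₀ X₁ ⋯ X_s` converge absolutely. -/
def ProdConverges {d : ℕ} (L : List (Kern d)) : Prop :=
  ∀ n n', Summable (fun t => pathWeight L n n' t)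

/-! ## The potential and the non-random operators -/

/-- `v_n = κ |n|^{-α}`. -/
def v {d : ℕ} (α κ : ℝ) (n : Site d) : ℝ := κ * siteNorm n ^ (-α)

/-- Multiplication by `v^k`. -/
def vp (d : ℕ) (α κ : ℝ) (k : ℕ) : Kern d := diag (fun n => v α κ n ^ k)

/-- `M₄(n₁,n₂) = G̃₀(n₁,n₂)³`. -/
def M4 (d : ℕ) : Kern d := fun n₁ n₂ => Gt d n₁ n₂ ^ 3

/-- `M = M₄ - (σ³ - ρ) I`. -/
def M (d : ℕ) : Kern d := fun n₁ n₂ =>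
  M4 d n₁ n₂ - if n₁ = n₂ then sigma d ^ 3 - rho d else 0

/-- `W = v² M v²`. -/
def W (d : ℕ) (α κ : ℝ) : Kern d := fun n₁ n₂ => v α κ n₁ ^ 2 * M d n₁ n₂ * v α κ n₂ ^ 2

/-- `D₄(n₁) = v_{n₁}² ∑_{n₂} v_{n₂}² G̃₀(n₁,n₂)⁴`. -/
def D4 (d : ℕ) (α κ : ℝ) (n₁ : Site d) : ℝ :=
  v α κ n₁ ^ 2 * ∑' n₂, v α κ n₂ ^ 2 * Gt d n₁ n₂ ^ 4

/-- `R₆(n₁) = v_{n₁}² (G̃₀ W G̃₀)(n₁,n₁)`. -/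
def R6 (d : ℕ) (α κ : ℝ) (n₁ : Site d) : ℝ :=
  v α κ n₁ ^ 2 * kprod [Gt d, W d α κ, Gt d] n₁ n₁

/-- `C(n₁,n₃) = v_{n₁}² v_{n₃}² G̃₀(n₁,n₃) ∑_{n₂} G̃₀(n₁,n₂)² v_{n₂}² G̃₀(n₂,n₃)²
- η δ_{n₁,n₃} v_{n₁}⁶`. -/
def C (d : ℕ) (α κ : ℝ) : Kern d := fun n₁ n₃ =>
  v α κ n₁ ^ 2 * v α κ n₃ ^ 2 * Gt d n₁ n₃ *
      (∑' n₂, Gt d n₁ n₂ ^ 2 * v α κ n₂ ^ 2 * Gt d n₂ n₃ ^ 2)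
    - if n₁ = n₃ then eta d * v α κ n₁ ^ 6 else 0

/-- `D₆⁽¹⁾(n₁) = v_{n₁}² ∑_{n₂} v_{n₂}⁴ G̃₀(n₁,n₂)⁴`. -/
def D61 (d : ℕ) (α κ : ℝ) (n₁ : Site d) : ℝ :=
  v α κ n₁ ^ 2 * ∑' n₂, v α κ n₂ ^ 4 * Gt d n₁ n₂ ^ 4

/-- `D₆⁽²⁾(n₁) = v_{n₁}² ∑_{n₂,n₃} v_{n₂}² v_{n₃}² G̃₀(n₁,n₂)² G̃₀(n₁,n₃)² G̃₀(n₂,n₃)²`. -/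
def D62 (d : ℕ) (α κ : ℝ) (n₁ : Site d) : ℝ :=
  v α κ n₁ ^ 2 * ∑' p : Site d × Site d,
    v α κ p.1 ^ 2 * v α κ p.2 ^ 2 * Gt d n₁ p.1 ^ 2 * Gt d n₁ p.2 ^ 2 * Gt d p.1 p.2 ^ 2

/-- `S(n₁,n₃) = v_{n₁}² v_{n₃}² G̃₀(n₁,n₃)² ∑_{n₂} G̃₀(n₁,n₂)³ v_{n₂}² G̃₀(n₂,n₃)`. -/
def S (d : ℕ) (α κ : ℝ) : Kern d := fun n₁ n₃ =>
  v α κ n₁ ^ 2 * v α κ n₃ ^ 2 * Gt d n₁ n₃ ^ 2 *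
    ∑' n₂, Gt d n₁ n₂ ^ 3 * v α κ n₂ ^ 2 * Gt d n₂ n₃

/-- The series that define `D₄, R₆, C, D₆⁽¹⁾, D₆⁽²⁾, S` converge absolutely. -/
def CoefficientSeriesConverge (d : ℕ) (α κ : ℝ) : Prop :=
  (∀ n₁ : Site d, Summable fun n₂ => v α κ n₂ ^ 2 * Gt d n₁ n₂ ^ 4) ∧
  ProdConverges [Gt d, W d α κ, Gt d] ∧
  (∀ n₁ n₃ : Site d, Summable fun n₂ => Gt d n₁ n₂ ^ 2 * v α κ n₂ ^ 2 * Gt d n₂ n₃ ^ 2) ∧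
  (∀ n₁ : Site d, Summable fun n₂ => v α κ n₂ ^ 4 * Gt d n₁ n₂ ^ 4) ∧
  (∀ n₁ : Site d, Summable fun p : Site d × Site d =>
    v α κ p.1 ^ 2 * v α κ p.2 ^ 2 * Gt d n₁ p.1 ^ 2 * Gt d n₁ p.2 ^ 2 * Gt d p.1 p.2 ^ 2) ∧
  (∀ n₁ n₃ : Site d, Summable fun n₂ => Gt d n₁ n₂ ^ 3 * v α κ n₂ ^ 2 * Gt d n₂ n₃)

/-! ## Randomness: admissible sums -/

section Random

variable {d : ℕ} {Ω : Type*} [MeasurableSpace Ω]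

/-- `(ω_n)` is a family of independent symmetric `±1` Bernoulli variables. -/
structure IsBernoulliField (P : Measure Ω) (ω : Site d → Ω → ℝ) : Prop where
  measurable : ∀ n, Measurable (ω n)
  indep : iIndepFun ω P
  law : ∀ n, P.map (ω n) =
    (2 : ℝ≥0∞)⁻¹ • Measure.dirac (1 : ℝ) + (2 : ℝ≥0∞)⁻¹ • Measure.dirac (-1 : ℝ)

/-- The randomness of the sub-tuple `(t_a, …, t_b)` cancels. -/
def Cancels (P : Measure Ω) (ω : Site d → Ω → ℝ) {s : ℕ} (t : Fin s → Site d)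
    (a b : Fin s) : Prop :=
  ∀ᵐ w ∂P, ∏ i ∈ Finset.Icc a b, ω (t i) w = 1

/-- The tuple is admissible: no sub-tuple of at least two consecutive entries cancels. -/
def Admissible (P : Measure Ω) (ω : Site d → Ω → ℝ) {s : ℕ} (t : Fin s → Site d) : Prop :=
  ∀ a b : Fin s, a < b → ¬ Cancels P ω t a b

/-- `S` is the unconditional sum of the family `f` in `L²(P)`: the net of finite partial sums
converges to `S` in mean square. -/
def IsL2Sum (P : Measure Ω) {ι : Type*} (f : ι → Ω → ℝ) (S : Ω → ℝ) : Prop :=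
  MemLp S 2 P ∧
    Tendsto (fun F : Finset ι => eLpNorm (fun w => ∑ i ∈ F, f i w - S w) 2 P) atTop (𝓝 0)

open Classical in
/-- The unconditional `L²(P)` sum of a family (unique up to a null set). -/
def l2Sum (P : Measure Ω) {ι : Type*} (f : ι → Ω → ℝ) : Ω → ℝ :=
  if h : ∃ S, IsL2Sum P f S then h.choose else 0

/-- The summand of `(A₀ V A₁ V ⋯ V A_s)^{(*)}(n,n')`, `V = diag (v_n ω_n)`, that belongs to the
admissible tuple `t`. The word `A` lists `A₀, …, A_s`, and each `A_i` is itself given as a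
product of non-random matrices. -/
def admSummand (P : Measure Ω) (ω : Site d → Ω → ℝ) (α κ : ℝ) (A : List (List (Kern d)))
    (n n' : Site d)
    (t : {t : Fin ((A.map kprod).length - 1) → Site d // Admissible P ω t}) (w : Ω) : ℝ :=
  pathWeight (A.map kprod) n n' t.1 * ∏ i, (v α κ (t.1 i) * ω (t.1 i) w)

/-- `(A₀ V A₁ V ⋯ V A_s)^{(*)}(n,n')`. For a word with one entry there is no `V`, and this is
the non-random matrix `A₀`. -/
def admSum (P : Measure Ω) (ω : Site d → Ω → ℝ) (α κ : ℝ) (A : List (List (Kern d)))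
    (n n' : Site d) : Ω → ℝ :=
  l2Sum P (admSummand P ω α κ A n n')

/-- All series in `(A₀ V A₁ V ⋯ V A_s)^{(*)}` converge: absolutely inside each `A_i`, and
unconditionally in `L²(P)` over the admissible tuples. -/
def AdmConverges (P : Measure Ω) (ω : Site d → Ω → ℝ) (α κ : ℝ)
    (A : List (List (Kern d))) : Prop :=
  (∀ L ∈ A, ProdConverges L) ∧ ∀ n n', ∃ S, IsL2Sum P (admSummand P ω α κ A n n') S

/-- The value of a linear combination `∑ c (A₀ V A₁ V ⋯ V A_s)^{(*)}`. -/
def evalExp (P : Measure Ω) (ω : Site d → Ω → ℝ) (α κ : ℝ)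
    (E : List (ℝ × List (List (Kern d)))) (n n' : Site d) (w : Ω) : ℝ :=
  (E.map fun p => p.1 * admSum P ω α κ p.2 n n' w).sum

end Random

/-! ## The terms of order `0, …, 7`

An entry `(c, [A₀, …, A_s])` stands for `c (A₀ V A₁ V ⋯ V A_s)^{(*)}`; for instance
`(c, [[G₀, v²], [G₀], [G₀]])` is `c (G₀ v² V G₀ V G₀)^{(*)}`, and `(c, [[G₀, W, G₀]])` is the
non-random operator `c G₀ W G₀`. -/

section Terms

variable (d : ℕ) (α κ : ℝ)

def terms0 : List (ℝ × List (List (Kern d))) := [(1, [[G0 d]])]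

def terms1 : List (ℝ × List (List (Kern d))) := [(-1, [[G0 d], [G0 d]])]

def terms2 : List (ℝ × List (List (Kern d))) := [(1, [[G0 d], [G0 d], [G0 d]])]

def terms3 : List (ℝ × List (List (Kern d))) :=
  let g := G0 d
  let σ := sigma d
  let v2 := vp d α κ 2
  [(σ ^ 2, [[g, v2], [g]]),
   (-1, [[g], [g], [g], [g]])]

def terms4 : List (ℝ × List (List (Kern d))) :=
  let g := G0 d
  let σ := sigma d
  let v2 := vp d α κ 2
  [(-σ ^ 2, [[g, v2], [g], [g]]),
   (-σ ^ 2, [[g], [g, v2], [g]]),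
   (1, [[g], [g], [g], [g], [g]]),
   (1, [[g, W d α κ, g]])]

def terms5 : List (ℝ × List (List (Kern d))) :=
  let g := G0 d
  let gt := Gt d
  let σ := sigma d
  let ρ := rho d
  let v2 := vp d α κ 2
  let v4 := vp d α κ 4
  let W := W d α κ
  let D4 := diag (D4 d α κ)
  [(-(2 * σ * ρ), [[g, v4], [g]]),
   (1, [[g], [D4, g]]),
   (-1, [[g], [gt, W, g]]),
   (-1, [[g, W, gt], [g]]),
   (σ ^ 2, [[g, v2], [g], [g], [g]]),
   (σ ^ 2, [[g], [g, v2], [g], [g]]),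
   (σ ^ 2, [[g], [g], [g, v2], [g]]),
   (-1, [[g], [g], [g], [g], [g], [g]])]

def terms6 : List (ℝ × List (List (Kern d))) :=
  let g := G0 d
  let gt := Gt d
  let σ := sigma d
  let ρ := rho d
  let v2 := vp d α κ 2
  let v4 := vp d α κ 4
  let W := W d α κ
  let C := C d α κ
  let D4 := diag (D4 d α κ)
  [(2 * σ * ρ, [[g, v4], [g], [g]]),
   (2 * σ * ρ, [[g], [g, v4], [g]]),
   (σ ^ 4, [[g, v2], [g, v2], [g]]),
   (-σ ^ 2, [[g, v2], [g], [g], [g], [g]]),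
   (-σ ^ 2, [[g], [g, v2], [g], [g], [g]]),
   (-σ ^ 2, [[g], [g], [g, v2], [g], [g]]),
   (-σ ^ 2, [[g], [g], [g], [g, v2], [g]]),
   (1, [[g], [g], [g], [g], [g], [g], [g]]),
   (1, [[g, W, gt], [g], [g]]),
   (1, [[g], [gt, W, gt], [g]]),
   (1, [[g], [g], [gt, W, g]]),
   (-1, [[g], [D4, g], [g]]),
   (-1, [[g], [g], [D4, g]]),
   (4, [[g, C, g]]),
   (-(2 * σ ^ 2), [[g, v2, W, g]]),
   (-(2 * σ ^ 2), [[g, W, v2, g]])]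

/-- All terms of order `7` except `- G₀ D₇ G₀`. -/
def terms7 : List (ℝ × List (List (Kern d))) :=
  let g := G0 d
  let gt := Gt d
  let σ := sigma d
  let ρ := rho d
  let η := eta d
  let v2 := vp d α κ 2
  let v4 := vp d α κ 4
  let v6 := vp d α κ 6
  let W := W d α κ
  let C := C d α κ
  let S := S d α κ
  let M4 := M4 d
  let D4 := diag (D4 d α κ)
  let D61 := diag (D61 d α κ)
  let D62 := diag (D62 d α κ)
  let R6 := diag (R6 d α κ)
  [(2 * σ, [[g], [R6, g]]),
   (8 * η * σ - 7 * σ ^ 6 + 12 * σ ^ 3 * ρ, [[g, v6], [g]]),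
   (-(2 * σ * ρ), [[g, v4], [g], [g], [g]]),
   (-(2 * σ * ρ), [[g], [g, v4], [g], [g]]),
   (-(2 * σ * ρ), [[g], [g], [g, v4], [g]]),
   (-σ ^ 4, [[g, v2], [g, v2], [g], [g]]),
   (-σ ^ 4, [[g, v2], [g], [g, v2], [g]]),
   (-σ ^ 4, [[g], [g, v2], [g, v2], [g]]),
   (σ ^ 2, [[g, v2], [g], [g], [g], [g], [g]]),
   (σ ^ 2, [[g], [g, v2], [g], [g], [g], [g]]),
   (σ ^ 2, [[g], [g], [g, v2], [g], [g], [g]]),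
   (σ ^ 2, [[g], [g], [g], [g, v2], [g], [g]]),
   (σ ^ 2, [[g], [g], [g], [g], [g, v2], [g]]),
   (σ ^ 2, [[g, W, gt, v2], [g]]),
   (σ ^ 2, [[g, v2], [gt, W, g]]),
   (2 * σ ^ 2, [[g, W, v2, gt], [g]]),
   (2 * σ ^ 2, [[g, v2, W, gt], [g]]),
   (2 * σ ^ 2, [[g], [gt, v2, W, g]]),
   (2 * σ ^ 2, [[g], [gt, W, v2, g]]),
   (-(3 * σ ^ 2), [[g, v2], [D4, g]]),
   (-(2 * σ ^ 2), [[g], [D61, g]]),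
   (-1, [[g], [g], [g], [g], [g], [g], [g], [g]]),
   (-1, [[g, W, gt], [g], [g], [g]]),
   (-1, [[g], [gt, W, gt], [g], [g]]),
   (-1, [[g], [g], [gt, W, gt], [g]]),
   (-1, [[g], [g], [g], [gt, W, g]]),
   (1, [[g], [D4, g], [g], [g]]),
   (1, [[g], [g], [D4, g], [g]]),
   (1, [[g], [g], [g], [D4, g]]),
   (1, [[g, v2, M4, v2], [M4, v2, g]]),
   (-4, [[g, C, gt], [g]]),
   (-4, [[g], [gt, C, g]]),
   (4, [[g], [D62, g]]),
   (1, [[g], [S, g]]),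
   (1, [[g, transp S], [g]])]

/-- The list of terms of order `i`, for `0 ≤ i ≤ 7`. -/
def terms : ℕ → List (ℝ × List (List (Kern d)))
  | 0 => terms0 d
  | 1 => terms1 d
  | 2 => terms2 d
  | 3 => terms3 d α κ
  | 4 => terms4 d α κ
  | 5 => terms5 d α κ
  | 6 => terms6 d α κ
  | 7 => terms7 d α κ
  | _ => []

end Terms

section Expansion

variable {d : ℕ} {Ω : Type*} [MeasurableSpace Ω]

/-- The summands of the random diagonal operator `D₇`, without the prefactor. -/
def D7summand (ω : Site d → Ω → ℝ) (α κ : ℝ) (n₁ : Site d) (w : Ω) (n₂ : Site d) : ℝ :=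
  v α κ n₂ ^ 3 * ω n₂ w * Gt d n₁ n₂ ^ 6

/-- `D₇(n₁) = v_{n₁}⁴ ∑_{n₂} v_{n₂}³ ω_{n₂} G̃₀(n₁,n₂)⁶`. -/
def D7 (ω : Site d → Ω → ℝ) (α κ : ℝ) (w : Ω) (n₁ : Site d) : ℝ :=
  v α κ n₁ ^ 4 * ∑' n₂, D7summand ω α κ n₁ w n₂

/-- The boxed terms `[G₀,i](n,n')` of exact order `i`, for `0 ≤ i ≤ 7`. -/
def box (P : Measure Ω) (ω : Site d → Ω → ℝ) (α κ : ℝ) (i : ℕ) (n n' : Site d) (w : Ω) : ℝ :=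
  evalExp P ω α κ (terms d α κ i) n n' w -
    if i = 7 then kprod [G0 d, diag (D7 ω α κ w), G0 d] n n' else 0

/-- `R₅ = [G₀,0] + ⋯ + [G₀,5]`. -/
def calR5 (P : Measure Ω) (ω : Site d → Ω → ℝ) (α κ : ℝ) (n n' : Site d) (w : Ω) : ℝ :=
  ∑ i ∈ Finset.Icc 0 5, box P ω α κ i n n' w

/-- `A = R₅ + [G₀,6] + [G₀,7]`. -/
def opA (P : Measure Ω) (ω : Site d → Ω → ℝ) (α κ : ℝ) (n n' : Site d) (w : Ω) : ℝ :=
  calR5 P ω α κ n n' w + box P ω α κ 6 n n' w + box P ω α κ 7 n n' w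

/-- `V_ω(n) = v_n ω_n`. -/
def potV (ω : Site d → Ω → ℝ) (α κ : ℝ) (w : Ω) (n : Site d) : ℝ := v α κ n * ω n w

/-- `Δ₂V = σ v²`. -/
def delta2V (α κ : ℝ) (n : Site d) : ℝ := sigma d * v α κ n ^ 2

/-- `Δ₄V = -ρ v⁴`. -/
def delta4V (α κ : ℝ) (n : Site d) : ℝ := -rho d * v α κ n ^ 4

/-- `Δ₆V = (4η - 3σ⁵ + 5σ²ρ) v⁶ + R₆`. -/
def delta6V (α κ : ℝ) (n : Site d) : ℝ :=
  (4 * eta d - 3 * sigma d ^ 5 + 5 * sigma d ^ 2 * rho d) * v α κ n ^ 6 + R6 d α κ n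

/-- The renormalized potential `V⁽⁶⁾ = V + σ v² - ρ v⁴ + (4η - 3σ⁵ + 5σ²ρ) v⁶ + R₆`. -/
def V6 (ω : Site d → Ω → ℝ) (α κ : ℝ) (w : Ω) (n : Site d) : ℝ :=
  potV ω α κ w n + delta2V α κ n + delta4V α κ n + delta6V α κ n

/-- `H = -Δ + V⁽⁶⁾`. -/
def ham (ω : Site d → Ω → ℝ) (α κ : ℝ) (w : Ω) : Kern d :=
  -laplacian d + diag (V6 ω α κ w)

/-- `B = -V [G₀,7] - Δ₂V ∑_{i=6}^7 [G₀,i] - Δ₄V ∑_{i=4}^7 [G₀,i] - Δ₆V ∑_{i=2}^7 [G₀,i]`. -/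
def opB (P : Measure Ω) (ω : Site d → Ω → ℝ) (α κ : ℝ) (n n' : Site d) (w : Ω) : ℝ :=
  -(potV ω α κ w n * box P ω α κ 7 n n' w)
    - delta2V α κ n * ∑ i ∈ Finset.Icc 6 7, box P ω α κ i n n' w
    - delta4V α κ n * ∑ i ∈ Finset.Icc 4 7, box P ω α κ i n n' w
    - delta6V α κ n * ∑ i ∈ Finset.Icc 2 7, box P ω α κ i n n' w

/-- `G` is the matrix of the inverse of the (bounded, self-adjoint) operator `H` on `ℓ²(ℤ^d)`,
which may be unbounded: the rows and columns of `G` lie in `ℓ²`, and `HG = GH = I`. (As `H`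
has finite range, the sums in these two products are finite. Existence of such a `G` means
exactly that `H` is injective on `ℓ²` and that all `δ_n` lie in its range; then
`G(n,n') = ⟨δ_n, H⁻¹ δ_{n'}⟩`.) -/
structure IsInverse (H G : Kern d) : Prop where
  row_sq : ∀ n, Summable fun m => G n m ^ 2
  col_sq : ∀ n', Summable fun m => G m n' ^ 2
  right_inv : ∀ n n', ∑' m, H n m * G m n' = if n = n' then 1 else 0
  left_inv : ∀ n n', ∑' m, G n m * H m n' = if n = n' then 1 else 0

end Expansion

end Renorm

end

/-!
`A` is an approximate inverse of `H`: writing `H = -Δ + V + Δ₂V + Δ₄V + Δ₆V` and sorting `H A` by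
order, the terms of the orders `1, …, 7` cancel, and what is left over is `H A = I - B`. As the
columns of `A` and the rows of `G` are square-summable, `H` may be moved from `A` to `G` by
summation by parts, and `G H = I` gives `A = G - G B`. Four things carry this argument.

**Kernels dominated by the Laplacian.** In dimension at least five the symbol of `G₀` is square
integrable (`integrableOn_G0hat_sq`), so the columns of `G₀` are in `ℓ²`, and a product of kernels
with at most two factors `G₀`, all other factors satisfying Schur's test, converges absolutely.
A product like `G₀ W G₀` has two Green's functions, and its rows are in `ℓ²` only because of the
renormalization: by the choice of `ρ` and `η` the convolution kernels behind `M` and `C` have total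
mass zero (`tsum_mFun`, `tsum_cFun`). They have finite second moments, as `G₀` is bounded by the
superharmonic weight `1 / (35 + |x|²)` (`abs_green_le`). Such a kernel acts through second
differences and is bounded by a multiple of `Δ`; the factors `v²` cost an error that decays like
`|x|⁻²`, as `4 α > 1`, and that is dominated by `Δ` through Rellich's inequality (`rellich`). The
resulting inequality `‖X ψ‖ ≤ c ‖Δ ψ‖` (`IsTame`, `isTame_of_decomposition`) puts the rows and
columns of `G₀ X G₀` into `ℓ²` (`isSq_sandwich`).

**Admissible sums.** The square of the `L²` norm of an admissible sum is at most a sum over pairs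
of admissible walks with the same sites of odd multiplicity. In each walk the edges can be divided
into two sets, one of which connects all sites of the walk to its last one, while the other
connects the sites of even multiplicity to the rest (`IsPattern.exists_split`). This is an instance
of Edmonds' theorem on disjoint covering (`exists_partition_of_supermodular`), whose rank condition
uses admissibility: in every block of letters some site has odd multiplicity, and it recurs outside
of the block if its total multiplicity is even. The factors of the first kind of one walk of the
pair are matched with those of the second kind of the other, and `a b ≤ a² + b²` decouples the two
sums, each of which is finite because the factors are in `ℓ²` (`exists_pair_bound`). This yields unconditional convergence,
continuity in the potential, and the square summability of the columns.

**The cancellation.** If the potential has finite support, all sums inside a term are finite. The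
terms are described by symbolic words, which are expanded into monomials in pairwise distinct sites
(`expand`, `sem_eq_expand`); on these, admissibility is a property of the indices alone, and
`ω² = 1`. The cancellation of the orders `1, …, 7` is then an identity of integer polynomials,
verified by a kernel computation (`checkZero_orderPrograms`, `negLap_orderSum_add`).

**Removal of the cutoff.** The terms with the potential restricted to a box converge in measure, so
almost surely along a subsequence that is common to a site and its neighbours; the cancellation
passes to the limit (`ae_negLap_box`).
-/

noncomputable section
namespace Renorm

/-! ### The symbol of the Green's function -/

lemma one_sub_cos_lower {θ : ℝ} (h0 : 0 < θ) (h1 : θ < 1) :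
    16 * θ ^ 2 ≤ 2 - 2 * Real.cos (2 * Real.pi * θ) ∨
      16 * (1 - θ) ^ 2 ≤ 2 - 2 * Real.cos (2 * Real.pi * θ) := by
  have key : ∀ t : ℝ, 0 ≤ t → t ≤ 1 / 2 →
      16 * t ^ 2 ≤ 2 - 2 * Real.cos (2 * Real.pi * t) := by
    intro t ht0 ht1
    have hpi := Real.pi_pos
    have h := Real.mul_le_sin (x := Real.pi * t) (by positivity) (by nlinarith)
    have h2 : 2 / Real.pi * (Real.pi * t) = 2 * t := by field_simp
    rw [h2] at h
    have h3 : Real.cos (2 * Real.pi * t) = 1 - 2 * Real.sin (Real.pi * t) ^ 2 := by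
      rw [mul_assoc, Real.cos_two_mul, Real.cos_sq']; ring
    rw [h3]
    nlinarith [mul_self_le_mul_self (by positivity : (0:ℝ) ≤ 2 * t) h]
  rcases le_total θ (1 / 2) with h | h
  · exact Or.inl (key θ h0.le h)
  · right
    have := key (1 - θ) (by linarith) (by linarith)
    have e : Real.cos (2 * Real.pi * (1 - θ)) = Real.cos (2 * Real.pi * θ) := by
      rw [mul_sub, mul_one, Real.cos_two_pi_sub]
    rwa [e] at this

/-- The one-dimensional symbol to a small negative power is integrable. -/
lemma integrableOn_symbol_rpow {s : ℝ} (hs0 : 0 ≤ s) (hs : 2 * s < 1) :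
    IntegrableOn (fun θ : ℝ => (2 - 2 * Real.cos (2 * Real.pi * θ)) ^ (-s)) (Set.Ioc 0 1) := by
  have i1 : IntegrableOn (fun θ : ℝ => θ ^ (-(2 * s))) (Set.Ioc 0 1) :=
    (intervalIntegrable_iff_integrableOn_Ioc_of_le zero_le_one).1
      (intervalIntegral.intervalIntegrable_rpow' (by linarith))
  have i2 : IntegrableOn (fun θ : ℝ => (1 - θ) ^ (-(2 * s))) (Set.Ioc 0 1) := by
    have h := (intervalIntegral.intervalIntegrable_rpow' (a := 0) (b := 1)
      (r := -(2 * s)) (by linarith)).comp_sub_left 1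
    simp only [sub_zero, sub_self] at h
    exact (intervalIntegrable_iff_integrableOn_Ioc_of_le zero_le_one).1 h.symm
  refine Integrable.mono' (i1.add i2) ?_ ?_
  · refine Measurable.aestronglyMeasurable ?_
    fun_prop
  · have : ∀ᵐ θ : ℝ ∂(volume.restrict (Set.Ioc 0 1)), θ ≠ 1 :=
      ae_restrict_of_ae (by simp [ae_iff])
    filter_upwards [ae_restrict_mem measurableSet_Ioc, this] with θ hθ hne
    have h0 := hθ.1
    have h1 : θ < 1 := lt_of_le_of_ne hθ.2 hne
    have h1' : 0 < 1 - θ := by linarith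
    have key : ∀ t L : ℝ, 0 < t → 16 * t ^ 2 ≤ L → L ^ (-s) ≤ t ^ (-(2 * s)) := by
      intro t L ht hL
      have hL' : t ^ (2 : ℝ) ≤ L := by
        rw [Real.rpow_two]; nlinarith [sq_nonneg t]
      calc L ^ (-s) ≤ (t ^ (2 : ℝ)) ^ (-s) :=
            Real.rpow_le_rpow_of_nonpos (by positivity) hL' (by linarith)
        _ = t ^ (-(2 * s)) := by rw [← Real.rpow_mul ht.le]; ring_nf
    have hL0 : 0 ≤ 2 - 2 * Real.cos (2 * Real.pi * θ) := by
      linarith [Real.cos_le_one (2 * Real.pi * θ)]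
    rw [Real.norm_of_nonneg (Real.rpow_nonneg hL0 _)]
    simp only [Pi.add_apply]
    rcases one_sub_cos_lower h0 h1 with h | h
    · have := key _ _ h0 h
      have : 0 ≤ (1 - θ) ^ (-(2 * s)) := by positivity
      linarith
    · have := key _ _ h1' h
      have : 0 ≤ θ ^ (-(2 * s)) := by positivity
      linarith

lemma G0hat_eq (d : ℕ) (ξ : Fin d → ℝ) :
    G0hat d ξ = (∑ j, (2 - 2 * Real.cos (2 * Real.pi * ξ j)))⁻¹ := by
  rw [G0hat, Finset.sum_sub_distrib, ← Finset.mul_sum]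
  simp [mul_comm]

lemma G0hat_nonneg (d : ℕ) (ξ : Fin d → ℝ) : 0 ≤ G0hat d ξ := by
  rw [G0hat_eq]
  refine inv_nonneg.2 (Finset.sum_nonneg fun j _ => ?_)
  linarith [Real.cos_le_one (2 * Real.pi * ξ j)]

lemma measurable_G0hat (d : ℕ) : Measurable (G0hat d) := by
  unfold G0hat; fun_prop

/-- In dimension at least five the symbol of `G₀` is square integrable: it is at most the
reciprocal of each of its `d` one-dimensional parts, so its square is at most the product of
their powers of exponent `-2/d`. -/
lemma integrableOn_G0hat_sq {d : ℕ} (hd : 5 ≤ d) :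
    IntegrableOn (fun ξ => G0hat d ξ ^ 2) (Set.univ.pi fun _ : Fin d => Set.Ioc (0 : ℝ) 1) := by
  have hd0 : (5 : ℝ) ≤ d := by exact_mod_cast hd
  have hdpos : (0 : ℝ) < d := by linarith
  set s : ℝ := 2 / d with hs
  have hs0 : 0 ≤ s := by positivity
  have hs1 : 2 * s < 1 := by
    rw [hs, ← mul_div_assoc, div_lt_one hdpos]; linarith
  have hprod : Integrable
      (fun ξ : Fin d → ℝ => ∏ j, (2 - 2 * Real.cos (2 * Real.pi * ξ j)) ^ (-s))
      (Measure.pi fun _ : Fin d => volume.restrict (Set.Ioc (0 : ℝ) 1)) :=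
    Integrable.fintype_prod (fun _ => integrableOn_symbol_rpow hs0 hs1)
  rw [IntegrableOn, volume_pi, Measure.restrict_pi_pi]
  refine hprod.mono' ((measurable_G0hat d).pow_const 2).aestronglyMeasurable ?_
  have hae : ∀ᵐ ξ : Fin d → ℝ ∂(Measure.pi fun _ : Fin d => volume.restrict (Set.Ioc (0 : ℝ) 1)),
      ∀ j, ξ j ∈ Set.Ioo (0 : ℝ) 1 := by
    rw [← Measure.restrict_pi_pi]
    have hne : ∀ᵐ ξ : Fin d → ℝ ∂(Measure.pi fun _ : Fin d => (volume : Measure ℝ)),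
        ∀ j, ξ j ≠ 1 := by
      rw [ae_all_iff]
      intro j
      have := Measure.ae_eval_ne (μ := fun _ : Fin d => (volume : Measure ℝ)) j 1
      exact this
    filter_upwards [ae_restrict_mem (MeasurableSet.univ_pi fun _ => measurableSet_Ioc),
      ae_restrict_of_ae hne] with ξ h1 h2 j
    have := h1 j trivial
    exact ⟨this.1, lt_of_le_of_ne this.2 (h2 j)⟩
  filter_upwards [hae] with ξ hξ
  have hpos : ∀ j, 0 < 2 - 2 * Real.cos (2 * Real.pi * ξ j) := by
    intro j
    have h0 := (hξ j).1
    have h1 : 0 < 1 - ξ j := by linarith [(hξ j).2]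
    rcases one_sub_cos_lower h0 (hξ j).2 with h | h
    · exact lt_of_lt_of_le (by positivity) h
    · exact lt_of_lt_of_le (by positivity) h
  have hG := G0hat_nonneg d ξ
  rw [Real.norm_of_nonneg (by positivity)]
  have e : G0hat d ξ ^ 2 = ∏ _j : Fin d, G0hat d ξ ^ s := by
    rw [Finset.prod_const, Finset.card_univ, Fintype.card_fin, ← Real.rpow_mul_natCast hG, hs,
      div_mul_cancel₀ _ hdpos.ne', Real.rpow_two]
  rw [e]
  refine Finset.prod_le_prod (fun _ _ => by positivity) fun j _ => ?_
  rw [Real.rpow_neg (hpos j).le, ← Real.inv_rpow (hpos j).le]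
  refine Real.rpow_le_rpow hG ?_ hs0
  rw [G0hat_eq]
  refine inv_anti₀ (hpos j) ?_
  exact Finset.single_le_sum (f := fun j => 2 - 2 * Real.cos (2 * Real.pi * ξ j))
    (fun i _ => (hpos i).le) (Finset.mem_univ j)

section Torus

open UnitAddTorus
open scoped ComplexConjugate

attribute [local instance] instMeasureSpaceUnitAddCircle

/-! ### Fourier series on the torus -/

instance isAddHaarMeasure_unitAddCircle : Measure.IsAddHaarMeasure (volume : Measure UnitAddCircle) :=
  inferInstanceAs (Measure.IsAddHaarMeasure AddCircle.haarAddCircle)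
instance isProbabilityMeasure_unitAddCircle : IsProbabilityMeasure (volume : Measure UnitAddCircle) :=
  inferInstanceAs (IsProbabilityMeasure AddCircle.haarAddCircle)
instance isNegInvariant_unitAddTorus {d : ℕ} :
    Measure.IsNegInvariant (volume : Measure (UnitAddTorus (Fin d))) :=
  haveI : Measure.IsNegInvariant (volume : Measure UnitAddCircle) :=
    Measure.IsAddHaarMeasure.isNegInvariant_of_regular _
  inferInstanceAs (Measure.IsNegInvariant (Measure.pi fun _ : Fin d => (volume : Measure UnitAddCircle)))

lemma integral_mFourier (n : Site d) :
    ∫ x : UnitAddTorus (Fin d), mFourier n x = if n = 0 then 1 else 0 := by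
  have h := (orthonormal_iff_ite.1 (orthonormal_mFourier (d := Fin d))) 0 n
  rw [ContinuousMap.inner_toLp] at h
  simpa [mFourier_zero, eq_comm] using h

lemma mFourier_apply_add (n : Site d) (x y : UnitAddTorus (Fin d)) :
    mFourier n (x + y) = mFourier n x * mFourier n y := by
  simp only [mFourier, ContinuousMap.coe_mk, ← Finset.prod_mul_distrib]
  refine Finset.prod_congr rfl fun i _ => ?_
  simp [fourier_apply, smul_add, AddCircle.toCircle_add]

lemma mFourier_apply_neg (n : Site d) (x : UnitAddTorus (Fin d)) :
    mFourier n (-x) = conj (mFourier n x) := by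
  rw [← mFourier_neg]
  simp only [mFourier, ContinuousMap.coe_mk]
  refine Finset.prod_congr rfl fun i _ => ?_
  simp [fourier_apply]

/-- The convolution of two square integrable functions on the torus is the sum, at every point,
of the Fourier series with the product coefficients. -/
lemma hasSum_convolution {F G : UnitAddTorus (Fin d) → ℂ} (hF : MemLp F 2) (hG : MemLp G 2)
    (x : UnitAddTorus (Fin d)) :
    HasSum (fun n => mFourierCoeff F n * mFourierCoeff G n * mFourier n x)
      (∫ s, F (x - s) * G s) := by
  have hmp : MeasurePreserving (fun s : UnitAddTorus (Fin d) => x - s) := by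
    have h := (measurePreserving_add_left volume x).comp
      (Measure.measurePreserving_neg (volume : Measure (UnitAddTorus (Fin d))))
    have e : (fun s : UnitAddTorus (Fin d) => x - s) = (fun s => x + s) ∘ Neg.neg :=
      funext fun s => sub_eq_add_neg x s
    rw [e]
    exact h
  have hF' : MemLp (fun s => conj (F (x - s))) 2 := (hF.comp_measurePreserving hmp).star
  have h := hasSum_prod_mFourierCoeff hF'.toLp hG.toLp
  have e1 : ∀ n, mFourierCoeff (hF'.toLp) n = conj (mFourier n x * mFourierCoeff F n) := by
    intro n
    have : mFourierCoeff (hF'.toLp) n = ∫ s, conj (mFourier n s * F (x - s)) := by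
      refine integral_congr_ae ?_
      filter_upwards [hF'.coeFn_toLp] with s hs
      rw [hs, mFourier_neg]; simp
    rw [this, integral_conj]
    congr 1
    rw [← integral_sub_left_eq_self _ _ x, mFourierCoeff, ← integral_const_mul]
    refine integral_congr_ae (Filter.Eventually.of_forall fun s => ?_)
    simp only [sub_sub_cancel]
    simp only [sub_eq_add_neg x s, mFourier_apply_add, mFourier_apply_neg,
      mFourier_neg, smul_eq_mul]
    ring
  have e2 : ∀ n, mFourierCoeff (hG.toLp) n = mFourierCoeff G n := by
    intro n
    refine integral_congr_ae ?_
    filter_upwards [hG.coeFn_toLp] with s hs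
    rw [hs]
  have e3 : ∫ t, conj ((hF'.toLp : Lp ℂ 2 _) t) * (hG.toLp : Lp ℂ 2 _) t = ∫ s, F (x - s) * G s := by
    refine integral_congr_ae ?_
    filter_upwards [hF'.coeFn_toLp, hG.coeFn_toLp] with s h1 h2
    rw [h1, h2]; simp
  rw [e3] at h
  simp only [e1, e2, Complex.conj_conj] at h
  refine h.congr_fun fun n => ?_
  ring

lemma continuous_tsum_mFourier {a : Site d → ℂ} (ha : Summable a) :
    Continuous fun x : UnitAddTorus (Fin d) => ∑' n, a n * mFourier n x := by
  refine continuous_tsum (fun n => by fun_prop) ha.norm fun n x => ?_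
  rw [norm_mul]
  refine mul_le_of_le_one_right (norm_nonneg _) ?_
  have := (mFourier n).norm_coe_le_norm x
  rwa [mFourier_norm] at this

lemma memLp_tsum_mFourier {a : Site d → ℂ} (ha : Summable a) :
    MemLp (fun x : UnitAddTorus (Fin d) => ∑' n, a n * mFourier n x) 2 :=
  (continuous_tsum_mFourier ha).memLp_of_hasCompactSupport
    (HasCompactSupport.of_compactSpace _)

lemma norm_mFourier_apply (n : Site d) (x : UnitAddTorus (Fin d)) : ‖mFourier n x‖ = 1 := by
  simp [mFourier, fourier_apply, Circle.norm_coe]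

/-- An absolutely convergent Fourier series has the expected coefficients. -/
lemma mFourierCoeff_tsum {a : Site d → ℂ} (ha : Summable a) (n : Site d) :
    mFourierCoeff (fun x : UnitAddTorus (Fin d) => ∑' m, a m * mFourier m x) n = a n := by
  have hi : ∀ m, Integrable fun x : UnitAddTorus (Fin d) => a m * mFourier (m - n) x := fun m =>
    (Continuous.memLp_of_hasCompactSupport (p := 1) (by fun_prop)
      (HasCompactSupport.of_compactSpace _)).integrable le_rfl
  have h := hasSum_integral_of_summable_integral_norm hi (by
    simp only [norm_mul, norm_mFourier_apply, mul_one, integral_const, probReal_univ, one_smul]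
    exact ha.norm)
  have e : mFourierCoeff (fun x : UnitAddTorus (Fin d) => ∑' m, a m * mFourier m x) n
      = ∫ x : UnitAddTorus (Fin d), ∑' m, a m * mFourier (m - n) x := by
    refine integral_congr_ae (Filter.Eventually.of_forall fun x => ?_)
    simp only [smul_eq_mul, ← tsum_mul_left]
    refine tsum_congr fun m => ?_
    rw [sub_eq_neg_add, mFourier_add]; ring
  rw [e, ← h.tsum_eq, tsum_eq_single n]
  · rw [integral_const_mul, integral_mFourier]; simp
  · intro m hm
    rw [integral_const_mul, integral_mFourier, if_neg (sub_ne_zero.2 hm), mul_zero]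

lemma integral_unitCube {E : Type*} [NormedAddCommGroup E] [NormedSpace ℝ E]
    (F : UnitAddTorus (Fin d) → E) :
    ∫ ξ in Set.Icc (0 : Fin d → ℝ) 1, F (fun i => (ξ i : UnitAddCircle)) = ∫ x, F x := by
  rw [integral_preimage F 0]
  refine setIntegral_congr_set ?_
  have := (Measure.univ_pi_Ioc_ae_eq_Icc (μ := fun _ : Fin d => (volume : Measure ℝ))
    (f := 0) (g := 1)).symm
  refine this.trans (Filter.EventuallyEq.of_eq ?_)
  ext ξ
  change (∀ i, i ∈ Set.univ → _) ↔ ∀ i, _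
  simp

variable {d : ℕ}

/-! ### The Green's function as a Fourier coefficient -/

/-- The free Green's function as a function of the difference of its arguments. -/
def green (d : ℕ) (n : Site d) : ℝ := G0 d n 0

lemma sigma_eq_green : sigma d = green d 0 := rfl

lemma G0_eq_green (n n' : Site d) : G0 d n n' = green d (n - n') := by
  simp [green, G0]

lemma green_neg (n : Site d) : green d (-n) = green d n := by
  simp only [green, G0]
  congr 1; ext ξ
  rw [← Real.cos_neg]
  congr 2
  rw [← mul_neg, ← Finset.sum_neg_distrib]
  congr 1
  refine Finset.sum_congr rfl fun j _ => ?_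
  simp

lemma G0_comm (n n' : Site d) : G0 d n n' = G0 d n' n := by
  rw [G0_eq_green, G0_eq_green, ← green_neg, neg_sub]

/-- The symbol of `G₀` as a function on the torus. -/
def torusSymbol (d : ℕ) (x : UnitAddTorus (Fin d)) : ℝ :=
  (2 * (d : ℝ) - 2 * ∑ j, (fourier 1 (x j)).re)⁻¹

lemma re_fourier_one (t : ℝ) : (fourier 1 (t : UnitAddCircle)).re = Real.cos (2 * Real.pi * t) := by
  rw [fourier_coe_apply]
  have : (2 * (Real.pi : ℂ) * Complex.I * ((1 : ℤ) : ℂ) * t / ((1 : ℝ) : ℂ))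
      = ((2 * Real.pi * t : ℝ) : ℂ) * Complex.I := by push_cast; ring
  rw [this, Complex.exp_ofReal_mul_I_re]

lemma torusSymbol_coe (ξ : Fin d → ℝ) :
    torusSymbol d (fun i => (ξ i : UnitAddCircle)) = G0hat d ξ := by
  simp only [torusSymbol, G0hat, re_fourier_one]

lemma mFourier_coe (n : Site d) (ξ : Fin d → ℝ) :
    mFourier n (fun i => (ξ i : UnitAddCircle))
      = Complex.exp (((2 * Real.pi * ∑ j, (n j : ℝ) * ξ j : ℝ) : ℂ) * Complex.I) := by
  simp only [mFourier, ContinuousMap.coe_mk, fourier_coe_apply, ← Complex.exp_sum]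
  congr 1
  push_cast
  rw [Finset.mul_sum, Finset.sum_mul]
  refine Finset.sum_congr rfl fun j _ => ?_
  ring

lemma measurable_torusSymbol : Measurable (torusSymbol d) := by
  unfold torusSymbol
  refine Measurable.inv (measurable_const.sub (measurable_const.mul ?_))
  refine Finset.measurable_sum _ fun j _ => ?_
  exact Complex.measurable_re.comp ((fourier 1).continuous.measurable.comp (measurable_pi_apply j))

lemma torusSymbol_neg (x : UnitAddTorus (Fin d)) : torusSymbol d (-x) = torusSymbol d x := by
  simp only [torusSymbol]
  congr 4
  ext j
  simp [fourier_apply, AddCircle.toCircle_neg]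

lemma memLp_torusSymbol (hd : 5 ≤ d) : MemLp (fun x => (torusSymbol d x : ℂ)) 2 := by
  have hm : AEStronglyMeasurable (fun x => (torusSymbol d x : ℂ)) :=
    (Complex.measurable_ofReal.comp measurable_torusSymbol).aestronglyMeasurable
  refine ⟨hm, ?_⟩
  rw [eLpNorm_lt_top_iff_lintegral_rpow_enorm_lt_top (by simp) (by simp)]
  have h := (integrableOn_G0hat_sq hd).2
  rw [HasFiniteIntegral] at h
  rw [UnitAddTorus.lintegral_preimage _ 0]
  refine lt_of_le_of_lt (le_of_eq ?_) h
  have e : {x : Fin d → ℝ | ∀ i, x i ∈ Set.Ioc ((0 : Fin d → ℝ) i) ((0 : Fin d → ℝ) i + 1)}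
      = Set.univ.pi fun _ : Fin d => Set.Ioc (0 : ℝ) 1 := by
    ext ξ; simp [Set.mem_pi]
  rw [e]
  refine lintegral_congr fun ξ => ?_
  rw [torusSymbol_coe]
  rw [← ofReal_norm (G0hat d ξ ^ 2), ← ofReal_norm ((G0hat d ξ : ℝ) : ℂ), Complex.norm_real,
    norm_pow, ENNReal.ofReal_pow (norm_nonneg _)]
  norm_num

/-- The Fourier coefficients of the symbol are the values of the free Green's function. -/
lemma mFourierCoeff_torusSymbol (hd : 5 ≤ d) (n : Site d) :
    mFourierCoeff (fun x => (torusSymbol d x : ℂ)) n = green d n := by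
  set f : UnitAddTorus (Fin d) → ℂ := fun x => (torusSymbol d x : ℂ) with hf
  have hint : Integrable fun x => mFourier (-n) x * f x := by
    have h1 : Integrable f := (memLp_torusSymbol hd).integrable (by norm_num)
    refine h1.bdd_mul (c := 1) (mFourier (-n)).continuous.aestronglyMeasurable ?_
    exact Filter.Eventually.of_forall fun x => (norm_mFourier_apply _ _).le
  have hre : (mFourierCoeff f n).re = green d n := by
    change (∫ x, mFourier (-n) x * f x).re = _
    have h2 := integral_re hint
    simp only [RCLike.re_eq_complex_re] at h2
    rw [← h2, ← integral_unitCube, green, G0]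
    refine integral_congr_ae (Filter.Eventually.of_forall fun ξ => ?_)
    simp only [hf, torusSymbol_coe, mFourier_coe, Complex.re_mul_ofReal, Complex.exp_ofReal_mul_I_re]
    congr 1
    rw [← Real.cos_neg]
    congr 1
    rw [← mul_neg, ← Finset.sum_neg_distrib]
    congr 1
    refine Finset.sum_congr rfl fun j _ => ?_
    simp
  have him : conj (mFourierCoeff f n) = mFourierCoeff f n := by
    change conj (∫ x, mFourier (-n) x * f x) = ∫ x, mFourier (-n) x * f x
    rw [← integral_conj, ← integral_sub_left_eq_self _ _ (0 : UnitAddTorus (Fin d))]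
    refine integral_congr_ae (Filter.Eventually.of_forall fun x => ?_)
    simp [hf, torusSymbol_neg, mFourier_apply_neg]
  rw [← Complex.conj_eq_iff_re.1 him, hre]

/-- The free Green's function is square summable in dimension at least five. -/
lemma summable_green_sq (hd : 5 ≤ d) : Summable fun n => green d n ^ 2 := by
  have h := (hasSum_sq_mFourierCoeff (memLp_torusSymbol hd).toLp).summable
  refine h.congr fun n => ?_
  have : mFourierCoeff ((memLp_torusSymbol hd).toLp : Lp ℂ 2 _) n = green d n := by
    rw [← mFourierCoeff_torusSymbol hd]
    refine integral_congr_ae ?_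
    filter_upwards [(memLp_torusSymbol hd).coeFn_toLp] with s hs
    rw [hs]
  rw [this]; simp

lemma integrableOn_G0hat (hd : 5 ≤ d) : IntegrableOn (G0hat d) (Set.Icc 0 1) := by
  have h1 : IntegrableOn (fun ξ => G0hat d ξ ^ 2) (Set.Icc (0 : Fin d → ℝ) 1) :=
    (integrableOn_G0hat_sq hd).congr_set_ae Measure.univ_pi_Ioc_ae_eq_Icc.symm
  have : IsFiniteMeasure (volume.restrict (Set.Icc (0 : Fin d → ℝ) 1)) :=
    ⟨by rw [Measure.restrict_apply_univ]; exact isCompact_Icc.measure_lt_top⟩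
  have h2 : MemLp (G0hat d) 2 (volume.restrict (Set.Icc (0 : Fin d → ℝ) 1)) :=
    (memLp_two_iff_integrable_sq (measurable_G0hat d).aestronglyMeasurable).2 h1
  exact h2.integrable (by norm_num)

/-- The convolution of two periodic functions on `ℝ^d`, in terms of the torus. -/
lemma torusConv_coe (F G : UnitAddTorus (Fin d) → ℝ) (ξ : Fin d → ℝ) :
    ((torusConv (fun ξ => F fun i => (ξ i : UnitAddCircle)) (fun ξ => G fun i => (ξ i : UnitAddCircle)) ξ
      : ℝ) : ℂ) = ∫ x, (F ((fun i => (ξ i : UnitAddCircle)) - x) : ℂ) * (G x : ℂ) := by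
  have e := integral_unitCube fun x : UnitAddTorus (Fin d) =>
    F ((fun i => (ξ i : UnitAddCircle)) - x) * G x
  have : torusConv (fun ξ => F fun i => (ξ i : UnitAddCircle))
      (fun ξ => G fun i => (ξ i : UnitAddCircle)) ξ
      = ∫ x, F ((fun i => (ξ i : UnitAddCircle)) - x) * G x := by
    rw [← e]; rfl
  rw [this, ← integral_complex_ofReal]
  simp

/-! ### Convolutions of the Green's function -/

/-- The off-diagonal part of the free Green's function, a function of the difference. -/
def greenT (d : ℕ) (n : Site d) : ℝ := green d n - if n = 0 then sigma d else 0

lemma Gt_eq_greenT (n n' : Site d) : Gt d n n' = greenT d (n - n') := by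
  simp only [Gt, greenT, G0_eq_green, sub_eq_zero]

lemma greenT_zero : greenT d 0 = 0 := by simp [greenT, sigma_eq_green]

lemma greenT_of_ne {n : Site d} (h : n ≠ 0) : greenT d n = green d n := by simp [greenT, h]

lemma greenT_neg (n : Site d) : greenT d (-n) = greenT d n := by
  simp [greenT, green_neg]

lemma abs_greenT_le (n : Site d) : |greenT d n| ≤ |green d n| := by
  by_cases h : n = 0
  · rw [h, greenT_zero, abs_zero]; positivity
  · rw [greenT_of_ne h]

lemma summable_greenT_sq (hd : 5 ≤ d) : Summable fun n => greenT d n ^ 2 :=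
  Summable.of_nonneg_of_le (fun _ => sq_nonneg _) (fun n => sq_le_sq.2 (abs_greenT_le n))
    (summable_green_sq hd)

lemma memLp_const_torus (c : ℂ) : MemLp (fun _ : UnitAddTorus (Fin d) => c) 2 := memLp_const c

lemma mFourierCoeff_torusSymbol_sub (hd : 5 ≤ d) (n : Site d) :
    mFourierCoeff (fun x => ((torusSymbol d x - sigma d : ℝ) : ℂ)) n = greenT d n := by
  have hi : ∀ f : UnitAddTorus (Fin d) → ℂ, MemLp f 2 →
      Integrable fun x => mFourier (-n) x * f x := fun f hf =>
    (hf.integrable (by norm_num)).bdd_mul (c := 1) (mFourier (-n)).continuous.aestronglyMeasurable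
      (Filter.Eventually.of_forall fun x => (norm_mFourier_apply _ _).le)
  have e : mFourierCoeff (fun x => ((torusSymbol d x - sigma d : ℝ) : ℂ)) n
      = (∫ x, mFourier (-n) x * (torusSymbol d x : ℂ)) - ∫ x, mFourier (-n) x * (sigma d : ℂ) := by
    rw [← integral_sub (hi _ (memLp_torusSymbol hd)) (hi _ (memLp_const_torus _))]
    refine integral_congr_ae (Filter.Eventually.of_forall fun x => ?_)
    simp [mul_sub]
  have e1 := mFourierCoeff_torusSymbol hd n
  change (∫ x, mFourier (-n) x * (torusSymbol d x : ℂ)) = _ at e1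
  rw [e, e1, integral_mul_const, integral_mFourier, greenT]
  by_cases h : n = 0 <;> simp [h]

lemma memLp_torusSymbol_sub (hd : 5 ≤ d) :
    MemLp (fun x => ((torusSymbol d x - sigma d : ℝ) : ℂ)) 2 := by
  have := (memLp_torusSymbol hd).sub (memLp_const_torus (d := d) (sigma d : ℂ))
  refine this.ae_eq (Filter.Eventually.of_forall fun x => ?_)
  simp

lemma coe_zero_torus : (fun i => ((0 : Fin d → ℝ) i : UnitAddCircle)) = (0 : UnitAddTorus (Fin d)) := by
  ext i; simp

/-- `(Ĝ₀ * Ĝ₀ * Ĝ₀)(0)` is the sum of the cubes of the free Green's function. -/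
lemma hasSum_green_cube (hd : 5 ≤ d) :
    HasSum (fun n => green d n ^ 3) (torusConv (torusConv (G0hat d) (G0hat d)) (G0hat d) 0) := by
  have hsq : Summable fun n : Site d => ((green d n ^ 2 : ℝ) : ℂ) :=
    Complex.summable_ofReal.2 (summable_green_sq hd)
  have hG : G0hat d = fun ξ => torusSymbol d fun i => (ξ i : UnitAddCircle) :=
    funext fun ξ => (torusSymbol_coe ξ).symm
  set U : UnitAddTorus (Fin d) → ℝ := fun x => ∫ s, torusSymbol d (x - s) * torusSymbol d s with hU
  have hUc : ∀ x, ((U x : ℝ) : ℂ) = ∑' n, ((green d n ^ 2 : ℝ) : ℂ) * mFourier n x := by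
    intro x
    have h := hasSum_convolution (memLp_torusSymbol hd) (memLp_torusSymbol hd) x
    rw [hU, ← integral_complex_ofReal]
    simp only [Complex.ofReal_mul]
    rw [← h.tsum_eq]
    refine tsum_congr fun n => ?_
    simp only [mFourierCoeff_torusSymbol hd]
    push_cast; ring
  have hconv : torusConv (G0hat d) (G0hat d) = fun ξ => U fun i => (ξ i : UnitAddCircle) := by
    ext ξ
    have := torusConv_coe (torusSymbol d) (torusSymbol d) ξ
    rw [← hG] at this
    have h2 : ((U fun i => (ξ i : UnitAddCircle) : ℝ) : ℂ)
        = ∫ x, (torusSymbol d ((fun i => (ξ i : UnitAddCircle)) - x) : ℂ) * (torusSymbol d x : ℂ) := by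
      rw [hU, ← integral_complex_ofReal]; simp
    rw [← h2] at this
    exact_mod_cast this
  have hUm : MemLp (fun x => ((U x : ℝ) : ℂ)) 2 := by
    simp only [hUc]; exact memLp_tsum_mFourier hsq
  have h := hasSum_convolution hUm (memLp_torusSymbol hd) 0
  have e := torusConv_coe U (torusSymbol d) 0
  rw [← hG, ← hconv, coe_zero_torus] at e
  rw [← e] at h
  rw [← Complex.hasSum_ofReal]
  refine h.congr_fun fun n => ?_
  rw [mFourierCoeff_torusSymbol hd]
  simp only [hUc]
  rw [mFourierCoeff_tsum hsq]
  have : mFourier n (0 : UnitAddTorus (Fin d)) = 1 := by simp [mFourier, fourier_apply]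
  rw [this]; push_cast; ring

/-- The sum of the cubes of the off-diagonal Green's function. -/
lemma hasSum_greenT_cube (hd : 5 ≤ d) :
    HasSum (fun n => greenT d n ^ 3) (sigma d ^ 3 - rho d) := by
  have h := hasSum_green_cube hd
  have h2 := h.sub (hasSum_ite_eq (0 : Site d) (sigma d ^ 3))
  have e : sigma d ^ 3 - rho d
      = torusConv (torusConv (G0hat d) (G0hat d)) (G0hat d) 0 - sigma d ^ 3 := by
    rw [rho]; ring
  rw [e]
  refine h2.congr_fun fun n => ?_
  by_cases hn : n = 0
  · simp [hn, greenT_zero, sigma_eq_green]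
  · simp [hn, greenT_of_ne]

/-- The coefficients of the square of the Fourier series with coefficients `greenT ^ 2`. -/
def greenConv (d : ℕ) (n : Site d) : ℝ := ∑' m, greenT d m ^ 2 * greenT d (n - m) ^ 2

lemma summable_greenConv_pair (hd : 5 ≤ d) :
    Summable fun p : Site d × Site d => greenT d p.2 ^ 2 * greenT d (p.1 - p.2) ^ 2 := by
  have h := (summable_greenT_sq hd).mul_of_nonneg (summable_greenT_sq hd)
    (fun n => sq_nonneg _) (fun n => sq_nonneg _)
  let e : Site d × Site d ≃ Site d × Site d :=
    { toFun := fun p => (p.2, p.1 - p.2)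
      invFun := fun q => (q.1 + q.2, q.1)
      left_inv := fun p => by ext <;> simp
      right_inv := fun q => by ext <;> simp }
  exact (e.summable_iff (f := fun q : Site d × Site d => greenT d q.1 ^ 2 * greenT d q.2 ^ 2)).2 h

/-- `η` as a lattice sum. -/
lemma hasSum_eta (hd : 5 ≤ d) : HasSum (fun n => greenT d n * greenConv d n) (eta d) := by
  have hsq : Summable fun n : Site d => ((greenT d n ^ 2 : ℝ) : ℂ) :=
    Complex.summable_ofReal.2 (summable_greenT_sq hd)
  have hG : (fun ξ => G0hat d ξ - sigma d)
      = fun ξ => (fun x => torusSymbol d x - sigma d) fun i => (ξ i : UnitAddCircle) :=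
    funext fun ξ => by simp only [torusSymbol_coe]
  set f : UnitAddTorus (Fin d) → ℝ := fun x => torusSymbol d x - sigma d with hf
  set U : UnitAddTorus (Fin d) → ℝ := fun x => ∫ s, f (x - s) * f s with hU
  have hUc : ∀ x, ((U x : ℝ) : ℂ) = ∑' n, ((greenT d n ^ 2 : ℝ) : ℂ) * mFourier n x := by
    intro x
    have h := hasSum_convolution (memLp_torusSymbol_sub hd) (memLp_torusSymbol_sub hd) x
    rw [hU, ← integral_complex_ofReal]
    simp only [Complex.ofReal_mul]
    rw [← h.tsum_eq]
    refine tsum_congr fun n => ?_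
    simp only [mFourierCoeff_torusSymbol_sub hd]
    push_cast; ring
  have hconv : torusConv (fun ξ => G0hat d ξ - sigma d) (fun ξ => G0hat d ξ - sigma d)
      = fun ξ => U fun i => (ξ i : UnitAddCircle) := by
    ext ξ
    have := torusConv_coe f f ξ
    rw [← hG] at this
    have h2 : ((U fun i => (ξ i : UnitAddCircle) : ℝ) : ℂ)
        = ∫ x, (f ((fun i => (ξ i : UnitAddCircle)) - x) : ℂ) * (f x : ℂ) := by
      rw [hU, ← integral_complex_ofReal]; simp
    rw [← h2] at this
    exact_mod_cast this
  have hpair := summable_greenConv_pair hd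
  have hcs : Summable fun n : Site d => ((greenConv d n : ℝ) : ℂ) :=
    Complex.summable_ofReal.2 hpair.prod
  have hU2 : ∀ x, (((U x) ^ 2 : ℝ) : ℂ) = ∑' n, ((greenConv d n : ℝ) : ℂ) * mFourier n x := by
    intro x
    set b : Site d → ℂ := fun n => ((greenT d n ^ 2 : ℝ) : ℂ) * mFourier n x with hb
    have hbs : Summable fun n => ‖b n‖ := by
      simp only [hb, norm_mul, norm_mFourier_apply, mul_one]
      exact hsq.norm
    have hprod := summable_mul_of_summable_norm hbs hbs
    rw [Complex.ofReal_pow, hUc, pow_two, tsum_mul_tsum_of_summable_norm hbs hbs]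
    let e : Site d × Site d ≃ Site d × Site d :=
      { toFun := fun p => (p.2, p.1 - p.2)
        invFun := fun q => (q.1 + q.2, q.1)
        left_inv := fun p => by ext <;> simp
        right_inv := fun q => by ext <;> simp }
    rw [← e.tsum_eq]
    have hs' := (e.summable_iff (f := fun z : Site d × Site d => b z.1 * b z.2)).2 hprod
    rw [Summable.tsum_prod (f := fun c => b (e c).1 * b (e c).2) hs']
    refine tsum_congr fun n => ?_
    rw [greenConv, Complex.ofReal_tsum, ← tsum_mul_right]
    refine tsum_congr fun m => ?_
    have hm : mFourier n x = mFourier m x * mFourier (n - m) x := by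
      rw [← mFourier_add]; congr 2; abel
    simp only [e, hb, Equiv.coe_fn_mk, hm]
    push_cast; ring
  have hU2m : MemLp (fun x => (((U x) ^ 2 : ℝ) : ℂ)) 2 := by
    simp only [hU2]; exact memLp_tsum_mFourier hcs
  have h := hasSum_convolution (memLp_torusSymbol_sub hd) hU2m 0
  have e := torusConv_coe f (fun x => U x ^ 2) 0
  have e3 : eta d = torusConv (fun ξ : Fin d → ℝ => f fun i => (ξ i : UnitAddCircle))
      (fun ξ => U (fun i => (ξ i : UnitAddCircle)) ^ 2) 0 := by
    rw [eta]
    simp only [hconv]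
    rw [hG]
  rw [← e3, coe_zero_torus] at e
  rw [← e] at h
  rw [← Complex.hasSum_ofReal]
  refine h.congr_fun fun n => ?_
  rw [mFourierCoeff_torusSymbol_sub hd]
  simp only [hU2]
  rw [mFourierCoeff_tsum hcs]
  have : mFourier n (0 : UnitAddTorus (Fin d)) = 1 := by simp [mFourier, fourier_apply]
  rw [this]; push_cast; ring

/-- The lattice operator `-Δ`. -/
def negLap (f : Site d → ℝ) (n : Site d) : ℝ :=
  2 * d * f n - ∑ i, (f (n + Pi.single i 1) + f (n - Pi.single i 1))

lemma green_eq_integral (n : Site d) :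
    green d n = ∫ ξ in Set.Icc (0 : Fin d → ℝ) 1,
      Real.cos (2 * Real.pi * ∑ j, (n j : ℝ) * ξ j) * G0hat d ξ := by
  simp [green, G0]

lemma integral_cos (n : Site d) :
    ∫ ξ in Set.Icc (0 : Fin d → ℝ) 1, Real.cos (2 * Real.pi * ∑ j, (n j : ℝ) * ξ j)
      = if n = 0 then 1 else 0 := by
  have h := integral_mFourier n
  rw [← integral_unitCube] at h
  have hi : Integrable (fun ξ : Fin d → ℝ => mFourier n (fun i => (ξ i : UnitAddCircle)))
      (volume.restrict (Set.Icc 0 1)) := by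
    have : Continuous fun ξ : Fin d → ℝ => mFourier n (fun i => (ξ i : UnitAddCircle)) := by
      simp only [mFourier_coe]; fun_prop
    exact this.continuousOn.integrableOn_compact isCompact_Icc
  have h2 := integral_re hi
  simp only [RCLike.re_eq_complex_re] at h2
  rw [h] at h2
  simp only [mFourier_coe, Complex.exp_ofReal_mul_I_re] at h2
  rw [h2]; split_ifs <;> simp

/-- `(-Δ) G₀ = I`. -/
lemma negLap_green (hd : 5 ≤ d) (n : Site d) :
    negLap (green d) n = if n = 0 then 1 else 0 := by
  have hint : ∀ g : (Fin d → ℝ) → ℝ, Continuous g → (∃ C, ∀ ξ, |g ξ| ≤ C) →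
      IntegrableOn (fun ξ => g ξ * G0hat d ξ) (Set.Icc 0 1) := by
    rintro g hg ⟨C, hC⟩
    exact (integrableOn_G0hat hd).bdd_mul (c := C) hg.aestronglyMeasurable
      (Filter.Eventually.of_forall hC)
  set P : (Fin d → ℝ) → ℝ := fun ξ => 2 * Real.pi * ∑ j, (n j : ℝ) * ξ j with hP
  have hPc : Continuous P := by fun_prop
  have hshift : ∀ i, green d (n + Pi.single i 1) + green d (n - Pi.single i 1)
      = ∫ ξ in Set.Icc (0 : Fin d → ℝ) 1,
          (2 * Real.cos (P ξ) * Real.cos (2 * Real.pi * ξ i)) * G0hat d ξ := by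
    intro i
    rw [green_eq_integral, green_eq_integral, ← integral_add]
    · refine integral_congr_ae (Filter.Eventually.of_forall fun ξ => ?_)
      have e1 : 2 * Real.pi * ∑ j, (((n + Pi.single i 1 : Site d) j : ℤ) : ℝ) * ξ j
          = P ξ + 2 * Real.pi * ξ i := by
        simp only [hP, Pi.add_apply, Int.cast_add, add_mul, Finset.sum_add_distrib, mul_add]
        congr 2
        rw [Finset.sum_eq_single i] <;> simp +contextual
      have e2 : 2 * Real.pi * ∑ j, (((n - Pi.single i 1 : Site d) j : ℤ) : ℝ) * ξ j
          = P ξ - 2 * Real.pi * ξ i := by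
        simp only [hP, Pi.sub_apply, Int.cast_sub, sub_mul, Finset.sum_sub_distrib, mul_sub]
        congr 2
        rw [Finset.sum_eq_single i] <;> simp +contextual
      simp only [e1, e2, Real.cos_add, Real.cos_sub]
      ring
    · exact hint _ (by fun_prop) ⟨1, fun ξ => Real.abs_cos_le_one _⟩
    · exact hint _ (by fun_prop) ⟨1, fun ξ => Real.abs_cos_le_one _⟩
  have hi2 : ∀ i : Fin d, IntegrableOn (fun ξ =>
      (2 * Real.cos (P ξ) * Real.cos (2 * Real.pi * ξ i)) * G0hat d ξ) (Set.Icc 0 1) := by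
    intro i
    refine hint _ (by fun_prop) ⟨2, fun ξ => ?_⟩
    rw [abs_mul, abs_mul]
    have h1 := Real.abs_cos_le_one (P ξ)
    have h2 := Real.abs_cos_le_one (2 * Real.pi * ξ i)
    norm_num
    nlinarith [abs_nonneg (Real.cos (P ξ)), abs_nonneg (Real.cos (2 * Real.pi * ξ i))]
  rw [negLap]
  simp only [hshift]
  rw [green_eq_integral, ← integral_const_mul, ← integral_finsetSum _ fun i _ => hi2 i,
    ← integral_sub, ← integral_cos]
  · refine integral_congr_ae ?_
    have hne : ∀ᵐ ξ : Fin d → ℝ ∂(volume.restrict (Set.Icc 0 1)), ∀ j, ξ j ∈ Set.Ioo (0 : ℝ) 1 := by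
      have := (Measure.univ_pi_Ioo_ae_eq_Icc (μ := fun _ : Fin d => (volume : Measure ℝ))
        (f := 0) (g := 1))
      rw [← volume_pi] at this
      rw [← Measure.restrict_congr_set this]
      filter_upwards [ae_restrict_mem (MeasurableSet.univ_pi fun _ => measurableSet_Ioo)] with ξ hξ j
      exact hξ j trivial
    filter_upwards [hne] with ξ hξ
    have hpos : ∀ j, 0 < 2 - 2 * Real.cos (2 * Real.pi * ξ j) := by
      intro j
      have h0 := (hξ j).1
      have h1 : 0 < 1 - ξ j := by linarith [(hξ j).2]
      rcases one_sub_cos_lower h0 (hξ j).2 with h | h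
      · exact lt_of_lt_of_le (by positivity) h
      · exact lt_of_lt_of_le (by positivity) h
    have hsum : 0 < ∑ j, (2 - 2 * Real.cos (2 * Real.pi * ξ j)) := by
      refine Finset.sum_pos (fun j _ => hpos j) ?_
      exact ⟨⟨0, by omega⟩, Finset.mem_univ _⟩
    have e : ∑ i, 2 * Real.cos (P ξ) * Real.cos (2 * Real.pi * ξ i) * G0hat d ξ
        = Real.cos (P ξ) * (2 * ∑ i, Real.cos (2 * Real.pi * ξ i)) * G0hat d ξ := by
      rw [Finset.mul_sum, Finset.mul_sum, Finset.sum_mul]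
      refine Finset.sum_congr rfl fun i _ => ?_
      ring
    have e4 : ∑ j, (2 - 2 * Real.cos (2 * Real.pi * ξ j))
        = 2 * d - 2 * ∑ i, Real.cos (2 * Real.pi * ξ i) := by
      rw [Finset.sum_sub_distrib, ← Finset.mul_sum]; simp [mul_comm]
    change 2 * (d : ℝ) * (Real.cos (P ξ) * G0hat d ξ) - _ = Real.cos (P ξ)
    rw [e, G0hat_eq, e4]
    rw [e4] at hsum
    have hc := mul_inv_cancel₀ hsum.ne'
    linear_combination Real.cos (P ξ) * hc
  · exact (hint _ (Real.continuous_cos.comp hPc) ⟨1, fun ξ => Real.abs_cos_le_one _⟩).const_mul _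
  · exact integrable_finsetSum _ fun i _ => hi2 i

end Torus

variable {d : ℕ}

/-! ### A superharmonic weight and the decay of the Green's function -/

/-- The Euclidean square of a lattice site. -/
def normSq (x : Site d) : ℝ := ∑ i, (x i : ℝ) ^ 2

lemma normSq_nonneg (x : Site d) : 0 ≤ normSq x := Finset.sum_nonneg fun _ _ => sq_nonneg _

/-- The weight `1 / (35 + |x|²)`; the constant makes it strictly superharmonic in dimension at
least five. -/
def weight (x : Site d) : ℝ := (35 + normSq x)⁻¹

lemma weight_pos (x : Site d) : 0 < weight x := by
  have := normSq_nonneg x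
  unfold weight; positivity

lemma weight_le_one (x : Site d) : weight x ≤ 1 := by
  have := normSq_nonneg x
  exact inv_le_one_of_one_le₀ (by linarith)

lemma normSq_add_single (x : Site d) (i : Fin d) :
    normSq (x + Pi.single i 1) = normSq x + 2 * x i + 1 := by
  have : ∀ j, (((x + Pi.single i 1 : Site d) j : ℤ) : ℝ) ^ 2
      = (x j : ℝ) ^ 2 + if j = i then (2 * (x i : ℝ) + 1) else 0 := by
    intro j
    by_cases h : j = i
    · subst h; simp; ring
    · simp [h]
  simp only [normSq, this, Finset.sum_add_distrib, Finset.sum_ite_eq', Finset.mem_univ, if_true]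
  ring

lemma normSq_sub_single (x : Site d) (i : Fin d) :
    normSq (x - Pi.single i 1) = normSq x - 2 * x i + 1 := by
  have : ∀ j, (((x - Pi.single i 1 : Site d) j : ℤ) : ℝ) ^ 2
      = (x j : ℝ) ^ 2 + if j = i then (-2 * (x i : ℝ) + 1) else 0 := by
    intro j
    by_cases h : j = i
    · subst h; simp; ring
    · simp [h]
  simp only [normSq, this, Finset.sum_add_distrib, Finset.sum_ite_eq', Finset.mem_univ, if_true]
  ring

lemma sq_le_normSq (x : Site d) (i : Fin d) : (x i : ℝ) ^ 2 ≤ normSq x :=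
  Finset.single_le_sum (f := fun j => (x j : ℝ) ^ 2) (fun _ _ => sq_nonneg _) (Finset.mem_univ i)

/-- The weight is strictly superharmonic. -/
lemma negLap_weight (hd : 5 ≤ d) (x : Site d) : weight x ^ 2 / 2 ≤ negLap weight x := by
  have hd' : (5 : ℝ) ≤ d := by exact_mod_cast hd
  set N := normSq x with hN
  have hN0 : 0 ≤ N := normSq_nonneg x
  set Q := 35 + N with hQ
  set P := Q + 1 with hP
  have hP36 : 36 ≤ P := by linarith
  have hpair : ∀ i, weight (x + Pi.single i 1) + weight (x - Pi.single i 1)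
      ≤ 2 / P + 9 * (x i : ℝ) ^ 2 / P ^ 3 := by
    intro i
    have hx : (x i : ℝ) ^ 2 ≤ N := sq_le_normSq x i
    simp only [weight, normSq_add_single, normSq_sub_single, ← hN]
    set t : ℝ := (x i : ℝ)
    have e1 : 35 + (N + 2 * t + 1) = P + 2 * t := by rw [hP, hQ]; ring
    have e2 : 35 + (N - 2 * t + 1) = P - 2 * t := by rw [hP, hQ]; ring
    rw [e1, e2]
    have h36 : 36 * t ^ 2 ≤ P ^ 2 := by nlinarith [sq_nonneg (P - 18)]
    have hp1 : 0 < P + 2 * t := by nlinarith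
    have hp2 : 0 < P - 2 * t := by nlinarith
    have hprod : (P + 2 * t) * (P - 2 * t) = P ^ 2 - 4 * t ^ 2 := by ring
    have hpp : 0 < P ^ 2 - 4 * t ^ 2 := by rw [← hprod]; positivity
    have e3 : (P + 2 * t)⁻¹ + (P - 2 * t)⁻¹ = 2 * P / (P ^ 2 - 4 * t ^ 2) := by
      rw [← hprod]; field_simp; ring
    have e4 : 2 / P + 9 * t ^ 2 / P ^ 3 = (2 * P ^ 2 + 9 * t ^ 2) / P ^ 3 := by
      field_simp
    rw [e3, e4, div_le_div_iff₀ hpp (by positivity)]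
    nlinarith [mul_nonneg (sq_nonneg t) (sub_nonneg.2 h36)]
  have hsum : ∑ i, (weight (x + Pi.single i 1) + weight (x - Pi.single i 1))
      ≤ d * (2 / P) + 9 * N / P ^ 3 := by
    refine (Finset.sum_le_sum fun i _ => hpair i).trans (le_of_eq ?_)
    rw [Finset.sum_add_distrib, ← Finset.sum_div Finset.univ (fun i => 9 * (x i : ℝ) ^ 2),
      ← Finset.mul_sum]
    simp [hN, normSq]
  have hw : weight x = Q⁻¹ := rfl
  rw [negLap, hw]
  refine le_trans ?_ (sub_le_sub_left hsum _)
  have hQ0 : 0 < Q := by linarith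
  have hP0 : 0 < P := by linarith
  have h1 : 2 * (d : ℝ) * Q⁻¹ - (d * (2 / P) + 9 * N / P ^ 3)
      = 2 * d / (Q * P) - 9 * N / P ^ 3 := by
    rw [hP]; field_simp; ring
  have h2 : 9 * N / P ^ 3 ≤ 9 / (Q * P) := by
    rw [div_le_div_iff₀ (by positivity) (by positivity)]
    have : N * Q ≤ P ^ 2 := by nlinarith
    nlinarith
  have h3 : 10 / (Q * P) ≤ 2 * d / (Q * P) := by gcongr; linarith
  have h4 : Q⁻¹ ^ 2 / 2 ≤ 10 / (Q * P) - 9 / (Q * P) := by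
    rw [← sub_div, inv_pow, inv_eq_one_div, div_div, div_le_div_iff₀ (by positivity) (by positivity)]
    nlinarith
  linarith

lemma negLap_add (f g : Site d → ℝ) (x : Site d) :
    negLap (fun y => f y + g y) x = negLap f x + negLap g x := by
  simp only [negLap, Finset.sum_add_distrib]; ring

lemma negLap_const_mul (c : ℝ) (f : Site d → ℝ) (x : Site d) :
    negLap (fun y => c * f y) x = c * negLap f x := by
  simp only [negLap, ← mul_add, ← Finset.mul_sum]; ring

lemma negLap_comp_sub (f : Site d → ℝ) (z x : Site d) :
    negLap (fun y => f (y - z)) x = negLap f (x - z) := by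
  simp only [negLap]
  congr 1
  refine Finset.sum_congr rfl fun i _ => ?_
  congr 2 <;> abel

/-- The minimum principle: a superharmonic function that vanishes at infinity is nonnegative. -/
lemma nonneg_of_negLap_nonneg (hd : 0 < d) {f : Site d → ℝ} (hf : Tendsto f cofinite (𝓝 0))
    (hs : ∀ x, 0 ≤ negLap f x) (x : Site d) : 0 ≤ f x := by
  by_contra hneg
  push Not at hneg
  have hfin : {y | f y ≤ f x}.Finite := by
    have := hf.eventually (lt_mem_nhds hneg)
    rw [Filter.eventually_cofinite] at this
    simpa using this
  obtain ⟨m, hm, hmin⟩ := hfin.exists_minimalFor f _ ⟨x, le_refl (f x)⟩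
  have hglob : ∀ y, f m ≤ f y := by
    intro y
    by_cases hy : f y ≤ f x
    · rcases le_total (f m) (f y) with h | h
      · exact h
      · exact hmin hy h
    · push Not at hy
      exact le_trans hm hy.le
  have hT : {y | f y = f m}.Finite := hfin.subset fun y hy => by
    simp only [Set.mem_ofPred_eq] at hy ⊢; rw [hy]; exact hm
  let i0 : Fin d := ⟨0, hd⟩
  obtain ⟨p, hp, hmax⟩ := hT.exists_maximalFor (fun y : Site d => y i0) _ ⟨m, rfl⟩
  have hL := hs p
  rw [negLap] at hL
  have hpm : f p = f m := hp
  have h1 : ∑ i : Fin d, (f m + f m) ≤ ∑ i, (f (p + Pi.single i 1) + f (p - Pi.single i 1)) :=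
    Finset.sum_le_sum fun i _ => add_le_add (hglob _) (hglob _)
  have h2 : f (p + Pi.single i0 1) ≤ f m := by
    by_contra hlt
    push Not at hlt
    have : ∑ i : Fin d, (f m + f m) < ∑ i, (f (p + Pi.single i 1) + f (p - Pi.single i 1)) :=
      Finset.sum_lt_sum (fun i _ => add_le_add (hglob _) (hglob _))
        ⟨i0, Finset.mem_univ _, add_lt_add_of_lt_of_le hlt (hglob _)⟩
    simp only [Finset.sum_const, Finset.card_univ, Fintype.card_fin, nsmul_eq_mul] at this
    rw [hpm] at hL
    linarith
  have h3 : (p + Pi.single i0 1) ∈ {y | f y = f m} := le_antisymm h2 (hglob _)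
  have := hmax h3 (by simp)
  simp at this

lemma tendsto_zero_of_summable_sq {f : Site d → ℝ} (hf : Summable fun x => f x ^ 2) :
    Tendsto f cofinite (𝓝 0) := by
  have h := hf.tendsto_cofinite_zero
  rw [tendsto_zero_iff_abs_tendsto_zero]
  have := (Real.continuous_sqrt.tendsto 0).comp h
  simpa [Function.comp_def, Real.sqrt_sq_eq_abs] using! this

lemma tendsto_weight : Tendsto (weight : Site d → ℝ) cofinite (𝓝 0) := by
  have h1 : Tendsto (fun x : Site d => ‖x‖) cofinite atTop := by
    rw [← Filter.cocompact_eq_cofinite]; exact tendsto_norm_cocompact_atTop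
  have h2 : Tendsto (fun x : Site d => ‖x‖⁻¹) cofinite (𝓝 0) := tendsto_inv_atTop_zero.comp h1
  refine squeeze_zero' (Filter.Eventually.of_forall fun x => (weight_pos x).le) ?_ h2
  filter_upwards [h1.eventually_ge_atTop 1] with x hx
  refine inv_anti₀ (by linarith) ?_
  have : ‖x‖ ^ 2 ≤ normSq x := by
    have hn : ‖x‖ ≤ Real.sqrt (normSq x) := by
      rw [pi_norm_le_iff_of_nonneg (Real.sqrt_nonneg _)]
      intro i
      refine Real.le_sqrt_of_sq_le ?_
      have : ‖x i‖ ^ 2 = (x i : ℝ) ^ 2 := by rw [Int.norm_eq_abs, sq_abs]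
      rw [this]; exact sq_le_normSq x i
    calc ‖x‖ ^ 2 ≤ Real.sqrt (normSq x) ^ 2 := by gcongr
      _ = normSq x := Real.sq_sqrt (normSq_nonneg x)
  nlinarith

/-- Decay of the free Green's function, by comparison with the superharmonic weight. -/
lemma abs_green_le (hd : 5 ≤ d) (n : Site d) : |green d n| ≤ 2450 * weight n := by
  -- `weight 0 ^ 2 / 2 = 1 / 2450`, so `2450 * weight ± green` is superharmonic at the origin
  have hw0 : weight (0 : Site d) = 1 / 35 := by simp [weight, normSq]
  have hgt := tendsto_zero_of_summable_sq (summable_green_sq hd)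
  have key : ∀ s : ℝ, |s| ≤ 1 → 0 ≤ 2450 * weight n + s * green d n := by
    intro s hs
    refine nonneg_of_negLap_nonneg (f := fun n => 2450 * weight n + s * green d n) (by omega) ?_
      (fun x => ?_) n
    · simpa using (tendsto_weight.const_mul 2450).add (hgt.const_mul s)
    · rw [negLap_add, negLap_const_mul, negLap_const_mul, negLap_green hd]
      have h := negLap_weight hd x
      have hs' := abs_le.1 hs
      by_cases hx : x = 0
      · rw [hx, hw0] at h
        simp only [hx, if_true]
        norm_num at h
        linarith
      · simp only [hx, if_false]
        have := sq_nonneg (weight x)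
        linarith
  have h1 := key 1 (by simp)
  have h2 := key (-1) (by simp)
  exact abs_le.2 ⟨by linarith, by linarith⟩

/-! ### Square-summable functions and Rellich's inequality -/

/-- Square summability of a function on the lattice. -/
def SqSummable {ι : Type*} (f : ι → ℝ) : Prop := Summable fun x => f x ^ 2

namespace SqSummable

variable {ι : Type*} {f g : ι → ℝ}

lemma mul (hf : SqSummable f) (hg : SqSummable g) : Summable fun x => f x * g x := by
  refine Summable.of_norm_bounded (hf.add hg) fun x => ?_
  rw [Real.norm_eq_abs, abs_mul]
  nlinarith [sq_abs (f x), sq_abs (g x), sq_nonneg (|f x| - |g x|), abs_nonneg (f x),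
    abs_nonneg (g x)]

lemma add (hf : SqSummable f) (hg : SqSummable g) : SqSummable fun x => f x + g x := by
  have h : Summable fun x => f x ^ 2 + g x ^ 2 + 2 * (f x * g x) :=
    (Summable.add hf hg).add ((hf.mul hg).mul_left 2)
  refine h.congr fun x => ?_
  ring

lemma const_mul (hf : SqSummable f) (c : ℝ) : SqSummable fun x => c * f x := by
  refine (Summable.mul_left (c ^ 2) hf).congr fun x => ?_
  ring

lemma neg (hf : SqSummable f) : SqSummable fun x => -f x := by
  refine Summable.congr hf fun x => ?_
  ring

lemma sub (hf : SqSummable f) (hg : SqSummable g) : SqSummable fun x => f x - g x := by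
  simpa only [sub_eq_add_neg] using hf.add hg.neg

lemma of_abs_le (hg : SqSummable g) (h : ∀ x, |f x| ≤ |g x|) : SqSummable f :=
  Summable.of_nonneg_of_le (fun _ => sq_nonneg _) (fun x => sq_le_sq.2 (h x)) hg

lemma mul_bounded (hf : SqSummable f) {b : ι → ℝ} {C : ℝ} (hb : ∀ x, |b x| ≤ C) :
    SqSummable fun x => b x * f x := by
  refine (hf.const_mul C).of_abs_le fun x => ?_
  rw [abs_mul, abs_mul]
  exact mul_le_mul_of_nonneg_right ((hb x).trans (le_abs_self C)) (abs_nonneg _)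

lemma sum {κ : Type*} {F : κ → ι → ℝ} (s : Finset κ) (h : ∀ k ∈ s, SqSummable (F k)) :
    SqSummable fun x => ∑ k ∈ s, F k x := by
  classical
  induction s using Finset.induction_on with
  | empty => simp [SqSummable]
  | insert a s ha ih =>
    simp only [Finset.sum_insert ha]
    exact (h a (Finset.mem_insert_self _ _)).add
      (ih fun k hk => h k (Finset.mem_insert_of_mem hk))

lemma comp_injective (hf : SqSummable f) {κ : Type*} {e : κ → ι} (he : Function.Injective e) :
    SqSummable fun x => f (e x) :=
  Summable.comp_injective (f := fun x => f x ^ 2) hf he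

end SqSummable

lemma SqSummable.shift {f : Site d → ℝ} (hf : SqSummable f) (k : Site d) :
    SqSummable fun x => f (x + k) := hf.comp_injective (add_left_injective k)

lemma SqSummable.shift_sub {f : Site d → ℝ} (hf : SqSummable f) (k : Site d) :
    SqSummable fun x => f (x - k) := hf.comp_injective (sub_left_injective (b := k))

lemma SqSummable.negLap {f : Site d → ℝ} (hf : SqSummable f) : SqSummable (negLap f) :=
  (hf.const_mul _).sub (SqSummable.sum _ fun _ _ => (hf.shift _).add (hf.shift_sub _))

lemma tsum_shift (f : Site d → ℝ) (k : Site d) : ∑' x, f (x + k) = ∑' x, f x :=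
  (Equiv.addRight k).tsum_eq f

lemma tsum_shift_sub (f : Site d → ℝ) (k : Site d) : ∑' x, f (x - k) = ∑' x, f x :=
  (Equiv.subRight k).tsum_eq f

lemma negLap_eq_sum (f : Site d → ℝ) (x : Site d) :
    negLap f x = ∑ i, (2 * f x - f (x + Pi.single i 1) - f (x - Pi.single i 1)) := by
  simp only [negLap, Finset.sum_sub_distrib, Finset.sum_add_distrib]
  simp
  ring

/-- The telescoping form of summation by parts in one lattice direction, with a weight. -/
lemma tsum_weighted_second_difference {w ψ : Site d → ℝ} {C : ℝ} (hw0 : ∀ x, 0 ≤ w x)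
    (hwC : ∀ x, w x ≤ C) (hψ : SqSummable ψ) (e : Site d) :
    ∑' x, (ψ x ^ 2 * (2 * w x - w (x + e) - w (x - e))) / 2
      ≤ ∑' x, w x * ψ x * (2 * ψ x - ψ (x + e) - ψ (x - e)) := by
  have hwb : ∀ x, |w x| ≤ C := fun x => by rw [abs_of_nonneg (hw0 x)]; exact hwC x
  have hp := hψ.shift e
  have hm := hψ.shift_sub e
  -- all products of two shifts of `ψ` with a shift of the weight are summable
  have hs : ∀ {f g : Site d → ℝ} (z : Site d), SqSummable f → SqSummable g →
      Summable fun x => w (x + z) * f x * g x := fun z hf hg =>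
    (hf.mul_bounded (b := fun x => w (x + z)) fun x => hwb _).mul hg
  have s1 : Summable fun x => w x * ψ x * ψ x := by simpa using hs 0 hψ hψ
  have s2 : Summable fun x => w x * ψ (x + e) * ψ (x + e) := by simpa using hs 0 hp hp
  have s3 : Summable fun x => w (x + e) * ψ x * ψ (x + e) := hs e hψ hp
  have s4 : Summable fun x => w x * ψ x * ψ (x + e) := by simpa using hs 0 hψ hp
  have s5 : Summable fun x => w x * ψ x * ψ (x - e) := by simpa using hs 0 hψ hm
  have s6 : Summable fun x => w (x + e) * ψ x * ψ x := hs e hψ hψ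
  have s7 : Summable fun x => w (x - e) * ψ x * ψ x := by
    simpa [sub_eq_add_neg] using hs (-e) hψ hψ
  have s8 : Summable fun x => w (x + e) * ψ (x + e) * ψ (x + e) := hs e hp hp
  have hD : 0 ≤ ∑' x, (w x + w (x + e)) / 2 * (ψ (x + e) - ψ x) ^ 2 :=
    tsum_nonneg fun x => mul_nonneg (by linarith [hw0 x, hw0 (x + e)]) (sq_nonneg _)
  have e1 : ∑' x, w (x + e) * ψ (x + e) * ψ (x + e) = ∑' x, w x * ψ x * ψ x :=
    tsum_shift (fun x => w x * ψ x * ψ x) e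
  have e2 : ∑' x, w (x - e) * ψ x * ψ x = ∑' x, w x * ψ (x + e) * ψ (x + e) := by
    rw [← tsum_shift_sub (fun x => w x * ψ (x + e) * ψ (x + e)) e]
    simp
  have e3 : ∑' x, w x * ψ x * ψ (x - e) = ∑' x, w (x + e) * ψ x * ψ (x + e) := by
    rw [← tsum_shift_sub (fun x => w (x + e) * ψ x * ψ (x + e)) e]
    refine tsum_congr fun x => ?_
    simp; ring
  have hL : ∑' x, (ψ x ^ 2 * (2 * w x - w (x + e) - w (x - e))) / 2
      = (∑' x, w x * ψ x * ψ x) - (∑' x, w (x + e) * ψ x * ψ x) / 2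
        - (∑' x, w (x - e) * ψ x * ψ x) / 2 := by
    rw [← tsum_div_const, ← tsum_div_const, ← s1.tsum_sub (s6.div_const 2),
      ← (s1.sub (s6.div_const 2)).tsum_sub (s7.div_const 2)]
    refine tsum_congr fun x => ?_
    ring
  have hR : ∑' x, w x * ψ x * (2 * ψ x - ψ (x + e) - ψ (x - e))
      = 2 * (∑' x, w x * ψ x * ψ x) - (∑' x, w x * ψ x * ψ (x + e))
        - ∑' x, w x * ψ x * ψ (x - e) := by
    rw [← tsum_mul_left, ← (s1.mul_left 2).tsum_sub s4, ← ((s1.mul_left 2).sub s4).tsum_sub s5]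
    refine tsum_congr fun x => ?_
    ring
  have hDe : ∑' x, (w x + w (x + e)) / 2 * (ψ (x + e) - ψ x) ^ 2
      = (∑' x, w x * ψ (x + e) * ψ (x + e)) / 2 + (∑' x, w x * ψ x * ψ x) / 2
        + (∑' x, w (x + e) * ψ (x + e) * ψ (x + e)) / 2 + (∑' x, w (x + e) * ψ x * ψ x) / 2
        - (∑' x, w x * ψ x * ψ (x + e)) - ∑' x, w (x + e) * ψ x * ψ (x + e) := by
    rw [← tsum_div_const, ← tsum_div_const, ← tsum_div_const, ← tsum_div_const,
      ← (s2.div_const 2).tsum_add (s1.div_const 2),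
      ← ((s2.div_const 2).add (s1.div_const 2)).tsum_add (s8.div_const 2),
      ← (((s2.div_const 2).add (s1.div_const 2)).add (s8.div_const 2)).tsum_add (s6.div_const 2),
      ← ((((s2.div_const 2).add (s1.div_const 2)).add (s8.div_const 2)).add
        (s6.div_const 2)).tsum_sub s4,
      ← (((((s2.div_const 2).add (s1.div_const 2)).add (s8.div_const 2)).add
        (s6.div_const 2)).sub s4).tsum_sub s3]
    refine tsum_congr fun x => ?_
    ring
  rw [hL, hR]
  rw [hDe] at hD
  linarith

/-- **Rellich's inequality** on the lattice, with an arbitrary centre. -/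
lemma rellich (hd : 5 ≤ d) {ψ : Site d → ℝ} (hψ : SqSummable ψ) (z : Site d) :
    ∑' x, (weight (x - z) * ψ x) ^ 2 ≤ 16 * ∑' x, negLap ψ x ^ 2 := by
  set w : Site d → ℝ := fun x => weight (x - z) with hw
  have hw0 : ∀ x, 0 ≤ w x := fun x => (weight_pos _).le
  have hw1 : ∀ x, w x ≤ 1 := fun x => weight_le_one _
  have hwb : ∀ x, |w x| ≤ 1 := fun x => by rw [abs_of_nonneg (hw0 x)]; exact hw1 x
  have hwψ : SqSummable fun x => w x * ψ x := hψ.mul_bounded hwb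
  have hL := hψ.negLap
  have hdir : ∀ i : Fin d, Summable fun x =>
      w x * ψ x * (2 * ψ x - ψ (x + Pi.single i 1) - ψ (x - Pi.single i 1)) := fun i =>
    hwψ.mul (((hψ.const_mul 2).sub (hψ.shift _)).sub (hψ.shift_sub _))
  have hdir2 : ∀ i : Fin d, Summable fun x =>
      (ψ x ^ 2 * (2 * w x - w (x + Pi.single i 1) - w (x - Pi.single i 1))) / 2 := by
    intro i
    have h4 : ∀ x, |2 * w x - w (x + Pi.single i 1) - w (x - Pi.single i 1)| ≤ 4 := by
      intro x
      rw [abs_le]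
      constructor <;> linarith [hw0 x, hw1 x, hw0 (x + Pi.single i 1), hw1 (x + Pi.single i 1),
        hw0 (x - Pi.single i 1), hw1 (x - Pi.single i 1)]
    have := hψ.mul (hψ.mul_bounded h4)
    refine (this.div_const 2).congr fun x => ?_
    ring
  have e1 : ∑' x, w x * ψ x * negLap ψ x = ∑ i : Fin d, ∑' x,
      w x * ψ x * (2 * ψ x - ψ (x + Pi.single i 1) - ψ (x - Pi.single i 1)) := by
    rw [← Summable.tsum_finsetSum fun i _ => hdir i]
    refine tsum_congr fun x => ?_
    rw [negLap_eq_sum, Finset.mul_sum]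
  have e2 : ∑' x, ψ x ^ 2 * negLap w x / 2 = ∑ i : Fin d, ∑' x,
      (ψ x ^ 2 * (2 * w x - w (x + Pi.single i 1) - w (x - Pi.single i 1))) / 2 := by
    rw [← Summable.tsum_finsetSum fun i _ => hdir2 i]
    refine tsum_congr fun x => ?_
    rw [negLap_eq_sum, Finset.mul_sum, Finset.sum_div]
  have s2 : Summable fun x => ψ x ^ 2 * negLap w x / 2 := by
    have := summable_sum fun i (_ : i ∈ Finset.univ) => hdir2 i
    refine this.congr fun x => ?_
    rw [negLap_eq_sum, Finset.mul_sum, Finset.sum_div]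
  have hle : ∑' x, ψ x ^ 2 * negLap w x / 2 ≤ ∑' x, w x * ψ x * negLap ψ x := by
    rw [e1, e2]
    exact Finset.sum_le_sum fun i _ => tsum_weighted_second_difference hw0 hw1 hψ _
  have hlow : (∑' x, (w x * ψ x) ^ 2) / 4 ≤ ∑' x, ψ x ^ 2 * negLap w x / 2 := by
    rw [← tsum_div_const]
    refine Summable.tsum_le_tsum (fun x => ?_) (Summable.div_const hwψ 4) s2
    have h := negLap_weight hd (x - z)
    rw [← negLap_comp_sub] at h
    have h' : w x ^ 2 / 2 ≤ negLap w x := h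
    nlinarith [sq_nonneg (ψ x), mul_le_mul_of_nonneg_left h' (sq_nonneg (ψ x))]
  have hup : ∑' x, w x * ψ x * negLap ψ x
      ≤ (∑' x, (w x * ψ x) ^ 2) / 8 + 2 * ∑' x, negLap ψ x ^ 2 := by
    rw [← tsum_div_const, ← tsum_mul_left,
      ← (Summable.div_const hwψ 8).tsum_add (Summable.mul_left 2 hL)]
    refine Summable.tsum_le_tsum (fun x => ?_) (hwψ.mul hL)
      ((Summable.div_const hwψ 8).add (Summable.mul_left 2 hL))
    nlinarith [sq_nonneg (w x * ψ x / 4 - negLap ψ x)]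
  linarith

/-- Summation by parts. -/
lemma tsum_mul_difference {f g : Site d → ℝ} (hf : SqSummable f) (hg : SqSummable g)
    (e : Site d) :
    ∑' x, (f (x - e) - f x) * g x = ∑' x, f x * (g (x + e) - g x) := by
  have h1 : Summable fun x => f (x - e) * g x := (hf.shift_sub e).mul hg
  have h2 : Summable fun x => f x * g (x + e) := hf.mul (hg.shift e)
  have h3 : Summable fun x => f x * g x := hf.mul hg
  simp only [sub_mul, mul_sub]
  rw [h1.tsum_sub h3, h2.tsum_sub h3, ← tsum_shift_sub (fun x => f x * g (x + e)) e]
  simp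

/-- The second differences of a square summable function are controlled by its Laplacian. -/
lemma tsum_second_difference_sq_le {ψ : Site d → ℝ} (hψ : SqSummable ψ) (i j : Fin d) :
    ∑' x, (ψ (x + Pi.single i 1 + Pi.single j 1) - ψ (x + Pi.single i 1)
      - ψ (x + Pi.single j 1) + ψ x) ^ 2 ≤ ∑' x, negLap ψ x ^ 2 := by
  set e : Fin d → Site d := fun i => Pi.single i 1 with he
  set D : Fin d → (Site d → ℝ) → Site d → ℝ := fun i f x => f (x + e i) - f x with hD
  have hDs : ∀ i f, SqSummable f → SqSummable (D i f) := fun i f hf => (hf.shift _).sub hf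
  set A : Fin d → Site d → ℝ := fun i x => D i ψ (x - e i) - D i ψ x with hA
  have hAs : ∀ i, SqSummable (A i) := fun i =>
    ((hDs i ψ hψ).shift_sub _).sub (hDs i ψ hψ)
  have hAL : ∀ x, negLap ψ x = ∑ i, A i x := by
    intro x
    simp only [negLap, hA, hD, Finset.sum_sub_distrib, Finset.sum_add_distrib, sub_add_cancel]
    simp [he]
    ring
  have key : ∀ i j, ∑' x, A i x * A j x = ∑' x, (D j (D i ψ) x) ^ 2 := by
    intro i j
    have hi := hDs i ψ hψ
    have hj := hDs j ψ hψ
    have c1 : ∑' x, A i x * A j x = ∑' x, D j (A i) x * D j ψ x := by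
      have := tsum_mul_difference hj (hAs i) (e j)
      calc ∑' x, A i x * A j x = ∑' x, (D j ψ (x - e j) - D j ψ x) * A i x :=
            tsum_congr fun x => mul_comm _ _
        _ = ∑' x, D j ψ x * (A i (x + e j) - A i x) := this
        _ = _ := tsum_congr fun x => mul_comm _ _
    have c2 : ∀ x, D j (A i) x = D j (D i ψ) (x - e i) - D j (D i ψ) x := by
      intro x
      simp only [hD, hA]
      have : x + e j - e i = x - e i + e j := by abel
      rw [this]
      have : x - e i + e j + e i = x + e j := by abel
      simp only [this, sub_add_cancel]
      ring
    rw [c1]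
    simp only [c2]
    rw [tsum_mul_difference (hDs j _ hi) hj]
    refine tsum_congr fun x => ?_
    simp only [hD]
    have : x + e j + e i = x + e i + e j := by abel
    rw [this]; ring
  have hexp : ∑' x, negLap ψ x ^ 2 = ∑ i, ∑ j, ∑' x, (D j (D i ψ) x) ^ 2 := by
    simp only [← key]
    have : ∀ i, ∑ j, ∑' x, A i x * A j x = ∑' x, ∑ j, A i x * A j x := fun i =>
      (Summable.tsum_finsetSum fun j _ => (hAs i).mul (hAs j)).symm
    simp only [this]
    rw [← Summable.tsum_finsetSum fun i _ => summable_sum fun j _ => (hAs i).mul (hAs j)]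
    refine tsum_congr fun x => ?_
    rw [hAL, pow_two, Finset.sum_mul_sum]
  rw [hexp]
  have h0 : ∀ i j, 0 ≤ ∑' x, (D j (D i ψ) x) ^ 2 := fun i j => tsum_nonneg fun _ => sq_nonneg _
  refine le_trans (le_of_eq ?_) ((Finset.single_le_sum (f := fun j => ∑' x, (D j (D i ψ) x) ^ 2)
    (fun j _ => h0 i j) (Finset.mem_univ j)).trans
    (Finset.single_le_sum (f := fun i => ∑ j, ∑' x, (D j (D i ψ) x) ^ 2)
    (fun i _ => Finset.sum_nonneg fun j _ => h0 i j) (Finset.mem_univ i)))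
  refine tsum_congr fun x => ?_
  simp only [hD, he]
  have : x + Pi.single j 1 + Pi.single i 1 = x + Pi.single i 1 + Pi.single j 1 := by abel
  rw [this]; ring

/-! ### Sums of squares in `[0, ∞]` -/

lemma ennreal_sqrt_sq (x : ℝ≥0∞) : (x ^ (1 / 2 : ℝ)) ^ 2 = x := by
  rw [← ENNReal.rpow_natCast, ← ENNReal.rpow_mul]; norm_num

lemma ennreal_tsum_mul_sq_le {ι : Type*} (f g : ι → ℝ≥0∞) :
    (∑' i, f i * g i) ^ 2 ≤ (∑' i, f i ^ 2) * ∑' i, g i ^ 2 := by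
  let _ : MeasurableSpace ι := ⊤
  have h := ENNReal.lintegral_mul_le_Lp_mul_Lq (μ := Measure.count) (p := 2) (q := 2)
    Real.HolderConjugate.two_two (f := f) (g := g) measurable_from_top.aemeasurable
    measurable_from_top.aemeasurable
  simp only [lintegral_count, Pi.mul_apply, ENNReal.rpow_two] at h
  have h2 := pow_le_pow_left' h 2
  rwa [mul_pow, ennreal_sqrt_sq, ennreal_sqrt_sq] at h2

/-- Cauchy–Schwarz with respect to a weight. -/
lemma ennreal_tsum_weighted_sq_le {ι : Type*} (b u : ι → ℝ≥0∞) :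
    (∑' i, b i * u i) ^ 2 ≤ (∑' i, b i) * ∑' i, b i * u i ^ 2 := by
  have h := ennreal_tsum_mul_sq_le (fun i => b i ^ (1 / 2 : ℝ)) fun i => b i ^ (1 / 2 : ℝ) * u i
  simp only [mul_pow, ennreal_sqrt_sq, ← mul_assoc, ← pow_two] at h
  exact h

/-- Minkowski's inequality for a superposition of functions in `ℓ²`. -/
lemma ennreal_tsum_superposition_sq_le {ι κ : Type*} (b c : κ → ℝ≥0∞) (u : κ → ι → ℝ≥0∞)
    {Y : ℝ≥0∞} (hc0 : ∀ k, c k ≠ 0) (hc : ∀ k, c k ≠ ∞)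
    (hu : ∀ k, ∑' x, u k x ^ 2 ≤ c k ^ 2 * Y) :
    ∑' x, (∑' k, b k * u k x) ^ 2 ≤ (∑' k, b k * c k) ^ 2 * Y := by
  have hpt : ∀ x, (∑' k, b k * u k x) ^ 2
      ≤ (∑' k, b k * c k) * ∑' k, b k * c k * (u k x / c k) ^ 2 := by
    intro x
    refine le_trans (le_of_eq ?_) (ennreal_tsum_weighted_sq_le _ _)
    congr 1
    refine tsum_congr fun k => ?_
    rw [mul_assoc, ENNReal.mul_div_cancel (hc0 k) (hc k)]
  calc ∑' x, (∑' k, b k * u k x) ^ 2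
      ≤ ∑' x, (∑' k, b k * c k) * ∑' k, b k * c k * (u k x / c k) ^ 2 :=
        ENNReal.tsum_le_tsum hpt
    _ = (∑' k, b k * c k) * ∑' k, b k * c k * ∑' x, (u k x / c k) ^ 2 := by
        rw [ENNReal.tsum_mul_left, ENNReal.tsum_comm]
        simp only [ENNReal.tsum_mul_left]
    _ ≤ (∑' k, b k * c k) * ∑' k, b k * c k * Y := by
        gcongr with k
        simp only [div_eq_mul_inv, mul_pow, ENNReal.tsum_mul_right]
        calc (∑' x, u k x ^ 2) * (c k)⁻¹ ^ 2 ≤ c k ^ 2 * Y * (c k)⁻¹ ^ 2 := by gcongr; exact hu k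
          _ = (c k * (c k)⁻¹) ^ 2 * Y := by ring
          _ = Y := by rw [ENNReal.mul_inv_cancel (hc0 k) (hc k)]; simp
    _ = (∑' k, b k * c k) ^ 2 * Y := by rw [ENNReal.tsum_mul_right]; ring

lemma enorm_sq_eq (a : ℝ) : ‖a‖ₑ ^ 2 = ENNReal.ofReal (a ^ 2) := by
  rw [← ofReal_norm, ← ENNReal.ofReal_pow (norm_nonneg _), Real.norm_eq_abs, sq_abs]

lemma SqSummable.ofReal_tsum {ι : Type*} {f : ι → ℝ} (hf : SqSummable f) :
    ENNReal.ofReal (∑' x, f x ^ 2) = ∑' x, ‖f x‖ₑ ^ 2 := by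
  rw [ENNReal.ofReal_tsum_of_nonneg (fun _ => sq_nonneg _) hf]
  simp only [enorm_sq_eq]

lemma sqSummable_of_tsum_ne_top {ι : Type*} {f : ι → ℝ} (h : ∑' x, ‖f x‖ₑ ^ 2 ≠ ∞) :
    SqSummable f := by
  simp only [enorm_sq_eq] at h
  have := ENNReal.summable_toReal h
  refine this.congr fun x => ?_
  rw [ENNReal.toReal_ofReal (sq_nonneg _)]

lemma SqSummable.tsum_ne_top {ι : Type*} {f : ι → ℝ} (hf : SqSummable f) :
    ∑' x, ‖f x‖ₑ ^ 2 ≠ ∞ := by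
  rw [← hf.ofReal_tsum]; exact ENNReal.ofReal_ne_top

lemma summable_of_tsum_enorm_ne_top {ι : Type*} {f : ι → ℝ} (h : ∑' x, ‖f x‖ₑ ≠ ∞) :
    Summable f := by
  have := ENNReal.summable_toReal h
  exact Summable.of_norm (this.congr fun x => by simp)

lemma tsum_enorm_ne_top {ι : Type*} {f : ι → ℝ} (h : Summable f) : ∑' x, ‖f x‖ₑ ≠ ∞ := by
  have : ∑' x, ‖f x‖ₑ = ENNReal.ofReal (∑' x, ‖f x‖) := by
    rw [ENNReal.ofReal_tsum_of_nonneg (fun _ => norm_nonneg _) h.norm]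
    simp only [ofReal_norm]
  rw [this]; exact ENNReal.ofReal_ne_top

lemma enorm_tsum_le {ι : Type*} (f : ι → ℝ) : ‖∑' x, f x‖ₑ ≤ ∑' x, ‖f x‖ₑ := by
  by_cases h : Summable f
  · have hn := h.norm
    calc ‖∑' x, f x‖ₑ = ENNReal.ofReal ‖∑' x, f x‖ := (ofReal_norm _).symm
      _ ≤ ENNReal.ofReal (∑' x, ‖f x‖) := ENNReal.ofReal_le_ofReal (norm_tsum_le_tsum_norm hn)
      _ = ∑' x, ‖f x‖ₑ := by
        rw [ENNReal.ofReal_tsum_of_nonneg (fun _ => norm_nonneg _) hn]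
        simp only [ofReal_norm]
  · rw [tsum_eq_zero_of_not_summable h]; simp

/-! ### Translates of functions in `ℓ²` -/

/-- The `ℓ²` norm, with values in `[0, ∞]`. -/
def l2norm (f : Site d → ℝ) : ℝ≥0∞ := eLpNorm f 2 Measure.count

lemma l2norm_sq (f : Site d → ℝ) : l2norm f ^ 2 = ∑' x, ‖f x‖ₑ ^ 2 := by
  rw [l2norm, eLpNorm_eq_lintegral_rpow_enorm_toReal (by simp) (by simp), lintegral_count,
    ← ENNReal.rpow_natCast, ← ENNReal.rpow_mul]
  norm_num

lemma l2norm_add_le (f g : Site d → ℝ) : l2norm (fun x => f x + g x) ≤ l2norm f + l2norm g :=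
  eLpNorm_add_le (Measurable.of_discrete).aestronglyMeasurable
    (Measurable.of_discrete).aestronglyMeasurable (by norm_num)

lemma l2norm_neg (f : Site d → ℝ) : l2norm (fun x => -f x) = l2norm f := eLpNorm_neg f 2 _

lemma l2norm_le_of_sq_le {f g : Site d → ℝ} (h : ∑' x, ‖f x‖ₑ ^ 2 ≤ ∑' x, ‖g x‖ₑ ^ 2) :
    l2norm f ≤ l2norm g := by
  rw [← l2norm_sq, ← l2norm_sq] at h
  exact le_of_not_gt fun hlt => absurd h (not_le.2 (ENNReal.pow_lt_pow_left two_ne_zero hlt))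

lemma l2norm_shift (f : Site d → ℝ) (k : Site d) : l2norm (fun x => f (x + k)) = l2norm f :=
  le_antisymm
    (l2norm_le_of_sq_le ((Equiv.addRight k).tsum_eq fun x => ‖f x‖ₑ ^ 2).le)
    (l2norm_le_of_sq_le ((Equiv.addRight k).tsum_eq fun x => ‖f x‖ₑ ^ 2).ge)

/-- The `ℓ¹` norm of a site. -/
def siteL1 (k : Site d) : ℕ := ∑ i, (k i).natAbs

/-- A translation changes a function by at most the length of the translation times its largest
first difference. -/
lemma l2norm_translate_sub_le (f : Site d → ℝ) {B : ℝ≥0∞}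
    (hB : ∀ i : Fin d, l2norm (fun x => f (x + Pi.single i 1) - f x) ≤ B) (k : Site d) :
    l2norm (fun x => f (x + k) - f x) ≤ siteL1 k * B := by
  set q : Site d → ℝ≥0∞ := fun k => l2norm (fun x => f (x + k) - f x) with hq
  have q0 : q 0 = 0 := by simp [hq, l2norm]
  have qadd : ∀ k l, q (k + l) ≤ q k + q l := by
    intro k l
    have e : (fun x => f (x + (k + l)) - f x)
        = fun x => (f (x + l + k) - f (x + l)) + (f (x + l) - f x) := by
      ext x; rw [add_assoc x l k, add_comm l k]; ring
    simp only [hq, e]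
    refine (l2norm_add_le _ _).trans ?_
    rw [l2norm_shift (fun x => f (x + k) - f x) l]
  have qneg : ∀ k, q (-k) = q k := by
    intro k
    simp only [hq]
    rw [← l2norm_shift (fun x => f (x + -k) - f x) k, ← l2norm_neg]
    congr 1; ext x; simp
  have qnat : ∀ (i : Fin d) (m : ℕ), q (Pi.single i (m : ℤ)) ≤ m * B := by
    intro i m
    induction m with
    | zero => simp [q0]
    | succ m ih =>
      have : (Pi.single i ((m + 1 : ℕ) : ℤ) : Site d) = Pi.single i (m : ℤ) + Pi.single i 1 := by
        rw [← Pi.single_add]; simp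
      rw [this]
      refine (qadd _ _).trans ?_
      push_cast
      rw [add_mul, one_mul]
      exact add_le_add ih (hB i)
  have qint : ∀ (i : Fin d) (m : ℤ), q (Pi.single i m) ≤ m.natAbs * B := by
    intro i m
    obtain ⟨n, rfl | rfl⟩ := m.eq_nat_or_neg
    · simpa using qnat i n
    · rw [Pi.single_neg, qneg]; simpa using qnat i n
  have hk : k = ∑ i, Pi.single i (k i) := (Finset.univ_sum_single k).symm
  calc q k = q (∑ i, Pi.single i (k i)) := by rw [← hk]
    _ ≤ ∑ i, q (Pi.single i (k i)) := Finset.le_sum_of_subadditive q q0.le qadd _ _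
    _ ≤ ∑ i, ((k i).natAbs : ℝ≥0∞) * B := Finset.sum_le_sum fun i _ => qint i _
    _ = siteL1 k * B := by rw [siteL1, ← Finset.sum_mul]; push_cast; rfl

/-- The difference of a translate of `f` and `f`. -/
def shiftDiff (k : Site d) (f : Site d → ℝ) : Site d → ℝ := fun x => f (x + k) - f x

lemma shiftDiff_comm (k l : Site d) (f : Site d → ℝ) :
    shiftDiff k (shiftDiff l f) = shiftDiff l (shiftDiff k f) := by
  ext x; simp only [shiftDiff, add_right_comm x k l]; ring

lemma SqSummable.shiftDiff {f : Site d → ℝ} (hf : SqSummable f) (k : Site d) :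
    SqSummable (shiftDiff k f) := (hf.shift k).sub hf

/-- Second differences over long distances are controlled by the Laplacian. -/
lemma l2norm_second_difference_le {ψ : Site d → ℝ} (hψ : SqSummable ψ) (k : Site d) :
    l2norm (fun x => ψ (x + k) + ψ (x - k) - 2 * ψ x)
      ≤ (siteL1 k : ℝ≥0∞) ^ 2 * l2norm (negLap ψ) := by
  have h1 : ∀ i j : Fin d,
      l2norm (shiftDiff (Pi.single j 1) (shiftDiff (Pi.single i 1) ψ)) ≤ l2norm (negLap ψ) := by
    intro i j
    have hs := (hψ.shiftDiff (Pi.single i 1)).shiftDiff (Pi.single j 1)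
    refine l2norm_le_of_sq_le ?_
    rw [← hs.ofReal_tsum, ← hψ.negLap.ofReal_tsum]
    refine ENNReal.ofReal_le_ofReal (le_trans (le_of_eq ?_) (tsum_second_difference_sq_le hψ j i))
    refine tsum_congr fun x => ?_
    simp only [shiftDiff]
    ring
  have h2 : ∀ i : Fin d, l2norm (shiftDiff (Pi.single i 1) (shiftDiff k ψ))
      ≤ siteL1 k * l2norm (negLap ψ) := by
    intro i
    rw [shiftDiff_comm]
    exact l2norm_translate_sub_le (shiftDiff (Pi.single i 1) ψ) (h1 i) k
  have h3 : l2norm (shiftDiff (-k) (shiftDiff k ψ)) ≤ _ :=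
    l2norm_translate_sub_le (shiftDiff k ψ) h2 (-k)
  have e : siteL1 (-k) = siteL1 k := by simp [siteL1]
  rw [e, ← mul_assoc, ← pow_two] at h3
  have e2 : (fun x => ψ (x + k) + ψ (x - k) - 2 * ψ x)
      = fun x => -(shiftDiff (-k) (shiftDiff k ψ) x) := by
    ext x
    simp only [shiftDiff]
    rw [neg_add_cancel_right, sub_eq_add_neg x k]; ring
  rw [e2, l2norm_neg]
  exact h3

lemma siteL1_sq_le (k : Site d) : ((siteL1 k : ℝ)) ^ 2 ≤ d * normSq k := by
  have h := sq_sum_le_card_mul_sum_sq (s := Finset.univ) (f := fun i => ((k i).natAbs : ℝ))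
  simp only [Finset.card_univ, Fintype.card_fin] at h
  refine le_trans (le_of_eq ?_) (h.trans (le_of_eq ?_))
  · simp [siteL1]
  · congr 1
    refine Finset.sum_congr rfl fun i _ => ?_
    rw [Nat.cast_natAbs, Int.cast_abs, sq_abs]

/-! ### Classes of nonnegative kernels -/

/-- Nonnegative kernels on the lattice, with values in `[0, ∞]`. -/
abbrev EKern (d : ℕ) := Site d → Site d → ℝ≥0∞

/-- The entrywise absolute value of a kernel. -/
def eabs (K : Kern d) : EKern d := fun x y => ‖K x y‖ₑ

/-- The product of two nonnegative kernels. -/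
def emul (A B : EKern d) : EKern d := fun x y => ∑' z, A x z * B z y

/-- The transposed kernel. -/
def etransp (A : EKern d) : EKern d := fun x y => A y x

lemma etransp_emul (A B : EKern d) : etransp (emul A B) = emul (etransp B) (etransp A) := by
  ext x y; simp only [etransp, emul, mul_comm]

/-- The rows of the kernel are bounded in `ℓ¹`. -/
def RowSum (A : EKern d) : Prop := ∃ c : ℝ≥0∞, c ≠ ∞ ∧ ∀ x, ∑' y, A x y ≤ c

/-- The rows of the kernel are bounded in `ℓ²`. -/
def RowSq (A : EKern d) : Prop := ∃ c : ℝ≥0∞, c ≠ ∞ ∧ ∀ x, ∑' y, A x y ^ 2 ≤ c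

/-- The kernel satisfies the hypothesis of Schur's test: rows and columns are bounded in `ℓ¹`. -/
def IsSchur (A : EKern d) : Prop := RowSum A ∧ RowSum (etransp A)

/-- The rows and the columns of the kernel are bounded in `ℓ²`. -/
def IsSq (A : EKern d) : Prop := RowSq A ∧ RowSq (etransp A)

/-- The entries of the kernel are bounded. -/
def IsBdd (A : EKern d) : Prop := ∃ c : ℝ≥0∞, c ≠ ∞ ∧ ∀ x y, A x y ≤ c

lemma RowSum.mono {A B : EKern d} (hB : RowSum B) (h : ∀ x y, A x y ≤ B x y) : RowSum A := by
  obtain ⟨c, hc, hb⟩ := hB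
  exact ⟨c, hc, fun x => (ENNReal.tsum_le_tsum (h x)).trans (hb x)⟩

lemma RowSq.mono {A B : EKern d} (hB : RowSq B) (h : ∀ x y, A x y ≤ B x y) : RowSq A := by
  obtain ⟨c, hc, hb⟩ := hB
  exact ⟨c, hc, fun x => (ENNReal.tsum_le_tsum fun y => pow_le_pow_left' (h x y) 2).trans (hb x)⟩

lemma IsSchur.mono {A B : EKern d} (hB : IsSchur B) (h : ∀ x y, A x y ≤ B x y) : IsSchur A :=
  ⟨hB.1.mono h, hB.2.mono fun x y => h y x⟩

lemma IsSq.mono {A B : EKern d} (hB : IsSq B) (h : ∀ x y, A x y ≤ B x y) : IsSq A :=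
  ⟨hB.1.mono h, hB.2.mono fun x y => h y x⟩

lemma IsBdd.mono {A B : EKern d} (hB : IsBdd B) (h : ∀ x y, A x y ≤ B x y) : IsBdd A := by
  obtain ⟨c, hc, hb⟩ := hB
  exact ⟨c, hc, fun x y => (h x y).trans (hb x y)⟩

lemma IsSchur.etransp {A : EKern d} (hA : IsSchur A) : IsSchur (etransp A) := ⟨hA.2, hA.1⟩

lemma IsSq.etransp {A : EKern d} (hA : IsSq A) : IsSq (etransp A) := ⟨hA.2, hA.1⟩

lemma RowSum.emul {A B : EKern d} (hA : RowSum A) (hB : RowSum B) : RowSum (emul A B) := by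
  obtain ⟨a, ha, hA⟩ := hA
  obtain ⟨b, hb, hB⟩ := hB
  refine ⟨a * b, ENNReal.mul_ne_top ha hb, fun x => ?_⟩
  simp only [Renorm.emul]
  rw [ENNReal.tsum_comm]
  simp only [ENNReal.tsum_mul_left]
  calc ∑' z, A x z * ∑' y, B z y ≤ ∑' z, A x z * b :=
        ENNReal.tsum_le_tsum fun z => by gcongr; exact hB z
    _ ≤ a * b := by rw [ENNReal.tsum_mul_right]; gcongr; exact hA x

lemma RowSum.emul_rowSq {A B : EKern d} (hA : RowSum A) (hB : RowSq B) : RowSq (Renorm.emul A B) := by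
  obtain ⟨a, ha, hA⟩ := hA
  obtain ⟨b, hb, hB⟩ := hB
  refine ⟨a * (a * b), ENNReal.mul_ne_top ha (ENNReal.mul_ne_top ha hb), fun x => ?_⟩
  calc ∑' y, Renorm.emul A B x y ^ 2 ≤ ∑' y, a * ∑' z, A x z * B z y ^ 2 := by
        refine ENNReal.tsum_le_tsum fun y => (ennreal_tsum_weighted_sq_le _ _).trans ?_
        gcongr
        exact hA x
    _ = a * ∑' z, A x z * ∑' y, B z y ^ 2 := by
        rw [ENNReal.tsum_mul_left, ENNReal.tsum_comm]
        simp only [ENNReal.tsum_mul_left]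
    _ ≤ a * ∑' z, A x z * b := by gcongr with z; exact hB z
    _ ≤ a * (a * b) := by rw [ENNReal.tsum_mul_right]; gcongr; exact hA x

lemma RowSq.emul_isSchur {A B : EKern d} (hB : RowSq B) (hA : IsSchur A) :
    RowSq (Renorm.emul B A) := by
  obtain ⟨⟨a, ha, hA⟩, ⟨a', ha', hA'⟩⟩ := hA
  obtain ⟨b, hb, hB⟩ := hB
  refine ⟨a' * (b * a), ENNReal.mul_ne_top ha' (ENNReal.mul_ne_top hb ha), fun x => ?_⟩
  calc ∑' y, Renorm.emul B A x y ^ 2 ≤ ∑' y, a' * ∑' z, A z y * B x z ^ 2 := by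
        refine ENNReal.tsum_le_tsum fun y => ?_
        have h := ennreal_tsum_weighted_sq_le (fun z => A z y) (fun z => B x z)
        simp only [Renorm.emul]
        simp only [mul_comm (B x _)]
        refine h.trans ?_
        gcongr
        exact hA' y
    _ = a' * ∑' z, B x z ^ 2 * ∑' y, A z y := by
        rw [ENNReal.tsum_mul_left, ENNReal.tsum_comm]
        simp only [ENNReal.tsum_mul_right, mul_comm]
    _ ≤ a' * ∑' z, B x z ^ 2 * a := by gcongr with z; exact hA z
    _ ≤ a' * (b * a) := by rw [ENNReal.tsum_mul_right]; gcongr; exact hB x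

lemma IsSchur.emul {A B : EKern d} (hA : IsSchur A) (hB : IsSchur B) : IsSchur (Renorm.emul A B) :=
  ⟨hA.1.emul hB.1, by rw [etransp_emul]; exact hB.2.emul hA.2⟩

lemma IsSchur.emul_isSq {A B : EKern d} (hA : IsSchur A) (hB : IsSq B) :
    IsSq (Renorm.emul A B) :=
  ⟨hA.1.emul_rowSq hB.1, by rw [etransp_emul]; exact hB.2.emul_isSchur hA.etransp⟩

lemma IsSq.emul_isSchur {A B : EKern d} (hB : IsSq B) (hA : IsSchur A) :
    IsSq (Renorm.emul B A) :=
  ⟨hB.1.emul_isSchur hA, by rw [etransp_emul]; exact hA.2.emul_rowSq hB.2⟩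

lemma ennreal_le_one_add_sq (x : ℝ≥0∞) : x ≤ 1 + x ^ 2 := by
  rcases le_total x 1 with h | h
  · exact h.trans le_self_add
  · calc x = x * 1 := (mul_one x).symm
      _ ≤ x * x := by gcongr
      _ ≤ 1 + x ^ 2 := by rw [pow_two]; exact le_add_self

lemma IsSq.emul {A B : EKern d} (hA : IsSq A) (hB : IsSq B) : IsBdd (Renorm.emul A B) := by
  obtain ⟨a, ha, hA⟩ := hA.1
  obtain ⟨b, hb, hB⟩ := hB.2
  refine ⟨1 + a * b, by finiteness, fun x y => (ennreal_le_one_add_sq _).trans ?_⟩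
  gcongr
  exact (ennreal_tsum_mul_sq_le _ _).trans (mul_le_mul' (hA x) (hB y))

lemma IsSchur.emul_isBdd {A B : EKern d} (hA : IsSchur A) (hB : IsBdd B) :
    IsBdd (Renorm.emul A B) := by
  obtain ⟨a, ha, hA⟩ := hA.1
  obtain ⟨b, hb, hB⟩ := hB
  refine ⟨a * b, ENNReal.mul_ne_top ha hb, fun x y => ?_⟩
  calc ∑' z, A x z * B z y ≤ ∑' z, A x z * b :=
        ENNReal.tsum_le_tsum fun z => by gcongr; exact hB z y
    _ ≤ a * b := by rw [ENNReal.tsum_mul_right]; gcongr; exact hA x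

lemma IsBdd.emul_isSchur {A B : EKern d} (hA : IsBdd A) (hB : IsSchur B) :
    IsBdd (Renorm.emul A B) := by
  obtain ⟨a, ha, hA⟩ := hA
  obtain ⟨b, hb, hB⟩ := hB.2
  refine ⟨a * b, ENNReal.mul_ne_top ha hb, fun x y => ?_⟩
  calc ∑' z, A x z * B z y ≤ ∑' z, a * B z y :=
        ENNReal.tsum_le_tsum fun z => by gcongr; exact hA x z
    _ ≤ a * b := by rw [ENNReal.tsum_mul_left]; gcongr; exact hB y

lemma IsSq.isBdd {A : EKern d} (hA : IsSq A) : IsBdd A := by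
  obtain ⟨a, ha, hA⟩ := hA.1
  refine ⟨1 + a, by finiteness, fun x y => (ennreal_le_one_add_sq _).trans ?_⟩
  gcongr
  exact (ENNReal.le_tsum y).trans (hA x)

lemma IsSq.sq_isSchur {A : EKern d} (hA : IsSq A) : IsSchur fun x y => A x y ^ 2 := hA

lemma IsBdd.mul_isSchur {A B : EKern d} (hA : IsBdd A) (hB : IsSchur B) :
    IsSchur fun x y => A x y * B x y := by
  obtain ⟨a, ha, hA⟩ := hA
  obtain ⟨⟨b, hb, hB⟩, ⟨b', hb', hB'⟩⟩ := hB
  refine ⟨⟨a * b, ENNReal.mul_ne_top ha hb, fun x => ?_⟩,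
    ⟨a * b', ENNReal.mul_ne_top ha hb', fun x => ?_⟩⟩
  · calc ∑' y, A x y * B x y ≤ ∑' y, a * B x y :=
          ENNReal.tsum_le_tsum fun z => by gcongr; exact hA _ _
      _ ≤ a * b := by rw [ENNReal.tsum_mul_left]; gcongr; exact hB x
  · calc ∑' y, A y x * B y x ≤ ∑' y, a * B y x :=
          ENNReal.tsum_le_tsum fun z => by gcongr; exact hA _ _
      _ ≤ a * b' := by rw [ENNReal.tsum_mul_left]; gcongr; exact hB' x

lemma IsSchur.const_mul {A : EKern d} (hA : IsSchur A) {c : ℝ≥0∞} (hc : c ≠ ∞) :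
    IsSchur fun x y => c * A x y :=
  IsBdd.mul_isSchur (A := fun _ _ => c) ⟨c, hc, fun _ _ => le_rfl⟩ hA

lemma IsSchur.add {A B : EKern d} (hA : IsSchur A) (hB : IsSchur B) :
    IsSchur fun x y => A x y + B x y := by
  obtain ⟨⟨a, ha, hA⟩, ⟨a', ha', hA'⟩⟩ := hA
  obtain ⟨⟨b, hb, hB⟩, ⟨b', hb', hB'⟩⟩ := hB
  refine ⟨⟨a + b, by finiteness, fun x => ?_⟩, ⟨a' + b', by finiteness, fun x => ?_⟩⟩
  · rw [ENNReal.tsum_add]; exact add_le_add (hA x) (hB x)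
  · exact ENNReal.tsum_add.trans_le (add_le_add (hA' x) (hB' x))

lemma IsSq.add {A B : EKern d} (hA : IsSq A) (hB : IsSq B) :
    IsSq fun x y => A x y + B x y := by
  have key : ∀ p q : ℝ≥0∞, (p + q) ^ 2 ≤ 2 * p ^ 2 + 2 * q ^ 2 := by
    intro p q
    by_cases hp : p = ∞
    · simp [hp, ENNReal.mul_top]
    by_cases hq : q = ∞
    · simp [hq, ENNReal.mul_top]
    lift p to NNReal using hp
    lift q to NNReal using hq
    norm_cast
    rw [← NNReal.coe_le_coe]; push_cast
    nlinarith [sq_nonneg ((p : ℝ) - q)]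
  have : ∀ {A B : EKern d}, RowSq A → RowSq B → RowSq fun x y => A x y + B x y := by
    rintro A B ⟨a, ha, hA⟩ ⟨b, hb, hB⟩
    refine ⟨2 * a + 2 * b, by finiteness, fun x => ?_⟩
    refine (ENNReal.tsum_le_tsum fun y => key _ _).trans ?_
    rw [ENNReal.tsum_add, ENNReal.tsum_mul_left, ENNReal.tsum_mul_left]
    gcongr
    · exact hA x
    · exact hB x
  exact ⟨this hA.1 hB.1, this hA.2 hB.2⟩

/-- The nonnegative diagonal kernel with entries `f`. -/
def ediag (f : Site d → ℝ≥0∞) : EKern d := fun x y => if x = y then f x else 0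

lemma isSchur_ediag {f : Site d → ℝ≥0∞} {c : ℝ≥0∞} (hc : c ≠ ∞) (hf : ∀ x, f x ≤ c) :
    IsSchur (ediag f) := by
  refine ⟨⟨c, hc, fun x => ?_⟩, ⟨c, hc, fun x => ?_⟩⟩
  · simp only [ediag]; rw [tsum_eq_single x (fun y hy => by simp [hy.symm])]; simpa using hf x
  · simp only [ediag, etransp]; rw [tsum_eq_single x (fun y hy => by simp [hy])]; simpa using hf x

/-! ### Sums over paths -/

/-- The sum of `|X₀(n,t₀) ⋯ X_s(t_{s-1},n')|` over all paths. -/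
def epath : List (Kern d) → EKern d
  | [] => fun _ _ => 1
  | [K] => eabs K
  | K :: L => emul (eabs K) (epath L)

lemma epath_singleton (K : Kern d) : epath [K] = eabs K := rfl

lemma epath_cons (K : Kern d) {L : List (Kern d)} (hL : L ≠ []) :
    epath (K :: L) = emul (eabs K) (epath L) := by
  cases L with
  | nil => exact absurd rfl hL
  | cons a l => rfl

lemma vertex_cons_succ {s : ℕ} (n n' z : Site d) (t : Fin s → Site d) (j : ℕ) :
    vertex (s := s + 1) n n' (Fin.cons z t) (j + 1) = vertex z n' t j := by
  cases j with
  | zero =>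
    simp only [vertex]
    norm_num
  | succ j =>
    simp only [vertex, Nat.add_sub_cancel]
    by_cases h : j < s
    · rw [if_neg (Nat.succ_ne_zero _), if_neg (Nat.succ_ne_zero _), dif_pos (by omega), dif_pos h]
      have : (⟨j + 1, by omega⟩ : Fin (s + 1)) = Fin.succ ⟨j, h⟩ := rfl
      rw [this, Fin.cons_succ]
    · rw [if_neg (Nat.succ_ne_zero _), if_neg (Nat.succ_ne_zero _), dif_neg (by omega), dif_neg h]

lemma pathWeight_singleton (K : Kern d) (n n' : Site d) (t : Fin ([K].length - 1) → Site d) :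
    pathWeight [K] n n' t = K n n' := by
  simp [pathWeight, vertex]

lemma pathWeight_cons (K K' : Kern d) (L : List (Kern d)) (n n' z : Site d)
    (t : Fin ((K' :: L).length - 1) → Site d) :
    pathWeight (K :: K' :: L) n n' (Fin.cons z t : Fin (L.length + 1) → Site d)
      = K n z * pathWeight (K' :: L) z n' t := by
  refine (Finset.prod_range_succ' (fun j => (K :: K' :: L).getD j 0
    (vertex (s := L.length + 1) n n' (Fin.cons z t) j)
    (vertex (s := L.length + 1) n n' (Fin.cons z t) (j + 1))) (K' :: L).length).trans ?_
  rw [mul_comm, pathWeight]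
  congr 1
  refine Finset.prod_congr rfl fun j _ => ?_
  rw [List.getD_cons_succ]
  exact congrArg₂ _ (vertex_cons_succ n n' z t j) (vertex_cons_succ n n' z t (j + 1))

/-- Splitting off the first vertex of a path. -/
def consPath (K K' : Kern d) (L : List (Kern d)) :
    Site d × (Fin ((K' :: L).length - 1) → Site d) ≃
      (Fin ((K :: K' :: L).length - 1) → Site d) :=
  Fin.consEquiv fun _ : Fin (L.length + 1) => Site d

lemma pathWeight_consPath (K K' : Kern d) (L : List (Kern d)) (n n' : Site d)
    (p : Site d × (Fin ((K' :: L).length - 1) → Site d)) :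
    pathWeight (K :: K' :: L) n n' (consPath K K' L p)
      = K n p.1 * pathWeight (K' :: L) p.1 n' p.2 :=
  pathWeight_cons K K' L n n' p.1 p.2

lemma tsum_enorm_pathWeight : ∀ {L : List (Kern d)}, L ≠ [] → ∀ n n' : Site d,
    ∑' t, ‖pathWeight L n n' t‖ₑ = epath L n n'
  | [], h, _, _ => absurd rfl h
  | [K], _, n, n' => by
    simp only [pathWeight_singleton, epath_singleton, eabs]
    change ∑' _ : Fin 0 → Site d, ‖K n n'‖ₑ = _
    exact tsum_eq_single finZeroElim
      fun b hb => absurd (Subsingleton.elim _ _) hb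
  | K :: K' :: L, _, n, n' => by
    rw [← (consPath K K' L).tsum_eq, epath_cons _ (by simp), emul, ENNReal.tsum_prod']
    refine tsum_congr fun z => ?_
    simp only [pathWeight_consPath, enorm_mul, ENNReal.tsum_mul_left, eabs]
    rw [tsum_enorm_pathWeight (by simp)]

lemma summable_pathWeight {L : List (Kern d)} {n n' : Site d} (h : epath L n n' ≠ ∞)
    (hL : L ≠ []) : Summable fun t => pathWeight L n n' t :=
  summable_of_tsum_enorm_ne_top (by rwa [tsum_enorm_pathWeight hL])

lemma prodConverges_of_isBdd {L : List (Kern d)} (hL : L ≠ []) (h : IsBdd (epath L)) :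
    ProdConverges L := by
  obtain ⟨c, hc, h⟩ := h
  exact fun n n' => summable_pathWeight (ne_top_of_le_ne_top hc (h n n')) hL

lemma enorm_kprod_le {L : List (Kern d)} (hL : L ≠ []) (n n' : Site d) :
    ‖kprod L n n'‖ₑ ≤ epath L n n' := by
  rw [← tsum_enorm_pathWeight hL]; exact enorm_tsum_le _

lemma kprod_singleton (K : Kern d) : kprod [K] = K := by
  ext n n'
  simp only [kprod, pathWeight_singleton]
  change ∑' _ : Fin 0 → Site d, K n n' = _
  exact tsum_eq_single finZeroElim
    fun b hb => absurd (Subsingleton.elim _ _) hb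

lemma kprod_cons (K : Kern d) {L : List (Kern d)} (hL : L ≠ []) {n n' : Site d}
    (h : epath (K :: L) n n' ≠ ∞) : kprod (K :: L) n n' = ∑' z, K n z * kprod L z n' := by
  obtain _ | ⟨K', L⟩ := L
  · exact absurd rfl hL
  have hs := summable_pathWeight h (by simp)
  rw [kprod, ← (consPath K K' L).tsum_eq]
  have hs' := (consPath K K' L).summable_iff.2 hs
  simp only [Function.comp_def, pathWeight_consPath] at hs' ⊢
  rw [hs'.tsum_prod]
  simp only [tsum_mul_left]
  rfl

lemma summable_kprod_cons (K : Kern d) {L : List (Kern d)} (hL : L ≠ []) {n n' : Site d}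
    (h : epath (K :: L) n n' ≠ ∞) : Summable fun z => K n z * kprod L z n' := by
  refine summable_of_tsum_enorm_ne_top (ne_top_of_le_ne_top h ?_)
  rw [epath_cons _ hL]
  refine ENNReal.tsum_le_tsum fun z => ?_
  rw [enorm_mul]
  exact mul_le_mul_right (enorm_kprod_le hL z n') _

/-! ### Operators dominated by the Laplacian -/

/-- `‖X ψ‖ ≤ c ‖Δ ψ‖` for all `ψ ∈ ℓ²`. -/
def IsTame (X : Kern d) : Prop := ∃ c : ℝ≥0∞, c ≠ ∞ ∧ ∀ ψ : Site d → ℝ, SqSummable ψ →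
  ∑' x, ‖∑' y, X x y * ψ y‖ₑ ^ 2 ≤ c * ∑' x, ‖negLap ψ x‖ₑ ^ 2

lemma SqSummable.exists_bound {ψ : Site d → ℝ} (hψ : SqSummable ψ) : ∃ B, ∀ x, |ψ x| ≤ B := by
  refine ⟨1 + ∑' x, ψ x ^ 2, fun x => ?_⟩
  have h := hψ.le_tsum x fun _ _ => sq_nonneg _
  nlinarith [sq_abs (ψ x), sq_nonneg (|ψ x| - 1), abs_nonneg (ψ x)]

lemma ennreal_add_sq_le (p q : ℝ≥0∞) : (p + q) ^ 2 ≤ 2 * p ^ 2 + 2 * q ^ 2 := by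
  by_cases hp : p = ∞
  · simp [hp, ENNReal.mul_top]
  by_cases hq : q = ∞
  · simp [hq, ENNReal.mul_top]
  lift p to NNReal using hp
  lift q to NNReal using hq
  norm_cast
  rw [← NNReal.coe_le_coe]; push_cast
  nlinarith [sq_nonneg ((p : ℝ) - q)]

/-- Summing by parts against an even function of total mass zero leaves second differences. -/
lemma tsum_even_mul {m ψ : Site d → ℝ} (hm : Summable m) (heven : ∀ k, m (-k) = m k)
    (hzero : ∑' k, m k = 0) {B : ℝ} (hψ : ∀ x, |ψ x| ≤ B) (x : Site d) :
    ∑' k, m k * ψ (x + k) = ∑' k, 1 / 2 * (m k * (ψ (x + k) + ψ (x - k) - 2 * ψ x)) := by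
  have hs : ∀ f : Site d → ℝ, (∀ k, |f k| ≤ B) → Summable fun k => m k * f k := by
    intro f hf
    refine Summable.of_norm_bounded (hm.norm.mul_right B) fun k => ?_
    rw [norm_mul]
    exact mul_le_mul_of_nonneg_left (hf k) (norm_nonneg _)
  have h1 := hs (fun k => ψ (x + k)) fun k => hψ _
  have h2 := hs (fun k => ψ (x - k)) fun k => hψ _
  have h3 := hs (fun _ => ψ x) fun k => hψ _
  have e2 : ∑' k, m k * ψ (x - k) = ∑' k, m k * ψ (x + k) := by
    rw [← (Equiv.neg (Site d)).tsum_eq]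
    refine tsum_congr fun k => ?_
    simp [heven]
  have e3 : ∑' k, m k * ψ x = 0 := by rw [tsum_mul_right, hzero, zero_mul]
  have : ∑' k, 1 / 2 * (m k * (ψ (x + k) + ψ (x - k) - 2 * ψ x))
      = ∑' k, (1 / 2 * (m k * ψ (x + k)) + 1 / 2 * (m k * ψ (x - k)) - m k * ψ x) :=
    tsum_congr fun k => by ring
  rw [this, Summable.tsum_sub ((h1.mul_left _).add (h2.mul_left _)) h3,
    Summable.tsum_add (h1.mul_left _) (h2.mul_left _), tsum_mul_left, tsum_mul_left, e2, e3]
  ring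

/-- A convolution with an even function of mass zero and finite second moment is dominated by
the Laplacian; so is, by Rellich's inequality, an operator whose entries decay like
`weight x = O(|x|⁻²)`. -/
lemma isTame_of_decomposition (hd : 5 ≤ d) {X : Kern d} (B m : Site d → ℝ) (E : Kern d)
    (e : Site d → ℝ≥0∞) {b : ℝ≥0∞} (hb : b ≠ ∞)
    (hX : ∀ x k, X x (x + k) = B x * m k + E x k) (hB : ∀ x, ‖B x‖ₑ ≤ b)
    (heven : ∀ k, m (-k) = m k) (hzero : ∑' k, m k = 0)
    (hmom : ∑' k, ‖m k‖ₑ * ENNReal.ofReal (1 + normSq k) ≠ ∞)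
    (hE : ∀ x k, ‖E x k‖ₑ ≤ e k * ‖weight x‖ₑ) (he : ∑' k, e k ≠ ∞) : IsTame X := by
  have hm : Summable m := by
    refine summable_of_tsum_enorm_ne_top (ne_top_of_le_ne_top hmom
      (ENNReal.tsum_le_tsum fun k => ?_))
    refine le_mul_of_one_le_right' ?_
    rw [← ENNReal.ofReal_one]
    exact ENNReal.ofReal_le_ofReal (by linarith [normSq_nonneg k])
  refine ⟨2 * (b ^ 2 * (∑' k, ‖m k‖ₑ * ((d : ℝ≥0∞) * ENNReal.ofReal (1 + normSq k))) ^ 2)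
    + 2 * ((∑' k, e k * 4) ^ 2), ?_, fun ψ hψ => ?_⟩
  · have h1 : ∑' k, ‖m k‖ₑ * ((d : ℝ≥0∞) * ENNReal.ofReal (1 + normSq k)) ≠ ∞ := by
      have : ∀ k, ‖m k‖ₑ * ((d : ℝ≥0∞) * ENNReal.ofReal (1 + normSq k))
          = d * (‖m k‖ₑ * ENNReal.ofReal (1 + normSq k)) := fun k => by ring
      simp only [this, ENNReal.tsum_mul_left]
      exact ENNReal.mul_ne_top (by simp) hmom
    have h2 : ∑' k, e k * 4 ≠ ∞ := by
      rw [ENNReal.tsum_mul_right]; exact ENNReal.mul_ne_top he (by simp)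
    finiteness
  obtain ⟨Bψ, hBψ⟩ := hψ.exists_bound
  set Y := ∑' x, ‖negLap ψ x‖ₑ ^ 2 with hY
  -- the second differences of `ψ` that the mass zero of `m` leaves, and the remainder for Rellich's
  -- inequality with centre `k`
  set D : Site d → Site d → ℝ := fun k x => ψ (x + k) + ψ (x - k) - 2 * ψ x with hD
  set R : Site d → Site d → ℝ := fun k x => weight x * ψ (x + k) with hR
  -- pointwise bound
  have hpt : ∀ x, ‖∑' y, X x y * ψ y‖ₑ
      ≤ b * (∑' k, ‖m k‖ₑ * ‖D k x‖ₑ) + ∑' k, e k * ‖R k x‖ₑ := by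
    intro x
    have hEs : Summable fun k => E x k * ψ (x + k) := by
      have hE1 : Summable (E x) := by
        refine summable_of_tsum_enorm_ne_top (ne_top_of_le_ne_top
          (ENNReal.mul_ne_top he (enorm_ne_top (x := weight x))) ?_)
        rw [← ENNReal.tsum_mul_right]
        exact ENNReal.tsum_le_tsum (hE x)
      refine Summable.of_norm_bounded (hE1.norm.mul_right Bψ) fun k => ?_
      rw [norm_mul]
      exact mul_le_mul_of_nonneg_left (hBψ _) (norm_nonneg _)
    have hms : Summable fun k => m k * ψ (x + k) := by
      refine Summable.of_norm_bounded (hm.norm.mul_right Bψ) fun k => ?_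
      rw [norm_mul]
      exact mul_le_mul_of_nonneg_left (hBψ _) (norm_nonneg _)
    have e1 : ∑' y, X x y * ψ y
        = B x * (∑' k, m k * ψ (x + k)) + ∑' k, E x k * ψ (x + k) := by
      rw [← (Equiv.addLeft x).tsum_eq, ← tsum_mul_left, ← (hms.mul_left _).tsum_add hEs]
      refine tsum_congr fun k => ?_
      simp only [Equiv.coe_addLeft, hX]; ring
    rw [e1, tsum_even_mul hm heven hzero hBψ]
    refine (enorm_add_le _ _).trans (add_le_add ?_ ?_)
    · rw [enorm_mul]
      refine mul_le_mul' (hB x) ((enorm_tsum_le _).trans (ENNReal.tsum_le_tsum fun k => ?_))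
      rw [enorm_mul, enorm_mul]
      refine mul_le_of_le_one_left' ?_
      rw [← ofReal_norm, ← ENNReal.ofReal_one]
      exact ENNReal.ofReal_le_ofReal (by norm_num)
    · refine (enorm_tsum_le _).trans (ENNReal.tsum_le_tsum fun k => ?_)
      rw [enorm_mul, hR, enorm_mul, ← mul_assoc]
      exact mul_le_mul' (hE x k) le_rfl
  have hDk : ∀ k, ∑' x, ‖D k x‖ₑ ^ 2
      ≤ ((d : ℝ≥0∞) * ENNReal.ofReal (1 + normSq k)) ^ 2 * Y := by
    intro k
    have h := pow_le_pow_left' (l2norm_second_difference_le hψ k) 2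
    rw [l2norm_sq, mul_pow, l2norm_sq] at h
    refine h.trans ?_
    gcongr
    have h1 : ((siteL1 k : ℝ≥0∞)) ^ 2 = ENNReal.ofReal ((siteL1 k : ℝ) ^ 2) := by
      rw [ENNReal.ofReal_pow (by positivity), ENNReal.ofReal_natCast]
    rw [h1, ← ENNReal.ofReal_natCast d, ← ENNReal.ofReal_mul (by positivity)]
    refine ENNReal.ofReal_le_ofReal ((siteL1_sq_le k).trans ?_)
    gcongr
    linarith
  have hRk : ∀ k, ∑' x, ‖R k x‖ₑ ^ 2 ≤ (4 : ℝ≥0∞) ^ 2 * Y := by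
    intro k
    have h := rellich hd hψ k
    have hs : SqSummable (fun x => weight (x - k) * ψ x) := hψ.mul_bounded (C := 1) fun x => by
      rw [abs_of_pos (weight_pos _)]; exact weight_le_one _
    have e1 : ∑' x, ‖R k x‖ₑ ^ 2 = ∑' x, ‖weight (x - k) * ψ x‖ₑ ^ 2 := by
      rw [← (Equiv.addRight k).tsum_eq fun x => ‖weight (x - k) * ψ x‖ₑ ^ 2]
      simp [hR]
    rw [e1, ← hs.ofReal_tsum, hY, ← hψ.negLap.ofReal_tsum]
    refine (ENNReal.ofReal_le_ofReal h).trans (le_of_eq ?_)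
    rw [ENNReal.ofReal_mul (by norm_num)]
    norm_num
  calc ∑' x, ‖∑' y, X x y * ψ y‖ₑ ^ 2
      ≤ ∑' x, (2 * (b ^ 2 * (∑' k, ‖m k‖ₑ * ‖D k x‖ₑ) ^ 2) + 2 * (∑' k, e k * ‖R k x‖ₑ) ^ 2) := by
        refine ENNReal.tsum_le_tsum fun x => ?_
        rw [← mul_pow]
        exact (pow_le_pow_left' (hpt x) 2).trans (ennreal_add_sq_le _ _)
    _ = 2 * (b ^ 2 * ∑' x, (∑' k, ‖m k‖ₑ * ‖D k x‖ₑ) ^ 2)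
        + 2 * ∑' x, (∑' k, e k * ‖R k x‖ₑ) ^ 2 := by
        rw [ENNReal.tsum_add]; simp only [ENNReal.tsum_mul_left]
    _ ≤ 2 * (b ^ 2 * ((∑' k, ‖m k‖ₑ * ((d : ℝ≥0∞) * ENNReal.ofReal (1 + normSq k))) ^ 2 * Y))
        + 2 * ((∑' k, e k * 4) ^ 2 * Y) := by
        gcongr
        · refine ennreal_tsum_superposition_sq_le _ _ (fun k x => ‖D k x‖ₑ) (fun k => ?_)
            (fun k => ?_) hDk
          · refine mul_ne_zero (by simp; omega) ?_
            rw [Ne, ENNReal.ofReal_eq_zero, not_le]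
            linarith [normSq_nonneg k]
          · finiteness
        · exact ennreal_tsum_superposition_sq_le _ (fun _ => 4) (fun k x => ‖R k x‖ₑ)
            (fun k => by simp) (fun k => by simp) hRk
    _ = _ := by ring

/-! ### The Green's function as a kernel -/

lemma isSq_of_translation {f : Site d → ℝ} (hf : SqSummable f) {K : Kern d}
    (hK : ∀ x y, K x y = f (x - y)) : IsSq (eabs K) := by
  refine ⟨⟨_, hf.tsum_ne_top, fun x => ?_⟩, ⟨_, hf.tsum_ne_top, fun x => ?_⟩⟩
  · simp only [eabs, hK]
    exact ((Equiv.subLeft x).tsum_eq fun z => ‖f z‖ₑ ^ 2).le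
  · simp only [eabs, hK, etransp]
    exact ((Equiv.subRight x).tsum_eq fun z => ‖f z‖ₑ ^ 2).le

lemma isSq_G0 (hd : 5 ≤ d) : IsSq (eabs (G0 d)) :=
  isSq_of_translation (summable_green_sq hd) G0_eq_green

lemma isSq_Gt (hd : 5 ≤ d) : IsSq (eabs (Gt d)) :=
  isSq_of_translation (summable_greenT_sq hd) Gt_eq_greenT

lemma transp_G0 : transp (G0 d) = G0 d := by ext x y; exact G0_comm y x

lemma Gt_comm (x y : Site d) : Gt d x y = Gt d y x := by
  rw [Gt_eq_greenT, Gt_eq_greenT, ← greenT_neg, neg_sub]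

lemma transp_Gt : transp (Gt d) = Gt d := by ext x y; exact Gt_comm y x

lemma negLap_G0 (hd : 5 ≤ d) (x y : Site d) :
    negLap (fun w => G0 d w y) x = if x = y then 1 else 0 := by
  have h : (fun w => G0 d w y) = fun w => green d (w - y) := by ext w; exact G0_eq_green w y
  rw [h, negLap_comp_sub, negLap_green hd]
  simp [sub_eq_zero]

lemma negLap_sum_green (hd : 5 ≤ d) (s : Finset (Site d)) (φ : Site d → ℝ) (x : Site d) :
    negLap (fun w => ∑ y ∈ s, φ y * G0 d w y) x = if x ∈ s then φ x else 0 := by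
  have h2 : negLap (fun w => ∑ y ∈ s, φ y * G0 d w y) x
      = ∑ y ∈ s, φ y * negLap (fun w => G0 d w y) x := by
    classical
    induction s using Finset.induction_on with
    | empty => simp [negLap]
    | insert a s ha ih =>
      simp only [Finset.sum_insert ha]
      rw [negLap_add, negLap_const_mul, ih]
  rw [h2]
  simp [negLap_G0 hd]

/-- If `X` is dominated by the Laplacian, the rows of `G₀ X G₀` are bounded in `ℓ²`: a row is tested
against its own restriction `φ` to a finite set, and `X` is applied to `ψ = G₀ φ`, whose Laplacian
is `-φ`. -/
lemma IsTame.rowSq (hd : 5 ≤ d) {X : Kern d} (hX : IsTame X) (hS : IsSchur (eabs X)) :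
    RowSq (eabs (kprod [G0 d, X, G0 d])) := by
  obtain ⟨c, hc, hX⟩ := hX
  obtain ⟨Γ, hΓ, hg⟩ := (isSq_G0 hd).1
  have hXg : IsSq (epath [X, G0 d]) := by
    rw [epath_cons _ (by simp)]; exact hS.emul_isSq (isSq_G0 hd)
  have hXgb := hXg.isBdd
  have hgXg : IsBdd (epath [G0 d, X, G0 d]) := by
    rw [epath_cons _ (by simp)]; exact (isSq_G0 hd).emul hXg
  obtain ⟨c1, hc1, hXgb⟩ := hXgb
  obtain ⟨c2, hc2, hgXg⟩ := hgXg
  refine ⟨Γ * c, ENNReal.mul_ne_top hΓ hc, fun x => ?_⟩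
  set K := kprod [G0 d, X, G0 d] with hK
  rw [ENNReal.tsum_eq_iSup_sum]
  refine iSup_le fun s => ?_
  set φ : Site d → ℝ := K x with hφ
  set ψ : Site d → ℝ := fun w => ∑ y ∈ s, φ y * G0 d w y with hψ
  have hψs : SqSummable ψ := SqSummable.sum s fun y _ => by
    have h : SqSummable fun w => G0 d w y := by
      have := SqSummable.shift_sub (summable_green_sq hd) y
      exact this.congr fun w => by simp only [G0_eq_green]
    exact h.const_mul _
  have hXψ : ∀ z, ∑' w, X z w * ψ w = ∑ y ∈ s, φ y * kprod [X, G0 d] z y := by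
    intro z
    have hsum : ∀ y, Summable fun w => X z w * kprod [G0 d] w y := fun y =>
      summable_kprod_cons X (by simp) (ne_top_of_le_ne_top hc1 (hXgb z y))
    simp only [kprod_singleton] at hsum
    have : ∀ w, X z w * ψ w = ∑ y ∈ s, φ y * (X z w * G0 d w y) := fun w => by
      rw [hψ, Finset.mul_sum]; exact Finset.sum_congr rfl fun y _ => by ring
    simp only [this]
    rw [Summable.tsum_finsetSum fun y _ => (hsum y).mul_left _]
    refine Finset.sum_congr rfl fun y _ => ?_
    rw [tsum_mul_left, kprod_cons X (by simp) (ne_top_of_le_ne_top hc1 (hXgb z y)),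
      kprod_singleton]
  have hKx : ∑ y ∈ s, φ y * K x y = ∑' z, G0 d x z * ∑' w, X z w * ψ w := by
    have hsum : ∀ y, Summable fun z => G0 d x z * kprod [X, G0 d] z y := fun y =>
      summable_kprod_cons _ (by simp) (ne_top_of_le_ne_top hc2 (hgXg x y))
    simp only [hXψ]
    have : ∀ z, G0 d x z * ∑ y ∈ s, φ y * kprod [X, G0 d] z y
        = ∑ y ∈ s, φ y * (G0 d x z * kprod [X, G0 d] z y) := fun z => by
      rw [Finset.mul_sum]; exact Finset.sum_congr rfl fun y _ => by ring
    simp only [this]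
    rw [Summable.tsum_finsetSum fun y _ => (hsum y).mul_left _]
    refine Finset.sum_congr rfl fun y _ => ?_
    rw [tsum_mul_left, hK, kprod_cons (G0 d) (by simp) (ne_top_of_le_ne_top hc2 (hgXg x y))]
  set N : ℝ≥0∞ := ∑ y ∈ s, ‖K x y‖ₑ ^ 2 with hN
  have hNeq : ‖∑ y ∈ s, φ y * K x y‖ₑ = N := by
    rw [hN, hφ, ← ofReal_norm, Real.norm_of_nonneg
      (Finset.sum_nonneg fun y _ => mul_self_nonneg _), ENNReal.ofReal_sum_of_nonneg
        fun y _ => mul_self_nonneg _]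
    exact Finset.sum_congr rfl fun y _ => by rw [enorm_sq_eq, pow_two]
  have hneg : ∑' w, ‖negLap ψ w‖ₑ ^ 2 = N := by
    rw [tsum_eq_sum (s := s)]
    · refine Finset.sum_congr rfl fun y hy => ?_
      rw [negLap_sum_green hd, if_pos hy]
    · intro w hw
      rw [negLap_sum_green hd, if_neg hw]; simp
  -- `N = (G₀ X ψ) x` and `‖Δ ψ‖² = N`, so the Cauchy–Schwarz inequality bounds `N ^ 2` by `N`
  have hle : N ^ 2 ≤ Γ * c * N := by
    calc N ^ 2 = ‖∑' z, G0 d x z * ∑' w, X z w * ψ w‖ₑ ^ 2 := by rw [← hNeq, hKx]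
      _ ≤ (∑' z, ‖G0 d x z‖ₑ * ‖∑' w, X z w * ψ w‖ₑ) ^ 2 := by
        gcongr
        refine (enorm_tsum_le _).trans (le_of_eq ?_)
        simp only [enorm_mul]
      _ ≤ (∑' z, ‖G0 d x z‖ₑ ^ 2) * ∑' z, ‖∑' w, X z w * ψ w‖ₑ ^ 2 :=
        ennreal_tsum_mul_sq_le _ _
      _ ≤ Γ * (c * N) := by
        gcongr
        · exact hg x
        · rw [← hneg]; exact hX ψ hψs
      _ = Γ * c * N := by ring
  change N ≤ Γ * c
  by_cases hN0 : N = 0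
  · rw [hN0]; exact zero_le
  have hNt : N ≠ ∞ := by
    rw [hN]; exact (ENNReal.sum_lt_top.2 fun y _ => by simp).ne
  rw [pow_two] at hle
  exact (ENNReal.mul_le_mul_iff_left hN0 hNt).1 hle

/-! ### Differences of the squared potential -/

lemma one_le_siteNorm (x : Site d) : 1 ≤ siteNorm x := le_max_right _ _

lemma abs_siteNorm_add_sub_le (x k : Site d) : |siteNorm (x + k) - siteNorm x| ≤ ‖k‖ := by
  refine (abs_max_sub_max_le_abs _ _ _).trans ?_
  simpa using abs_norm_sub_norm_le (x + k) x

lemma norm_sq_le_normSq (k : Site d) : ‖k‖ ^ 2 ≤ normSq k := by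
  have h : ‖k‖ ≤ √(normSq k) := (pi_norm_le_iff_of_nonneg (Real.sqrt_nonneg _)).2 fun i => by
    rw [Int.norm_eq_abs]
    exact Real.abs_le_sqrt (sq_le_normSq k i)
  calc ‖k‖ ^ 2 ≤ √(normSq k) ^ 2 := by gcongr
    _ = normSq k := Real.sq_sqrt (normSq_nonneg k)

lemma normSq_le_siteNorm_sq (x : Site d) : normSq x ≤ d * siteNorm x ^ 2 := by
  have : ∀ i, (x i : ℝ) ^ 2 ≤ siteNorm x ^ 2 := by
    intro i
    rw [← sq_abs, ← Int.norm_eq_abs]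
    exact pow_le_pow_left₀ (norm_nonneg _) ((norm_le_pi_norm x i).trans (le_max_left _ _)) 2
  calc normSq x ≤ ∑ _i : Fin d, siteNorm x ^ 2 := Finset.sum_le_sum fun i _ => this i
    _ = d * siteNorm x ^ 2 := by simp

lemma siteNorm_inv_sq_le_weight (x : Site d) :
    (siteNorm x ^ 2)⁻¹ ≤ (35 + d) * weight x := by
  have h1 := one_le_siteNorm x
  have h2 := normSq_le_siteNorm_sq x
  have h3 := normSq_nonneg x
  have h4 : (0 : ℝ) < siteNorm x ^ 2 := by positivity
  rw [weight, inv_le_iff_one_le_mul₀ h4]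
  have h5 : 0 < 35 + normSq x := by linarith
  rw [mul_assoc, mul_comm, mul_assoc, inv_mul_eq_div, one_le_div h5]
  nlinarith

lemma abs_rpow_neg_sub_le {β a b c : ℝ} (hβ : 0 ≤ β) (hc : 0 < c) (ha : c ≤ a) (hb : c ≤ b) :
    |a ^ (-β) - b ^ (-β)| ≤ β * c ^ (-β - 1) * |a - b| := by
  have := Convex.norm_image_sub_le_of_norm_hasDerivWithin_le (f := fun t : ℝ => t ^ (-β))
    (f' := fun t => -β * t ^ (-β - 1)) (C := β * c ^ (-β - 1)) (s := Set.Ici c) (x := b) (y := a)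
    (fun t ht => ((Real.hasDerivAt_rpow_const (Or.inl (hc.trans_le ht).ne')).hasDerivWithinAt))
    (fun t ht => by
      rw [norm_mul, norm_neg, Real.norm_of_nonneg hβ,
        Real.norm_of_nonneg (Real.rpow_nonneg (hc.trans_le ht).le _)]
      exact mul_le_mul_of_nonneg_left (Real.rpow_le_rpow_of_nonpos hc ht (by linarith)) hβ) (convex_Ici c) hb ha
  simpa using this

lemma v_nonneg {α κ : ℝ} (hκ : 0 ≤ κ) (x : Site d) : 0 ≤ v α κ x :=
  mul_nonneg hκ (Real.rpow_nonneg (zero_le_one.trans (one_le_siteNorm x)) _)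

lemma v_le {α κ : ℝ} (hα : 0 ≤ α) (hκ : 0 ≤ κ) (x : Site d) : v α κ x ≤ κ :=
  mul_le_of_le_one_right hκ (Real.rpow_le_one_of_one_le_of_nonpos (one_le_siteNorm x) (by linarith))

lemma abs_v_le {α κ : ℝ} (hα : 0 ≤ α) (hκ : 0 ≤ κ) (x : Site d) : |v α κ x| ≤ κ := by
  rw [abs_of_nonneg (v_nonneg hκ x)]; exact v_le hα hκ x

lemma v_sq (α κ : ℝ) (x : Site d) : v α κ x ^ 2 = κ ^ 2 * siteNorm x ^ (-(2 * α)) := by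
  rw [v, mul_pow, ← Real.rpow_natCast (siteNorm x ^ (-α)), ← Real.rpow_mul
    (zero_le_one.trans (one_le_siteNorm x))]
  congr 2; push_cast; ring

/-- As `4α > 1`, the first differences of `v²` decay, after multiplication by `v²`, like
`|x|⁻²`. -/
lemma abs_v_sq_difference_le {α κ : ℝ} (hα : 1 / 4 < α) : ∃ c, 0 ≤ c ∧ ∀ x k : Site d,
    |v α κ x ^ 2 * (v α κ (x + k) ^ 2 - v α κ x ^ 2)| ≤ c * (1 + normSq k) * weight x := by
  set β := 2 * α with hβ
  set A : ℝ := β * 2 ^ (β + 1) with hA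
  have hA0 : 0 ≤ A := by positivity
  refine ⟨κ ^ 4 * (4 + A) * (35 + d), by positivity, fun x k => ?_⟩
  set r := siteNorm x with hr
  set r' := siteNorm (x + k) with hr'
  have h1 : 1 ≤ r := one_le_siteNorm x
  have h1' : 1 ≤ r' := one_le_siteNorm _
  have hk : |r' - r| ≤ ‖k‖ := abs_siteNorm_add_sub_le x k
  have hkn := norm_sq_le_normSq k
  have hw := siteNorm_inv_sq_le_weight x
  have hrβ : r ^ (-β) ≤ 1 := Real.rpow_le_one_of_one_le_of_nonpos h1 (by linarith)
  have hrβ' : r' ^ (-β) ≤ 1 := Real.rpow_le_one_of_one_le_of_nonpos h1' (by linarith)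
  have hp : 0 ≤ r ^ (-β) := Real.rpow_nonneg (by linarith) _
  have hp' : 0 ≤ r' ^ (-β) := Real.rpow_nonneg (by linarith) _
  have key : r ^ (-β) * |r' ^ (-β) - r ^ (-β)| ≤ (4 + A) * (1 + normSq k) * (r ^ 2)⁻¹ := by
    have hr2 : (0 : ℝ) < r ^ 2 := by positivity
    rw [← div_eq_mul_inv, le_div_iff₀ hr2]
    by_cases hc : r / 2 ≤ ‖k‖
    · have e1 : r ^ (-β) * |r' ^ (-β) - r ^ (-β)| ≤ 1 := by
        refine mul_le_one₀ hrβ (abs_nonneg _) (abs_le.2 ⟨by linarith, by linarith⟩)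
      have e2 : r ^ 2 ≤ 4 * normSq k := by nlinarith
      nlinarith [normSq_nonneg k, mul_nonneg hA0 (normSq_nonneg k)]
    · push Not at hc
      have hmin : r / 2 ≤ r' := by have := (abs_le.1 hk).1; linarith
      have e1 := abs_rpow_neg_sub_le (β := β) (by linarith) (by linarith : 0 < r / 2) hmin
        (by linarith : r / 2 ≤ r)
      have e2 : (r / 2) ^ (-β - 1) = 2 ^ (β + 1) * r ^ (-β - 1) := by
        rw [Real.div_rpow (by linarith) (by norm_num), div_eq_mul_inv, ← Real.rpow_neg (by norm_num)]
        rw [mul_comm]; congr 2; ring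
      have e3 : r ^ (-β) * r ^ (-β - 1) * r ^ 2 ≤ 1 := by
        rw [← Real.rpow_natCast r 2, ← Real.rpow_add (by linarith), ← Real.rpow_add (by linarith)]
        refine Real.rpow_le_one_of_one_le_of_nonpos h1 ?_
        push_cast; linarith
      have e4 : ‖k‖ ≤ 1 + normSq k := by nlinarith [sq_nonneg (‖k‖ - 1)]
      calc r ^ (-β) * |r' ^ (-β) - r ^ (-β)| * r ^ 2
          ≤ r ^ (-β) * (β * (2 ^ (β + 1) * r ^ (-β - 1)) * ‖k‖) * r ^ 2 := by
            rw [← e2]; gcongr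
            exact e1.trans (by gcongr)
        _ = A * ‖k‖ * (r ^ (-β) * r ^ (-β - 1) * r ^ 2) := by rw [hA]; ring
        _ ≤ A * ‖k‖ * 1 := by gcongr
        _ ≤ (4 + A) * (1 + normSq k) := by nlinarith [norm_nonneg k, normSq_nonneg k]
  have e0 : |v α κ x ^ 2 * (v α κ (x + k) ^ 2 - v α κ x ^ 2)|
      = κ ^ 4 * (r ^ (-β) * |r' ^ (-β) - r ^ (-β)|) := by
    rw [v_sq, v_sq, ← mul_sub, abs_mul, abs_mul, abs_mul, abs_of_nonneg (sq_nonneg κ),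
      abs_of_nonneg hp]
    ring
  rw [e0]
  calc κ ^ 4 * (r ^ (-β) * |r' ^ (-β) - r ^ (-β)|)
      ≤ κ ^ 4 * ((4 + A) * (1 + normSq k) * (r ^ 2)⁻¹) := by gcongr
    _ ≤ κ ^ 4 * ((4 + A) * (1 + normSq k) * ((35 + d) * weight x)) := by
        have := normSq_nonneg k
        gcongr
    _ = _ := by ring

/-! ### Moments of the renormalized kernels -/

/-- The convolution kernel of `M`. -/
def mFun (d : ℕ) (k : Site d) : ℝ := greenT d k ^ 3 - if k = 0 then sigma d ^ 3 - rho d else 0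

/-- The convolution kernel to which `C` reduces when `v` is constant equal to `1`. -/
def cFun (d : ℕ) (k : Site d) : ℝ := greenT d k * greenConv d k - if k = 0 then eta d else 0

lemma M_eq_mFun (x y : Site d) : M d x y = mFun d (y - x) := by
  simp only [M, M4, mFun, Gt_comm x y, Gt_eq_greenT, sub_eq_zero, eq_comm (a := x)]

lemma Gt_eq_greenT_sub (x y : Site d) : Gt d x y = greenT d (y - x) := by
  rw [Gt_comm, Gt_eq_greenT]

lemma mFun_neg (k : Site d) : mFun d (-k) = mFun d k := by simp [mFun, greenT_neg]

lemma M_comm (x y : Site d) : M d x y = M d y x := by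
  rw [M_eq_mFun, M_eq_mFun, ← mFun_neg, neg_sub]

lemma greenConv_neg (k : Site d) : greenConv d (-k) = greenConv d k := by
  rw [greenConv, ← (Equiv.neg (Site d)).tsum_eq]
  refine tsum_congr fun m => ?_
  simp only [Equiv.neg_apply, greenT_neg]
  rw [← greenT_neg (-k - -m)]
  congr 3; abel

lemma cFun_neg (k : Site d) : cFun d (-k) = cFun d k := by simp [cFun, greenT_neg, greenConv_neg]

/-- The constant `ρ` is what makes the total mass of the kernel `M` vanish. -/
lemma tsum_mFun (hd : 5 ≤ d) : ∑' k, mFun d k = 0 := by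
  have h := (hasSum_greenT_cube hd).sub (hasSum_ite_eq (0 : Site d) (sigma d ^ 3 - rho d))
  rw [sub_self] at h
  exact h.tsum_eq

/-- The constant `η` is what makes the total mass of the kernel of `C` vanish. -/
lemma tsum_cFun (hd : 5 ≤ d) : ∑' k, cFun d k = 0 := by
  have h := (hasSum_eta hd).sub (hasSum_ite_eq (0 : Site d) (eta d))
  rw [sub_self] at h
  exact h.tsum_eq

/-- The weight `1 + |k|²` with values in `[0, ∞]`. -/
def eWt (k : Site d) : ℝ≥0∞ := ENNReal.ofReal (1 + normSq k)

lemma enorm_greenT_mul_eWt_le (hd : 5 ≤ d) (k : Site d) :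
    ‖greenT d k‖ₑ * eWt k ≤ 2450 := by
  have h2 := normSq_nonneg k
  have h : ‖greenT d k‖ * (1 + normSq k) ≤ 2450 := by
    rw [Real.norm_eq_abs]
    have h1 := (abs_greenT_le k).trans (abs_green_le hd k)
    have h3 : weight k * (35 + normSq k) = 1 := inv_mul_cancel₀ (by linarith)
    have := mul_le_mul_of_nonneg_right h1 h2
    nlinarith [weight_pos k]
  rw [← ofReal_norm, eWt, ← ENNReal.ofReal_mul (norm_nonneg _)]
  refine (ENNReal.ofReal_le_ofReal h).trans (by norm_num)

lemma tsum_enorm_greenT_sq_ne_top (hd : 5 ≤ d) : ∑' k, ‖greenT d k‖ₑ ^ 2 ≠ ∞ :=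
  SqSummable.tsum_ne_top (summable_greenT_sq hd)

lemma tsum_tsum_greenT_sq (d : ℕ) : ∑' k, ∑' p, ‖greenT d p‖ₑ ^ 2 * ‖greenT d (k - p)‖ₑ ^ 2
    = (∑' k, ‖greenT d k‖ₑ ^ 2) * ∑' k, ‖greenT d k‖ₑ ^ 2 := by
  rw [ENNReal.tsum_comm, ← ENNReal.tsum_mul_right]
  refine tsum_congr fun p => ?_
  rw [ENNReal.tsum_mul_left]
  congr 1
  exact (Equiv.subRight p).tsum_eq fun k => ‖greenT d k‖ₑ ^ 2

lemma tsum_tsum_greenT_triangle_ne_top (hd : 5 ≤ d) :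
    ∑' k, ∑' p, ‖greenT d k‖ₑ * (‖greenT d p‖ₑ * ‖greenT d (k - p)‖ₑ ^ 2) ≠ ∞ := by
  obtain ⟨c, hc, h⟩ := (isSq_Gt hd).emul ((isSq_Gt hd).sq_isSchur.emul_isSq (isSq_Gt hd))
  refine ne_top_of_le_ne_top hc (le_trans (le_of_eq ?_) (h 0 0))
  simp only [emul, eabs, Gt_eq_greenT, sub_zero, zero_sub, greenT_neg, ENNReal.tsum_mul_left,
    mul_comm]

lemma tsum_enorm_ite_mul_eWt (a : ℝ) :
    ∑' k : Site d, ‖(if k = 0 then a else 0 : ℝ)‖ₑ * eWt k ≠ ∞ := by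
  rw [tsum_eq_single 0 (fun k hk => by simp [hk])]
  simp [eWt, ENNReal.mul_eq_top]

lemma tsum_mFun_mul_eWt_ne_top (hd : 5 ≤ d) : ∑' k, ‖mFun d k‖ₑ * eWt k ≠ ∞ := by
  have h : ∀ k : Site d, ‖mFun d k‖ₑ * eWt k ≤ 2450 * ‖greenT d k‖ₑ ^ 2
      + ‖(if k = 0 then sigma d ^ 3 - rho d else 0 : ℝ)‖ₑ * eWt k := by
    intro k
    rw [mFun]
    refine (mul_le_mul' enorm_sub_le le_rfl).trans ?_
    rw [add_mul]
    refine add_le_add ?_ le_rfl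
    rw [enorm_pow]
    calc ‖greenT d k‖ₑ ^ 3 * eWt k = (‖greenT d k‖ₑ * eWt k) * ‖greenT d k‖ₑ ^ 2 := by ring
      _ ≤ 2450 * ‖greenT d k‖ₑ ^ 2 := by gcongr; exact enorm_greenT_mul_eWt_le hd k
  refine ne_top_of_le_ne_top ?_ (ENNReal.tsum_le_tsum h)
  rw [ENNReal.tsum_add, ENNReal.tsum_mul_left]
  have h1 := tsum_enorm_greenT_sq_ne_top hd
  have h2 := tsum_enorm_ite_mul_eWt (d := d) (sigma d ^ 3 - rho d)
  finiteness

lemma enorm_greenConv_le (k : Site d) :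
    ‖greenConv d k‖ₑ ≤ ∑' p, ‖greenT d p‖ₑ ^ 2 * ‖greenT d (k - p)‖ₑ ^ 2 := by
  refine (enorm_tsum_le _).trans (le_of_eq ?_)
  simp only [enorm_mul, enorm_pow]

lemma tsum_cFun_mul_eWt_ne_top (hd : 5 ≤ d) : ∑' k, ‖cFun d k‖ₑ * eWt k ≠ ∞ := by
  have h : ∀ k : Site d, ‖cFun d k‖ₑ * eWt k
      ≤ 2450 * ∑' p, ‖greenT d p‖ₑ ^ 2 * ‖greenT d (k - p)‖ₑ ^ 2
      + ‖(if k = 0 then eta d else 0 : ℝ)‖ₑ * eWt k := by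
    intro k
    rw [cFun]
    refine (mul_le_mul' enorm_sub_le le_rfl).trans ?_
    rw [add_mul]
    refine add_le_add ?_ le_rfl
    rw [enorm_mul, mul_right_comm]
    exact mul_le_mul' (enorm_greenT_mul_eWt_le hd k) (enorm_greenConv_le k)
  refine ne_top_of_le_ne_top ?_ (ENNReal.tsum_le_tsum h)
  rw [ENNReal.tsum_add, ENNReal.tsum_mul_left, tsum_tsum_greenT_sq]
  have h1 := tsum_enorm_greenT_sq_ne_top hd
  have h2 := tsum_enorm_ite_mul_eWt (d := d) (eta d)
  finiteness

/-! ### The coefficient kernels for an arbitrary potential -/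

/-- The kernel `W` with an arbitrary function `u` in place of `v`. -/
def wKern (u : Site d → ℝ) : Kern d := fun n₁ n₂ => u n₁ ^ 2 * M d n₁ n₂ * u n₂ ^ 2

/-- The kernel `C` with an arbitrary function `u` in place of `v`. -/
def cKern (u : Site d → ℝ) : Kern d := fun n₁ n₃ =>
  u n₁ ^ 2 * u n₃ ^ 2 * Gt d n₁ n₃ * (∑' n₂, Gt d n₁ n₂ ^ 2 * u n₂ ^ 2 * Gt d n₂ n₃ ^ 2)
    - if n₁ = n₃ then eta d * u n₁ ^ 6 else 0

lemma cKern_comm (u : Site d → ℝ) (x y : Site d) : cKern u x y = cKern u y x := by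
  simp only [cKern]
  congr 1
  · rw [Gt_comm x y]
    congr 1
    · ring
    · refine tsum_congr fun z => ?_
      rw [Gt_comm x z, Gt_comm z y]; ring
  · by_cases h : x = y
    · rw [h]
    · rw [if_neg h, if_neg fun h' => h h'.symm]

/-- Conjugates of the convolution with `mFun` by slowly varying functions are dominated by the
Laplacian. -/
lemma isTame_conj_mFun (hd : 5 ≤ d) {p q : Site d → ℝ} {b c : ℝ} (hb : ∀ x, |p x * q x| ≤ b)
    (hc : ∀ x k, |p x * (q (x + k) - q x)| ≤ c * (1 + normSq k) * weight x) :
    IsTame fun x y => p x * M d x y * q y := by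
  have hmom := tsum_mFun_mul_eWt_ne_top hd
  refine isTame_of_decomposition hd (fun x => p x * q x) (mFun d)
    (fun x k => p x * (q (x + k) - q x) * mFun d k)
    (fun k => ENNReal.ofReal c * (‖mFun d k‖ₑ * eWt k)) (b := ENNReal.ofReal b)
    ENNReal.ofReal_ne_top (fun x k => ?_) (fun x => ?_) mFun_neg (tsum_mFun hd) hmom
    (fun x k => ?_) ?_
  · rw [M_eq_mFun, add_sub_cancel_left]; ring
  · rw [← ofReal_norm, Real.norm_eq_abs]; exact ENNReal.ofReal_le_ofReal (hb x)
  · rw [enorm_mul, ← ofReal_norm (p x * _), Real.norm_eq_abs, ← ofReal_norm (weight x),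
      Real.norm_of_nonneg (weight_pos x).le]
    have h0 := normSq_nonneg k
    by_cases hc0 : 0 ≤ c
    · calc _ ≤ ENNReal.ofReal (c * (1 + normSq k) * weight x) * ‖mFun d k‖ₑ := by
            gcongr; exact hc x k
        _ = _ := by
            rw [ENNReal.ofReal_mul (by positivity), ENNReal.ofReal_mul hc0, eWt]; ring
    · have h1 : c * (1 + normSq k) * weight x ≤ 0 := by
        push Not at hc0
        exact mul_nonpos_of_nonpos_of_nonneg
          (mul_nonpos_of_nonpos_of_nonneg hc0.le (by linarith)) (weight_pos x).le
      rw [ENNReal.ofReal_of_nonpos ((hc x k).trans h1)]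
      simp
  · rw [ENNReal.tsum_mul_left]; exact ENNReal.mul_ne_top (by simp) hmom

lemma greenConv_summable (hd : 5 ≤ d) (k : Site d) :
    Summable fun p => greenT d p ^ 2 * greenT d (k - p) ^ 2 := by
  refine summable_of_tsum_enorm_ne_top ?_
  simp only [enorm_mul, enorm_pow]
  have h : ∑' k, ∑' p, ‖greenT d p‖ₑ ^ 2 * ‖greenT d (k - p)‖ₑ ^ 2 ≠ ∞ := by
    rw [tsum_tsum_greenT_sq]
    have h1 := tsum_enorm_greenT_sq_ne_top hd
    finiteness
  exact ne_top_of_le_ne_top h (ENNReal.le_tsum k)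

lemma isTame_cKern (hd : 5 ≤ d) {u : Site d → ℝ} {κ c : ℝ} (hu : ∀ x, |u x| ≤ κ) (hc0 : 0 ≤ c)
    (hc : ∀ x k, |u x ^ 2 * (u (x + k) ^ 2 - u x ^ 2)| ≤ c * (1 + normSq k) * weight x) :
    IsTame (cKern u) := by
  have hmom := tsum_cFun_mul_eWt_ne_top hd
  have hu2 : ∀ x, u x ^ 2 ≤ κ ^ 2 := fun x => by
    rw [← sq_abs]; exact pow_le_pow_left₀ (abs_nonneg _) (hu x) 2
  set r : Site d → Site d → Site d → ℝ := fun x k p =>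
    u x ^ 2 * (u (x + k) ^ 2 * u (x + p) ^ 2 - u x ^ 4) with hr
  have hrb : ∀ x k p, |r x k p|
      ≤ κ ^ 2 * c * ((1 + normSq k) + (1 + normSq p)) * weight x := by
    intro x k p
    have e : r x k p = u (x + p) ^ 2 * (u x ^ 2 * (u (x + k) ^ 2 - u x ^ 2))
        + u x ^ 2 * (u x ^ 2 * (u (x + p) ^ 2 - u x ^ 2)) := by rw [hr]; ring
    rw [e]
    refine (abs_add_le _ _).trans ?_
    rw [abs_mul (u (x + p) ^ 2), abs_mul (u x ^ 2) (u x ^ 2 * _),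
      abs_of_nonneg (sq_nonneg (u (x + p))), abs_of_nonneg (sq_nonneg (u x))]
    calc _ ≤ κ ^ 2 * (c * (1 + normSq k) * weight x) + κ ^ 2 * (c * (1 + normSq p) * weight x) :=
          add_le_add (mul_le_mul (hu2 _) (hc x k) (abs_nonneg _) (sq_nonneg _))
            (mul_le_mul (hu2 _) (hc x p) (abs_nonneg _) (sq_nonneg _))
      _ = _ := by ring
  set a : Site d → Site d → ℝ := fun k p => greenT d p ^ 2 * greenT d (k - p) ^ 2 with ha
  set e : Site d → ℝ≥0∞ := fun k => ENNReal.ofReal (κ ^ 2 * c) * (‖greenT d k‖ₑ *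
    ∑' p, ‖a k p‖ₑ * (eWt k + eWt p)) with he
  have hX : ∀ x k, cKern u x (x + k)
      = u x ^ 6 * cFun d k + greenT d k * ∑' p, a k p * r x k p := by
    intro x k
    have has := greenConv_summable hd k
    have e1 : ∑' z, Gt d x z ^ 2 * u z ^ 2 * Gt d z (x + k) ^ 2
        = ∑' p, a k p * u (x + p) ^ 2 := by
      rw [← (Equiv.addLeft x).tsum_eq]
      refine tsum_congr fun p => ?_
      simp only [Equiv.coe_addLeft, ha]
      rw [Gt_eq_greenT_sub, Gt_eq_greenT_sub, add_sub_cancel_left, add_sub_add_left_eq_sub]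
      ring
    have hbs : Summable fun p => a k p * u (x + p) ^ 2 :=
      Summable.of_norm_bounded (has.norm.mul_right (κ ^ 2)) fun p => by
        rw [norm_mul]
        gcongr
        rw [Real.norm_of_nonneg (sq_nonneg _)]; exact hu2 _
    have e2 : ∑' p, a k p * r x k p
        = u x ^ 2 * u (x + k) ^ 2 * (∑' p, a k p * u (x + p) ^ 2) - u x ^ 6 * greenConv d k := by
      rw [greenConv, ← tsum_mul_left, ← tsum_mul_left, ← (hbs.mul_left _).tsum_sub (has.mul_left _)]
      refine tsum_congr fun p => ?_
      simp only [hr, ha]; ring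
    rw [cKern, e1, e2, cFun, Gt_comm, Gt_eq_greenT, add_sub_cancel_left]
    have e3 : (x = x + k) = (k = 0) := by simp
    simp only [e3]
    split_ifs <;> ring
  refine isTame_of_decomposition hd (fun x => u x ^ 6) (cFun d)
    (fun x k => greenT d k * ∑' p, a k p * r x k p) e (b := ENNReal.ofReal (κ ^ 6))
    ENNReal.ofReal_ne_top hX (fun x => ?_) cFun_neg (tsum_cFun hd) hmom (fun x k => ?_) ?_
  · rw [← ofReal_norm, norm_pow]
    exact ENNReal.ofReal_le_ofReal (pow_le_pow_left₀ (norm_nonneg _) (hu x) 6)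
  · rw [enorm_mul, he]
    have : ∀ p, ‖a k p * r x k p‖ₑ
        ≤ ENNReal.ofReal (κ ^ 2 * c) * (‖a k p‖ₑ * (eWt k + eWt p)) * ‖weight x‖ₑ := by
      intro p
      rw [enorm_mul, ← ofReal_norm (r x k p), Real.norm_eq_abs, ← ofReal_norm (weight x),
        Real.norm_of_nonneg (weight_pos x).le]
      have h1 := normSq_nonneg k
      have h2 := normSq_nonneg p
      calc _ ≤ ‖a k p‖ₑ * ENNReal.ofReal
            (κ ^ 2 * c * ((1 + normSq k) + (1 + normSq p)) * weight x) := by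
            gcongr; exact hrb x k p
        _ = _ := by
            rw [ENNReal.ofReal_mul (by positivity), ENNReal.ofReal_mul (by positivity),
              ENNReal.ofReal_add (by positivity) (by positivity), eWt, eWt]
            ring
    calc _ ≤ ‖greenT d k‖ₑ * ∑' p,
          ENNReal.ofReal (κ ^ 2 * c) * (‖a k p‖ₑ * (eWt k + eWt p)) * ‖weight x‖ₑ := by
          gcongr
          exact (enorm_tsum_le _).trans (ENNReal.tsum_le_tsum this)
      _ = _ := by
          rw [ENNReal.tsum_mul_right, ENNReal.tsum_mul_left]; ring
  · rw [he, ENNReal.tsum_mul_left]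
    refine ENNReal.mul_ne_top (by simp) ?_
    have hle : ∀ k, ‖greenT d k‖ₑ * ∑' p, ‖a k p‖ₑ * (eWt k + eWt p)
        ≤ 2450 * (∑' p, ‖greenT d p‖ₑ ^ 2 * ‖greenT d (k - p)‖ₑ ^ 2)
        + 2450 * ∑' p, ‖greenT d k‖ₑ * (‖greenT d p‖ₑ * ‖greenT d (k - p)‖ₑ ^ 2) := by
      intro k
      rw [← ENNReal.tsum_mul_left, ← ENNReal.tsum_mul_left, ← ENNReal.tsum_mul_left,
        ← ENNReal.tsum_add]
      refine ENNReal.tsum_le_tsum fun p => ?_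
      simp only [ha, enorm_mul, enorm_pow]
      have h1 := enorm_greenT_mul_eWt_le hd k
      have h2 := enorm_greenT_mul_eWt_le hd p
      calc _ = (‖greenT d k‖ₑ * eWt k) * (‖greenT d p‖ₑ ^ 2 * ‖greenT d (k - p)‖ₑ ^ 2)
            + (‖greenT d p‖ₑ * eWt p) *
              (‖greenT d k‖ₑ * (‖greenT d p‖ₑ * ‖greenT d (k - p)‖ₑ ^ 2)) := by ring
        _ ≤ _ := by gcongr
    refine ne_top_of_le_ne_top ?_ (ENNReal.tsum_le_tsum hle)
    rw [ENNReal.tsum_add, ENNReal.tsum_mul_left, ENNReal.tsum_mul_left, tsum_tsum_greenT_sq]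
    have h1 := tsum_enorm_greenT_sq_ne_top hd
    have h2 := tsum_tsum_greenT_triangle_ne_top hd
    finiteness

/-! ### Families of kernels that depend on the potential -/

lemma tendsto_tsum_of_enorm_le {ι : Type*} {f : ℕ → ι → ℝ} {g : ι → ℝ} {b : ι → ℝ≥0∞}
    (hb : ∑' i, b i ≠ ∞) (hf : ∀ i, Tendsto (fun N => f N i) atTop (𝓝 (g i)))
    (hfb : ∀ N i, ‖f N i‖ₑ ≤ b i) : Tendsto (fun N => ∑' i, f N i) atTop (𝓝 (∑' i, g i)) := by
  refine tendsto_tsum_of_dominated_convergence (bound := fun i => (b i).toReal)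
    (ENNReal.summable_toReal hb) hf (Eventually.of_forall fun N i => ?_)
  rw [← toReal_enorm]
  exact ENNReal.toReal_mono (ENNReal.ne_top_of_tsum_ne_top hb i) (hfb N i)

/-- The kernels `F u`, for `|u| ≤ κ`, have the common majorant `A`, and depend continuously
on `u`. -/
structure Dominated (κ : ℝ) (F : (Site d → ℝ) → Kern d) (A : EKern d) : Prop where
  bound : ∀ u : Site d → ℝ, (∀ x, |u x| ≤ κ) → ∀ x y, ‖F u x y‖ₑ ≤ A x y
  tendsto : ∀ (u : ℕ → Site d → ℝ) (u' : Site d → ℝ), (∀ N x, |u N x| ≤ κ) →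
    (∀ x, Tendsto (fun N => u N x) atTop (𝓝 (u' x))) →
    ∀ x y, Tendsto (fun N => F (u N) x y) atTop (𝓝 (F u' x y))

/-- The analogue of `Dominated` for products: the majorant bounds the sum over paths. -/
structure DominatedPath (κ : ℝ) (L : List ((Site d → ℝ) → Kern d)) (A : EKern d) : Prop where
  bound : ∀ u : Site d → ℝ, (∀ x, |u x| ≤ κ) → ∀ x y, epath (L.map fun F => F u) x y ≤ A x y
  tendsto : ∀ (u : ℕ → Site d → ℝ) (u' : Site d → ℝ), (∀ N x, |u N x| ≤ κ) →
    (∀ x, Tendsto (fun N => u N x) atTop (𝓝 (u' x))) →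
    ∀ x y, Tendsto (fun N => kprod (L.map fun F => F (u N)) x y) atTop
      (𝓝 (kprod (L.map fun F => F u') x y))

lemma abs_le_of_tendsto {κ : ℝ} {u : ℕ → Site d → ℝ} {u' : Site d → ℝ} (h : ∀ N x, |u N x| ≤ κ)
    (ht : ∀ x, Tendsto (fun N => u N x) atTop (𝓝 (u' x))) (x : Site d) : |u' x| ≤ κ :=
  le_of_tendsto (ht x).abs (Eventually.of_forall fun N => h N x)

lemma Dominated.path {κ : ℝ} {F : (Site d → ℝ) → Kern d} {A : EKern d} (h : Dominated κ F A) :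
    DominatedPath κ [F] A where
  bound := h.bound
  tendsto u u' hu ht x y := by
    simp only [List.map_cons, List.map_nil, kprod_singleton]
    exact h.tendsto u u' hu ht x y

lemma DominatedPath.cons {κ : ℝ} {F : (Site d → ℝ) → Kern d} {A B : EKern d}
    {L : List ((Site d → ℝ) → Kern d)} (hF : Dominated κ F A) (hL : DominatedPath κ L B)
    (hne : L ≠ []) (hfin : ∀ x y, emul A B x y ≠ ∞) : DominatedPath κ (F :: L) (emul A B) := by
  have hne' : ∀ u : Site d → ℝ, L.map (fun F => F u) ≠ [] := fun u => by simpa using hne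
  have hb : ∀ u : Site d → ℝ, (∀ x, |u x| ≤ κ) →
      ∀ x y, epath ((F :: L).map fun F => F u) x y ≤ emul A B x y := by
    intro u hu x y
    rw [List.map_cons, epath_cons _ (hne' u)]
    exact ENNReal.tsum_le_tsum fun z => mul_le_mul' (hF.bound u hu x z) (hL.bound u hu z y)
  refine ⟨hb, fun u u' hu ht x y => ?_⟩
  have hk : ∀ u : Site d → ℝ, (∀ x, |u x| ≤ κ) → kprod ((F :: L).map fun F => F u) x y
      = ∑' z, F u x z * kprod (L.map fun F => F u) z y := fun u hu =>
    kprod_cons _ (hne' u) (ne_top_of_le_ne_top (hfin x y) (hb u hu x y))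
  rw [hk u' (abs_le_of_tendsto hu ht)]
  simp only [fun N => hk (u N) (hu N)]
  refine tendsto_tsum_of_enorm_le (hfin x y)
    (fun z => (hF.tendsto u u' hu ht x z).mul (hL.tendsto u u' hu ht z y)) fun N z => ?_
  rw [enorm_mul]
  exact mul_le_mul' (hF.bound _ (hu N) x z)
    ((enorm_kprod_le (hne' _) z y).trans (hL.bound _ (hu N) z y))

/-- `S` for an arbitrary function `u` in place of `v`. -/
def sKern (u : Site d → ℝ) : Kern d := fun n₁ n₃ =>
  u n₁ ^ 2 * u n₃ ^ 2 * Gt d n₁ n₃ ^ 2 * ∑' n₂, Gt d n₁ n₂ ^ 3 * u n₂ ^ 2 * Gt d n₂ n₃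

/-- `D₄` and `D₆⁽¹⁾`, for `k = 2, 4`, with an arbitrary function `u` in place of `v`. -/
def dFun (k : ℕ) (u : Site d → ℝ) (n₁ : Site d) : ℝ :=
  u n₁ ^ 2 * ∑' n₂, u n₂ ^ k * Gt d n₁ n₂ ^ 4

/-- `D₆⁽²⁾` for an arbitrary function `u` in place of `v`. -/
def triangleFun (u : Site d → ℝ) (n₁ : Site d) : ℝ :=
  u n₁ ^ 2 * ∑' p : Site d × Site d,
    u p.1 ^ 2 * u p.2 ^ 2 * Gt d n₁ p.1 ^ 2 * Gt d n₁ p.2 ^ 2 * Gt d p.1 p.2 ^ 2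

/-- `R₆` for an arbitrary function `u` in place of `v`. -/
def rFun (u : Site d → ℝ) (n₁ : Site d) : ℝ :=
  u n₁ ^ 2 * kprod [Gt d, wKern u, Gt d] n₁ n₁

/-- The names of the nonrandom kernels from which the words of the expansion are built. -/
inductive Atom
  | g | gt | vpow (k : ℕ) | M4 | W | C | D4 | D61 | D62 | R6 | S | St

/-- The kernel with a given name, for an arbitrary function `u` in place of `v`. -/
def Atom.kern : Atom → (Site d → ℝ) → Kern d
  | .g, _ => G0 d
  | .gt, _ => Gt d
  | .vpow k, u => diag fun n => u n ^ k
  | .M4, _ => Renorm.M4 d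
  | .W, u => wKern u
  | .C, u => cKern u
  | .D4, u => diag (dFun 2 u)
  | .D61, u => diag (dFun 4 u)
  | .D62, u => diag (triangleFun u)
  | .R6, u => diag (rFun u)
  | .S, u => sKern u
  | .St, u => transp (sKern u)

section Bounds

variable {κ : ℝ} {u : Site d → ℝ}

lemma enorm_le_of_abs_le (hu : ∀ x, |u x| ≤ κ) (x : Site d) : ‖u x‖ₑ ≤ ENNReal.ofReal κ := by
  rw [← ofReal_norm]; exact ENNReal.ofReal_le_ofReal (hu x)

lemma enorm_pow_le_of_abs_le (hu : ∀ x, |u x| ≤ κ) (k : ℕ) (x : Site d) :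
    ‖u x ^ k‖ₑ ≤ ENNReal.ofReal κ ^ k := by
  rw [enorm_pow]; exact pow_le_pow_left' (enorm_le_of_abs_le hu x) k

end Bounds

lemma isSchur_of_translation {f : Site d → ℝ} (hf : ∑' k, ‖f k‖ₑ ≠ ∞) {K : Kern d}
    (hK : ∀ x y, K x y = f (y - x)) : IsSchur (eabs K) := by
  refine ⟨⟨_, hf, fun x => ?_⟩, ⟨_, hf, fun x => ?_⟩⟩
  · simp only [eabs, hK]
    exact ((Equiv.subRight x).tsum_eq fun z => ‖f z‖ₑ).le
  · simp only [eabs, hK, etransp]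
    exact ((Equiv.subLeft x).tsum_eq fun z => ‖f z‖ₑ).le

lemma isSchur_M (hd : 5 ≤ d) : IsSchur (eabs (M d)) := by
  refine isSchur_of_translation (ne_top_of_le_ne_top (tsum_mFun_mul_eWt_ne_top hd)
    (ENNReal.tsum_le_tsum fun k => ?_)) M_eq_mFun
  refine le_mul_of_one_le_right' ?_
  rw [eWt, ← ENNReal.ofReal_one]
  exact ENNReal.ofReal_le_ofReal (by linarith [normSq_nonneg k])

lemma dominated_const (κ : ℝ) (K : Kern d) : Dominated κ (fun _ => K) (eabs K) :=
  ⟨fun _ _ _ _ => le_rfl, fun _ _ _ _ _ _ => tendsto_const_nhds⟩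

lemma dominated_diag {κ : ℝ} {f : (Site d → ℝ) → Site d → ℝ} {b : ℝ≥0∞}
    (hb : ∀ u : Site d → ℝ, (∀ x, |u x| ≤ κ) → ∀ x, ‖f u x‖ₑ ≤ b)
    (ht : ∀ (u : ℕ → Site d → ℝ) (u' : Site d → ℝ), (∀ N x, |u N x| ≤ κ) →
      (∀ x, Tendsto (fun N => u N x) atTop (𝓝 (u' x))) →
      ∀ x, Tendsto (fun N => f (u N) x) atTop (𝓝 (f u' x))) :
    Dominated κ (fun u => diag (f u)) (ediag fun _ => b) := by
  refine ⟨fun u hu x y => ?_, fun u u' hu h x y => ?_⟩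
  · simp only [diag, ediag]
    split_ifs
    · exact hb u hu x
    · simp
  · simp only [diag]
    split_ifs
    · exact ht u u' hu h x
    · exact tendsto_const_nhds

lemma dominated_wKern (d : ℕ) (κ : ℝ) :
    Dominated κ (wKern (d := d)) fun x y => ENNReal.ofReal κ ^ 4 * ‖M d x y‖ₑ := by
  refine ⟨fun u hu x y => ?_, fun u u' hu h x y => ?_⟩
  · rw [wKern, enorm_mul, enorm_mul]
    calc _ ≤ ENNReal.ofReal κ ^ 2 * ‖M d x y‖ₑ * ENNReal.ofReal κ ^ 2 := by
          gcongr <;> exact enorm_pow_le_of_abs_le hu 2 _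
      _ = _ := by ring
  · exact (((h x).pow 2).mul_const _).mul ((h y).pow 2)

/-- The kernel `|G̃₀|²`. -/
def gtSq (d : ℕ) : EKern d := fun x y => ‖Gt d x y‖ₑ ^ 2

lemma isSchur_gtSq (hd : 5 ≤ d) : IsSchur (gtSq d) := (isSq_Gt hd).sq_isSchur

lemma isBdd_pow {A : EKern d} (hA : IsBdd A) (k : ℕ) : IsBdd fun x y => A x y ^ k := by
  obtain ⟨c, hc, h⟩ := hA
  exact ⟨c ^ k, ENNReal.pow_ne_top hc, fun x y => pow_le_pow_left' (h x y) k⟩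

lemma isSchur_gt_pow (hd : 5 ≤ d) {k : ℕ} (hk : 2 ≤ k) :
    IsSchur fun x y => ‖Gt d x y‖ₑ ^ k := by
  have h := IsBdd.mul_isSchur (isBdd_pow (isSq_Gt hd).isBdd (k - 2)) (isSchur_gtSq hd)
  refine h.mono fun x y => ?_
  rw [gtSq, eabs, ← pow_add, Nat.sub_add_cancel hk]

lemma exists_dominated_cKern (hd : 5 ≤ d) (κ : ℝ) :
    ∃ A : EKern d, IsSchur A ∧ Dominated κ cKern A := by
  have hq := isSchur_gtSq hd
  have hqq := hq.emul hq
  have hqb : IsBdd (emul (gtSq d) (gtSq d)) :=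
    hq.emul_isBdd (isBdd_pow (isSq_Gt hd).isBdd 2)
  have hz : ∀ u : Site d → ℝ, (∀ x, |u x| ≤ κ) → ∀ x y z,
      ‖Gt d x z ^ 2 * u z ^ 2 * Gt d z y ^ 2‖ₑ
        ≤ ENNReal.ofReal κ ^ 2 * (gtSq d x z * gtSq d z y) := fun u hu x y z => by
    rw [enorm_mul, enorm_mul, enorm_pow, enorm_pow (Gt d z y)]
    calc _ ≤ ‖Gt d x z‖ₑ ^ 2 * ENNReal.ofReal κ ^ 2 * ‖Gt d z y‖ₑ ^ 2 := by
          gcongr; exact enorm_pow_le_of_abs_le hu 2 _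
      _ = _ := by simp only [gtSq]; ring
  refine ⟨fun x y => ENNReal.ofReal κ ^ 6 * (‖Gt d x y‖ₑ * emul (gtSq d) (gtSq d) x y)
    + ediag (fun _ => ‖eta d‖ₑ * ENNReal.ofReal κ ^ 6) x y,
    ((IsBdd.mul_isSchur (isSq_Gt hd).isBdd hqq).const_mul (by finiteness)).add
      (isSchur_ediag (c := ‖eta d‖ₑ * ENNReal.ofReal κ ^ 6) (by finiteness) fun _ => le_rfl),
    fun u hu x y => ?_, fun u u' hu h x y => ?_⟩
  · have h1 : ‖∑' z, Gt d x z ^ 2 * u z ^ 2 * Gt d z y ^ 2‖ₑ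
        ≤ ENNReal.ofReal κ ^ 2 * emul (gtSq d) (gtSq d) x y := by
      refine (enorm_tsum_le _).trans ?_
      rw [emul, ← ENNReal.tsum_mul_left]
      exact ENNReal.tsum_le_tsum (hz u hu x y)
    rw [cKern]
    refine enorm_sub_le.trans (add_le_add ?_ ?_)
    · rw [enorm_mul, enorm_mul, enorm_mul]
      calc _ ≤ ENNReal.ofReal κ ^ 2 * ENNReal.ofReal κ ^ 2 * ‖Gt d x y‖ₑ
            * (ENNReal.ofReal κ ^ 2 * emul (gtSq d) (gtSq d) x y) := by
            gcongr <;> exact enorm_pow_le_of_abs_le hu 2 _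
        _ = _ := by ring
    · simp only [ediag]
      split_ifs
      · rw [enorm_mul]; gcongr; exact enorm_pow_le_of_abs_le hu 6 _
      · simp
  · simp only [cKern]
    refine Tendsto.sub (((((h x).pow 2).mul ((h y).pow 2)).mul_const _).mul ?_) ?_
    · obtain ⟨c, hc, hqb⟩ := hqb
      refine tendsto_tsum_of_enorm_le
        (b := fun z => ENNReal.ofReal κ ^ 2 * (gtSq d x z * gtSq d z y)) ?_
        (fun z => (((h z).pow 2).const_mul _).mul_const _) fun N z => hz _ (hu N) x y z
      rw [ENNReal.tsum_mul_left]
      exact ENNReal.mul_ne_top (by finiteness) (ne_top_of_le_ne_top hc (hqb x y))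
    · split_ifs
      · exact ((h x).pow 6).const_mul _
      · exact tendsto_const_nhds

lemma exists_dominated_sKern (hd : 5 ≤ d) (κ : ℝ) :
    ∃ A : EKern d, IsSchur A ∧ Dominated κ sKern A := by
  have hb : IsBdd (emul (fun x y => ‖Gt d x y‖ₑ ^ 3) (eabs (Gt d))) :=
    (isSchur_gt_pow hd (by norm_num)).emul_isBdd (isSq_Gt hd).isBdd
  have hz : ∀ u : Site d → ℝ, (∀ x, |u x| ≤ κ) → ∀ x y z, ‖Gt d x z ^ 3 * u z ^ 2 * Gt d z y‖ₑ
      ≤ ENNReal.ofReal κ ^ 2 * (‖Gt d x z‖ₑ ^ 3 * ‖Gt d z y‖ₑ) := fun u hu x y z => by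
    rw [enorm_mul, enorm_mul, enorm_pow]
    calc _ ≤ ‖Gt d x z‖ₑ ^ 3 * ENNReal.ofReal κ ^ 2 * ‖Gt d z y‖ₑ := by
          gcongr; exact enorm_pow_le_of_abs_le hu 2 _
      _ = _ := by ring
  refine ⟨fun x y => ENNReal.ofReal κ ^ 6 *
    (emul (fun x y => ‖Gt d x y‖ₑ ^ 3) (eabs (Gt d)) x y * gtSq d x y),
    (IsBdd.mul_isSchur hb (isSchur_gtSq hd)).const_mul (by finiteness),
    fun u hu x y => ?_, fun u u' hu h x y => ?_⟩
  · have h1 : ‖∑' z, Gt d x z ^ 3 * u z ^ 2 * Gt d z y‖ₑ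
        ≤ ENNReal.ofReal κ ^ 2 * emul (fun x y => ‖Gt d x y‖ₑ ^ 3) (eabs (Gt d)) x y := by
      refine (enorm_tsum_le _).trans ?_
      rw [emul, ← ENNReal.tsum_mul_left]
      exact ENNReal.tsum_le_tsum (hz u hu x y)
    rw [sKern, enorm_mul, enorm_mul, enorm_mul, enorm_pow (Gt d x y)]
    calc _ ≤ ENNReal.ofReal κ ^ 2 * ENNReal.ofReal κ ^ 2 * ‖Gt d x y‖ₑ ^ 2
          * (ENNReal.ofReal κ ^ 2 * emul (fun x y => ‖Gt d x y‖ₑ ^ 3) (eabs (Gt d)) x y) := by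
          gcongr <;> exact enorm_pow_le_of_abs_le hu 2 _
      _ = _ := by simp only [gtSq]; ring
  · simp only [sKern]
    refine ((((h x).pow 2).mul ((h y).pow 2)).mul_const _).mul ?_
    obtain ⟨c, hc, hb⟩ := hb
    refine tendsto_tsum_of_enorm_le
      (b := fun z => ENNReal.ofReal κ ^ 2 * (‖Gt d x z‖ₑ ^ 3 * ‖Gt d z y‖ₑ)) ?_
      (fun z => (((h z).pow 2).const_mul _).mul_const _) fun N z => hz _ (hu N) x y z
    rw [ENNReal.tsum_mul_left]
    exact ENNReal.mul_ne_top (by finiteness) (ne_top_of_le_ne_top hc (hb x y))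

lemma exists_dominated_dFun (hd : 5 ≤ d) (κ : ℝ) (k : ℕ) :
    ∃ A : EKern d, IsSchur A ∧ Dominated κ (fun u => diag (dFun k u)) A := by
  obtain ⟨c, hc, hb⟩ := (isSchur_gt_pow hd (k := 4) (by norm_num)).1
  have hz : ∀ u : Site d → ℝ, (∀ x, |u x| ≤ κ) → ∀ x z, ‖u z ^ k * Gt d x z ^ 4‖ₑ
      ≤ ENNReal.ofReal κ ^ k * ‖Gt d x z‖ₑ ^ 4 := fun u hu x z => by
    rw [enorm_mul, enorm_pow (Gt d x z)]
    gcongr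
    exact enorm_pow_le_of_abs_le hu k z
  refine ⟨_, isSchur_ediag (c := ENNReal.ofReal κ ^ 2 * (ENNReal.ofReal κ ^ k * c))
    (by finiteness) fun _ => le_rfl, dominated_diag (fun u hu x => ?_) fun u u' hu h x => ?_⟩
  · rw [dFun, enorm_mul]
    refine mul_le_mul' (enorm_pow_le_of_abs_le hu 2 x) ((enorm_tsum_le _).trans ?_)
    refine (ENNReal.tsum_le_tsum (hz u hu x)).trans ?_
    rw [ENNReal.tsum_mul_left]
    gcongr
    exact hb x
  · refine ((h x).pow 2).mul (tendsto_tsum_of_enorm_le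
      (b := fun z => ENNReal.ofReal κ ^ k * ‖Gt d x z‖ₑ ^ 4) ?_
      (fun z => ((h z).pow k).mul_const _) fun N z => hz _ (hu N) x z)
    rw [ENNReal.tsum_mul_left]
    exact ENNReal.mul_ne_top (by finiteness) (ne_top_of_le_ne_top hc (hb x))

lemma exists_triangle_bound (hd : 5 ≤ d) : ∃ c : ℝ≥0∞, c ≠ ∞ ∧ ∀ x : Site d,
    ∑' p : Site d × Site d, gtSq d x p.1 * gtSq d x p.2 * gtSq d p.1 p.2 ≤ c := by
  obtain ⟨c, hc, hb⟩ := (isSchur_gtSq hd).1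
  obtain ⟨b, hb', hbb⟩ := isBdd_pow (isSq_Gt hd).isBdd 2
  refine ⟨c * (c * b), by finiteness, fun x => ?_⟩
  rw [ENNReal.tsum_prod']
  calc _ ≤ ∑' y, ∑' z, gtSq d x y * (gtSq d x z * b) := by
        refine ENNReal.tsum_le_tsum fun y => ENNReal.tsum_le_tsum fun z => ?_
        rw [mul_assoc]
        gcongr
        exact hbb y z
    _ = (∑' y, gtSq d x y) * ((∑' z, gtSq d x z) * b) := by
        simp only [ENNReal.tsum_mul_left, ENNReal.tsum_mul_right]
    _ ≤ _ := by gcongr <;> exact hb x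

lemma exists_dominated_triangleFun (hd : 5 ≤ d) (κ : ℝ) :
    ∃ A : EKern d, IsSchur A ∧ Dominated κ (fun u => diag (triangleFun u)) A := by
  obtain ⟨c, hc, hb⟩ := exists_triangle_bound hd
  have hz : ∀ u : Site d → ℝ, (∀ x, |u x| ≤ κ) → ∀ (x : Site d) (p : Site d × Site d),
      ‖u p.1 ^ 2 * u p.2 ^ 2 * Gt d x p.1 ^ 2 * Gt d x p.2 ^ 2 * Gt d p.1 p.2 ^ 2‖ₑ
      ≤ ENNReal.ofReal κ ^ 4 * (gtSq d x p.1 * gtSq d x p.2 * gtSq d p.1 p.2) := by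
    intro u hu x p
    simp only [enorm_mul, gtSq]
    rw [enorm_pow (Gt d x p.1), enorm_pow (Gt d x p.2), enorm_pow (Gt d p.1 p.2)]
    calc _ ≤ ENNReal.ofReal κ ^ 2 * ENNReal.ofReal κ ^ 2 * ‖Gt d x p.1‖ₑ ^ 2
          * ‖Gt d x p.2‖ₑ ^ 2 * ‖Gt d p.1 p.2‖ₑ ^ 2 := by
          gcongr <;> exact enorm_pow_le_of_abs_le hu 2 _
      _ = _ := by ring
  refine ⟨_, isSchur_ediag (c := ENNReal.ofReal κ ^ 2 * (ENNReal.ofReal κ ^ 4 * c))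
    (by finiteness) fun _ => le_rfl, dominated_diag (fun u hu x => ?_) fun u u' hu h x => ?_⟩
  · rw [triangleFun, enorm_mul]
    refine mul_le_mul' (enorm_pow_le_of_abs_le hu 2 x) ((enorm_tsum_le _).trans ?_)
    refine (ENNReal.tsum_le_tsum (hz u hu x)).trans ?_
    rw [ENNReal.tsum_mul_left]
    gcongr
    exact hb x
  · refine ((h x).pow 2).mul (tendsto_tsum_of_enorm_le (b := fun p : Site d × Site d =>
      ENNReal.ofReal κ ^ 4 * (gtSq d x p.1 * gtSq d x p.2 * gtSq d p.1 p.2)) ?_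
      (fun p => ((((((h p.1).pow 2).mul ((h p.2).pow 2))).mul_const _).mul_const _).mul_const _)
      fun N z => hz _ (hu N) x z)
    rw [ENNReal.tsum_mul_left]
    exact ENNReal.mul_ne_top (by finiteness) (ne_top_of_le_ne_top hc (hb x))

lemma exists_dominatedPath_loop (hd : 5 ≤ d) (κ : ℝ) : ∃ A : EKern d, IsBdd A ∧
    DominatedPath κ [fun _ => Gt d, wKern, fun _ => Gt d] A := by
  have hG := dominated_const κ (Gt d)
  have hA : IsSchur fun x y => ENNReal.ofReal κ ^ 4 * ‖M d x y‖ₑ :=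
    (isSchur_M hd).const_mul (by finiteness)
  have h1 := hA.emul_isSq (isSq_Gt hd)
  have h2 := (isSq_Gt hd).emul h1
  have ne : ∀ {A : EKern d}, IsBdd A → ∀ x y, A x y ≠ ∞ := fun ⟨c, hc, h⟩ x y =>
    ne_top_of_le_ne_top hc (h x y)
  exact ⟨_, h2, (DominatedPath.cons hG ((DominatedPath.cons (dominated_wKern d κ) hG.path
    (by simp) (ne h1.isBdd))) (by simp) (ne h2))⟩

lemma exists_dominated_rFun (hd : 5 ≤ d) (κ : ℝ) :
    ∃ A : EKern d, IsSchur A ∧ Dominated κ (fun u => diag (rFun u)) A := by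
  obtain ⟨A, ⟨c, hc, hA⟩, hdom⟩ := exists_dominatedPath_loop hd κ
  refine ⟨_, isSchur_ediag (c := ENNReal.ofReal κ ^ 2 * c)
    (by finiteness) fun _ => le_rfl, dominated_diag (fun u hu x => ?_) fun u u' hu h x => ?_⟩
  · rw [rFun, enorm_mul]
    exact mul_le_mul' (enorm_pow_le_of_abs_le hu 2 x)
      (((enorm_kprod_le (by simp) x x).trans (hdom.bound u hu x x)).trans (hA x x))
  · exact ((h x).pow 2).mul (hdom.tendsto u u' hu h x x)

/-- Whether a kernel is one of the Green's functions `G₀`, `G̃₀`, which are bounded in `ℓ²`; all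
others are bounded in `ℓ¹`. -/
def Atom.green : Atom → ℕ
  | .g => 1
  | .gt => 1
  | _ => 0

/-- The class of the products with `k` Green's functions. -/
def GreenClass : ℕ → EKern d → Prop
  | 0 => IsSchur
  | 1 => IsSq
  | 2 => IsBdd
  | _ => fun _ => False

lemma Atom.exists_dominated (hd : 5 ≤ d) (κ : ℝ) (a : Atom) :
    ∃ A : EKern d, GreenClass a.green A ∧ Dominated κ a.kern A := by
  cases a with
  | g => exact ⟨_, isSq_G0 hd, dominated_const κ _⟩
  | gt => exact ⟨_, isSq_Gt hd, dominated_const κ _⟩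
  | vpow k =>
    exact ⟨_, isSchur_ediag (c := ENNReal.ofReal κ ^ k) (by finiteness) fun _ => le_rfl,
      dominated_diag (fun u hu x => enorm_pow_le_of_abs_le hu k x) fun u u' _ h x => (h x).pow k⟩
  | M4 =>
    refine ⟨_, ?_, dominated_const κ _⟩
    refine (isSchur_gt_pow hd (k := 3) (by norm_num)).mono fun x y => ?_
    exact (enorm_pow (Gt d x y) 3).le
  | W => exact ⟨_, (isSchur_M hd).const_mul (by finiteness), dominated_wKern d κ⟩
  | C => exact exists_dominated_cKern hd κ
  | D4 => exact exists_dominated_dFun hd κ 2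
  | D61 => exact exists_dominated_dFun hd κ 4
  | D62 => exact exists_dominated_triangleFun hd κ
  | R6 => exact exists_dominated_rFun hd κ
  | S => exact exists_dominated_sKern hd κ
  | St =>
    obtain ⟨A, hA, h⟩ := exists_dominated_sKern hd κ
    exact ⟨Renorm.etransp A, hA.etransp, fun u hu x y => h.bound u hu y x,
      fun u u' hu ht x y => h.tendsto u u' hu ht y x⟩

lemma GreenClass.isBdd : ∀ {k : ℕ} {A : EKern d}, GreenClass k A → IsBdd A
  | 0, _, h => by
    obtain ⟨c, hc, h⟩ := h.1
    exact ⟨c, hc, fun x y => (ENNReal.le_tsum y).trans (h x)⟩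
  | 1, _, h => IsSq.isBdd h
  | 2, _, h => h
  | _ + 3, _, h => h.elim

lemma GreenClass.emul : ∀ {k l : ℕ} {A B : EKern d}, k + l ≤ 2 → GreenClass k A →
    GreenClass l B → GreenClass (k + l) (Renorm.emul A B)
  | 0, 0, _, _, _, h, h' => IsSchur.emul h h'
  | 0, 1, _, _, _, h, h' => IsSchur.emul_isSq h h'
  | 0, 2, _, _, _, h, h' => IsSchur.emul_isBdd h h'
  | 1, 0, _, _, _, h, h' => IsSq.emul_isSchur h h'
  | 1, 1, _, _, _, h, h' => IsSq.emul h h'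
  | 2, 0, _, _, _, h, h' => IsBdd.emul_isSchur h h'
  | 1, _ + 2, _, _, hk, _, _ => by omega
  | 2, _ + 1, _, _, hk, _, _ => by omega
  | 0, _ + 3, _, _, hk, _, _ => by omega
  | _ + 3, _, _, _, hk, _, _ => by omega

/-- The number of Green's functions in a product. -/
def greenCount (L : List Atom) : ℕ := (L.map Atom.green).sum

lemma exists_dominatedPath (hd : 5 ≤ d) (κ : ℝ) : ∀ L : List Atom, L ≠ [] → greenCount L ≤ 2 →
    ∃ A : EKern d, GreenClass (greenCount L) A ∧ DominatedPath κ (L.map Atom.kern) A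
  | [], h, _ => absurd rfl h
  | [a], _, _ => by
    obtain ⟨A, hA, h⟩ := a.exists_dominated hd κ
    exact ⟨A, by simpa [greenCount] using hA, h.path⟩
  | a :: b :: L, _, hg => by
    obtain ⟨A, hA, h⟩ := a.exists_dominated hd κ
    have e : greenCount (a :: b :: L) = a.green + greenCount (b :: L) := by simp [greenCount]
    rw [e] at hg ⊢
    obtain ⟨B, hB, h'⟩ := exists_dominatedPath hd κ (b :: L) (by simp) (by omega)
    have hAB := hA.emul hg hB
    obtain ⟨c, hc, hb⟩ := hAB.isBdd
    exact ⟨_, hAB, DominatedPath.cons h h' (by simp) fun x y =>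
      ne_top_of_le_ne_top hc (hb x y)⟩

/-! ### Products with two Green's functions -/

lemma epath_ne_top_of_isBdd {L : List (Kern d)} (h : IsBdd (epath L)) (x y : Site d) :
    epath L x y ≠ ∞ := by
  obtain ⟨c, hc, h⟩ := h
  exact ne_top_of_le_ne_top hc (h x y)

lemma isBdd_epath_three {A X B : Kern d} (hA : IsSq (eabs A)) (hX : IsSchur (eabs X))
    (hB : IsSq (eabs B)) : IsBdd (epath [A, X, B]) := by
  rw [epath_cons _ (by simp), epath_cons _ (by simp)]
  exact hA.emul (hX.emul_isSq hB)

lemma isSq_epath_two {X B : Kern d} (hX : IsSchur (eabs X)) (hB : IsSq (eabs B)) :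
    IsSq (epath [X, B]) := by
  rw [epath_cons _ (by simp)]; exact hX.emul_isSq hB

lemma isSq_kprod {L : List (Kern d)} (hL : L ≠ []) (h : IsSq (epath L)) : IsSq (eabs (kprod L)) :=
  h.mono fun x y => enorm_kprod_le hL x y

lemma kprod_two {X B : Kern d} (h : IsBdd (epath [X, B])) (x y : Site d) :
    kprod [X, B] x y = ∑' z, X x z * B z y := by
  rw [kprod_cons _ (by simp) (epath_ne_top_of_isBdd h x y)]
  simp only [kprod_singleton]

lemma kprod_three {A X B : Kern d} (h : IsBdd (epath [A, X, B])) (hXB : IsBdd (epath [X, B]))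
    (x y : Site d) : kprod [A, X, B] x y = ∑' p : Site d × Site d, A x p.1 * X p.1 p.2 * B p.2 y := by
  have hs : Summable fun p : Site d × Site d => A x p.1 * X p.1 p.2 * B p.2 y := by
    refine summable_of_tsum_enorm_ne_top (ne_top_of_le_ne_top (epath_ne_top_of_isBdd h x y)
      (le_of_eq ?_))
    rw [ENNReal.tsum_prod', epath_cons _ (by simp), epath_cons _ (by simp), epath_singleton]
    refine tsum_congr fun z => ?_
    simp only [emul, eabs, enorm_mul, mul_assoc, ENNReal.tsum_mul_left]
  rw [kprod_cons _ (by simp) (epath_ne_top_of_isBdd h x y), hs.tsum_prod]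
  refine tsum_congr fun z => ?_
  rw [kprod_two hXB, ← tsum_mul_left]
  simp only [mul_assoc]

lemma eabs_transp (A : Kern d) : eabs (transp A) = etransp (eabs A) := rfl

lemma transp_kprod_three {A X B : Kern d} (hA : IsSq (eabs A)) (hX : IsSchur (eabs X))
    (hB : IsSq (eabs B)) :
    transp (kprod [A, X, B]) = kprod [transp B, transp X, transp A] := by
  ext x y
  have h := kprod_three (A := transp B) (X := transp X) (B := transp A)
    (isBdd_epath_three hB.etransp hX.etransp hA.etransp)
    (isSq_epath_two (X := transp X) hX.etransp hA.etransp).isBdd x y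
  rw [transp, kprod_three (isBdd_epath_three hA hX hB) (isSq_epath_two hX hB).isBdd, h,
    ← (Equiv.prodComm _ _).tsum_eq]
  refine tsum_congr fun p => ?_
  simp only [transp, Equiv.prodComm_apply, Prod.fst_swap, Prod.snd_swap]
  ring

lemma IsSq.sub {A B : Kern d} (hA : IsSq (eabs A)) (hB : IsSq (eabs B)) (c : ℝ) :
    IsSq (eabs fun x y => A x y - c * B x y) := by
  have hc : IsSq fun x y => ‖c‖ₑ * eabs B x y := by
    have := IsSchur.emul_isSq (isSchur_ediag (d := d) (f := fun _ => ‖c‖ₑ) (c := ‖c‖ₑ) (by simp)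
      fun _ => le_rfl) hB
    refine this.mono fun x y => ?_
    rw [Renorm.emul, tsum_eq_single x (fun z hz => by simp [ediag, hz.symm])]
    simp [ediag]
  refine (hA.add hc).mono fun x y => ?_
  exact enorm_sub_le.trans (by rw [enorm_mul]; rfl)

lemma kprod_Gt_cons {L : List (Kern d)} (hL : L ≠ []) {x y : Site d}
    (h : epath (G0 d :: L) x y ≠ ∞) (h' : epath (Gt d :: L) x y ≠ ∞) :
    kprod (Gt d :: L) x y = kprod (G0 d :: L) x y - sigma d * kprod L x y := by
  rw [kprod_cons _ hL h, kprod_cons _ hL h']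
  have h2 : HasSum (fun z => if z = x then sigma d * kprod L x y else 0)
      (sigma d * kprod L x y) := hasSum_ite_eq x _
  rw [← h2.tsum_eq, ← (summable_kprod_cons _ hL h).tsum_sub h2.summable]
  refine tsum_congr fun z => ?_
  by_cases hz : z = x
  · subst hz; simp only [Gt, if_true]; ring
  · simp [Gt, hz, Ne.symm hz]

/-- If `X` and its transpose are dominated by the Laplacian, products `A X B` with
`A, B ∈ {G₀, G̃₀}` have rows and columns bounded in `ℓ²`. -/
lemma isSq_sandwich (hd : 5 ≤ d) {X : Kern d} (hX : IsTame X) (hXt : IsTame (transp X))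
    (hS : IsSchur (eabs X)) {A B : Kern d} (hA : A = G0 d ∨ A = Gt d) (hB : B = G0 d ∨ B = Gt d) :
    IsSq (eabs (kprod [A, X, B])) := by
  have hg := isSq_G0 hd
  have ht := isSq_Gt hd
  have h00 : ∀ {X : Kern d}, IsTame X → IsTame (transp X) → IsSchur (eabs X) →
      IsSq (eabs (kprod [G0 d, X, G0 d])) := by
    intro X hX hXt hS
    refine ⟨hX.rowSq hd hS, ?_⟩
    rw [← eabs_transp, transp_kprod_three hg hS hg, transp_G0]
    exact hXt.rowSq hd hS.etransp
  have hsub : ∀ {X B : Kern d}, IsSchur (eabs X) → IsSq (eabs B) →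
      IsSq (eabs (kprod [G0 d, X, B])) → IsSq (eabs (kprod [Gt d, X, B])) := by
    intro X B hX hB h
    have h2 := h.sub (isSq_kprod (by simp) (isSq_epath_two hX hB)) (sigma d)
    refine h2.mono fun x y => le_of_eq ?_
    simp only [eabs]
    rw [kprod_Gt_cons (by simp) (epath_ne_top_of_isBdd (isBdd_epath_three hg hX hB) x y)
      (epath_ne_top_of_isBdd (isBdd_epath_three ht hX hB) x y)]
  have h01 : ∀ {X : Kern d}, IsTame X → IsTame (transp X) → IsSchur (eabs X) →
      IsSq (eabs (kprod [G0 d, X, Gt d])) := by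
    intro X hX hXt hS
    have h := (hsub (X := transp X) hS.etransp hg (h00 (X := transp X) hXt hX hS.etransp)).etransp
    rw [← eabs_transp, transp_kprod_three (X := transp X) ht hS.etransp hg, transp_G0,
      transp_Gt] at h
    exact h
  rcases hA with rfl | rfl <;> rcases hB with rfl | rfl
  · exact h00 hX hXt hS
  · exact h01 hX hXt hS
  · exact hsub hS hg (h00 hX hXt hS)
  · exact hsub hS ht (h01 hX hXt hS)

lemma kprod_cons_congr (A : Kern d) {L L' : List (Kern d)} (hL : L ≠ []) (hL' : L' ≠ [])
    (h : IsBdd (epath (A :: L))) (h' : IsBdd (epath (A :: L'))) (e : kprod L = kprod L') :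
    kprod (A :: L) = kprod (A :: L') := by
  ext x y
  rw [kprod_cons A hL (epath_ne_top_of_isBdd h x y), kprod_cons A hL' (epath_ne_top_of_isBdd h' x y),
    e]

lemma kprod_diag_cons (f : Site d → ℝ) {L : List (Kern d)} (hL : L ≠ [])
    (h : IsBdd (epath (diag f :: L))) (x y : Site d) :
    kprod (diag f :: L) x y = f x * kprod L x y := by
  rw [kprod_cons _ hL (epath_ne_top_of_isBdd h x y), tsum_eq_single x]
  · simp [diag]
  · intro z hz; simp [diag, hz.symm]

lemma kprod_snoc_diag {A : Kern d} (f : Site d → ℝ) (h : IsBdd (epath [A, diag f]))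
    (x y : Site d) : kprod [A, diag f] x y = A x y * f y := by
  rw [kprod_two h, tsum_eq_single y]
  · simp [diag]
  · intro z hz; simp [diag, hz]

/-- The potential `v` is bounded, and the first differences of `v²` decay quadratically when
multiplied by `v²`. -/
structure SlowlyVarying (κ : ℝ) (u : Site d → ℝ) : Prop where
  bound : ∀ x, |u x| ≤ κ
  difference : ∃ c, 0 ≤ c ∧ ∀ x k : Site d,
    |u x ^ 2 * (u (x + k) ^ 2 - u x ^ 2)| ≤ c * (1 + normSq k) * weight x

lemma slowlyVarying_v {α κ : ℝ} (hα : 1 / 4 < α) (hκ : 0 ≤ κ) :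
    SlowlyVarying κ (v (d := d) α κ) where
  bound := abs_v_le (by linarith) hκ
  difference := abs_v_sq_difference_le hα

section Tame

variable {κ : ℝ} {u : Site d → ℝ}

lemma SlowlyVarying.pow_le (hu : SlowlyVarying κ u) (k : ℕ) (x : Site d) : |u x ^ k| ≤ κ ^ k := by
  rw [abs_pow]; exact pow_le_pow_left₀ (abs_nonneg _) (hu.bound x) k

lemma SlowlyVarying.isTame_pow (hd : 5 ≤ d) (hu : SlowlyVarying κ u) {a b : ℕ}
    (hab : (a = 2 ∧ b = 2) ∨ (a = 4 ∧ b = 2) ∨ (a = 2 ∧ b = 4)) :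
    IsTame fun x y => u x ^ a * M d x y * u y ^ b := by
  obtain ⟨c, hc0, hc⟩ := hu.difference
  have hb : ∀ x, |u x ^ a * u x ^ b| ≤ κ ^ (a + b) := fun x => by
    rw [← pow_add]; exact hu.pow_le _ x
  have h0 : ∀ x k : Site d, 0 ≤ c * (1 + normSq k) * weight x := fun x k =>
    mul_nonneg (mul_nonneg hc0 (by linarith [normSq_nonneg k])) (weight_pos x).le
  rcases hab with ⟨rfl, rfl⟩ | ⟨rfl, rfl⟩ | ⟨rfl, rfl⟩
  · exact isTame_conj_mFun hd hb hc
  · refine isTame_conj_mFun hd hb (c := κ ^ 2 * c) fun x k => ?_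
    have e : u x ^ 4 * (u (x + k) ^ 2 - u x ^ 2)
        = u x ^ 2 * (u x ^ 2 * (u (x + k) ^ 2 - u x ^ 2)) := by ring
    rw [e, abs_mul, mul_assoc, mul_assoc, ← mul_assoc c]
    exact mul_le_mul (hu.pow_le 2 x) (hc x k) (abs_nonneg _) (sq_nonneg _)
  · refine isTame_conj_mFun hd hb (c := 2 * κ ^ 2 * c) fun x k => ?_
    have e : u x ^ 2 * (u (x + k) ^ 4 - u x ^ 4)
        = (u (x + k) ^ 2 + u x ^ 2) * (u x ^ 2 * (u (x + k) ^ 2 - u x ^ 2)) := by ring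
    rw [e, abs_mul, mul_assoc, mul_assoc, ← mul_assoc c]
    refine mul_le_mul ?_ (hc x k) (abs_nonneg _) (by positivity)
    refine (abs_add_le _ _).trans ?_
    linarith [hu.pow_le 2 x, hu.pow_le 2 (x + k)]

lemma SlowlyVarying.isSchur_pow (hd : 5 ≤ d) (hu : SlowlyVarying κ u) (a b : ℕ) :
    IsSchur (eabs fun x y => u x ^ a * M d x y * u y ^ b) := by
  refine ((isSchur_M hd).const_mul (c := ENNReal.ofReal κ ^ (a + b)) (by finiteness)).mono
    fun x y => ?_
  simp only [eabs, enorm_mul]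
  calc _ ≤ ENNReal.ofReal κ ^ a * ‖M d x y‖ₑ * ENNReal.ofReal κ ^ b := by
        gcongr <;> exact enorm_pow_le_of_abs_le hu.bound _ _
    _ = _ := by ring

lemma transp_conj (a b : ℕ) : transp (fun x y => u x ^ a * M d x y * u y ^ b)
    = fun x y => u x ^ b * M d x y * u y ^ a := by
  ext x y; simp only [transp, M_comm y x]; ring

lemma SlowlyVarying.isSq_conj (hd : 5 ≤ d) (hu : SlowlyVarying κ u) {a b : ℕ}
    (hab : (a = 2 ∧ b = 2) ∨ (a = 4 ∧ b = 2) ∨ (a = 2 ∧ b = 4)) {A B : Kern d}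
    (hA : A = G0 d ∨ A = Gt d) (hB : B = G0 d ∨ B = Gt d) :
    IsSq (eabs (kprod [A, fun x y => u x ^ a * M d x y * u y ^ b, B])) :=
  isSq_sandwich hd (hu.isTame_pow hd hab)
    (by rw [transp_conj]; exact hu.isTame_pow hd (by omega)) (hu.isSchur_pow hd a b) hA hB

lemma isSchur_cKern (hd : 5 ≤ d) (hu : SlowlyVarying κ u) : IsSchur (eabs (cKern u)) := by
  obtain ⟨A, hA, h⟩ := exists_dominated_cKern hd κ
  exact hA.mono (h.bound u hu.bound)

lemma SlowlyVarying.isSq_cKern (hd : 5 ≤ d) (hu : SlowlyVarying κ u) {A B : Kern d}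
    (hA : A = G0 d ∨ A = Gt d) (hB : B = G0 d ∨ B = Gt d) :
    IsSq (eabs (kprod [A, cKern u, B])) := by
  obtain ⟨c, hc0, hc⟩ := hu.difference
  have h : IsTame (cKern u) := isTame_cKern hd hu.bound hc0 hc
  have e : transp (cKern u) = cKern u := by ext x y; exact cKern_comm u y x
  exact isSq_sandwich hd h (by rwa [e]) (isSchur_cKern hd hu) hA hB

end Tame

/-- The products of kernels that occur in the expansion: one Green's function, or two Green's
functions around one of the kernels `W`, `C` that the Laplacian dominates, up to factors `v²`. -/
def goodProduct : List Atom → Bool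
  | [.g, .W, .g] => true
  | [.g, .W, .gt] => true
  | [.gt, .W, .g] => true
  | [.gt, .W, .gt] => true
  | [.g, .C, .g] => true
  | [.g, .C, .gt] => true
  | [.gt, .C, .g] => true
  | [.g, .vpow 2, .W, .g] => true
  | [.g, .vpow 2, .W, .gt] => true
  | [.gt, .vpow 2, .W, .g] => true
  | [.g, .W, .vpow 2, .g] => true
  | [.g, .W, .vpow 2, .gt] => true
  | [.gt, .W, .vpow 2, .g] => true
  | [.g, .W, .gt, .vpow 2] => true
  | L => !L.isEmpty && decide (greenCount L = 1)

lemma goodProduct_spec {L : List Atom} (h : goodProduct L = true) :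
    L ≠ [] ∧ greenCount L ≤ 2 := by
  unfold goodProduct at h
  split at h <;> first | (simp [greenCount, Atom.green]; done) | skip
  simp only [Bool.and_eq_true, decide_eq_true_eq, Bool.not_eq_true', List.isEmpty_eq_false_iff] at h
  exact ⟨h.1, by omega⟩

lemma isBdd_epath (hd : 5 ≤ d) {κ : ℝ} {u : Site d → ℝ} (hu : ∀ x, |u x| ≤ κ) {L : List Atom}
    (hL : L ≠ []) (hg : greenCount L ≤ 2) : IsBdd (epath (L.map fun a => a.kern u)) := by
  obtain ⟨A, hA, h⟩ := exists_dominatedPath hd κ L hL hg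
  have := hA.isBdd.mono (h.bound u hu)
  simpa [List.map_map, Function.comp_def] using this

lemma isSq_eabs_of_eq {K K' : Kern d} (h : IsSq (eabs K)) (e : K' = K) : IsSq (eabs K') := e ▸ h

/-- All products in the expansion have rows and columns bounded in `ℓ²`; for those with two Green's
functions this rests on the cancellation in `W` and `C`. -/
lemma SlowlyVarying.isSq_kprod (hd : 5 ≤ d) {κ : ℝ} {u : Site d → ℝ} (hu : SlowlyVarying κ u)
    {L : List Atom} (h : goodProduct L = true) :
    IsSq (eabs (kprod (L.map fun a => a.kern u))) := by
  have hg : G0 d = G0 d ∨ G0 d = Gt d := Or.inl rfl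
  have ht : Gt d = G0 d ∨ Gt d = Gt d := Or.inr rfl
  have hbd : ∀ L : List Atom, L ≠ [] → greenCount L ≤ 2 →
      IsBdd (epath (L.map fun a => a.kern u)) := fun L => isBdd_epath hd hu.bound
  have sq : ∀ {A : Kern d}, A = G0 d ∨ A = Gt d → IsSq (eabs A) := by
    rintro A (rfl | rfl)
    · exact isSq_G0 hd
    · exact isSq_Gt hd
  have hk : ∀ a : Atom, (a = .g ∨ a = .gt) → a.kern u = G0 d ∨ a.kern u = Gt d := by
    rintro a (rfl | rfl)
    exacts [hg, ht]
  -- a power of `u` next to `W` is absorbed into `W`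
  have hleft : ∀ a b : Atom, (a = .g ∨ a = .gt) → (b = .g ∨ b = .gt) →
      IsSq (eabs (kprod ([a, .vpow 2, .W, b].map fun a => a.kern u))) := by
    intro a b ha hb
    have hA := hk a ha
    have hB := hk b hb
    have hg2 : greenCount [.W, b] ≤ 1 ∧ greenCount [.vpow 2, .W, b] ≤ 1
        ∧ greenCount [a, .vpow 2, .W, b] ≤ 2 := by
      rcases ha with rfl | rfl <;> rcases hb with rfl | rfl <;> simp [greenCount, Atom.green]
    refine isSq_eabs_of_eq (hu.isSq_conj hd (a := 4) (b := 2) (by simp) hA hB) ?_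
    refine kprod_cons_congr _ (by simp) (by simp) (hbd _ (by simp) hg2.2.2)
      (isBdd_epath_three (sq hA) (hu.isSchur_pow hd 4 2) (sq hB)) ?_
    ext x y
    have h1 := kprod_diag_cons (fun n => u n ^ 2) (L := [wKern u, b.kern u]) (by simp)
      (hbd [.vpow 2, .W, b] (by simp) (by omega)) x y
    have h2 := kprod_two (hbd [.W, b] (by simp) (by omega)) x y
    have h3 := kprod_two (isSq_epath_two (hu.isSchur_pow hd 4 2) (sq hB)).isBdd x y
    refine h1.trans ?_
    refine (congrArg _ h2).trans ?_
    rw [h3, ← tsum_mul_left]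
    refine tsum_congr fun z => ?_
    simp only [Atom.kern, wKern]; ring
  have hright : ∀ a b : Atom, (a = .g ∨ a = .gt) → (b = .g ∨ b = .gt) →
      IsSq (eabs (kprod ([a, .W, .vpow 2, b].map fun a => a.kern u))) := by
    intro a b ha hb
    have hA := hk a ha
    have hB := hk b hb
    have hg2 : greenCount [.vpow 2, b] ≤ 1 ∧ greenCount [.W, .vpow 2, b] ≤ 1
        ∧ greenCount [a, .W, .vpow 2, b] ≤ 2 := by
      rcases ha with rfl | rfl <;> rcases hb with rfl | rfl <;> simp [greenCount, Atom.green]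
    refine isSq_eabs_of_eq (hu.isSq_conj hd (a := 2) (b := 4) (by simp) hA hB) ?_
    refine kprod_cons_congr _ (by simp) (by simp) (hbd _ (by simp) hg2.2.2)
      (isBdd_epath_three (sq hA) (hu.isSchur_pow hd 2 4) (sq hB)) ?_
    ext x y
    have h1 := kprod_cons (wKern u) (L := [diag fun n => u n ^ 2, b.kern u]) (by simp)
      (epath_ne_top_of_isBdd (hbd [.W, .vpow 2, b] (by simp) (by omega)) x y)
    have h3 := kprod_two (isSq_epath_two (hu.isSchur_pow hd 2 4) (sq hB)).isBdd x y
    refine h1.trans ?_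
    rw [h3]
    refine tsum_congr fun z => ?_
    have h4 := kprod_diag_cons (fun n => u n ^ 2) (L := [b.kern u]) (by simp)
      (hbd [.vpow 2, b] (by simp) (by omega)) z y
    rw [h4, kprod_singleton]
    simp only [wKern]; ring
  have h3 : ∀ {A B : Kern d}, (A = G0 d ∨ A = Gt d) → (B = G0 d ∨ B = Gt d) →
      IsSq (eabs (kprod [A, wKern u, B])) := fun hA hB =>
    hu.isSq_conj hd (a := 2) (b := 2) (by simp) hA hB
  unfold goodProduct at h
  split at h
  · exact h3 hg hg
  · exact h3 hg ht
  · exact h3 ht hg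
  · exact h3 ht ht
  · exact hu.isSq_cKern hd hg hg
  · exact hu.isSq_cKern hd hg ht
  · exact hu.isSq_cKern hd ht hg
  · exact hleft _ _ (by simp) (by simp)
  · exact hleft _ _ (by simp) (by simp)
  · exact hleft _ _ (by simp) (by simp)
  · exact hright _ _ (by simp) (by simp)
  · exact hright _ _ (by simp) (by simp)
  · exact hright _ _ (by simp) (by simp)
  · -- a power of `u` at the end multiplies the columns by bounded numbers
    have h1 := (h3 hg ht).emul_isSchur (isSchur_ediag (d := d) (f := fun x => ‖u x ^ 2‖ₑ)
      (c := ENNReal.ofReal κ ^ 2) (by finiteness) (enorm_pow_le_of_abs_le hu.bound 2))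
    refine h1.mono fun x y => ?_
    have e2 : ∀ z, kprod [wKern u, Gt d, diag fun n => u n ^ 2] z y
        = kprod [wKern u, Gt d] z y * u y ^ 2 := by
      intro z
      have h4 := kprod_cons (wKern u) (L := [Gt d, diag fun n => u n ^ 2]) (by simp)
        (epath_ne_top_of_isBdd (hbd [.W, .gt, .vpow 2] (by simp) (by decide)) z y)
      have h5 := kprod_two (hbd [.W, .gt] (by simp) (by decide)) z y
      refine h4.trans (Eq.trans ?_ (congrArg (· * u y ^ 2) h5).symm)
      simp only [Atom.kern]
      rw [← tsum_mul_right]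
      refine tsum_congr fun w => ?_
      have h6 := kprod_snoc_diag (A := Gt d) (fun n => u n ^ 2)
        (hbd [.gt, .vpow 2] (by simp) (by decide)) w y
      rw [h6]
      ring
    have e3 : kprod [G0 d, wKern u, Gt d, diag fun n => u n ^ 2] x y
        = kprod [G0 d, wKern u, Gt d] x y * u y ^ 2 := by
      have h4 := kprod_cons (G0 d) (L := [wKern u, Gt d, diag fun n => u n ^ 2]) (by simp)
        (epath_ne_top_of_isBdd (hbd [.g, .W, .gt, .vpow 2] (by simp) (by decide)) x y)
      have h5 := kprod_cons (G0 d) (L := [wKern u, Gt d]) (by simp)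
        (epath_ne_top_of_isBdd (hbd [.g, .W, .gt] (by simp) (by decide)) x y)
      rw [h4, h5, ← tsum_mul_right]
      refine tsum_congr fun z => ?_
      rw [e2]; ring
    rw [emul, tsum_eq_single y (fun z hz => by simp [ediag, hz])]
    refine le_of_eq ((congrArg _ e3).trans ?_)
    rw [enorm_mul]; simp [ediag, eabs]
  · simp only [Bool.and_eq_true, decide_eq_true_eq, Bool.not_eq_true',
      List.isEmpty_eq_false_iff] at h
    obtain ⟨A, hA, hdom⟩ := exists_dominatedPath hd κ _ h.1 (by omega)
    have hb := hdom.bound u hu.bound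
    simp only [List.map_map, Function.comp_def] at hb
    rw [h.2] at hA
    exact IsSq.mono hA fun x y => (enorm_kprod_le (by simpa using h.1) x y).trans (hb x y)

/-! ### The words of the expansion as syntactic objects -/

/-- An integer polynomial in `σ, ρ, η`: the entry `(c, a, b, e)` stands for `c σ^a ρ^b η^e`. -/
abbrev Coef := List (ℤ × ℕ × ℕ × ℕ)

/-- The value of a polynomial at given `σ, ρ, η`. -/
def Coef.eval (σ ρ η : ℝ) (c : Coef) : ℝ :=
  (c.map fun m => (m.1 : ℝ) * σ ^ m.2.1 * ρ ^ m.2.2.1 * η ^ m.2.2.2).sum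

/-- A word `A₀, …, A_s`, each letter being a product of named kernels. -/
abbrev Word := List (List Atom)

/-- The terms of order `i`, except `-G₀ D₇ G₀`, as linear combinations of words. -/
def wordTerms : ℕ → List (Coef × Word)
  | 0 => [([(1, 0, 0, 0)], [[.g]])]
  | 1 => [([(-1, 0, 0, 0)], [[.g], [.g]])]
  | 2 => [([(1, 0, 0, 0)], [[.g], [.g], [.g]])]
  | 3 =>
    [([(1, 2, 0, 0)], [[.g, .vpow 2], [.g]]),
     ([(-1, 0, 0, 0)], [[.g], [.g], [.g], [.g]])]
  | 4 =>
    [([(-1, 2, 0, 0)], [[.g, .vpow 2], [.g], [.g]]),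
     ([(-1, 2, 0, 0)], [[.g], [.g, .vpow 2], [.g]]),
     ([(1, 0, 0, 0)], [[.g], [.g], [.g], [.g], [.g]]),
     ([(1, 0, 0, 0)], [[.g, .W, .g]])]
  | 5 =>
    [([(-2, 1, 1, 0)], [[.g, .vpow 4], [.g]]),
     ([(1, 0, 0, 0)], [[.g], [.D4, .g]]),
     ([(-1, 0, 0, 0)], [[.g], [.gt, .W, .g]]),
     ([(-1, 0, 0, 0)], [[.g, .W, .gt], [.g]]),
     ([(1, 2, 0, 0)], [[.g, .vpow 2], [.g], [.g], [.g]]),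
     ([(1, 2, 0, 0)], [[.g], [.g, .vpow 2], [.g], [.g]]),
     ([(1, 2, 0, 0)], [[.g], [.g], [.g, .vpow 2], [.g]]),
     ([(-1, 0, 0, 0)], [[.g], [.g], [.g], [.g], [.g], [.g]])]
  | 6 =>
    [([(2, 1, 1, 0)], [[.g, .vpow 4], [.g], [.g]]),
     ([(2, 1, 1, 0)], [[.g], [.g, .vpow 4], [.g]]),
     ([(1, 4, 0, 0)], [[.g, .vpow 2], [.g, .vpow 2], [.g]]),
     ([(-1, 2, 0, 0)], [[.g, .vpow 2], [.g], [.g], [.g], [.g]]),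
     ([(-1, 2, 0, 0)], [[.g], [.g, .vpow 2], [.g], [.g], [.g]]),
     ([(-1, 2, 0, 0)], [[.g], [.g], [.g, .vpow 2], [.g], [.g]]),
     ([(-1, 2, 0, 0)], [[.g], [.g], [.g], [.g, .vpow 2], [.g]]),
     ([(1, 0, 0, 0)], [[.g], [.g], [.g], [.g], [.g], [.g], [.g]]),
     ([(1, 0, 0, 0)], [[.g, .W, .gt], [.g], [.g]]),
     ([(1, 0, 0, 0)], [[.g], [.gt, .W, .gt], [.g]]),
     ([(1, 0, 0, 0)], [[.g], [.g], [.gt, .W, .g]]),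
     ([(-1, 0, 0, 0)], [[.g], [.D4, .g], [.g]]),
     ([(-1, 0, 0, 0)], [[.g], [.g], [.D4, .g]]),
     ([(4, 0, 0, 0)], [[.g, .C, .g]]),
     ([(-2, 2, 0, 0)], [[.g, .vpow 2, .W, .g]]),
     ([(-2, 2, 0, 0)], [[.g, .W, .vpow 2, .g]])]
  | 7 =>
    [([(2, 1, 0, 0)], [[.g], [.R6, .g]]),
     ([(8, 1, 0, 1), (-7, 6, 0, 0), (12, 3, 1, 0)], [[.g, .vpow 6], [.g]]),
     ([(-2, 1, 1, 0)], [[.g, .vpow 4], [.g], [.g], [.g]]),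
     ([(-2, 1, 1, 0)], [[.g], [.g, .vpow 4], [.g], [.g]]),
     ([(-2, 1, 1, 0)], [[.g], [.g], [.g, .vpow 4], [.g]]),
     ([(-1, 4, 0, 0)], [[.g, .vpow 2], [.g, .vpow 2], [.g], [.g]]),
     ([(-1, 4, 0, 0)], [[.g, .vpow 2], [.g], [.g, .vpow 2], [.g]]),
     ([(-1, 4, 0, 0)], [[.g], [.g, .vpow 2], [.g, .vpow 2], [.g]]),
     ([(1, 2, 0, 0)], [[.g, .vpow 2], [.g], [.g], [.g], [.g], [.g]]),
     ([(1, 2, 0, 0)], [[.g], [.g, .vpow 2], [.g], [.g], [.g], [.g]]),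
     ([(1, 2, 0, 0)], [[.g], [.g], [.g, .vpow 2], [.g], [.g], [.g]]),
     ([(1, 2, 0, 0)], [[.g], [.g], [.g], [.g, .vpow 2], [.g], [.g]]),
     ([(1, 2, 0, 0)], [[.g], [.g], [.g], [.g], [.g, .vpow 2], [.g]]),
     ([(1, 2, 0, 0)], [[.g, .W, .gt, .vpow 2], [.g]]),
     ([(1, 2, 0, 0)], [[.g, .vpow 2], [.gt, .W, .g]]),
     ([(2, 2, 0, 0)], [[.g, .W, .vpow 2, .gt], [.g]]),
     ([(2, 2, 0, 0)], [[.g, .vpow 2, .W, .gt], [.g]]),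
     ([(2, 2, 0, 0)], [[.g], [.gt, .vpow 2, .W, .g]]),
     ([(2, 2, 0, 0)], [[.g], [.gt, .W, .vpow 2, .g]]),
     ([(-3, 2, 0, 0)], [[.g, .vpow 2], [.D4, .g]]),
     ([(-2, 2, 0, 0)], [[.g], [.D61, .g]]),
     ([(-1, 0, 0, 0)], [[.g], [.g], [.g], [.g], [.g], [.g], [.g], [.g]]),
     ([(-1, 0, 0, 0)], [[.g, .W, .gt], [.g], [.g], [.g]]),
     ([(-1, 0, 0, 0)], [[.g], [.gt, .W, .gt], [.g], [.g]]),
     ([(-1, 0, 0, 0)], [[.g], [.g], [.gt, .W, .gt], [.g]]),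
     ([(-1, 0, 0, 0)], [[.g], [.g], [.g], [.gt, .W, .g]]),
     ([(1, 0, 0, 0)], [[.g], [.D4, .g], [.g], [.g]]),
     ([(1, 0, 0, 0)], [[.g], [.g], [.D4, .g], [.g]]),
     ([(1, 0, 0, 0)], [[.g], [.g], [.g], [.D4, .g]]),
     ([(1, 0, 0, 0)], [[.g, .vpow 2, .M4, .vpow 2], [.M4, .vpow 2, .g]]),
     ([(-4, 0, 0, 0)], [[.g, .C, .gt], [.g]]),
     ([(-4, 0, 0, 0)], [[.g], [.gt, .C, .g]]),
     ([(4, 0, 0, 0)], [[.g], [.D62, .g]]),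
     ([(1, 0, 0, 0)], [[.g], [.S, .g]]),
     ([(1, 0, 0, 0)], [[.g, .St], [.g]])]
  | _ => []

/-- The word of kernels with potential `u` that belongs to a syntactic word. -/
def Word.kern (u : Site d → ℝ) (A : Word) : List (List (Kern d)) :=
  A.map fun L => L.map fun a => a.kern u

lemma terms_eq (d : ℕ) (α κ : ℝ) {i : ℕ} (hi : i ≤ 7) : terms d α κ i
    = (wordTerms i).map fun p => (p.1.eval (sigma d) (rho d) (eta d), Word.kern (v α κ) p.2) := by
  have h : i = 0 ∨ i = 1 ∨ i = 2 ∨ i = 3 ∨ i = 4 ∨ i = 5 ∨ i = 6 ∨ i = 7 := by omega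
  rcases h with rfl | rfl | rfl | rfl | rfl | rfl | rfl | rfl <;>
    simp only [terms, terms0, terms1, terms2, terms3, terms4, terms5, terms6, terms7, wordTerms,
      List.map_cons, List.map_nil] <;>
    repeat'
      first
        | refine congrArg₂ List.cons (Prod.ext ?_ rfl) ?_
        | rfl
        | (simp only [Coef.eval, List.map_cons, List.map_nil, List.sum_cons, List.sum_nil,
            pow_zero, pow_one]; push_cast; ring)

lemma coefficientSeriesConverge (hd : 5 ≤ d) {α κ : ℝ} (hα : 0 ≤ α) (hκ : 0 ≤ κ) :
    CoefficientSeriesConverge d α κ := by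
  have hu := abs_v_le (d := d) hα hκ
  have hK : ∀ k, ENNReal.ofReal κ ^ k ≠ ∞ := fun k => by finiteness
  have h4 : ∀ (k : ℕ) (x : Site d), Summable fun z => v α κ z ^ k * Gt d x z ^ 4 := by
    intro k x
    obtain ⟨c, hc, hb⟩ := (isSchur_gt_pow hd (k := 4) (by norm_num)).1
    refine summable_of_tsum_enorm_ne_top (ne_top_of_le_ne_top
      (ENNReal.mul_ne_top (hK k) (ne_top_of_le_ne_top hc (hb x))) ?_)
    rw [← ENNReal.tsum_mul_left]
    refine ENNReal.tsum_le_tsum fun z => ?_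
    rw [enorm_mul, enorm_pow (Gt d x z)]
    gcongr
    exact enorm_pow_le_of_abs_le hu k z
  refine ⟨h4 2, ?_, fun x y => ?_, h4 4, fun x => ?_, fun x y => ?_⟩
  · exact prodConverges_of_isBdd (by simp)
      (isBdd_epath hd hu (L := [.gt, .W, .gt]) (by simp) (by decide))
  · obtain ⟨c, hc, hb⟩ := (isSchur_gtSq hd).emul_isBdd (isBdd_pow (isSq_Gt hd).isBdd 2)
    refine summable_of_tsum_enorm_ne_top (ne_top_of_le_ne_top
      (ENNReal.mul_ne_top (hK 2) (ne_top_of_le_ne_top hc (hb x y))) ?_)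
    rw [emul, ← ENNReal.tsum_mul_left]
    refine ENNReal.tsum_le_tsum fun z => ?_
    rw [enorm_mul, enorm_mul, enorm_pow, enorm_pow (Gt d z y)]
    calc _ ≤ ‖Gt d x z‖ₑ ^ 2 * ENNReal.ofReal κ ^ 2 * ‖Gt d z y‖ₑ ^ 2 := by
          gcongr; exact enorm_pow_le_of_abs_le hu 2 _
      _ = _ := by simp only [gtSq, eabs]; ring
  · obtain ⟨c, hc, hb⟩ := exists_triangle_bound hd
    refine summable_of_tsum_enorm_ne_top (ne_top_of_le_ne_top
      (ENNReal.mul_ne_top (hK 4) (ne_top_of_le_ne_top hc (hb x))) ?_)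
    rw [← ENNReal.tsum_mul_left]
    refine ENNReal.tsum_le_tsum fun p => ?_
    simp only [enorm_mul, gtSq]
    rw [enorm_pow (Gt d x p.1), enorm_pow (Gt d x p.2), enorm_pow (Gt d p.1 p.2)]
    calc _ ≤ ENNReal.ofReal κ ^ 2 * ENNReal.ofReal κ ^ 2 * ‖Gt d x p.1‖ₑ ^ 2
          * ‖Gt d x p.2‖ₑ ^ 2 * ‖Gt d p.1 p.2‖ₑ ^ 2 := by
          gcongr <;> exact enorm_pow_le_of_abs_le hu 2 _
      _ = _ := by ring
  · obtain ⟨c, hc, hb⟩ := (isSchur_gt_pow hd (k := 3) (by norm_num)).emul_isBdd (isSq_Gt hd).isBdd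
    refine summable_of_tsum_enorm_ne_top (ne_top_of_le_ne_top
      (ENNReal.mul_ne_top (hK 2) (ne_top_of_le_ne_top hc (hb x y))) ?_)
    rw [emul, ← ENNReal.tsum_mul_left]
    refine ENNReal.tsum_le_tsum fun z => ?_
    rw [enorm_mul, enorm_mul, enorm_pow]
    calc _ ≤ ‖Gt d x z‖ₑ ^ 3 * ENNReal.ofReal κ ^ 2 * ‖Gt d z y‖ₑ := by
          gcongr; exact enorm_pow_le_of_abs_le hu 2 _
      _ = _ := by simp only [eabs]; ring

/-! ### Random signs -/

/-- The sites at which a tuple has odd multiplicity. -/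
def oddSet {ι : Type*} (I : Finset ι) (t : ι → Site d) : Finset (Site d) :=
  (I.image t).filter fun x => Odd (I.filter fun i => t i = x).card

/-- The product of the signs over a finite set of sites. -/
def chi {Ω : Type*} (ω : Site d → Ω → ℝ) (S : Finset (Site d)) (w : Ω) : ℝ := ∏ x ∈ S, ω x w

lemma mem_oddSet {ι : Type*} {I : Finset ι} {t : ι → Site d} {x : Site d} :
    x ∈ oddSet I t ↔ Odd (I.filter fun i => t i = x).card := by
  rw [oddSet, Finset.mem_filter, and_iff_right_of_imp]
  intro h
  obtain ⟨i, hi⟩ := Finset.card_pos.1 h.pos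
  rw [Finset.mem_filter] at hi
  exact Finset.mem_image.2 ⟨i, hi⟩

lemma prod_eq_chi_oddSet {ι Ω : Type*} {ω : Site d → Ω → ℝ} {w : Ω} (hw : ∀ x, ω x w ^ 2 = 1)
    (I : Finset ι) (t : ι → Site d) : ∏ i ∈ I, ω (t i) w = chi ω (oddSet I t) w := by
  rw [Finset.prod_comp (fun x => ω x w) t, chi, oddSet, Finset.prod_filter]
  refine Finset.prod_congr rfl fun x _ => ?_
  split_ifs with h
  · obtain ⟨k, hk⟩ := h
    rw [hk, pow_succ, pow_mul, hw, one_pow, one_mul]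
  · obtain ⟨k, hk⟩ := Nat.not_odd_iff_even.1 h
    rw [hk, ← two_mul, pow_mul, hw, one_pow]

lemma chi_mul_chi {Ω : Type*} {ω : Site d → Ω → ℝ} {w : Ω} (hw : ∀ x, ω x w ^ 2 = 1)
    (S T : Finset (Site d)) : chi ω S w * chi ω T w = chi ω (symmDiff S T) w := by
  have h1 : chi ω S w = chi ω (S \ T) w * chi ω (S ∩ T) w := by
    simp only [chi]
    rw [← Finset.prod_union (Finset.disjoint_sdiff_inter S T), Finset.sdiff_union_inter]
  have h2 : chi ω T w = chi ω (T \ S) w * chi ω (S ∩ T) w := by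
    simp only [chi]
    rw [Finset.inter_comm, ← Finset.prod_union (Finset.disjoint_sdiff_inter T S),
      Finset.sdiff_union_inter]
  have h3 : chi ω (symmDiff S T) w = chi ω (S \ T) w * chi ω (T \ S) w := by
    simp only [chi]
    rw [← Finset.prod_union disjoint_sdiff_sdiff]; rfl
  have h4 : chi ω (S ∩ T) w ^ 2 = 1 := by
    simp only [chi]
    rw [← Finset.prod_pow]; exact Finset.prod_eq_one fun x _ => hw x
  rw [h1, h2, h3]
  linear_combination (chi ω (S \ T) w * chi ω (T \ S) w) * h4

section Field

variable {Ω : Type*} [MeasurableSpace Ω] {P : Measure Ω}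
  {ω : Site d → Ω → ℝ}

lemma IsBernoulliField.ae_sq_eq_one (hω : IsBernoulliField P ω) :
    ∀ᵐ w ∂P, ∀ n, ω n w ^ 2 = 1 := by
  rw [ae_all_iff]
  intro n
  have h : ∀ᵐ x ∂(P.map (ω n)), x ^ 2 = 1 := by
    have h2 : (2 : ℝ≥0∞)⁻¹ ≠ 0 := by simp
    rw [hω.law n, ae_add_measure_iff]
    constructor <;> refine Measure.ae_smul_measure ?_ _ <;>
      (rw [ae_dirac_eq]; norm_num)
  exact ae_of_ae_map (hω.measurable n).aemeasurable h

lemma IsBernoulliField.integral_eq_zero (hω : IsBernoulliField P ω) (n : Site d) :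
    ∫ w, ω n w ∂P = 0 := by
  have h : ∫ x, x ∂(P.map (ω n)) = ∫ w, ω n w ∂P :=
    integral_map (hω.measurable n).aemeasurable aestronglyMeasurable_id
  rw [← h, hω.law n, integral_add_measure, integral_smul_measure, integral_smul_measure]
  · simp
  · exact (integrable_dirac (by simp)).smul_measure (by simp)
  · exact (integrable_dirac (by simp)).smul_measure (by simp)

lemma IsBernoulliField.measurable_chi (hω : IsBernoulliField P ω) (S : Finset (Site d)) :
    Measurable (chi ω S) := by
  have : chi ω S = fun w => ∏ x ∈ S, ω x w := rfl
  rw [this]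
  exact Finset.measurable_fun_prod S fun x _ => hω.measurable x

lemma chi_sq {Ω : Type*} {ω : Site d → Ω → ℝ} {w : Ω} (hw : ∀ x, ω x w ^ 2 = 1)
    (S : Finset (Site d)) : chi ω S w ^ 2 = 1 := by
  simp only [chi]
  rw [← Finset.prod_pow]; exact Finset.prod_eq_one fun x _ => hw x

variable [IsProbabilityMeasure P]

lemma IsBernoulliField.memLp_chi (hω : IsBernoulliField P ω) (S : Finset (Site d)) :
    MemLp (chi ω S) 2 P := by
  refine MemLp.of_bound (hω.measurable_chi S).aestronglyMeasurable 1 ?_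
  filter_upwards [hω.ae_sq_eq_one] with w hw
  have := chi_sq hw S
  rw [Real.norm_eq_abs]
  exact (sq_le_one_iff_abs_le_one _).1 this.le

lemma IsBernoulliField.integral_chi (hω : IsBernoulliField P ω) (S : Finset (Site d)) :
    ∫ w, chi ω S w ∂P = if S = ∅ then 1 else 0 := by
  split_ifs with h
  · subst h; simp [chi]
  · obtain ⟨x, hx⟩ := Finset.nonempty_iff_ne_empty.2 h
    have hind : iIndepFun (fun x : S => ω x) P := hω.indep.precomp Subtype.val_injective
    have h1 := hind.integral_fun_prod_eq_prod_integral
      (fun i => (hω.measurable i).aestronglyMeasurable)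
    have h2 : ∫ w, chi ω S w ∂P = ∫ w, ∏ i : S, ω i w ∂P := by
      refine integral_congr_ae (Eventually.of_forall fun w => ?_)
      simp only [chi]
      exact (Finset.prod_coe_sort S fun x => ω x w).symm
    rw [h2, h1]
    exact Finset.prod_eq_zero (Finset.mem_univ ⟨x, hx⟩) (hω.integral_eq_zero x)

lemma IsBernoulliField.cancels_iff (hω : IsBernoulliField P ω) {s : ℕ} (t : Fin s → Site d)
    (a b : Fin s) : Cancels P ω t a b ↔ oddSet (Finset.Icc a b) t = ∅ := by
  have h : ∀ᵐ w ∂P, ∏ i ∈ Finset.Icc a b, ω (t i) w = chi ω (oddSet (Finset.Icc a b) t) w := by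
    filter_upwards [hω.ae_sq_eq_one] with w hw using prod_eq_chi_oddSet hw _ _
  constructor
  · intro hc
    by_contra hne
    have h1 : ∫ w, chi ω (oddSet (Finset.Icc a b) t) w ∂P = ∫ _, (1 : ℝ) ∂P := by
      refine integral_congr_ae ?_
      filter_upwards [h, hc] with w h1 h2
      rw [← h1, h2]
    rw [hω.integral_chi, if_neg hne] at h1
    simp at h1
  · intro he
    rw [Cancels]
    filter_upwards [h] with w hw
    rw [hw, he]; simp [chi]

/-! ### Square-integrable sums of sign products -/

/-- A product of signs as an element of `L²(P)`. -/
def eSign (hω : IsBernoulliField P ω) (S : Finset (Site d)) : Lp ℝ 2 P :=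
  (hω.memLp_chi S).toLp _

lemma inner_eSign (hω : IsBernoulliField P ω) (S T : Finset (Site d)) :
    inner ℝ (eSign hω S) (eSign hω T) = if S = T then 1 else 0 := by
  rw [L2.inner_def]
  have h : ∫ a, inner ℝ (eSign hω S a) (eSign hω T a) ∂P
      = ∫ a, chi ω (symmDiff S T) a ∂P := by
    refine integral_congr_ae ?_
    filter_upwards [(hω.memLp_chi S).coeFn_toLp, (hω.memLp_chi T).coeFn_toLp,
      hω.ae_sq_eq_one] with w h1 h2 hw
    simp only [eSign]
    rw [h1, h2, ← chi_mul_chi hw]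
    simp [mul_comm]
  rw [h, hω.integral_chi]
  simp only [← Finset.bot_eq_empty, symmDiff_eq_bot]

end Field

/-- A family in a Hilbert space with absolutely summable Gram matrix is summable. -/
lemma summable_of_summable_inner {E ι : Type*} [NormedAddCommGroup E] [InnerProductSpace ℝ E]
    [CompleteSpace E] {x : ι → E} (h : Summable fun p : ι × ι => |inner ℝ (x p.1) (x p.2)|) :
    Summable x ∧ ‖∑' i, x i‖ ^ 2 ≤ ∑' p : ι × ι, |inner ℝ (x p.1) (x p.2)| := by
  classical
  have hsq : ∀ F : Finset ι, ‖∑ i ∈ F, x i‖ ^ 2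
      ≤ ∑ p ∈ F ×ˢ F, |inner ℝ (x p.1) (x p.2)| := by
    intro F
    rw [← real_inner_self_eq_norm_sq, sum_inner]
    simp only [inner_sum]
    rw [← Finset.sum_product' F F fun i j => inner ℝ (x i) (x j)]
    exact Finset.sum_le_sum fun p _ => le_abs_self _
  have hs : Summable x := by
    rw [summable_iff_vanishing_norm]
    intro ε hε
    obtain ⟨s, hs⟩ := summable_iff_vanishing_norm.1 h (ε ^ 2) (by positivity)
    refine ⟨s.image Prod.fst, fun t ht => ?_⟩
    have hd : Disjoint (t ×ˢ t) s := by
      rw [Finset.disjoint_left]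
      intro p hp hps
      exact Finset.disjoint_left.1 ht (Finset.mem_product.1 hp).1 (Finset.mem_image_of_mem _ hps)
    have h1 := hs _ hd
    rw [Real.norm_of_nonneg (Finset.sum_nonneg fun _ _ => abs_nonneg _)] at h1
    exact lt_of_pow_lt_pow_left₀ 2 hε.le ((hsq t).trans_lt h1)
  refine ⟨hs, ?_⟩
  refine le_of_tendsto (hs.hasSum.norm.pow 2) (Eventually.of_forall fun F => (hsq F).trans ?_)
  exact h.sum_le_tsum _ fun _ _ => abs_nonneg _

section Field

variable {Ω : Type*} [MeasurableSpace Ω] {P : Measure Ω} [IsProbabilityMeasure P]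
  {ω : Site d → Ω → ℝ}

/-- The sum of `|a_i a_j|` over the pairs with the same sign product. -/
def pairSum {ι : Type*} (a : ι → ℝ) (O : ι → Finset (Site d)) : ℝ≥0∞ :=
  ∑' i, ∑' j, if O i = O j then ‖a i‖ₑ * ‖a j‖ₑ else 0

lemma enorm_inner_smul_eSign (hω : IsBernoulliField P ω) {ι : Type*} (a : ι → ℝ)
    (O : ι → Finset (Site d)) (i j : ι) :
    ‖|inner ℝ (a i • eSign hω (O i)) (a j • eSign hω (O j))|‖ₑ
      = if O i = O j then ‖a i‖ₑ * ‖a j‖ₑ else 0 := by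
  rw [← ofReal_norm, Real.norm_eq_abs, abs_abs, ← Real.norm_eq_abs, ofReal_norm,
    real_inner_smul_left, real_inner_smul_right, inner_eSign]
  split_ifs <;> simp [enorm_mul]

/-- As the sign products are orthonormal, `pairSum` bounds the square of the norm. -/
lemma hasSum_eSign (hω : IsBernoulliField P ω) {ι : Type*} {a : ι → ℝ}
    {O : ι → Finset (Site d)} (h : pairSum a O ≠ ∞) :
    Summable (fun i => a i • eSign hω (O i)) ∧
      ‖∑' i, a i • eSign hω (O i)‖ₑ ^ 2 ≤ pairSum a O := by
  have e : ∑' p : ι × ι, ‖|inner ℝ (a p.1 • eSign hω (O p.1)) (a p.2 • eSign hω (O p.2))|‖ₑ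
      = pairSum a O := by
    simp only [enorm_inner_smul_eSign]
    rw [ENNReal.tsum_prod']; rfl
  have hs : Summable fun p : ι × ι =>
      |inner ℝ (a p.1 • eSign hω (O p.1)) (a p.2 • eSign hω (O p.2))| :=
    summable_of_tsum_enorm_ne_top (by rw [e]; exact h)
  obtain ⟨h1, h2⟩ := summable_of_summable_inner (x := fun i => a i • eSign hω (O i)) hs
  refine ⟨h1, ?_⟩
  rw [← e, ← ofReal_norm, ← ENNReal.ofReal_pow (norm_nonneg _)]
  refine (ENNReal.ofReal_le_ofReal h2).trans (le_of_eq ?_)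
  rw [ENNReal.ofReal_tsum_of_nonneg (fun _ => abs_nonneg _) hs]
  refine tsum_congr fun p => ?_
  rw [← ofReal_norm, Real.norm_eq_abs, abs_abs]

/-- Dominated convergence for sums of sign products. -/
lemma tendsto_tsum_eSign (hω : IsBernoulliField P ω) {ι : Type*} {a : ℕ → ι → ℝ} {a' b : ι → ℝ}
    {O : ι → Finset (Site d)} (hb : pairSum b O ≠ ∞) (ha : ∀ N i, ‖a N i‖ₑ ≤ ‖b i‖ₑ)
    (ha' : ∀ i, ‖a' i‖ₑ ≤ ‖b i‖ₑ) (ht : ∀ i, Tendsto (fun N => a N i) atTop (𝓝 (a' i))) :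
    Tendsto (fun N => ∑' i, a N i • eSign hω (O i)) atTop (𝓝 (∑' i, a' i • eSign hω (O i))) := by
  have hmono : ∀ c : ι → ℝ, (∀ i, ‖c i‖ₑ ≤ ‖b i‖ₑ) → pairSum c O ≠ ∞ := by
    intro c hc
    refine ne_top_of_le_ne_top hb (ENNReal.tsum_le_tsum fun i => ENNReal.tsum_le_tsum fun j => ?_)
    split_ifs
    · exact mul_le_mul' (hc i) (hc j)
    · exact le_rfl
  have hdiff : ∀ N i, ‖a N i - a' i‖ₑ ≤ 2 * ‖b i‖ₑ := fun N i => by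
    rw [two_mul]; exact enorm_sub_le.trans (add_le_add (ha N i) (ha' i))
  set T : ℕ → ι × ι → ℝ≥0∞ := fun N p =>
    if O p.1 = O p.2 then ‖a N p.1 - a' p.1‖ₑ * ‖a N p.2 - a' p.2‖ₑ else 0 with hT
  have hTb : ∀ N p, T N p ≤ 4 * (if O p.1 = O p.2 then ‖b p.1‖ₑ * ‖b p.2‖ₑ else 0) := by
    intro N p
    simp only [hT]
    split_ifs
    · calc _ ≤ (2 * ‖b p.1‖ₑ) * (2 * ‖b p.2‖ₑ) := mul_le_mul' (hdiff N _) (hdiff N _)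
        _ = _ := by ring
    · simp
  have hsum : ∑' p : ι × ι, 4 * (if O p.1 = O p.2 then ‖b p.1‖ₑ * ‖b p.2‖ₑ else 0) ≠ ∞ := by
    rw [ENNReal.tsum_mul_left, ENNReal.tsum_prod']
    exact ENNReal.mul_ne_top (by simp) hb
  have hTp : ∀ N, pairSum (fun i => a N i - a' i) O = ∑' p, T N p := fun N => by
    rw [ENNReal.tsum_prod']; rfl
  have hfinite : ∀ N, pairSum (fun i => a N i - a' i) O ≠ ∞ := fun N => by
    rw [hTp]; exact ne_top_of_le_ne_top hsum (ENNReal.tsum_le_tsum (hTb N))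
  have hpd : Tendsto (fun N => pairSum (fun i => a N i - a' i) O) atTop (𝓝 0) := by
    have key : Tendsto (fun N => ∑' p, (T N p).toReal) atTop (𝓝 (∑' _ : ι × ι, (0 : ℝ))) := by
      refine tendsto_tsum_of_dominated_convergence (ENNReal.summable_toReal hsum) (fun p => ?_)
        (Eventually.of_forall fun N p => ?_)
      · simp only [hT]
        split_ifs
        · have h0 : ∀ i, Tendsto (fun N => ‖a N i - a' i‖) atTop (𝓝 0) := fun i =>
            tendsto_zero_iff_norm_tendsto_zero.1 (by simpa using (ht i).sub_const (a' i))
          simpa [ENNReal.toReal_mul] using (h0 p.1).mul (h0 p.2)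
        · simp
      · rw [Real.norm_of_nonneg ENNReal.toReal_nonneg]
        exact ENNReal.toReal_mono (ENNReal.ne_top_of_tsum_ne_top hsum p) (hTb N p)
    rw [tsum_zero] at key
    have e : ∀ N, pairSum (fun i => a N i - a' i) O = ENNReal.ofReal (∑' p, (T N p).toReal) := by
      intro N
      have hN := hfinite N
      rw [hTp] at hN
      rw [hTp, ← ENNReal.tsum_toReal_eq (ENNReal.ne_top_of_tsum_ne_top hN),
        ENNReal.ofReal_toReal hN]
    simp only [e]
    simpa using ENNReal.tendsto_ofReal key
  rw [tendsto_iff_edist_tendsto_0]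
  have hle : ∀ N, edist (∑' i, a N i • eSign hω (O i)) (∑' i, a' i • eSign hω (O i)) ^ 2
      ≤ pairSum (fun i => a N i - a' i) O := by
    intro N
    rw [edist_eq_enorm_sub, ← Summable.tsum_sub (hasSum_eSign hω (hmono _ (ha N))).1
      (hasSum_eSign hω (hmono _ ha')).1]
    simp only [← sub_smul]
    exact (hasSum_eSign hω (hfinite N)).2
  have h0 := tendsto_of_tendsto_of_tendsto_of_le_of_le tendsto_const_nhds hpd
    (fun _ => zero_le) hle
  have h1 := h0.ennrpow_const (1 / 2)
  rw [ENNReal.zero_rpow_of_pos (by norm_num)] at h1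
  refine h1.congr fun N => ?_
  rw [← ENNReal.rpow_natCast, ← ENNReal.rpow_mul]
  norm_num

lemma coeFn_sum_eSign (hω : IsBernoulliField P ω) {ι : Type*} {f : ι → Ω → ℝ} {a : ι → ℝ}
    {O : ι → Finset (Site d)} (hf : ∀ i, f i =ᵐ[P] fun w => a i * chi ω (O i) w) (F : Finset ι) :
    (fun w => ∑ i ∈ F, f i w) =ᵐ[P] ⇑(∑ i ∈ F, a i • eSign hω (O i)) := by
  classical
  induction F using Finset.induction_on with
  | empty =>
    simp only [Finset.sum_empty]
    filter_upwards [Lp.coeFn_zero ℝ 2 P] with w hw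
    rw [hw]; rfl
  | insert i F hi ih =>
    rw [Finset.sum_insert hi]
    filter_upwards [ih, hf i, Lp.coeFn_add (a i • eSign hω (O i)) (∑ i ∈ F, a i • eSign hω (O i)),
      Lp.coeFn_smul (a i) (eSign hω (O i)), (hω.memLp_chi (O i)).coeFn_toLp] with w h1 h2 h3 h4 h5
    rw [Finset.sum_insert hi, h1, h2, h3, Pi.add_apply, h4, Pi.smul_apply, eSign, h5, smul_eq_mul]

lemma isL2Sum_iff (hω : IsBernoulliField P ω) {ι : Type*} {f : ι → Ω → ℝ} {a : ι → ℝ}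
    {O : ι → Finset (Site d)} (hf : ∀ i, f i =ᵐ[P] fun w => a i * chi ω (O i) w) (S : Ω → ℝ) :
    IsL2Sum P f S ↔ ∃ x : Lp ℝ 2 P, HasSum (fun i => a i • eSign hω (O i)) x ∧ S =ᵐ[P] x := by
  have key : ∀ (x : Lp ℝ 2 P), S =ᵐ[P] x → ∀ F : Finset ι,
      eLpNorm (fun w => ∑ i ∈ F, f i w - S w) 2 P = edist (∑ i ∈ F, a i • eSign hω (O i)) x := by
    intro x hx F
    rw [edist_eq_enorm_sub, Lp.enorm_def]
    refine eLpNorm_congr_ae ?_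
    filter_upwards [coeFn_sum_eSign hω hf F, hx, Lp.coeFn_sub (∑ i ∈ F, a i • eSign hω (O i)) x]
      with w h1 h2 h3
    rw [h3, Pi.sub_apply, ← h1, ← h2]
  constructor
  · rintro ⟨hS, h⟩
    have hx : S =ᵐ[P] hS.toLp S := hS.coeFn_toLp.symm
    refine ⟨hS.toLp S, ?_, hx⟩
    rw [HasSum, SummationFilter.unconditional_filter, tendsto_iff_edist_tendsto_0]
    simpa only [key _ hx] using h
  · rintro ⟨x, hx, hS⟩
    refine ⟨(memLp_congr_ae hS).2 (Lp.memLp x), ?_⟩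
    rw [HasSum, SummationFilter.unconditional_filter, tendsto_iff_edist_tendsto_0] at hx
    simpa only [key _ hS] using hx

lemma l2Sum_ae_eq (hω : IsBernoulliField P ω) {ι : Type*} {f : ι → Ω → ℝ} {a : ι → ℝ}
    {O : ι → Finset (Site d)} (hf : ∀ i, f i =ᵐ[P] fun w => a i * chi ω (O i) w)
    (h : pairSum a O ≠ ∞) :
    (∃ S, IsL2Sum P f S) ∧ l2Sum P f =ᵐ[P] ⇑(∑' i, a i • eSign hω (O i)) := by
  have hs := (hasSum_eSign hω h).1
  have hex : ∃ S, IsL2Sum P f S := ⟨_, (isL2Sum_iff hω hf _).2 ⟨_, hs.hasSum, EventuallyEq.rfl⟩⟩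
  refine ⟨hex, ?_⟩
  obtain ⟨x, hx, hS⟩ := (isL2Sum_iff hω hf _).1 hex.choose_spec
  rw [l2Sum, dif_pos hex, hs.hasSum.unique hx]
  exact hS

end Field

/-! ### Splitting the edges of a walk -/

/-- Disjoint covering by two independent systems, in the form of Edmonds' theorem: the deficiency
functions `c₁`, `c₂` are supermodular, and every `F ⊆ R` leaves at least `c₁ F + c₂ F` elements of
`R`. -/
lemma exists_partition_of_supermodular {E : Type*} [DecidableEq E] {c₁ c₂ : Finset E → ℕ}
    (h₁ : ∀ A B, c₁ A + c₁ B ≤ c₁ (A ∪ B) + c₁ (A ∩ B))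
    (h₂ : ∀ A B, c₂ A + c₂ B ≤ c₂ (A ∪ B) + c₂ (A ∩ B)) {R : Finset E}
    (h : ∀ F ⊆ R, c₁ F + c₂ F ≤ (R \ F).card) : ∃ I ⊆ R, c₁ I = 0 ∧ c₂ (R \ I) = 0 := by
  -- the elements are assigned one at a time, preserving the condition relative to the
  -- elements that are not yet assigned
  suffices H : ∀ (n : ℕ) (R I J : Finset E), R.card = n → Disjoint R I → Disjoint R J →
      (∀ F ⊆ R, c₁ (I ∪ F) + c₂ (J ∪ F) ≤ (R \ F).card) →
      ∃ K ⊆ R, c₁ (I ∪ K) = 0 ∧ c₂ (J ∪ (R \ K)) = 0 by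
    obtain ⟨K, hK, h1, h2⟩ := H R.card R ∅ ∅ rfl (by simp) (by simp) (by simpa using h)
    exact ⟨K, hK, by simpa using h1, by simpa using h2⟩
  intro n
  induction n with
  | zero =>
    intro R I J hR _ _ h
    have hR' := Finset.card_eq_zero.1 hR
    subst hR'
    have := h ∅ le_rfl
    refine ⟨∅, le_rfl, ?_, ?_⟩ <;> simp at this ⊢ <;> omega
  | succ n ih =>
    intro R I J hR hRI hRJ h
    obtain ⟨e, he⟩ := Finset.card_pos.1 (by omega : 0 < R.card)
    have heI : e ∉ I := fun h' => Finset.disjoint_left.1 hRI he h'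
    have heJ : e ∉ J := fun h' => Finset.disjoint_left.1 hRJ he h'
    have hcard : (R.erase e).card = n := by rw [Finset.card_erase_of_mem he]; omega
    have hd : ∀ K, Disjoint R K → Disjoint (R.erase e) (insert e K) := by
      intro K hK
      rw [Finset.disjoint_insert_right]
      exact ⟨Finset.notMem_erase e R, hK.mono_left (Finset.erase_subset e R)⟩
    have hd' : ∀ K, Disjoint R K → Disjoint (R.erase e) K := fun K hK =>
      hK.mono_left (Finset.erase_subset e R)
    by_cases hI : ∀ F ⊆ R.erase e, c₁ (insert e I ∪ F) + c₂ (J ∪ F) ≤ (R.erase e \ F).card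
    · obtain ⟨K, hK, h1, h2⟩ := ih _ _ _ hcard (hd I hRI) (hd' J hRJ) hI
      refine ⟨insert e K, ?_, ?_, ?_⟩
      · exact Finset.insert_subset he (hK.trans (Finset.erase_subset e R))
      · rwa [Finset.union_insert, ← Finset.insert_union]
      · have e1 : R \ insert e K = R.erase e \ K := by
          ext x; simp only [Finset.mem_sdiff, Finset.mem_insert, Finset.mem_erase]; tauto
        rwa [e1]
    by_cases hJ : ∀ F ⊆ R.erase e, c₁ (I ∪ F) + c₂ (insert e J ∪ F) ≤ (R.erase e \ F).card
    · obtain ⟨K, hK, h1, h2⟩ := ih _ _ _ hcard (hd' I hRI) (hd J hRJ) hJ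
      have heK : e ∉ K := fun h' => Finset.notMem_erase e R (hK h')
      refine ⟨K, hK.trans (Finset.erase_subset e R), h1, ?_⟩
      have e1 : J ∪ R \ K = insert e J ∪ R.erase e \ K := by
        ext x
        simp only [Finset.mem_union, Finset.mem_sdiff, Finset.mem_insert, Finset.mem_erase]
        by_cases hx : x = e
        · subst hx; simp [he, heK]
        · simp [hx]
      rwa [e1]
    -- if neither choice keeps the condition, violating sets `F₁` and `F₂` contradict it at
    -- `insert e (F₁ ∪ F₂)` and `F₁ ∩ F₂`, by supermodularity
    exfalso
    push Not at hI hJ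
    obtain ⟨F₁, hF₁, hlt₁⟩ := hI
    obtain ⟨F₂, hF₂, hlt₂⟩ := hJ
    have he₁ : e ∉ F₁ := fun h' => Finset.notMem_erase e R (hF₁ h')
    have he₂ : e ∉ F₂ := fun h' => Finset.notMem_erase e R (hF₂ h')
    have hF₁' := hF₁.trans (Finset.erase_subset e R)
    have hF₂' := hF₂.trans (Finset.erase_subset e R)
    have hU := h (insert e (F₁ ∪ F₂)) (Finset.insert_subset he (Finset.union_subset hF₁' hF₂'))
    have hN := h (F₁ ∩ F₂) (Finset.inter_subset_left.trans hF₁')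
    have s1 := h₁ (insert e I ∪ F₁) (I ∪ F₂)
    have s2 := h₂ (J ∪ F₁) (insert e J ∪ F₂)
    have e1 : insert e I ∪ F₁ ∪ (I ∪ F₂) = I ∪ insert e (F₁ ∪ F₂) := by
      ext x; simp only [Finset.mem_union, Finset.mem_insert]; tauto
    have e2 : (insert e I ∪ F₁) ∩ (I ∪ F₂) = I ∪ F₁ ∩ F₂ := by
      ext x
      simp only [Finset.mem_union, Finset.mem_insert, Finset.mem_inter]
      by_cases hx : x = e
      · subst hx; simp [heI, he₁, he₂]
      · simp only [hx, false_or]; tauto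
    have e3 : J ∪ F₁ ∪ (insert e J ∪ F₂) = J ∪ insert e (F₁ ∪ F₂) := by
      ext x; simp only [Finset.mem_union, Finset.mem_insert]; tauto
    have e4 : (J ∪ F₁) ∩ (insert e J ∪ F₂) = J ∪ F₁ ∩ F₂ := by
      ext x
      simp only [Finset.mem_union, Finset.mem_insert, Finset.mem_inter]
      by_cases hx : x = e
      · subst hx; simp [heJ, he₁, he₂]
      · simp only [hx, false_or]; tauto
    rw [e1, e2] at s1
    rw [e3, e4] at s2
    have k1 : (R.erase e \ F₁).card = R.card - 1 - F₁.card := by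
      rw [Finset.card_sdiff_of_subset hF₁, Finset.card_erase_of_mem he]
    have k2 : (R.erase e \ F₂).card = R.card - 1 - F₂.card := by
      rw [Finset.card_sdiff_of_subset hF₂, Finset.card_erase_of_mem he]
    have k3 : (R \ insert e (F₁ ∪ F₂)).card = R.card - ((F₁ ∪ F₂).card + 1) := by
      rw [Finset.card_sdiff_of_subset (Finset.insert_subset he (Finset.union_subset hF₁' hF₂')),
        Finset.card_insert_of_notMem (by simp [he₁, he₂])]
    have k4 : (R \ (F₁ ∩ F₂)).card = R.card - (F₁ ∩ F₂).card :=
      Finset.card_sdiff_of_subset (Finset.inter_subset_left.trans hF₁')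
    have k5 := Finset.card_union_add_card_inter F₁ F₂
    have k6 := Finset.card_le_card hF₁
    have k7 := Finset.card_le_card hF₂
    have k8 := Finset.card_le_card (Finset.union_subset hF₁ hF₂)
    have k9 := Finset.card_le_card (Finset.inter_subset_left.trans hF₁' : F₁ ∩ F₂ ⊆ R)
    rw [Finset.card_erase_of_mem he] at k6 k7 k8
    rw [k1] at hlt₁
    rw [k2] at hlt₂
    rw [k3] at hU
    rw [k4] at hN
    omega

section Walk

variable {s : ℕ}

/-- For a walk with positions `0, …, s + 1`, whose coincidences are described by the map `φ` to
representatives: the functions on the positions that respect the coincidences, vanish on `X`, and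
are constant along the edges in `F`. -/
def walkFunctions (φ : Fin (s + 2) → Fin (s + 2)) (X : Set (Fin (s + 2)))
    (F : Finset (Fin (s + 1))) : Submodule ℝ (Fin (s + 2) → ℝ) where
  carrier := {f | (∀ p, f (φ p) = f p) ∧ (∀ p ∈ X, f p = 0) ∧ ∀ e ∈ F, f e.castSucc = f e.succ}
  add_mem' := by
    rintro f g ⟨h1, h2, h3⟩ ⟨k1, k2, k3⟩
    refine ⟨fun p => ?_, fun p hp => ?_, fun e he => ?_⟩
    · simp [h1 p, k1 p]
    · simp [h2 p hp, k2 p hp]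
    · simp [h3 e he, k3 e he]
  zero_mem' := by simp
  smul_mem' := by
    rintro c f ⟨h1, h2, h3⟩
    refine ⟨fun p => ?_, fun p hp => ?_, fun e he => ?_⟩
    · simp [h1 p]
    · simp [h2 p hp]
    · simp [h3 e he]

variable {φ : Fin (s + 2) → Fin (s + 2)} {X : Set (Fin (s + 2))}

/-- The dimensions of the spaces of walk functions are the deficiencies to which
`exists_partition_of_supermodular` is applied. -/
lemma finrank_walkFunctions_supermodular (φ : Fin (s + 2) → Fin (s + 2)) (X : Set (Fin (s + 2)))
    (A B : Finset (Fin (s + 1))) :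
    Module.finrank ℝ (walkFunctions φ X A) + Module.finrank ℝ (walkFunctions φ X B)
      ≤ Module.finrank ℝ (walkFunctions φ X (A ∪ B))
        + Module.finrank ℝ (walkFunctions φ X (A ∩ B)) := by
  have h := Submodule.finrank_sup_add_finrank_inf_eq (walkFunctions φ X A) (walkFunctions φ X B)
  have h1 : walkFunctions φ X A ⊔ walkFunctions φ X B ≤ walkFunctions φ X (A ∩ B) := by
    refine sup_le ?_ ?_ <;> rintro f ⟨h1, h2, h3⟩ <;> refine ⟨h1, h2, fun e he => h3 e ?_⟩
    · exact (Finset.mem_inter.1 he).1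
    · exact (Finset.mem_inter.1 he).2
  have h2 : walkFunctions φ X A ⊓ walkFunctions φ X B ≤ walkFunctions φ X (A ∪ B) := by
    rintro f ⟨⟨h1, h2, h3⟩, ⟨-, -, h4⟩⟩
    refine ⟨h1, h2, fun e he => ?_⟩
    rcases Finset.mem_union.1 he with h | h
    · exact h3 e h
    · exact h4 e h
  have h3 := Submodule.finrank_mono h1
  have h4 := Submodule.finrank_mono h2
  omega

/-- If no nonzero walk function is constant along the edges in `I`, then `I` has an edge out of
every nonempty set of representatives that avoids `X`. -/
lemma exists_crossing {I : Finset (Fin (s + 1))}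
    (h : Module.finrank ℝ (walkFunctions φ X I) = 0) (hφ : ∀ p, φ (φ p) = φ p)
    (hX : ∀ p ∈ X, φ p ∈ X) {F : Finset (Fin (s + 2))} (hne : F.Nonempty)
    (hroot : ∀ p ∈ F, φ p = p) (hFX : ∀ p ∈ F, p ∉ X) :
    ∃ e ∈ I, ¬ (φ e.castSucc ∈ F ↔ φ e.succ ∈ F) := by
  by_contra hcon
  push Not at hcon
  have hbot : walkFunctions φ X I = ⊥ := Submodule.finrank_eq_zero.1 h
  have hmem : (fun p => if φ p ∈ F then (1 : ℝ) else 0) ∈ walkFunctions φ X I := by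
    refine ⟨fun p => ?_, fun p hp => ?_, fun e he => ?_⟩
    · simp only [hφ]
    · simp only [ite_eq_right_iff, one_ne_zero, imp_false]
      exact fun h => hFX _ h (hX p hp)
    · simp only [hcon e he]
  rw [hbot, Submodule.mem_bot] at hmem
  obtain ⟨p, hp⟩ := hne
  have := congrFun hmem p
  simp [hroot p hp, hp] at this

/-- The letters of the walk are the positions `1, …, s`. -/
def IsLetter (p : Fin (s + 2)) : Prop := p ≠ 0 ∧ p ≠ Fin.last (s + 1)

instance (p : Fin (s + 2)) : Decidable (IsLetter p) := inferInstanceAs (Decidable (_ ∧ _))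

/-- The positions of letters of odd multiplicity, together with both ends of the walk. -/
def oddPositions (φ : Fin (s + 2) → Fin (s + 2)) : Set (Fin (s + 2)) :=
  {p | ¬ IsLetter p ∨ Odd (Finset.univ.filter fun q => IsLetter q ∧ φ q = φ p).card}

/-- The data of the coincidences in an admissible walk: `φ` sends the ends to themselves and
letters to letters, and no block of at least two consecutive letters has only even
multiplicities. -/
structure IsPattern (φ : Fin (s + 2) → Fin (s + 2)) : Prop where
  idem : ∀ p, φ (φ p) = φ p
  zero : φ 0 = 0
  last : φ (Fin.last (s + 1)) = Fin.last (s + 1)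
  letter : ∀ p, IsLetter p → IsLetter (φ p)
  block : ∀ a b : Fin (s + 2), IsLetter a → IsLetter b → a < b →
    ∃ q ∈ Finset.Icc a b, Odd ((Finset.Icc a b).filter fun r => φ r = φ q).card

/-- The maximal interval `[a, b]` around a position `p` all of whose edges lie in `F`. -/
lemma exists_segment (F : Finset (Fin (s + 1))) (p : Fin (s + 2)) :
    ∃ a b : Fin (s + 2), a ≤ p ∧ p ≤ b ∧
      (∀ e : Fin (s + 1), a ≤ e.castSucc → e.succ ≤ b → e ∈ F) ∧
      (∀ e : Fin (s + 1), e.succ = a → e ∉ F) ∧ ∀ e : Fin (s + 1), e.castSucc = b → e ∉ F := by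
  classical
  set A : Finset (Fin (s + 2)) := Finset.univ.filter fun a =>
    a ≤ p ∧ ∀ e : Fin (s + 1), a ≤ e.castSucc → e.succ ≤ p → e ∈ F with hA
  set B : Finset (Fin (s + 2)) := Finset.univ.filter fun b =>
    p ≤ b ∧ ∀ e : Fin (s + 1), p ≤ e.castSucc → e.succ ≤ b → e ∈ F with hB
  have hpp : ∀ e : Fin (s + 1), p ≤ e.castSucc → e.succ ≤ p → e ∈ F := fun e h1 h2 =>
    absurd (h2.trans h1) (not_le.2 (Fin.castSucc_lt_succ))
  have hpA : p ∈ A := by simpa [hA] using hpp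
  have hpB : p ∈ B := by simpa [hB] using hpp
  have ha := A.min'_mem ⟨p, hpA⟩
  have hb := B.max'_mem ⟨p, hpB⟩
  have hamin := fun x hx => A.min'_le x hx
  have hbmax := fun x hx => B.le_max' x hx
  set a := A.min' ⟨p, hpA⟩
  set b := B.max' ⟨p, hpB⟩
  simp only [hA, hB, Finset.mem_filter, Finset.mem_univ, true_and] at ha hb
  refine ⟨a, b, ha.1, hb.1, fun e h1 h2 => ?_, fun e he heF => ?_, fun e he heF => ?_⟩
  · by_cases h : e.succ ≤ p
    · exact ha.2 e h1 h
    · exact hb.2 e (Fin.le_castSucc_iff.2 (not_le.1 h)) h2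
  · have hlt : e.castSucc < a := he ▸ Fin.castSucc_lt_succ
    refine absurd (hamin e.castSucc ?_) (not_le.2 hlt)
    simp only [hA, Finset.mem_filter, Finset.mem_univ, true_and]
    refine ⟨hlt.le.trans ha.1, fun e' h1 h2 => ?_⟩
    rcases h1.eq_or_lt with h | h
    · rwa [← Fin.castSucc_injective _ h]
    · refine ha.2 e' ?_ h2
      rw [← he]
      exact Fin.succ_le_castSucc_iff.2 (Fin.castSucc_lt_castSucc_iff.1 h)
  · have hlt : b < e.succ := he ▸ Fin.castSucc_lt_succ
    refine absurd (hbmax e.succ ?_) (not_le.2 hlt)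
    simp only [hB, Finset.mem_filter, Finset.mem_univ, true_and]
    refine ⟨hb.1.trans hlt.le, fun e' h1 h2 => ?_⟩
    rcases h2.eq_or_lt with h | h
    · rwa [Fin.succ_injective _ h]
    · refine hb.2 e' h1 ?_
      rw [← he]
      exact Fin.succ_le_castSucc_iff.2 (Fin.succ_lt_succ_iff.1 h)

lemma eq_of_segment {F : Finset (Fin (s + 1))} {f : Fin (s + 2) → ℝ}
    (hf : ∀ e ∈ F, f e.castSucc = f e.succ) {a b : Fin (s + 2)}
    (hab : ∀ e : Fin (s + 1), a ≤ e.castSucc → e.succ ≤ b → e ∈ F) :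
    ∀ p, a ≤ p → p ≤ b → f p = f a := by
  intro p
  induction p using Fin.induction with
  | zero =>
    intro h _
    rw [Fin.le_zero_iff.1 h]
  | succ i ih =>
    intro h1 h2
    rcases h1.eq_or_lt with h | h
    · rw [h]
    · have h3 : a ≤ i.castSucc := Fin.le_castSucc_iff.2 h
      rw [← hf i (hab i h3 h2)]
      exact ih h3 ((Fin.castSucc_lt_succ).le.trans h2)

/-- The linear independence behind the splitting of the edges: a walk function `g` on the even
letters and a walk function `f` with `f + e g = 0` at the left end of every edge `e ∉ F` vanish.
The number `e` of the edge serves as a coefficient that differs from edge to edge. -/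
lemma walkFunctions_eq_zero (hφ : IsPattern φ) {F : Finset (Fin (s + 1))} {f g : Fin (s + 2) → ℝ}
    (hf : f ∈ walkFunctions φ {Fin.last (s + 1)} F) (hg : g ∈ walkFunctions φ (oddPositions φ) F)
    (hcut : ∀ e : Fin (s + 1), e ∉ F → f e.castSucc + (e : ℝ) * g e.castSucc = 0) :
    f = 0 ∧ g = 0 := by
  obtain ⟨hf1, hf2, hf3⟩ := hf
  obtain ⟨hg1, hg2, hg3⟩ := hg
  have hlast : ∀ b : Fin (s + 2), b ≠ Fin.last (s + 1) → ∃ e : Fin (s + 1), e.castSucc = b :=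
    fun b hb => ⟨b.castPred hb, Fin.castSucc_castPred b hb⟩
  have glast : g (Fin.last (s + 1)) = 0 := hg2 _ (Or.inl fun h => h.2 rfl)
  have hgz : g = 0 := by
    by_contra hne
    obtain ⟨p, hp⟩ := Function.ne_iff.1 hne
    rw [Pi.zero_apply] at hp
    obtain ⟨a, b, hap, hpb, hin, ha, hb⟩ := exists_segment F p
    have hga : ∀ q, a ≤ q → q ≤ b → g q = g a := eq_of_segment hg3 hin
    have hfa : ∀ q, a ≤ q → q ≤ b → f q = f a := eq_of_segment hf3 hin
    have hne : ∀ q, a ≤ q → q ≤ b → g q ≠ 0 := fun q h1 h2 => by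
      rwa [hga q h1 h2, ← hga p hap hpb]
    have heven : ∀ q, a ≤ q → q ≤ b → q ∉ oddPositions φ := fun q h1 h2 hq =>
      hne q h1 h2 (hg2 q hq)
    have hlet : ∀ q, a ≤ q → q ≤ b → IsLetter q := fun q h1 h2 => by
      by_contra h; exact heven q h1 h2 (Or.inl h)
    have hab := hap.trans hpb
    -- a letter of odd multiplicity inside the block
    obtain ⟨q, hq, hodd⟩ : ∃ q ∈ Finset.Icc a b,
        Odd ((Finset.Icc a b).filter fun r => φ r = φ q).card := by
      rcases hab.eq_or_lt with h | h
      · subst h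
        exact ⟨a, by simp, by simp [Finset.filter_singleton]⟩
      · exact hφ.block a b (hlet a le_rfl hab) (hlet b hab le_rfl) h
    rw [Finset.mem_Icc] at hq
    -- occurs again outside, as its multiplicity is even
    obtain ⟨q', hq', hqq, hout⟩ : ∃ q', IsLetter q' ∧ φ q' = φ q ∧ ¬ (a ≤ q' ∧ q' ≤ b) := by
      by_contra hcon
      push Not at hcon
      refine heven q hq.1 hq.2 (Or.inr ?_)
      convert hodd using 2
      ext r
      simp only [Finset.mem_filter, Finset.mem_univ, true_and, Finset.mem_Icc]
      constructor
      · rintro ⟨h1, h2⟩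
        refine ⟨⟨?_, ?_⟩, h2⟩
        · by_contra h3; exact absurd (hcon r h1 h2) (by tauto)
        · by_contra h3; exact absurd (hcon r h1 h2) (by tauto)
      · rintro ⟨h1, h2⟩
        exact ⟨hlet r h1.1 h1.2, h2⟩
    -- the segment of `q'` ends at another edge outside of `F` than that of `p`, with the same
    -- values of `f` and `g`; subtracting the two conditions gives `(e - e') g = 0`
    have hgq : g q' = g a := by rw [← hg1 q', hqq, hg1, hga q hq.1 hq.2]
    have hfq : f q' = f a := by rw [← hf1 q', hqq, hf1, hfa q hq.1 hq.2]
    obtain ⟨a', b', hap', hpb', hin', ha', hb'⟩ := exists_segment F q'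
    have hgb' : g b' = g a := by
      rw [eq_of_segment hg3 hin' b' (hap'.trans hpb') le_rfl,
        ← eq_of_segment hg3 hin' q' hap' hpb', hgq]
    have hfb' : f b' = f a := by
      rw [eq_of_segment hf3 hin' b' (hap'.trans hpb') le_rfl,
        ← eq_of_segment hf3 hin' q' hap' hpb', hfq]
    have hga0 := hne a le_rfl hab
    have hbl : b ≠ Fin.last (s + 1) := (hlet b hab le_rfl).2
    have hbl' : b' ≠ Fin.last (s + 1) := by
      rintro rfl; rw [glast] at hgb'; exact hga0 hgb'.symm
    have hbb : b ≠ b' := by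
      rintro rfl
      have hq'a : q' < a := by
        by_contra h; exact hout ⟨not_lt.1 h, hpb'⟩
      have ha0 : a ≠ 0 := (hlet a le_rfl hab).1
      obtain ⟨e, rfl⟩ : ∃ e : Fin (s + 1), e.succ = a := ⟨a.pred ha0, Fin.succ_pred a ha0⟩
      exact ha e rfl (hin' e (hap'.trans (Fin.le_castSucc_iff.2 hq'a)) hab)
    obtain ⟨e, rfl⟩ := hlast b hbl
    obtain ⟨e', rfl⟩ := hlast b' hbl'
    have h1 := hcut e (hb e rfl)
    have h2 := hcut e' (hb' e' rfl)
    rw [hga _ hab le_rfl, hfa _ hab le_rfl] at h1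
    rw [hgb', hfb'] at h2
    have h3 : ((e : ℝ) - e') * g a = 0 := by linear_combination h1 - h2
    rcases mul_eq_zero.1 h3 with h | h
    · have h4 : (e : ℕ) = e' := by exact_mod_cast sub_eq_zero.1 h
      exact hbb (by rw [Fin.ext h4])
    · exact hga0 h
  refine ⟨?_, hgz⟩
  ext p
  obtain ⟨a, b, hap, hpb, hin, -, hb⟩ := exists_segment F p
  have hfb : f b = f p := by
    rw [eq_of_segment hf3 hin b (hap.trans hpb) le_rfl, ← eq_of_segment hf3 hin p hap hpb]
  rw [← hfb, Pi.zero_apply]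
  by_cases hbl : b = Fin.last (s + 1)
  · rw [hbl]; exact hf2 _ rfl
  · obtain ⟨e, rfl⟩ := hlast b hbl
    have := hcut e (hb e rfl)
    rw [hgz] at this
    simpa using this

/-- The evaluation map on the cuts in `Q`. -/
def cutMap (φ : Fin (s + 2) → Fin (s + 2)) (X Y : Set (Fin (s + 2))) (F Q : Finset (Fin (s + 1))) :
    walkFunctions φ X F × walkFunctions φ Y F →ₗ[ℝ] (Q → ℝ) where
  toFun x e := x.1.1 e.1.castSucc + (e.1 : ℝ) * x.2.1 e.1.castSucc
  map_add' x y := by ext e; simp; ring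
  map_smul' c x := by ext e; simp; ring

/-- The hypothesis of `exists_partition_of_supermodular`, from the injectivity of `cutMap`. -/
lemma finrank_add_finrank_le {Y : Set (Fin (s + 2))} {F Q : Finset (Fin (s + 1))}
    (h : ∀ f ∈ walkFunctions φ X F, ∀ g ∈ walkFunctions φ Y F,
      (∀ e ∈ Q, f e.castSucc + (e : ℝ) * g e.castSucc = 0) → f = 0 ∧ g = 0) :
    Module.finrank ℝ (walkFunctions φ X F) + Module.finrank ℝ (walkFunctions φ Y F) ≤ Q.card := by
  have hinj : Function.Injective (cutMap φ X Y F Q) := by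
    rw [injective_iff_map_eq_zero]
    rintro ⟨⟨f, hf⟩, ⟨g, hg⟩⟩ h0
    obtain ⟨h1, h2⟩ := h f hf g hg fun e he => congrFun h0 ⟨e, he⟩
    ext p
    · simp [h1]
    · simp [h2]
  have := LinearMap.finrank_le_finrank_of_injective hinj
  rwa [Module.finrank_prod, Module.finrank_fintype_fun_eq_card, Fintype.card_coe] at this

/-- All edges can be split into a set that connects everything to the last position, and one that
connects the even letters to the rest; connectivity is expressed by the vanishing of a space of
walk functions. -/
lemma IsPattern.exists_split (hφ : IsPattern φ) : ∃ I : Finset (Fin (s + 1)),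
    Module.finrank ℝ (walkFunctions φ {Fin.last (s + 1)} I) = 0 ∧
    Module.finrank ℝ (walkFunctions φ (oddPositions φ) Iᶜ) = 0 := by
  obtain ⟨I, -, h1, h2⟩ := exists_partition_of_supermodular (R := Finset.univ)
    (finrank_walkFunctions_supermodular φ {Fin.last (s + 1)})
    (finrank_walkFunctions_supermodular φ (oddPositions φ)) fun F _ =>
      finrank_add_finrank_le fun f hf g hg h =>
        walkFunctions_eq_zero hφ hf hg fun e he => h e (by simpa using he)
  exact ⟨I, h1, h2⟩

/-- If also the first position is fixed, one edge can be spared. -/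
lemma IsPattern.exists_split_erase (hφ : IsPattern φ) (j : Fin (s + 1)) :
    ∃ I J : Finset (Fin (s + 1)), Disjoint I J ∧ j ∉ I ∧ j ∉ J ∧
    Module.finrank ℝ (walkFunctions φ {0, Fin.last (s + 1)} I) = 0 ∧
    Module.finrank ℝ (walkFunctions φ (oddPositions φ) J) = 0 := by
  obtain ⟨I, hI, h1, h2⟩ := exists_partition_of_supermodular (R := Finset.univ.erase j)
    (finrank_walkFunctions_supermodular φ {0, Fin.last (s + 1)})
    (finrank_walkFunctions_supermodular φ (oddPositions φ)) fun F hF => by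
      have hjF : j ∉ F := fun h => Finset.notMem_erase j _ (hF h)
      -- the first cut imposes no condition, as `f` and `g` vanish at the beginning of the walk
      have hne : Fᶜ.Nonempty := ⟨j, by simpa using hjF⟩
      set m := Fᶜ.min' hne with hm
      have hmF : m ∈ Fᶜ := Finset.min'_mem _ hne
      have hcard : ((Finset.univ.erase j) \ F).card = (Fᶜ.erase m).card := by
        rw [Finset.card_erase_of_mem hmF, Finset.card_sdiff_of_subset hF,
          Finset.card_erase_of_mem (Finset.mem_univ j), Finset.card_compl, Finset.card_univ]
        omega
      rw [hcard]
      refine finrank_add_finrank_le fun f hf g hg h => ?_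
      have h0 : ∀ f : Fin (s + 2) → ℝ, (∀ e ∈ F, f e.castSucc = f e.succ) → f 0 = 0 →
          f m.castSucc = 0 := by
        intro f hf h0
        rw [← h0]
        refine eq_of_segment hf (a := 0) (b := m.castSucc) (fun e _ he => ?_) _ (Fin.zero_le _) le_rfl
        by_contra hcon
        have h1 := Fᶜ.min'_le e (by simpa using hcon)
        have h2 : e < m := Fin.succ_le_castSucc_iff.1 he
        exact absurd h1 (not_le.2 h2)
      refine walkFunctions_eq_zero hφ ⟨hf.1, fun p hp => hf.2.1 p (Or.inr hp), hf.2.2⟩ hg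
        fun e he => ?_
      by_cases hem : e = m
      · subst hem
        rw [h0 f hf.2.2 (hf.2.1 0 (Or.inl rfl)),
          h0 g hg.2.2 (hg.2.1 0 (Or.inl fun h => h.1 rfl))]
        ring
      · exact h e (by simp [hem, he])
  refine ⟨I, Finset.univ.erase j \ I, Finset.disjoint_sdiff, fun h => ?_, by simp, h1, h2⟩
  exact Finset.notMem_erase j _ (hI h)

end Walk

/-! ### Summation over the vertices of a graph -/

/-- The sum of `G` over the functions that agree with `y₀` outside of `U`. -/
def sumOff {ι : Type*} (U : Finset ι) (y₀ : ι → Site d) (G : (ι → Site d) → ℝ≥0∞) : ℝ≥0∞ :=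
  open Classical in ∑' y : ι → Site d, if ∀ i, i ∉ U → y i = y₀ i then G y else 0

lemma sumOff_empty {ι : Type*} (y₀ : ι → Site d) (G : (ι → Site d) → ℝ≥0∞) :
    sumOff ∅ y₀ G = G y₀ := by
  rw [sumOff, tsum_eq_single y₀]
  · simp
  · intro y hy
    rw [if_neg]
    intro h
    exact hy (funext fun i => h i (by simp))

lemma sumOff_mono {ι : Type*} {U : Finset ι} {y₀ : ι → Site d} {G G' : (ι → Site d) → ℝ≥0∞}
    (h : ∀ y, (∀ i, i ∉ U → y i = y₀ i) → G y ≤ G' y) : sumOff U y₀ G ≤ sumOff U y₀ G' := by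
  refine ENNReal.tsum_le_tsum fun y => ?_
  split_ifs with hy
  · exact h y hy
  · exact le_rfl

lemma sumOff_const_mul {ι : Type*} (U : Finset ι) (y₀ : ι → Site d) (c : ℝ≥0∞)
    (G : (ι → Site d) → ℝ≥0∞) : sumOff U y₀ (fun y => c * G y) = c * sumOff U y₀ G := by
  rw [sumOff, sumOff, ← ENNReal.tsum_mul_left]
  refine tsum_congr fun y => ?_
  split_ifs <;> simp

/-- Summing over one coordinate first. -/
lemma sumOff_erase {ι : Type*} [DecidableEq ι] {U : Finset ι} {i : ι} (hi : i ∈ U)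
    (y₀ : ι → Site d) (G : (ι → Site d) → ℝ≥0∞) :
    sumOff U y₀ G = ∑' z, sumOff (U.erase i) (Function.update y₀ i z) G := by
  simp only [sumOff]
  rw [ENNReal.tsum_comm]
  refine tsum_congr fun y => ?_
  rw [tsum_eq_single (y i)]
  · congr 1
    refine propext ⟨fun h j hj => ?_, fun h j hj => ?_⟩
    · by_cases hji : j = i
      · subst hji; simp
      · rw [Function.update_of_ne hji]
        exact h j fun hjU => hj (Finset.mem_erase.2 ⟨hji, hjU⟩)
    · have hji : j ≠ i := fun h' => hj (h' ▸ hi)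
      have := h j fun hjU => hj (Finset.mem_of_mem_erase hjU)
      rwa [Function.update_of_ne hji] at this
  · intro z hz
    rw [if_neg]
    intro h
    have := h i (Finset.notMem_erase i U)
    rw [Function.update_self] at this
    exact hz this.symm

lemma IsSq.exists_bound {A : EKern d} (hA : IsSq A) : ∃ c : ℝ≥0∞, c ≠ ∞ ∧
    (∀ x y, A x y ^ 2 ≤ c) ∧ (∀ x, ∑' y, A x y ^ 2 ≤ c) ∧ ∀ y, ∑' x, A x y ^ 2 ≤ c := by
  obtain ⟨⟨a, ha, hA⟩, ⟨b, hb, hB⟩⟩ := hA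
  refine ⟨a + b, by finiteness, fun x y => ?_, fun x => (hA x).trans le_self_add,
    fun y => (hB y).trans le_add_self⟩
  exact ((ENNReal.le_tsum y).trans (hA x)).trans le_self_add

/-- Eliminating vertices along crossing edges: if every nonempty set of free vertices has an edge
that leaves it, the sum over the free vertices of the product of the squared edge factors is
bounded. -/
lemma exists_sumOff_bound {ι E : Type*} [DecidableEq ι] [DecidableEq E] (k : E → EKern d)
    (a b : E → ι) (U : Finset ι) (J : Finset E) (hk : ∀ e ∈ J, IsSq (k e))
    (hcross : ∀ F ⊆ U, F.Nonempty → ∃ e ∈ J, ¬ (a e ∈ F ↔ b e ∈ F)) :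
    ∃ c : ℝ≥0∞, c ≠ ∞ ∧ ∀ y₀ : ι → Site d,
      sumOff U y₀ (fun y => ∏ e ∈ J, k e (y (a e)) (y (b e)) ^ 2) ≤ c := by
  induction hn : U.card generalizing U J with
  | zero =>
    have hU := Finset.card_eq_zero.1 hn
    subst hU
    have hex : ∀ e, ∃ c : ℝ≥0∞, c ≠ ∞ ∧ (e ∈ J → ∀ x y, k e x y ^ 2 ≤ c) := by
      intro e
      by_cases he : e ∈ J
      · obtain ⟨c, hc, h, -⟩ := (hk e he).exists_bound
        exact ⟨c, hc, fun _ => h⟩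
      · exact ⟨0, by simp, fun h => absurd h he⟩
    choose c hc hb using hex
    refine ⟨∏ e ∈ J, c e, (ENNReal.prod_lt_top fun e _ => (hc e).lt_top).ne, fun y₀ => ?_⟩
    rw [sumOff_empty]
    exact Finset.prod_le_prod' fun e he => hb e he _ _
  | succ n ih =>
    have hne : U.Nonempty := Finset.card_pos.1 (by omega)
    -- the end of a crossing edge `e` in `U` is summed over last, using only the factor of `e`; this
    -- edge crosses no subset of the remaining free vertices
    obtain ⟨e, heJ, he⟩ := hcross U le_rfl hne
    obtain ⟨c, hc, -, hrow, hcol⟩ := (hk e heJ).exists_bound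
    -- `i` is the end of `e` in `U`, and `j` the other one
    have hstep : ∀ i j : ι, i ∈ U → j ∉ U → (∀ F : Finset ι, i ∉ F → j ∉ F → a e ∉ F ∧ b e ∉ F) →
        ∀ K : EKern d, (∀ y : ι → Site d, k e (y (a e)) (y (b e)) = K (y i) (y j)) →
        (∀ y, ∑' x, K x y ^ 2 ≤ c) →
        ∃ c : ℝ≥0∞, c ≠ ∞ ∧ ∀ y₀ : ι → Site d,
          sumOff U y₀ (fun y => ∏ e ∈ J, k e (y (a e)) (y (b e)) ^ 2) ≤ c := by
      intro i j hi hj hends K hK hcK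
      obtain ⟨c', hc', h'⟩ := ih (U.erase i) (J.erase e)
        (fun e' he' => hk e' (Finset.mem_of_mem_erase he'))
        (fun F hF hFne => by
          obtain ⟨e', he'J, he'⟩ := hcross F (hF.trans (Finset.erase_subset i U)) hFne
          refine ⟨e', Finset.mem_erase.2 ⟨?_, he'J⟩, he'⟩
          rintro rfl
          obtain ⟨h1, h2⟩ := hends F (fun h => Finset.notMem_erase i U (hF h))
            fun h => hj (Finset.mem_of_mem_erase (hF h))
          exact he' ⟨fun h => absurd h h1, fun h => absurd h h2⟩)
        (by rw [Finset.card_erase_of_mem hi]; omega)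
      refine ⟨c * c', ENNReal.mul_ne_top hc hc', fun y₀ => ?_⟩
      rw [sumOff_erase hi]
      have hji : j ≠ i := fun h => hj (h ▸ hi)
      calc _ ≤ ∑' z, K z (y₀ j) ^ 2 * c' := by
            refine ENNReal.tsum_le_tsum fun z => ?_
            calc _ ≤ sumOff (U.erase i) (Function.update y₀ i z) (fun y => K z (y₀ j) ^ 2 *
                  ∏ e ∈ J.erase e, k e (y (a e)) (y (b e)) ^ 2) := by
                  refine sumOff_mono fun y hy => le_of_eq ?_
                  have h1 := hy i (Finset.notMem_erase i U)
                  have h2 := hy j fun h => hj (Finset.mem_of_mem_erase h)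
                  rw [Function.update_self] at h1
                  rw [Function.update_of_ne hji] at h2
                  rw [← Finset.mul_prod_erase J _ heJ, hK y, h1, h2]
              _ = K z (y₀ j) ^ 2 * sumOff (U.erase i) (Function.update y₀ i z) (fun y =>
                  ∏ e ∈ J.erase e, k e (y (a e)) (y (b e)) ^ 2) := sumOff_const_mul _ _ _ _
              _ ≤ _ := by gcongr; exact h' _
        _ ≤ c * c' := by
            rw [ENNReal.tsum_mul_right]; gcongr; exact hcK _
    by_cases hae : a e ∈ U
    · have hbe : b e ∉ U := fun h => he ⟨fun _ => h, fun _ => hae⟩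
      exact hstep (a e) (b e) hae hbe (fun F h1 h2 => ⟨h1, h2⟩) (k e) (fun _ => rfl) hcol
    · have hbe : b e ∈ U := by by_contra h; exact he ⟨fun h' => absurd h' hae, fun h' => absurd h' h⟩
      exact hstep (b e) (a e) hbe hae (fun F h1 h2 => ⟨h2, h1⟩) (etransp (k e)) (fun _ => rfl) hrow

section Walk

variable {s : ℕ}

/-- The product of edge factors of a walk, over the edges in `J`. -/
def walkProd (k : Fin (s + 1) → EKern d) (J : Finset (Fin (s + 1))) (y : Fin (s + 2) → Site d) :
    ℝ≥0∞ := ∏ e ∈ J, k e (y e.castSucc) (y e.succ)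

/-- A sum over walks with a given coincidence pattern `φ`: such a walk is determined by its values
at the representatives. Those in `U` are free, the others are known up to the finite set `Y₀`. -/
lemma tsum_walkProd_sq_le {φ : Fin (s + 2) → Fin (s + 2)} {k : Fin (s + 1) → EKern d}
    {J : Finset (Fin (s + 1))} {U : Finset (Fin (s + 2))}
    {c : ℝ≥0∞} (hc : ∀ y₀ : Fin (s + 2) → Site d, sumOff U y₀
      (fun y => ∏ e ∈ J, k e (y (φ e.castSucc)) (y (φ e.succ)) ^ 2) ≤ c)
    (hφ : ∀ p, φ (φ p) = φ p)
    (Q : (Fin (s + 2) → Site d) → Prop) (Y₀ : Finset (Fin (s + 2) → Site d))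
    (hQ : ∀ y, Q y → (∀ p, y (φ p) = y p) ∧ ∃ y₀ ∈ Y₀, ∀ i, i ∉ U → φ i = i → y i = y₀ i) :
    ∑' y : {y // Q y}, walkProd k J y ^ 2 ≤ Y₀.card * c := by
  classical
  set G : (Fin (s + 2) → Site d) → ℝ≥0∞ :=
    fun y => ∏ e ∈ J, k e (y (φ e.castSucc)) (y (φ e.succ)) ^ 2 with hG
  -- `N y` keeps the values at the representatives only
  set N : (Fin (s + 2) → Site d) → Fin (s + 2) → Site d :=
    fun y i => if φ i = i then y i else 0 with hN
  have hNG : ∀ y, Q y → walkProd k J y ^ 2 = G (N y) := by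
    intro y hy
    have h := (hQ y hy).1
    simp only [walkProd, hG, ← Finset.prod_pow]
    refine Finset.prod_congr rfl fun e _ => ?_
    simp only [hN, hφ, if_true, h]
  have hinj : Function.Injective fun y : {y // Q y} => N y := by
    intro y y' h
    refine Subtype.ext (funext fun p => ?_)
    have h1 := congrFun h (φ p)
    simp only [hN, hφ, if_true] at h1
    rwa [(hQ _ y.2).1, (hQ _ y'.2).1] at h1
  have hle : ∀ y : {y // Q y}, walkProd k J y ^ 2 ≤ ∑ y₀ ∈ Y₀,
      if ∀ i, i ∉ U → N y i = N y₀ i then G (N y) else 0 := by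
    intro y
    obtain ⟨-, y₀, hy₀, h⟩ := hQ _ y.2
    rw [hNG _ y.2]
    refine le_trans (le_of_eq ?_) (Finset.single_le_sum (fun _ _ => zero_le) hy₀)
    rw [if_pos]
    intro i hi
    simp only [hN]
    split_ifs with hφi
    · exact h i hi hφi
    · rfl
  calc _ ≤ ∑' y : {y // Q y}, ∑ y₀ ∈ Y₀,
        if ∀ i, i ∉ U → N y i = N y₀ i then G (N y) else 0 := ENNReal.tsum_le_tsum hle
    _ = ∑ y₀ ∈ Y₀, ∑' y : {y // Q y},
        if ∀ i, i ∉ U → N y i = N y₀ i then G (N y) else 0 :=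
        Summable.tsum_finsetSum fun _ _ => ENNReal.summable
    _ ≤ ∑ y₀ ∈ Y₀, c := by
        refine Finset.sum_le_sum fun y₀ _ => ?_
        refine le_trans ?_ (hc (N y₀))
        refine (ENNReal.tsum_comp_le_tsum_of_injective hinj
          fun z => if ∀ i, i ∉ U → z i = N y₀ i then G z else 0).trans (le_of_eq ?_)
        refine tsum_congr fun z => ?_
        split_ifs <;> rfl
    _ = _ := by rw [Finset.sum_const, nsmul_eq_mul]

/-- The sites of odd multiplicity of a walk. -/
def walkOdd (y : Fin (s + 2) → Site d) : Finset (Site d) :=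
  oddSet (Finset.univ.filter IsLetter) y

/-- No block of at least two consecutive letters has only even multiplicities. -/
def WalkAdmissible (y : Fin (s + 2) → Site d) : Prop :=
  ∀ a b : Fin (s + 2), IsLetter a → IsLetter b → a < b → oddSet (Finset.Icc a b) y ≠ ∅

/-- `φ` describes the coincidences of the walk `y`. -/
structure Fits (φ : Fin (s + 2) → Fin (s + 2)) (y : Fin (s + 2) → Site d) : Prop where
  pattern : IsPattern φ
  eq : ∀ p, y (φ p) = y p
  inj : ∀ p q, IsLetter p → IsLetter q → y p = y q → φ p = φ q

lemma Fits.iff {φ : Fin (s + 2) → Fin (s + 2)} {y : Fin (s + 2) → Site d} (h : Fits φ y)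
    {p q : Fin (s + 2)} (hp : IsLetter p) (hq : IsLetter q) : φ p = φ q ↔ y p = y q :=
  ⟨fun e => by rw [← h.eq p, e, h.eq], h.inj p q hp hq⟩

lemma isLetter_of_mem_Icc {a b p : Fin (s + 2)} (ha : IsLetter a) (hb : IsLetter b)
    (hp : p ∈ Finset.Icc a b) : IsLetter p := by
  rw [Finset.mem_Icc] at hp
  constructor
  · rintro rfl
    exact ha.1 (Fin.le_zero_iff.1 hp.1)
  · rintro rfl
    exact hb.2 (le_antisymm (Fin.le_last b) hp.2)

lemma WalkAdmissible.exists_fits {y : Fin (s + 2) → Site d} (hy : WalkAdmissible y) :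
    ∃ φ, Fits φ y := by
  classical
  set r : Site d → Fin (s + 2) := fun x =>
    if h : ∃ q, IsLetter q ∧ y q = x then h.choose else 0 with hr
  set φ : Fin (s + 2) → Fin (s + 2) := fun p => if IsLetter p then r (y p) else p with hφ
  have hrs : ∀ p, IsLetter p → IsLetter (r (y p)) ∧ y (r (y p)) = y p := by
    intro p hp
    have h : ∃ q, IsLetter q ∧ y q = y p := ⟨p, hp, rfl⟩
    simp only [hr, dif_pos h]
    exact h.choose_spec
  have h1 : ∀ p, IsLetter p → φ p = r (y p) := fun p hp => if_pos hp
  have h2 : ∀ p, ¬ IsLetter p → φ p = p := fun p hp => if_neg hp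
  have hlet : ∀ p, IsLetter p → IsLetter (φ p) := fun p hp => by rw [h1 p hp]; exact (hrs p hp).1
  have heq : ∀ p, y (φ p) = y p := fun p => by
    by_cases hp : IsLetter p
    · rw [h1 p hp]; exact (hrs p hp).2
    · rw [h2 p hp]
  refine ⟨φ, ⟨fun p => ?_, h2 0 fun h => h.1 rfl, h2 _ fun h => h.2 rfl, hlet,
    fun a b ha hb hab => ?_⟩, heq, fun p q hp hq h => ?_⟩
  · by_cases hp : IsLetter p
    · rw [h1 _ (hlet p hp), heq, ← h1 p hp]
    · rw [h2 p hp, h2 p hp]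
  · obtain ⟨x, hx⟩ := Finset.nonempty_iff_ne_empty.2 (hy a b ha hb hab)
    rw [mem_oddSet] at hx
    obtain ⟨q, hq⟩ := Finset.card_pos.1 hx.pos
    rw [Finset.mem_filter] at hq
    refine ⟨q, hq.1, ?_⟩
    convert hx using 2
    refine Finset.filter_congr fun p hp => ?_
    have hpl := isLetter_of_mem_Icc ha hb hp
    have hql := isLetter_of_mem_Icc ha hb hq.1
    rw [← hq.2, h1 p hpl, h1 q hql]
    constructor
    · intro h; rw [← (hrs p hpl).2, h, (hrs q hql).2]
    · intro h; rw [h]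
  · rw [h1 p hp, h1 q hq, h]

lemma Fits.mem_oddPositions {φ : Fin (s + 2) → Fin (s + 2)} {y : Fin (s + 2) → Site d}
    (h : Fits φ y) {p : Fin (s + 2)} (hp : IsLetter p) :
    p ∈ oddPositions φ ↔ y p ∈ walkOdd y := by
  rw [oddPositions, Set.mem_ofPred_eq, or_iff_right (by simpa using hp), walkOdd, mem_oddSet,
    Finset.filter_filter]
  have : (Finset.univ.filter fun q => IsLetter q ∧ φ q = φ p)
      = Finset.univ.filter fun q => IsLetter q ∧ y q = y p :=
    Finset.filter_congr fun q _ => and_congr_right fun hq => h.iff hq hp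
  rw [this]

lemma IsPattern.oddPositions_invariant {φ : Fin (s + 2) → Fin (s + 2)} (hφ : IsPattern φ) :
    ∀ p ∈ oddPositions φ, φ p ∈ oddPositions φ := by
  rintro p (hp | hp)
  · have : φ p = p := by
      rw [IsLetter, not_and_or, not_not, not_not] at hp
      rcases hp with rfl | rfl
      · exact hφ.zero
      · exact hφ.last
    rw [this]; exact Or.inl hp
  · refine Or.inr ?_
    rw [hφ.idem]; exact hp

lemma ennreal_mul_le_sq_add_sq (a b : ℝ≥0∞) : a * b ≤ a ^ 2 + b ^ 2 := by
  rcases le_total a b with h | h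
  · calc a * b ≤ b * b := by gcongr
      _ ≤ a ^ 2 + b ^ 2 := by rw [← pow_two]; exact le_add_self
  · calc a * b ≤ a * a := by gcongr
      _ ≤ a ^ 2 + b ^ 2 := by rw [← pow_two]; exact le_self_add

/-- Two admissible walks with the same ends and the same product of signs. -/
def SameSign (y y' : Fin (s + 2) → Site d) : Prop :=
  WalkAdmissible y ∧ WalkAdmissible y' ∧ y 0 = y' 0 ∧
    y (Fin.last (s + 1)) = y' (Fin.last (s + 1)) ∧ walkOdd y = walkOdd y'

lemma card_walkOdd_le (y : Fin (s + 2) → Site d) : (walkOdd y).card ≤ s + 2 := by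
  refine (Finset.card_filter_le _ _).trans (Finset.card_image_le.trans ?_)
  refine (Finset.card_filter_le _ _).trans ?_
  simp

/-- The sum over pairs of walks with the same sign product. The edges of each walk are split into
two sets as in `IsPattern.exists_split`; in the pair the factors of the first kind of one walk are
matched with those of the second kind of the other, and the arithmetic-geometric mean inequality
decouples the two sums. -/
theorem exists_pair_bound {k : Fin (s + 1) → EKern d} (hb : ∀ e, IsBdd (k e))
    {X : Set (Fin (s + 2))} (hX : X ⊆ {0, Fin.last (s + 1)})
    (hsplit : ∀ φ : Fin (s + 2) → Fin (s + 2), IsPattern φ → ∃ I J : Finset (Fin (s + 1)),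
      Disjoint I J ∧ (∀ e ∈ I ∪ J, IsSq (k e)) ∧
      Module.finrank ℝ (walkFunctions φ X I) = 0 ∧
      Module.finrank ℝ (walkFunctions φ (oddPositions φ) J) = 0) :
    ∃ c : ℝ≥0∞, c ≠ ∞ ∧ ∀ b : Fin (s + 2) → Site d,
      (open Classical in ∑' y : {y : Fin (s + 2) → Site d // ∀ p ∈ X, y p = b p},
        ∑' y' : {y : Fin (s + 2) → Site d // ∀ p ∈ X, y p = b p},
          if SameSign y.1 y'.1 then walkProd k Finset.univ y.1 * walkProd k Finset.univ y'.1
          else 0) ≤ c := by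
  classical
  have hsplit' : ∀ φ : Fin (s + 2) → Fin (s + 2), ∃ I J : Finset (Fin (s + 1)), IsPattern φ →
      (Disjoint I J ∧ (∀ e ∈ I ∪ J, IsSq (k e)) ∧
      Module.finrank ℝ (walkFunctions φ X I) = 0 ∧
      Module.finrank ℝ (walkFunctions φ (oddPositions φ) J) = 0) := by
    intro φ
    by_cases h : IsPattern φ
    · obtain ⟨I, J, h'⟩ := hsplit φ h
      exact ⟨I, J, fun _ => h'⟩
    · exact ⟨∅, ∅, fun h' => absurd h' h⟩
  choose I J hIJ using hsplit'
  -- a bound for all kernels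
  choose c₁ hc₁ hc₁b using hb
  set c₀ : ℝ≥0∞ := ∏ e, (1 + c₁ e) with hc₀
  have hc₀t : c₀ ≠ ∞ := (ENNReal.prod_lt_top fun e _ =>
    (ENNReal.add_ne_top.2 ⟨ENNReal.one_ne_top, hc₁ e⟩).lt_top).ne
  have hfac : ∀ φ, IsPattern φ → ∀ y, walkProd k Finset.univ y
      ≤ c₀ * (walkProd k (I φ) y * walkProd k (J φ) y) := by
    intro φ hφ y
    have hd := (hIJ φ hφ).1
    simp only [walkProd]
    rw [← Finset.prod_union hd, ← Finset.prod_sdiff (Finset.subset_univ (I φ ∪ J φ))]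
    gcongr
    calc _ ≤ ∏ e ∈ Finset.univ \ (I φ ∪ J φ), (1 + c₁ e) :=
          Finset.prod_le_prod' fun e _ => (hc₁b e _ _).trans le_add_self
      _ ≤ c₀ := Finset.prod_le_prod_of_subset_of_one_le' (Finset.subset_univ _)
          fun e _ _ => le_self_add
  -- sums over one walk of given pattern
  have hg : ∀ φ : Fin (s + 2) → Fin (s + 2), ∃ c : ℝ≥0∞, c ≠ ∞ ∧ ∀ b : Fin (s + 2) → Site d,
      ∑' y : {y : Fin (s + 2) → Site d // Fits φ y ∧ ∀ p ∈ X, y p = b p},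
        walkProd k (I φ) y ^ 2 ≤ c := by
    intro φ
    by_cases hφ : IsPattern φ
    swap
    · refine ⟨0, by simp, fun b => ?_⟩
      have : IsEmpty {y : Fin (s + 2) → Site d // Fits φ y ∧ ∀ p ∈ X, y p = b p} :=
        ⟨fun y => hφ y.2.1.pattern⟩
      simp
    obtain ⟨-, hsq, hI, -⟩ := hIJ φ hφ
    obtain ⟨c, hc, hcb⟩ := exists_sumOff_bound k (fun e => φ e.castSucc) (fun e => φ e.succ)
      (Finset.univ.filter fun p => φ p = p ∧ p ∉ X) (I φ)
      (fun e he => hsq e (Finset.mem_union_left _ he)) fun F hF hne =>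
        exists_crossing hI hφ.idem (fun p hp => by
          rcases hX hp with rfl | hp'
          · rwa [hφ.zero]
          · rw [Set.mem_singleton_iff] at hp'
            subst hp'; rwa [hφ.last]) hne
          (fun p hp => (Finset.mem_filter.1 (hF hp)).2.1)
          fun p hp => (Finset.mem_filter.1 (hF hp)).2.2
    refine ⟨c, hc, fun b => ?_⟩
    refine (tsum_walkProd_sq_le hcb hφ.idem _ {b} fun y hy => ⟨hy.1.eq, b, by simp,
      fun i hi hφi => hy.2 i ?_⟩).trans (by simp)
    by_contra h
    exact hi (by simp [hφi, h])
  -- the same, for walks with the ends and the sign product of `y₀`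
  have hf : ∀ φ : Fin (s + 2) → Fin (s + 2), ∃ c : ℝ≥0∞, c ≠ ∞ ∧ ∀ y₀ : Fin (s + 2) → Site d,
      ∑' y : {y : Fin (s + 2) → Site d // Fits φ y ∧ SameSign y₀ y},
        walkProd k (J φ) y ^ 2 ≤ c := by
    intro φ
    by_cases hφ : IsPattern φ
    swap
    · refine ⟨0, by simp, fun b => ?_⟩
      have : IsEmpty {y : Fin (s + 2) → Site d // Fits φ y ∧ SameSign b y} :=
        ⟨fun y => hφ y.2.1.pattern⟩
      simp
    obtain ⟨-, hsq, -, hJ⟩ := hIJ φ hφ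
    obtain ⟨c, hc, hcb⟩ := exists_sumOff_bound k (fun e => φ e.castSucc) (fun e => φ e.succ)
      (Finset.univ.filter fun p => φ p = p ∧ p ∉ oddPositions φ) (J φ)
      (fun e he => hsq e (Finset.mem_union_right _ he)) fun F hF hne =>
        exists_crossing hJ hφ.idem hφ.oddPositions_invariant hne
          (fun p hp => (Finset.mem_filter.1 (hF hp)).2.1)
          fun p hp => (Finset.mem_filter.1 (hF hp)).2.2
    refine ⟨((s + 4) ^ (s + 2) : ℕ) * c, ENNReal.mul_ne_top (by simp) hc, fun y₀ => ?_⟩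
    -- letters of odd multiplicity take their values in a finite set
    set V : Finset (Site d) :=
      insert (y₀ 0) (insert (y₀ (Fin.last (s + 1))) (walkOdd y₀)) with hV
    have hVc : V.card ≤ s + 4 := by
      have h1 := Finset.card_insert_le (y₀ 0) (insert (y₀ (Fin.last (s + 1))) (walkOdd y₀))
      have h2 := Finset.card_insert_le (y₀ (Fin.last (s + 1))) (walkOdd y₀)
      have h3 := card_walkOdd_le y₀
      refine le_trans (le_of_eq ?_) (h1.trans (by omega : _ ≤ s + 4))
      rw [hV]
    refine (tsum_walkProd_sq_le hcb hφ.idem _ (Fintype.piFinset fun _ => V)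
      fun y hy => ⟨hy.1.eq, fun i => if i ∈ oddPositions φ then y i else y₀ 0, ?_, ?_⟩).trans ?_
    · obtain ⟨hfit, -, -, h0, hl, ho⟩ := hy
      rw [Fintype.mem_piFinset]
      intro i
      split_ifs with hi
      · by_cases hil : IsLetter i
        · have := (hfit.mem_oddPositions hil).1 hi
          rw [← ho] at this
          simp [hV, this]
        · rw [IsLetter, not_and_or, not_not, not_not] at hil
          rcases hil with rfl | rfl
          · simp [hV, h0]
          · simp [hV, hl]
      · simp [hV]
    · intro i hi hφi
      have : i ∈ oddPositions φ := by
        by_contra h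
        exact hi (by simp [hφi, h])
      exact (if_pos this).symm
    · gcongr
      rw [Fintype.card_piFinset]
      simp only [Finset.prod_const, Finset.card_univ, Fintype.card_fin]
      exact_mod_cast Nat.pow_le_pow_left hVc _
  choose cg hcg hg using hg
  choose cf hcf hf using hf
  -- a pattern for every admissible walk
  have hpat : ∀ y : Fin (s + 2) → Site d, ∃ φ, WalkAdmissible y → Fits φ y := by
    intro y
    by_cases hy : WalkAdmissible y
    · obtain ⟨φ, h⟩ := hy.exists_fits
      exact ⟨φ, fun _ => h⟩
    · exact ⟨id, fun h => absurd h hy⟩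
  choose Φ hΦ using hpat
  set A : (Fin (s + 2) → Site d) → ℝ≥0∞ := fun y => walkProd k (I (Φ y)) y with hA
  set B : (Fin (s + 2) → Site d) → ℝ≥0∞ := fun y => walkProd k (J (Φ y)) y with hB
  set CG : ℝ≥0∞ := ∑ φ, cg φ with hCG
  set CF : ℝ≥0∞ := ∑ φ, cf φ with hCF
  have hCGt : CG ≠ ∞ := (ENNReal.sum_lt_top.2 fun φ _ => (hcg φ).lt_top).ne
  have hCFt : CF ≠ ∞ := (ENNReal.sum_lt_top.2 fun φ _ => (hcf φ).lt_top).ne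
  refine ⟨c₀ ^ 2 * (CG * CF + CG * CF), by finiteness, fun b => ?_⟩
  set T := {y : Fin (s + 2) → Site d // ∀ p ∈ X, y p = b p} with hT
  have hsumf : ∀ y₀ : Fin (s + 2) → Site d,
      ∑' y : T, (if SameSign y₀ y.1 then B y.1 ^ 2 else 0) ≤ CF := by
    intro y₀
    calc ∑' y : T, (if SameSign y₀ y.1 then B y.1 ^ 2 else 0)
        ≤ ∑' y : Fin (s + 2) → Site d, (if SameSign y₀ y then B y ^ 2 else 0) :=
          ENNReal.tsum_comp_le_tsum_of_injective Subtype.val_injective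
            fun y => if SameSign y₀ y then B y ^ 2 else 0
      _ ≤ ∑' y : Fin (s + 2) → Site d, ∑ φ,
            {y | Fits φ y ∧ SameSign y₀ y}.indicator (fun y => walkProd k (J φ) y ^ 2) y := by
          refine ENNReal.tsum_le_tsum fun y => ?_
          split_ifs with h
          · refine le_trans (le_of_eq ?_)
              (Finset.single_le_sum (fun _ _ => zero_le) (Finset.mem_univ (Φ y)))
            exact (Set.indicator_of_mem (s := {z | Fits (Φ y) z ∧ SameSign y₀ z})
              ⟨hΦ y h.2.1, h⟩ fun z => walkProd k (J (Φ y)) z ^ 2).symm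
          · exact zero_le
      _ = ∑ φ, ∑' y : {y : Fin (s + 2) → Site d // Fits φ y ∧ SameSign y₀ y},
            walkProd k (J φ) y ^ 2 := by
          rw [Summable.tsum_finsetSum fun _ _ => ENNReal.summable]
          refine Finset.sum_congr rfl fun φ _ => ?_
          exact (tsum_subtype {y | Fits φ y ∧ SameSign y₀ y} _).symm
      _ ≤ CF := Finset.sum_le_sum fun φ _ => hf φ y₀
  have hsumg : ∑' y : T, (if WalkAdmissible y.1 then A y.1 ^ 2 else 0) ≤ CG := by
    have e : ∑' y : T, (if WalkAdmissible y.1 then A y.1 ^ 2 else 0)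
        = ∑' y : Fin (s + 2) → Site d, {y : Fin (s + 2) → Site d | ∀ p ∈ X, y p = b p}.indicator
          (fun y => if WalkAdmissible y then A y ^ 2 else 0) y :=
      tsum_subtype {y : Fin (s + 2) → Site d | ∀ p ∈ X, y p = b p}
        fun y => if WalkAdmissible y then A y ^ 2 else 0
    rw [e]
    calc _ ≤ ∑' y : Fin (s + 2) → Site d, ∑ φ, {y | Fits φ y ∧ ∀ p ∈ X, y p = b p}.indicator
            (fun y => walkProd k (I φ) y ^ 2) y := by
          refine ENNReal.tsum_le_tsum fun y => ?_
          by_cases hy : y ∈ {y : Fin (s + 2) → Site d | ∀ p ∈ X, y p = b p}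
          · rw [Set.indicator_of_mem hy]
            split_ifs with h
            · refine le_trans (le_of_eq ?_)
                (Finset.single_le_sum (fun _ _ => zero_le) (Finset.mem_univ (Φ y)))
              exact (Set.indicator_of_mem (s := {z | Fits (Φ y) z ∧ ∀ p ∈ X, z p = b p})
                ⟨hΦ y h, hy⟩ fun z => walkProd k (I (Φ y)) z ^ 2).symm
            · exact zero_le
          · rw [Set.indicator_of_notMem hy]; exact zero_le
      _ = ∑ φ, ∑' y : {y : Fin (s + 2) → Site d // Fits φ y ∧ ∀ p ∈ X, y p = b p},
            walkProd k (I φ) y ^ 2 := by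
          rw [Summable.tsum_finsetSum fun _ _ => ENNReal.summable]
          refine Finset.sum_congr rfl fun φ _ => ?_
          exact (tsum_subtype {y | Fits φ y ∧ ∀ p ∈ X, y p = b p} _).symm
      _ ≤ CG := Finset.sum_le_sum fun φ _ => hg φ b
  have hsymm : ∀ y y' : Fin (s + 2) → Site d, SameSign y y' ↔ SameSign y' y := fun y y' =>
    ⟨fun ⟨h1, h2, h3, h4, h5⟩ => ⟨h2, h1, h3.symm, h4.symm, h5.symm⟩,
     fun ⟨h1, h2, h3, h4, h5⟩ => ⟨h2, h1, h3.symm, h4.symm, h5.symm⟩⟩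
  -- the sum over `y'` is bounded for every `y`; only then is the sum over `y` carried out
  have hdec : ∑' y : T, ∑' y' : T, (if SameSign y.1 y'.1 then A y.1 ^ 2 * B y'.1 ^ 2 else 0)
      ≤ CG * CF := by
    calc _ ≤ ∑' y : T, (if WalkAdmissible y.1 then A y.1 ^ 2 else 0) * CF := by
          refine ENNReal.tsum_le_tsum fun y => ?_
          by_cases hy : WalkAdmissible y.1
          · rw [if_pos hy]
            refine le_trans ?_ (mul_le_mul_right (hsumf y.1) (A y.1 ^ 2))
            rw [← ENNReal.tsum_mul_left]
            refine ENNReal.tsum_le_tsum fun y' => ?_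
            split_ifs <;> simp
          · have : ∀ y' : T, ¬ SameSign y.1 y'.1 := fun y' h => hy h.1
            simp [this]
      _ ≤ CG * CF := by rw [ENNReal.tsum_mul_right]; gcongr
  calc _ ≤ ∑' y : T, ∑' y' : T, c₀ ^ 2 *
        ((if SameSign y.1 y'.1 then A y.1 ^ 2 * B y'.1 ^ 2 else 0)
          + (if SameSign y'.1 y.1 then A y'.1 ^ 2 * B y.1 ^ 2 else 0)) := by
        refine ENNReal.tsum_le_tsum fun y => ENNReal.tsum_le_tsum fun y' => ?_
        by_cases h : SameSign y.1 y'.1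
        · rw [if_pos h, if_pos h, if_pos ((hsymm _ _).1 h)]
          calc _ ≤ (c₀ * (A y.1 * B y.1)) * (c₀ * (A y'.1 * B y'.1)) :=
                mul_le_mul' (hfac _ (hΦ _ h.1).pattern _) (hfac _ (hΦ _ h.2.1).pattern _)
            _ = c₀ ^ 2 * ((A y.1 * B y'.1) * (A y'.1 * B y.1)) := by ring
            _ ≤ c₀ ^ 2 * ((A y.1 * B y'.1) ^ 2 + (A y'.1 * B y.1) ^ 2) := by
                gcongr; exact ennreal_mul_le_sq_add_sq _ _
            _ = _ := by rw [mul_pow, mul_pow]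
        · rw [if_neg h]; exact zero_le
    _ = c₀ ^ 2 * (∑' y : T, ∑' y' : T,
          (if SameSign y.1 y'.1 then A y.1 ^ 2 * B y'.1 ^ 2 else 0)
        + ∑' y : T, ∑' y' : T, (if SameSign y'.1 y.1 then A y'.1 ^ 2 * B y.1 ^ 2 else 0)) := by
        simp only [ENNReal.tsum_mul_left, ENNReal.tsum_add]
    _ ≤ c₀ ^ 2 * (CG * CF + CG * CF) := by
        gcongr
        rw [ENNReal.tsum_comm]
        exact hdec

end Walk

/-! ### Admissible sums as sums over walks -/

section Walks

variable {s : ℕ}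

/-- The product `K₀(n,t₀) K₁(t₀,t₁) ⋯ K_s(t_{s-1},n')`. -/
def edgeProd (K : ℕ → Kern d) (s : ℕ) (n n' : Site d) (t : Fin s → Site d) : ℝ :=
  ∏ j ∈ Finset.range (s + 1), K j (vertex n n' t j) (vertex n n' t (j + 1))

/-- The sequence of vertices of a path, including its ends. -/
def walkOf (n n' : Site d) (t : Fin s → Site d) (p : Fin (s + 2)) : Site d := vertex n n' t p

/-- The position of the `i`-th letter in a walk. -/
def letterPos : Fin s ↪o Fin (s + 2) :=
  (Fin.castSuccOrderEmb (n := s)).trans (Fin.succOrderEmb (s + 1))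

lemma letterPos_val (i : Fin s) : (letterPos i : ℕ) = i + 1 := rfl

lemma walkOf_letterPos (n n' : Site d) (t : Fin s → Site d) (i : Fin s) :
    walkOf n n' t (letterPos i) = t i := by
  simp [walkOf, vertex, letterPos_val]

lemma walkOf_zero (n n' : Site d) (t : Fin s → Site d) : walkOf n n' t 0 = n := by
  simp [walkOf, vertex]

lemma walkOf_last (n n' : Site d) (t : Fin s → Site d) :
    walkOf n n' t (Fin.last (s + 1)) = n' := by
  simp [walkOf, vertex]

lemma isLetter_letterPos (i : Fin s) : IsLetter (letterPos i) := by
  constructor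
  · intro h
    have := congrArg Fin.val h
    simp [letterPos_val] at this
  · intro h
    have := congrArg Fin.val h
    simp only [letterPos_val, Fin.val_last] at this
    omega

lemma IsLetter.exists_letterPos {p : Fin (s + 2)} (hp : IsLetter p) : ∃ i, letterPos i = p := by
  have h0 : (p : ℕ) ≠ 0 := fun h => hp.1 (Fin.ext h)
  have h1 : (p : ℕ) ≠ s + 1 := fun h => hp.2 (Fin.ext h)
  refine ⟨⟨p - 1, by omega⟩, Fin.ext ?_⟩
  rw [letterPos_val]
  simp only
  omega

lemma oddSet_map {ι ι' : Type*} (f : ι ↪ ι') (I : Finset ι) (y : ι' → Site d) :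
    oddSet (I.map f) y = oddSet I fun i => y (f i) := by
  ext x
  rw [mem_oddSet, mem_oddSet, Finset.filter_map, Finset.card_map]
  rfl

lemma oddSet_Icc_walkOf (n n' : Site d) (t : Fin s → Site d) (a b : Fin s) :
    oddSet (Finset.Icc (letterPos a) (letterPos b)) (walkOf n n' t)
      = oddSet (Finset.Icc a b) t := by
  have : Finset.Icc (letterPos a) (letterPos b)
      = (Finset.Icc a b).map (letterPos (s := s)).toEmbedding := by
    ext p
    rw [Finset.mem_map]
    constructor
    · intro hp
      obtain ⟨i, rfl⟩ := (isLetter_of_mem_Icc (isLetter_letterPos a) (isLetter_letterPos b)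
        hp).exists_letterPos
      exact ⟨i, by simpa using hp, rfl⟩
    · rintro ⟨i, hi, rfl⟩
      simpa using hi
  rw [this, oddSet_map]
  congr 1
  ext i : 1
  exact walkOf_letterPos n n' t i

lemma walkOdd_walkOf (n n' : Site d) (t : Fin s → Site d) :
    walkOdd (walkOf n n' t) = oddSet Finset.univ t := by
  have : Finset.univ.filter (IsLetter (s := s))
      = Finset.univ.map (letterPos (s := s)).toEmbedding := by
    ext p
    rw [Finset.mem_map, Finset.mem_filter]
    exact ⟨fun h => by obtain ⟨i, hi⟩ := h.2.exists_letterPos; exact ⟨i, Finset.mem_univ _, hi⟩,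
      fun ⟨i, _, hi⟩ => ⟨Finset.mem_univ _, hi ▸ isLetter_letterPos i⟩⟩
  rw [walkOdd, this, oddSet_map]
  congr 1
  ext i : 1
  exact walkOf_letterPos n n' t i

variable {Ω : Type*} [MeasurableSpace Ω] {P : Measure Ω} {ω : Site d → Ω → ℝ}

lemma enorm_finset_prod {ι : Type*} (I : Finset ι) (f : ι → ℝ) :
    ‖∏ i ∈ I, f i‖ₑ = ∏ i ∈ I, ‖f i‖ₑ := by
  classical
  induction I using Finset.induction_on with
  | empty => simp
  | insert i I hi ih => rw [Finset.prod_insert hi, Finset.prod_insert hi, enorm_mul, ih]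

lemma enorm_edgeProd_le {K : ℕ → Kern d} {k : Fin (s + 1) → EKern d}
    (h : ∀ (e : Fin (s + 1)) x y, ‖K e x y‖ₑ ≤ k e x y) (n n' : Site d) (t : Fin s → Site d) :
    ‖edgeProd K s n n' t‖ₑ ≤ walkProd k Finset.univ (walkOf n n' t) := by
  rw [edgeProd, walkProd, Finset.prod_range
    (fun j => K j (vertex n n' t j) (vertex n n' t (j + 1))), enorm_finset_prod]
  exact Finset.prod_le_prod' fun e _ => h e _ _

lemma enorm_prod_le {κ : ℝ} {u : Site d → ℝ} (hu : ∀ x, |u x| ≤ κ) (t : Fin s → Site d) :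
    ‖∏ i, u (t i)‖ₑ ≤ ENNReal.ofReal κ ^ s := by
  rw [enorm_finset_prod]
  calc _ ≤ ∏ _i : Fin s, ENNReal.ofReal κ :=
        Finset.prod_le_prod' fun i _ => enorm_le_of_abs_le hu _
    _ = _ := by simp

/-- A bound for the coefficients of an admissible sum. -/
def walkBound (P : Measure Ω) (ω : Site d → Ω → ℝ) (k : Fin (s + 1) → EKern d) (κ : ℝ)
    (n n' : Site d) (t : {t : Fin s → Site d // Admissible P ω t}) : ℝ≥0∞ :=
  walkProd k Finset.univ (walkOf n n' t.1) * ENNReal.ofReal κ ^ s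

lemma enorm_coefficient_le {K : ℕ → Kern d} {k : Fin (s + 1) → EKern d}
    (h : ∀ (e : Fin (s + 1)) x y, ‖K e x y‖ₑ ≤ k e x y) {κ : ℝ} {u : Site d → ℝ}
    (hu : ∀ x, |u x| ≤ κ) (n n' : Site d) (t : {t : Fin s → Site d // Admissible P ω t}) :
    ‖edgeProd K s n n' t.1 * ∏ i, u (t.1 i)‖ₑ ≤ walkBound P ω k κ n n' t := by
  rw [enorm_mul]
  exact mul_le_mul' (enorm_edgeProd_le h n n' t.1) (enorm_prod_le hu t.1)

lemma pairSum_le {K : ℕ → Kern d} {k : Fin (s + 1) → EKern d}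
    (h : ∀ (e : Fin (s + 1)) x y, ‖K e x y‖ₑ ≤ k e x y) {κ : ℝ} {u : Site d → ℝ}
    (hu : ∀ x, |u x| ≤ κ) (n n' : Site d) :
    pairSum (fun t : {t : Fin s → Site d // Admissible P ω t} =>
      edgeProd K s n n' t.1 * ∏ i, u (t.1 i)) (fun t => oddSet Finset.univ t.1)
    ≤ ∑' t, ∑' t', open Classical in
      if oddSet Finset.univ t.1 = oddSet Finset.univ t'.1 then
        walkBound P ω k κ n n' t * walkBound P ω k κ n n' t' else 0 := by
  refine ENNReal.tsum_le_tsum fun t => ENNReal.tsum_le_tsum fun t' => ?_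
  split_ifs
  · exact mul_le_mul' (enorm_coefficient_le h hu n n' t) (enorm_coefficient_le h hu n n' t')
  · exact le_rfl

variable [IsProbabilityMeasure P]

lemma IsBernoulliField.admissible_iff (hω : IsBernoulliField P ω) (t : Fin s → Site d) :
    Admissible P ω t ↔ ∀ a b : Fin s, a < b → oddSet (Finset.Icc a b) t ≠ ∅ := by
  simp only [Admissible, hω.cancels_iff, ne_eq]

lemma IsBernoulliField.walkAdmissible (hω : IsBernoulliField P ω) (n n' : Site d)
    {t : Fin s → Site d} (ht : Admissible P ω t) : WalkAdmissible (walkOf n n' t) := by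
  intro a b ha hb hab
  obtain ⟨i, rfl⟩ := ha.exists_letterPos
  obtain ⟨j, rfl⟩ := hb.exists_letterPos
  rw [oddSet_Icc_walkOf]
  exact (hω.admissible_iff t).1 ht i j (by simpa using hab)

lemma IsBernoulliField.sameSign (hω : IsBernoulliField P ω) (n n' : Site d)
    {t t' : Fin s → Site d} (ht : Admissible P ω t) (ht' : Admissible P ω t')
    (h : oddSet Finset.univ t = oddSet Finset.univ t') :
    SameSign (walkOf n n' t) (walkOf n n' t') := by
  refine ⟨hω.walkAdmissible n n' ht, hω.walkAdmissible n n' ht', ?_, ?_, ?_⟩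
  · rw [walkOf_zero, walkOf_zero]
  · rw [walkOf_last, walkOf_last]
  · rw [walkOdd_walkOf, walkOdd_walkOf, h]

/-- The admissible sum with kernels `K` and potential `u`, as an element of `L²`. -/
def admLp (hω : IsBernoulliField P ω) (K : ℕ → Kern d) (s : ℕ) (u : Site d → ℝ)
    (n n' : Site d) : Lp ℝ 2 P :=
  ∑' t : {t : Fin s → Site d // Admissible P ω t},
    (edgeProd K s n n' t.1 * ∏ i, u (t.1 i)) • eSign hω (oddSet Finset.univ t.1)

lemma walkOf_injective (n' : Site d) {n m : Site d} {t t' : Fin s → Site d}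
    (h : walkOf n n' t = walkOf m n' t') : n = m ∧ t = t' := by
  refine ⟨?_, funext fun i => ?_⟩
  · rw [← walkOf_zero n n' t, h, walkOf_zero]
  · rw [← walkOf_letterPos n n' t, h, walkOf_letterPos]

lemma tsum_tsum_comp_le {ι T : Type*} {g : ι → T} (hg : Function.Injective g)
    (F : T → T → ℝ≥0∞) : ∑' i, ∑' j, F (g i) (g j) ≤ ∑' y, ∑' y', F y y' :=
  (ENNReal.tsum_le_tsum fun i => ENNReal.tsum_comp_le_tsum_of_injective hg (F (g i))).trans
    (ENNReal.tsum_comp_le_tsum_of_injective hg fun y => ∑' y', F y y')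

/-- The pairs of walks between two given sites with the same sign product. As both ends are fixed,
`IsPattern.exists_split_erase` spares the edge `j`, whose factor need only be bounded. -/
lemma exists_pairSum_bound (hω : IsBernoulliField P ω) {k : Fin (s + 1) → EKern d}
    (hb : ∀ e, IsBdd (k e)) (j : Fin (s + 1)) (hk : ∀ e, e ≠ j → IsSq (k e)) (κ : ℝ)
    (n n' : Site d) : (∑' t, ∑' t', open Classical in
      if oddSet Finset.univ t.1 = oddSet Finset.univ t'.1 then
        walkBound P ω k κ n n' t * walkBound P ω k κ n n' t' else 0) ≠ ∞ := by
  classical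
  obtain ⟨c, hc, hcb⟩ := exists_pair_bound hb (X := {0, Fin.last (s + 1)}) le_rfl fun φ hφ => by
    obtain ⟨I, J, h1, h2, h3, h4, h5⟩ := hφ.exists_split_erase j
    refine ⟨I, J, h1, fun e he => hk e ?_, h4, h5⟩
    rintro rfl
    rcases Finset.mem_union.1 he with h | h
    exacts [h2 h, h3 h]
  set b : Fin (s + 2) → Site d := walkOf n n' (0 : Fin s → Site d) with hbdef
  set g : {t : Fin s → Site d // Admissible P ω t} →
      {y : Fin (s + 2) → Site d // ∀ p ∈ ({0, Fin.last (s + 1)} : Set (Fin (s + 2))), y p = b p} :=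
    fun t => ⟨walkOf n n' t.1, by
      rintro p (rfl | rfl)
      · rw [hbdef, walkOf_zero, walkOf_zero]
      · rw [hbdef, walkOf_last, walkOf_last]⟩ with hg
  have hinj : Function.Injective g := fun t t' h =>
    Subtype.ext (walkOf_injective n' (congrArg Subtype.val h)).2
  have h1 := (tsum_tsum_comp_le hinj _).trans (hcb b)
  refine ne_top_of_le_ne_top (ENNReal.mul_ne_top
    (b := (ENNReal.ofReal κ ^ s) ^ 2) hc (by finiteness)) ?_
  refine le_trans ?_ (mul_le_mul_left h1 _)
  simp only [← ENNReal.tsum_mul_right]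
  refine ENNReal.tsum_le_tsum fun t => ENNReal.tsum_le_tsum fun t' => ?_
  split_ifs with h2 h3
  · exact le_of_eq (by simp only [walkBound, hg]; ring)
  · exact absurd (hω.sameSign n n' t.2 t'.2 h2) h3
  · exact zero_le
  · exact zero_le

/-- If all factors are square-summable, the bound for pairs of walks is summable over the
beginning of the walk. -/
lemma exists_tsum_pairSum_bound (hω : IsBernoulliField P ω) {k : Fin (s + 1) → EKern d}
    (hk : ∀ e, IsSq (k e)) (κ : ℝ) : ∃ c : ℝ≥0∞, c ≠ ∞ ∧ ∀ n' : Site d,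
      ∑' n, (∑' t, ∑' t', open Classical in
        if oddSet Finset.univ t.1 = oddSet Finset.univ t'.1 then
        walkBound P ω k κ n n' t * walkBound P ω k κ n n' t' else 0) ≤ c := by
  classical
  obtain ⟨c, hc, hcb⟩ := exists_pair_bound (fun e => (hk e).isBdd) (X := {Fin.last (s + 1)})
    (by simp) fun φ hφ => by
      obtain ⟨I, h1, h2⟩ := hφ.exists_split
      exact ⟨I, Iᶜ, disjoint_compl_right, fun e _ => hk e, h1, h2⟩
  refine ⟨c * (ENNReal.ofReal κ ^ s) ^ 2, ENNReal.mul_ne_top hc (by finiteness), fun n' => ?_⟩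
  set b : Fin (s + 2) → Site d := fun _ => n' with hbdef
  set g : Site d × {t : Fin s → Site d // Admissible P ω t} →
      {y : Fin (s + 2) → Site d // ∀ p ∈ ({Fin.last (s + 1)} : Set (Fin (s + 2))), y p = b p} :=
    fun q => ⟨walkOf q.1 n' q.2.1, by
      rintro p rfl
      rw [walkOf_last]⟩ with hg
  have hinj : Function.Injective g := fun q q' h => by
    obtain ⟨h1, h2⟩ := walkOf_injective n' (congrArg Subtype.val h)
    exact Prod.ext h1 (Subtype.ext h2)
  have h1 := (tsum_tsum_comp_le hinj _).trans (hcb b)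
  refine le_trans ?_ (mul_le_mul_left h1 _)
  rw [ENNReal.tsum_prod', ← ENNReal.tsum_mul_right]
  refine ENNReal.tsum_le_tsum fun n => ?_
  rw [← ENNReal.tsum_mul_right]
  refine ENNReal.tsum_le_tsum fun t => ?_
  rw [← ENNReal.tsum_mul_right, ENNReal.tsum_prod']
  refine le_trans ?_ (ENNReal.le_tsum n)
  refine ENNReal.tsum_le_tsum fun t' => ?_
  split_ifs with h2 h3
  · exact le_of_eq (by simp only [walkBound, hg]; ring)
  · exact absurd (hω.sameSign n n' t.2 t'.2 h2) h3
  · exact zero_le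
  · exact zero_le

end Walks

/-! ### The admissible sums of the expansion -/

lemma GreenClass.isSq {A : EKern d} : ∀ {k : ℕ}, k ≤ 1 → GreenClass k A → IsSq A
  | 0, _, h => by
    have hb : IsBdd A := GreenClass.isBdd (k := 0) h
    have h2 : IsSchur fun x y => A x y * A x y := hb.mul_isSchur h
    simp only [← pow_two] at h2
    exact h2
  | 1, _, h => h

/-- The `j`-th factor of a word. -/
def Word.edge (u : Site d → ℝ) (A : Word) (j : ℕ) : Kern d :=
  kprod ((A.getD j []).map fun a => a.kern u)

/-- A word to which the convergence results apply: all factors are admitted products, and at most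
one of them, the `j`-th, contains two Green's functions. -/
structure Word.Good (A : Word) (s : ℕ) : Prop where
  length : A.length = s + 1
  product : ∀ j < s + 1, goodProduct (A.getD j []) = true
  two : ∃ j < s + 1, ∀ e < s + 1, e ≠ j → greenCount (A.getD e []) ≤ 1

lemma wordTerms_isGood {i : ℕ} (hi : i ≤ 7) {p : Coef × Word} (hp : p ∈ wordTerms i) {s : ℕ}
    (hs : p.2.length - 1 = s) : Word.Good p.2 s := by
  have h : ∀ i ≤ 7, (wordTerms i).all (fun p =>
      decide (p.2.length = p.2.length - 1 + 1 ∧ (∀ j < p.2.length - 1 + 1,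
        goodProduct (p.2.getD j []) = true) ∧ ∃ j < p.2.length - 1 + 1, ∀ e < p.2.length - 1 + 1,
        e ≠ j → greenCount (p.2.getD e []) ≤ 1)) = true := by decide +kernel
  obtain ⟨h1, h2, h3⟩ := of_decide_eq_true (List.all_eq_true.1 (h i hi) p hp)
  subst hs
  exact ⟨h1, h2, h3⟩

/-- Majorants of the factors of a word, uniform in the potential. The factor with two Green's
functions only gets a bounded one, as its square summability rests on a cancellation that fails at
the edge of a cutoff of the potential. -/
lemma exists_majorants (hd : 5 ≤ d) (κ : ℝ) {A : Word} {s : ℕ} (hA : A.Good s) :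
    ∃ (k : Fin (s + 1) → EKern d) (j : Fin (s + 1)), (∀ e, IsBdd (k e)) ∧
      (∀ e, e ≠ j → IsSq (k e)) ∧
      (∀ u : Site d → ℝ, (∀ x, |u x| ≤ κ) → ∀ (e : Fin (s + 1)) x y,
        ‖A.edge u e x y‖ₑ ≤ k e x y) ∧
      ∀ (u : ℕ → Site d → ℝ) (u' : Site d → ℝ), (∀ N x, |u N x| ≤ κ) →
        (∀ x, Tendsto (fun N => u N x) atTop (𝓝 (u' x))) → ∀ (e : Fin (s + 1)) x y,
        Tendsto (fun N => A.edge (u N) e x y) atTop (𝓝 (A.edge u' e x y)) := by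
  have hex : ∀ e : Fin (s + 1), ∃ B : EKern d, GreenClass (greenCount (A.getD e [])) B ∧
      DominatedPath κ ((A.getD e []).map Atom.kern) B := fun e =>
    exists_dominatedPath hd κ _ (goodProduct_spec (hA.product e e.2)).1
      (goodProduct_spec (hA.product e e.2)).2
  choose k hk hdom using hex
  obtain ⟨j, hj, hj2⟩ := hA.two
  refine ⟨k, ⟨j, hj⟩, fun e => (hk e).isBdd, fun e he => (hk e).isSq
    (hj2 e e.2 fun h => he (Fin.ext h)), fun u hu e x y => ?_, fun u u' hu ht e x y => ?_⟩
  · have h1 := (hdom e).bound u hu x y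
    rw [List.map_map] at h1
    exact (enorm_kprod_le (by simpa using (goodProduct_spec (hA.product e e.2)).1) x y).trans h1
  · have h1 := (hdom e).tendsto u u' hu ht x y
    simp only [List.map_map] at h1
    exact h1

section Field

variable {Ω : Type*} [MeasurableSpace Ω] {P : Measure Ω} [IsProbabilityMeasure P]
  {ω : Site d → Ω → ℝ}

lemma Word.Good.pairSum_ne_top (hd : 5 ≤ d) (hω : IsBernoulliField P ω) {A : Word} {s : ℕ}
    (hA : A.Good s) {κ : ℝ} {u : Site d → ℝ} (hu : ∀ x, |u x| ≤ κ) (n n' : Site d) :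
    pairSum (fun t : {t : Fin s → Site d // Admissible P ω t} =>
      edgeProd (A.edge u) s n n' t.1 * ∏ i, u (t.1 i)) (fun t => oddSet Finset.univ t.1) ≠ ∞ := by
  obtain ⟨k, j, h1, h2, h3, -⟩ := exists_majorants hd κ hA
  exact ne_top_of_le_ne_top (exists_pairSum_bound hω h1 j h2 κ n n') (pairSum_le (h3 u hu) hu n n')

/-- The admissible sums depend continuously on the potential. -/
lemma Word.Good.tendsto_admLp (hd : 5 ≤ d) (hω : IsBernoulliField P ω) {A : Word} {s : ℕ}
    (hA : A.Good s) {κ : ℝ} {u : ℕ → Site d → ℝ} {u' : Site d → ℝ} (hu : ∀ N x, |u N x| ≤ κ)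
    (ht : ∀ x, Tendsto (fun N => u N x) atTop (𝓝 (u' x))) (n n' : Site d) :
    Tendsto (fun N => admLp hω (A.edge (u N)) s (u N) n n') atTop
      (𝓝 (admLp hω (A.edge u') s u' n n')) := by
  obtain ⟨k, j, h1, h2, h3, h4⟩ := exists_majorants hd κ hA
  have hu' := abs_le_of_tendsto hu ht
  have hfin : ∀ t : {t : Fin s → Site d // Admissible P ω t}, walkBound P ω k κ n n' t ≠ ∞ :=
    fun t => ENNReal.mul_ne_top (ENNReal.prod_lt_top fun e _ => by
      obtain ⟨c, hc, h⟩ := h1 e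
      exact (h _ _).trans_lt hc.lt_top).ne (by finiteness)
  have he : ∀ t, ‖(walkBound P ω k κ n n' t).toReal‖ₑ = walkBound P ω k κ n n' t := fun t => by
    rw [Real.enorm_of_nonneg ENNReal.toReal_nonneg, ENNReal.ofReal_toReal (hfin t)]
  refine tendsto_tsum_eSign hω (b := fun t => (walkBound P ω k κ n n' t).toReal) ?_
    (fun N t => ?_) (fun t => ?_) fun t => ?_
  · simp only [pairSum, he]
    exact exists_pairSum_bound hω h1 j h2 κ n n'
  · rw [he]; exact enorm_coefficient_le (h3 _ (hu N)) (hu N) n n' t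
  · rw [he]; exact enorm_coefficient_le (h3 _ hu') hu' n n' t
  · refine Tendsto.mul (tendsto_finsetProd _ fun j hj => ?_) (tendsto_finsetProd _ fun i _ => ht _)
    exact h4 u u' hu ht ⟨j, Finset.mem_range.1 hj⟩ _ _

/-- The columns of the admissible sums of the expansion are square-summable in mean. -/
lemma Word.Good.tsum_enorm_admLp_sq (hd : 5 ≤ d) (hω : IsBernoulliField P ω) {A : Word} {s : ℕ}
    (hA : A.Good s) {κ : ℝ} {u : Site d → ℝ} (hu : SlowlyVarying κ u) (n' : Site d) :
    ∑' n, ‖admLp hω (A.edge u) s u n n'‖ₑ ^ 2 ≠ ∞ := by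
  obtain ⟨c, hc, hcb⟩ := exists_tsum_pairSum_bound hω
    (k := fun e : Fin (s + 1) => eabs (A.edge u e))
    (fun e => hu.isSq_kprod hd (hA.product e e.2)) κ
  refine ne_top_of_le_ne_top hc (le_trans (ENNReal.tsum_le_tsum fun n => ?_) (hcb n'))
  exact (hasSum_eSign hω (hA.pairSum_ne_top hd hω hu.bound n n')).2.trans
    (pairSum_le (fun e x y => le_rfl) hu.bound n n')

/-- The series of a word converge, and the admissible sum is represented by `admLp`. -/
lemma Word.Good.admConverges (hd : 5 ≤ d) (hω : IsBernoulliField P ω) {A : Word} {s : ℕ}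
    {α κ : ℝ} (hs : ((Word.kern (v (d := d) α κ) A).map kprod).length - 1 = s) (hA : A.Good s)
    (hv : ∀ x : Site d, |v α κ x| ≤ κ) :
    AdmConverges P ω α κ (Word.kern (v α κ) A) ∧ ∀ n n',
      admSum P ω α κ (Word.kern (v α κ) A) n n' =ᵐ[P] admLp hω (A.edge (v α κ)) s (v α κ) n n' := by
  subst hs
  have hlen : ((Word.kern (v (d := d) α κ) A).map kprod).length
      = ((Word.kern (v (d := d) α κ) A).map kprod).length - 1 + 1 := by
    have := hA.length
    simp only [Word.kern, List.length_map] at this ⊢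
    omega
  have hcoef : ∀ n n' t, pathWeight ((Word.kern (v (d := d) α κ) A).map kprod) n n' t
      = edgeProd (A.edge (v α κ)) _ n n' t := by
    intro n n' t
    rw [pathWeight, edgeProd, ← hlen]
    refine Finset.prod_congr rfl fun j hj => ?_
    have hj' : j < A.length := by simpa [Word.kern] using hj
    have e : ((Word.kern (v (d := d) α κ) A).map kprod).getD j 0 = A.edge (v α κ) j := by
      simp [Word.kern, Word.edge, List.getD_eq_getElem?_getD, hj']
    rw [e]
  have hae : ∀ n n' (t : {t : Fin (((Word.kern (v (d := d) α κ) A).map kprod).length - 1) → Site d //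
      Admissible P ω t}), admSummand P ω α κ (Word.kern (v α κ) A) n n' t
      =ᵐ[P] fun w => edgeProd (A.edge (v α κ)) _ n n' t.1 * (∏ i, v α κ (t.1 i))
        * chi ω (oddSet Finset.univ t.1) w := by
    intro n n' t
    filter_upwards [hω.ae_sq_eq_one] with w hw
    rw [admSummand, hcoef, Finset.prod_mul_distrib, ← prod_eq_chi_oddSet hw, mul_assoc]
  refine ⟨⟨fun L hL => ?_, fun n n' => ?_⟩, fun n n' => ?_⟩
  · obtain ⟨L', hL', rfl⟩ := List.mem_map.1 hL
    obtain ⟨j, hj, rfl⟩ := List.mem_iff_getElem.1 hL'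
    have h1 := hA.product j (by rw [← hA.length]; exact hj)
    rw [List.getD_eq_getElem _ _ hj] at h1
    have h2 := goodProduct_spec h1
    exact prodConverges_of_isBdd (by simpa using h2.1) (isBdd_epath hd hv h2.1 h2.2)
  · exact (l2Sum_ae_eq hω (hae n n') (hA.pairSum_ne_top hd hω hv n n')).1
  · exact (l2Sum_ae_eq hω (hae n n') (hA.pairSum_ne_top hd hω hv n n')).2

end Field

/-! ### Symbolic expansion of words into sums over distinct sites -/

/-- Elementary operations on functions of a current site, of a saved site, and of the list of the
letters so far: multiplication by `u ^ k`, by the sign, or by a letter `u ε` that extends an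
admissible tuple; summation over a new current site, against the kernel `G̃₀ ^ k` off the diagonal
and `c` on it; saving the current site; multiplication by `G̃₀ ^ k` between the current and the
saved site; and the return to the saved site. -/
inductive Op
  | pot (k : ℕ)
  | sign
  | letter
  | move (k : ℕ) (c : Coef)
  | save
  | edge (k : ℕ)
  | back

/-- No final segment with at least two entries has only even multiplicities. A tuple is admissible
if and only if this holds for all of its initial segments, so that admissibility can be tested
letter by letter. -/
def okHist {α : Type*} [DecidableEq α] (l : List α) : Bool :=
  (List.range (l.length - 1)).all fun k => (l.drop k).any fun a => (l.drop k).count a % 2 == 1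

/-- A factor of a monomial: `(0,i,_)` is `u`, `(1,i,_)` the sign and `(3,i,_)` the final function
at the `i`-th site, `(2,i,j)` is `G̃₀` between two sites; all other factors are `σ`, `ρ`, `η`. -/
abbrev Tok := ℕ × ℕ × ℕ

/-- An integer, a number of summation sites, and a list of factors. -/
abbrev Term := ℤ × ℕ × List Tok

/-- A term, multiplied by an integer and by further factors. -/
def Term.mul (c : ℤ) (l : List Tok) (T : Term) : Term := (c * T.1, T.2.1, l ++ T.2.2)

/-- The site that follows the given ones becomes a summation site. -/
def Term.fresh (T : Term) : Term := (T.1, T.2.1 + 1, T.2.2)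

/-- The factor `G̃₀` between two sites, which are ordered as `G̃₀` is symmetric. -/
def edgeTok (i j : ℕ) : Tok := if i < j then (2, i, j) else (2, j, i)

/-- The factors of a monomial in `σ, ρ, η`. -/
def coefToks (m : ℕ × ℕ × ℕ) : List Tok :=
  List.replicate m.1 (4, 0, 0) ++ (List.replicate m.2.1 (5, 0, 0) ++
    List.replicate m.2.2 (6, 0, 0))

/-- The expansion of a list of operations into monomials in distinct sites. The first `r` sites
are given, among them the current and the saved one; a sum over all sites is split according to
whether the new site is one of these. -/
def expand : List Op → ℕ → ℕ → ℕ → List ℕ → List Term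
  | [], _, cur, _, _ => [(1, 0, [(3, cur, 0)])]
  | .pot k :: ops, r, cur, s, l =>
    (expand ops r cur s l).map (Term.mul 1 (List.replicate k (0, cur, 0)))
  | .sign :: ops, r, cur, s, l => (expand ops r cur s l).map (Term.mul 1 [(1, cur, 0)])
  | .letter :: ops, r, cur, s, l =>
    if okHist (l ++ [cur]) then
      (expand ops r cur s (l ++ [cur])).map (Term.mul 1 [(0, cur, 0), (1, cur, 0)]) else []
  | .move k c :: ops, r, cur, s, l =>
    ((List.range r).flatMap fun i =>
      if i = cur then c.flatMap fun m => (expand ops r i s l).map (Term.mul m.1 (coefToks m.2))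
      else (expand ops r i s l).map (Term.mul 1 (List.replicate k (edgeTok cur i)))) ++
    (expand ops (r + 1) r s l).map
      fun T => (Term.mul 1 (List.replicate k (edgeTok cur r)) T).fresh
  | .save :: ops, r, cur, _, l => expand ops r cur cur l
  | .edge k :: ops, r, cur, s, l =>
    if cur = s then [] else
      (expand ops r cur s l).map (Term.mul 1 (List.replicate k (edgeTok cur s)))
  | .back :: ops, r, _, s, l => expand ops r s s l

/-- A sorting key for factors. It need not be injective, as terms are compared themselves. -/
def tokCode (t : Tok) : ℕ := t.1 * 256 + t.2.1 * 16 + t.2.2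

/-- Insertion of a factor; two equal signs cancel. -/
def insertTok (t : Tok) : List Tok → List Tok
  | [] => [t]
  | a :: l =>
    if tokCode t < tokCode a then t :: a :: l
    else if t.1 = 1 ∧ t = a then l else a :: insertTok t l

/-- Sorts the factors of a monomial and cancels squares of signs. -/
def sortToks (l : List Tok) : List Tok := l.foldr insertTok []

def swapIdx (i : ℕ) : ℕ := if i = 1 then 2 else if i = 2 then 1 else i

/-- Interchange of the sites `1` and `2`. -/
def swapTok (t : Tok) : Tok :=
  if t.1 = 2 then edgeTok (swapIdx t.2.1) (swapIdx t.2.2) else (t.1, swapIdx t.2.1, t.2.2)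

/-- A sorting key for monomials, which need not be injective either. -/
def tokKey (l : List Tok) : ℕ := l.foldl (fun a t => a * 4096 + tokCode t) 0

/-- A normal form of a term, with a sorting key. The sites `1` and `2` are interchanged if this
makes the key smaller; no other renaming of summation sites is needed for the terms to cancel. -/
def Term.canon (T : Term) : ℕ × Term :=
  if T.2.1 < 2 then (tokKey (sortToks T.2.2), T.1, T.2.1, sortToks T.2.2)
  else if tokKey (sortToks T.2.2) ≤ tokKey (sortToks (T.2.2.map swapTok)) then
    (tokKey (sortToks T.2.2), T.1, T.2.1, sortToks T.2.2)
  else (tokKey (sortToks (T.2.2.map swapTok)), T.1, T.2.1, sortToks (T.2.2.map swapTok))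

/-- Search trees of terms, ordered by their keys. -/
inductive TermTree
  | leaf
  | node (l : TermTree) (T : ℕ × Term) (r : TermTree)

/-- Addition of a term to the sum that a tree represents. -/
def TermTree.insert (T : ℕ × Term) : TermTree → TermTree
  | leaf => node leaf T leaf
  | node l S r =>
    if T.1 < S.1 then node (l.insert T) S r
    else if T.2.2 = S.2.2 then node l (S.1, T.2.1 + S.2.1, S.2.2) r
    else node l S (r.insert T)

/-- All coefficients vanish. -/
def TermTree.isZero : TermTree → Bool
  | leaf => true
  | node l S r => S.2.1 == 0 && l.isZero && r.isZero

/-- A sufficient condition for the sum of the terms to vanish. -/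
def checkZero (L : List Term) : Bool :=
  (L.foldr (fun T acc => acc.insert T.canon) TermTree.leaf).isZero

/-- Products of integer polynomials in `σ, ρ, η`. -/
def Coef.mul (c c' : Coef) : Coef :=
  c.flatMap fun m => c'.map fun m' => (m.1 * m'.1, m.2.1 + m'.2.1, m.2.2.1 + m'.2.2.1,
    m.2.2.2 + m'.2.2.2)

/-- The diagonal entry `ρ - σ³` of `M`. -/
def coefM : Coef := [(-1, 3, 0, 0), (1, 0, 1, 0)]

/-- The named kernels in terms of elementary operations. -/
def Atom.ops : Atom → List (Coef × List Op)
  | .g => [([(1, 0, 0, 0)], [.move 1 [(1, 1, 0, 0)]])]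
  | .gt => [([(1, 0, 0, 0)], [.move 1 []])]
  | .vpow k => [([(1, 0, 0, 0)], [.pot k])]
  | .M4 => [([(1, 0, 0, 0)], [.move 3 []])]
  | .W => [([(1, 0, 0, 0)], [.pot 2, .move 3 coefM, .pot 2])]
  | .C => [([(1, 0, 0, 0)], [.save, .pot 2, .move 2 [], .pot 2, .move 2 [], .pot 2, .edge 1]),
      ([(-1, 0, 0, 1)], [.pot 6])]
  | .D4 => [([(1, 0, 0, 0)], [.save, .pot 2, .move 4 [], .pot 2, .back])]
  | .D61 => [([(1, 0, 0, 0)], [.save, .pot 2, .move 4 [], .pot 4, .back])]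
  | .D62 => [([(1, 0, 0, 0)],
      [.save, .pot 2, .move 2 [], .pot 2, .move 2 [], .pot 2, .edge 2, .back])]
  | .R6 => [([(1, 0, 0, 0)],
      [.save, .pot 2, .move 1 [], .pot 2, .move 3 coefM, .pot 2, .edge 1, .back])]
  | .S => [([(1, 0, 0, 0)], [.save, .pot 2, .move 3 [], .pot 2, .move 1 [], .pot 2, .edge 2])]
  | .St => [([(1, 0, 0, 0)], [.save, .pot 2, .move 1 [], .pot 2, .move 3 [], .pot 2, .edge 2])]

/-- The sequence of kernels and letters (`none`) of a word, without the last kernel. -/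
def Word.flat : Word → List (Option Atom)
  | [] => []
  | [L] => L.dropLast.map some
  | L :: A => L.map some ++ none :: Word.flat A

/-- The operations for a sequence of kernels and letters. -/
def programs : List (Option Atom) → List (Coef × List Op)
  | [] => [([(1, 0, 0, 0)], [])]
  | none :: l => (programs l).map fun p => (p.1, .letter :: p.2)
  | some a :: l => a.ops.flatMap fun q => (programs l).map fun p => (q.1.mul p.1, q.2 ++ p.2)

/-- All terms of a linear combination of lists of operations. -/
def allTerms (L : List (Coef × List Op)) : List Term :=
  L.flatMap fun p => p.1.flatMap fun m => (expand p.2 1 0 0 []).map (Term.mul m.1 (coefToks m.2))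

/-- The operations for `D₇`. -/
def opsD7 : List Op := [.save, .pot 4, .move 6 [], .pot 3, .sign, .back]

/-- The terms of order `i ≥ 1` without the first Green's function. -/
def strippedPrograms (i : ℕ) : List (Coef × List Op) :=
  ((wordTerms i).flatMap fun p => (programs (Word.flat p.2).tail).map fun q =>
    (p.1.mul q.1, q.2)) ++ if i = 7 then [([(-1, 0, 0, 0)], opsD7)] else []

/-- The terms of order `i ≤ 6`, multiplied by `c` and with the operations `l` in front. -/
def prefixedPrograms (c : Coef) (l : List Op) (i : ℕ) : List (Coef × List Op) :=
  (wordTerms i).flatMap fun p => (programs (Word.flat p.2)).map fun q =>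
    (c.mul (p.1.mul q.1), l ++ q.2)

/-- The coefficient `4η - 3σ⁵ + 5σ²ρ` of `v⁶` in the potential. -/
def coef6 : Coef := [(4, 0, 0, 1), (-3, 5, 0, 0), (5, 2, 1, 0)]

/-- The terms of order `i` in the product of the Hamiltonian with the expansion. -/
def orderPrograms (i : ℕ) : List (Coef × List Op) :=
  strippedPrograms i ++ prefixedPrograms [(1, 0, 0, 0)] [.pot 1, .sign] (i - 1) ++
  (if 2 ≤ i then prefixedPrograms [(1, 1, 0, 0)] [.pot 2] (i - 2) else []) ++
  (if 4 ≤ i then prefixedPrograms [(-1, 0, 1, 0)] [.pot 4] (i - 4) else []) ++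
  (if 6 ≤ i then prefixedPrograms coef6 [.pot 6] (i - 6) ++
    Atom.R6.ops.flatMap fun q => prefixedPrograms q.1 q.2 (i - 6) else [])

/-- The combinatorial core: order by order, the terms of the Hamiltonian times the expansion cancel,
once they are written as sums over distinct sites. This is a finite computation with integers. -/
theorem checkZero_orderPrograms :
    ∀ i ∈ [1, 2, 3, 4, 5, 6, 7], checkZero (allTerms (orderPrograms i)) = true := by decide +kernel

/-! ### Soundness of the symbolic expansion -/

section Symbolic

variable (Λ : Finset (Site d)) (u ε h : Site d → ℝ)

/-- The kernel `G̃₀ ^ k` off the diagonal, and `c` on it. -/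
def moveKern (d k : ℕ) (c : Coef) : Kern d := fun x y =>
  if x = y then c.eval (sigma d) (rho d) (eta d) else Gt d x y ^ k

/-- The action of a list of operations on a function of the current site, the saved site, and the
list of letters. Sums run over `Λ`. -/
def sem (K : Site d → Site d → List (Site d) → ℝ) :
    List Op → Site d → Site d → List (Site d) → ℝ
  | [], x, s, l => K x s l
  | .pot k :: ops, x, s, l => u x ^ k * sem K ops x s l
  | .sign :: ops, x, s, l => ε x * sem K ops x s l
  | .letter :: ops, x, s, l =>
    if okHist (l ++ [x]) then u x * ε x * sem K ops x s (l ++ [x]) else 0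
  | .move k c :: ops, x, s, l => ∑ y ∈ Λ, moveKern d k c x y * sem K ops y s l
  | .save :: ops, x, _, l => sem K ops x x l
  | .edge k :: ops, x, s, l => (if x = s then 0 else Gt d x s ^ k) * sem K ops x s l
  | .back :: ops, _, s, l => sem K ops s s l

/-- The value of a factor, when the sites are given by `x`. -/
def Tok.eval (x : ℕ → Site d) : Tok → ℝ
  | (0, i, _) => u (x i)
  | (1, i, _) => ε (x i)
  | (2, i, j) => Gt d (x i) (x j)
  | (3, i, _) => h (x i)
  | (4, _, _) => sigma d
  | (5, _, _) => rho d
  | _ => eta d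

/-- The value of a monomial. -/
def tokEval (l : List Tok) (x : ℕ → Site d) : ℝ := (l.map (Tok.eval u ε h x)).prod

/-- The sum of `F` over `m` further sites, that are distinct and different from the first `r`. -/
def sumFresh : ℕ → ℕ → (ℕ → Site d) → ((ℕ → Site d) → ℝ) → ℝ
  | 0, _, x, F => F x
  | m + 1, r, x, F => ∑ y ∈ Λ with ∀ i < r, x i ≠ y, sumFresh m (r + 1) (Function.update x r y) F

/-- The value of a term, when the first `r` sites are given by `x`. -/
def Term.value (r : ℕ) (x : ℕ → Site d) (T : Term) : ℝ :=
  T.1 * sumFresh Λ T.2.1 r x (tokEval u ε h T.2.2)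

variable {Λ u ε h}

lemma sumFresh_congr {F F' : (ℕ → Site d) → ℝ} (m r : ℕ) (x : ℕ → Site d)
    (hF : ∀ x' : ℕ → Site d, (∀ i < r, x' i = x i) → F x' = F' x') :
    sumFresh Λ m r x F = sumFresh Λ m r x F' := by
  induction m generalizing r x with
  | zero => exact hF x fun _ _ => rfl
  | succ m ih =>
    refine Finset.sum_congr rfl fun y _ => ih _ _ fun x' hx' => hF x' fun i hi => ?_
    rw [hx' i (by omega), Function.update_of_ne (by omega)]

lemma sumFresh_const_mul (a : ℝ) (F : (ℕ → Site d) → ℝ) (m r : ℕ) (x : ℕ → Site d) :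
    sumFresh Λ m r x (fun x' => a * F x') = a * sumFresh Λ m r x F := by
  induction m generalizing r x with
  | zero => rfl
  | succ m ih => simp only [sumFresh, ih, Finset.mul_sum]

lemma tokEval_append (l l' : List Tok) (x : ℕ → Site d) :
    tokEval u ε h (l ++ l') x = tokEval u ε h l x * tokEval u ε h l' x := by
  simp [tokEval]

lemma tokEval_replicate (k : ℕ) (t : Tok) (x : ℕ → Site d) :
    tokEval u ε h (List.replicate k t) x = Tok.eval u ε h x t ^ k := by
  simp [tokEval]

lemma Term.value_mul {r : ℕ} {x : ℕ → Site d} (c : ℤ) {l : List Tok} {a : ℝ}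
    (hl : ∀ x' : ℕ → Site d, (∀ i < r, x' i = x i) → tokEval u ε h l x' = a) (T : Term) :
    (T.mul c l).value Λ u ε h r x = c * a * T.value Λ u ε h r x := by
  simp only [Term.value, Term.mul]
  rw [sumFresh_congr (F' := fun x' => a * tokEval u ε h T.2.2 x') _ _ _ fun x' hx' => by
    rw [tokEval_append, hl x' hx'], sumFresh_const_mul]
  push_cast; ring

lemma sum_value_mul {r : ℕ} {x : ℕ → Site d} (c : ℤ) {l : List Tok} {a : ℝ}
    (hl : ∀ x' : ℕ → Site d, (∀ i < r, x' i = x i) → tokEval u ε h l x' = a) (L : List Term) :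
    ((L.map (Term.mul c l)).map (Term.value Λ u ε h r x)).sum
      = c * a * (L.map (Term.value Λ u ε h r x)).sum := by
  induction L with
  | nil => simp
  | cons T L ih =>
    simp only [List.map_cons, List.sum_cons] at ih ⊢
    rw [ih, Term.value_mul c hl]; ring

lemma sum_list_sum {α β : Type*} (A : Finset α) (L : List β) (f : α → β → ℝ) :
    ∑ y ∈ A, (L.map (f y)).sum = (L.map fun T => ∑ y ∈ A, f y T).sum := by
  induction L with
  | nil => simp
  | cons T L ih => simp [Finset.sum_add_distrib, ih]

lemma sum_map_flatMap {α β : Type*} (L : List α) (f : α → List β) (g : β → ℝ) :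
    ((L.flatMap f).map g).sum = (L.map fun a => ((f a).map g).sum).sum := by
  induction L with
  | nil => simp
  | cons a L ih => simp [ih]

lemma tokEval_coefToks (m : ℕ × ℕ × ℕ) (x : ℕ → Site d) :
    tokEval u ε h (coefToks m) x = sigma d ^ m.1 * rho d ^ m.2.1 * eta d ^ m.2.2 := by
  rw [coefToks, tokEval_append, tokEval_append, tokEval_replicate, tokEval_replicate,
    tokEval_replicate]
  simp only [Tok.eval]; ring

lemma sum_value_coef (c : Coef) (r : ℕ) (x : ℕ → Site d) (L : List Term) :
    ((c.flatMap fun m => L.map (Term.mul m.1 (coefToks m.2))).map (Term.value Λ u ε h r x)).sum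
      = c.eval (sigma d) (rho d) (eta d) * (L.map (Term.value Λ u ε h r x)).sum := by
  rw [sum_map_flatMap, Coef.eval, ← List.sum_map_mul_right]
  congr 2
  funext m
  rw [sum_value_mul m.1 (fun x' _ => tokEval_coefToks m.2 x')]
  ring

lemma tok_eval_edgeTok (i j : ℕ) (x : ℕ → Site d) :
    Tok.eval u ε h x (edgeTok i j) = Gt d (x i) (x j) := by
  unfold edgeTok
  split_ifs
  · rfl
  · exact Gt_comm _ _

lemma okHist_map {α β : Type*} [DecidableEq α] [DecidableEq β] {f : α → β} {l : List α}
    (hf : ∀ a ∈ l, ∀ b ∈ l, f a = f b → a = b) : okHist (l.map f) = okHist l := by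
  have hc : ∀ k, ∀ a ∈ l.drop k, ((l.drop k).map f).count (f a) = (l.drop k).count a := by
    intro k a ha
    rw [List.count, List.count, List.countP_map]
    refine List.countP_congr fun b hb => ?_
    simp only [Function.comp_apply, beq_iff_eq]
    exact ⟨fun e => hf b (List.mem_of_mem_drop hb) a (List.mem_of_mem_drop ha) e,
      fun e => by rw [e]⟩
  rw [Bool.eq_iff_iff]
  simp only [okHist, List.length_map, List.all_eq_true, List.any_eq_true, ← List.map_drop]
  refine forall₂_congr fun k _ => ?_
  constructor
  · rintro ⟨b, hb, h⟩
    obtain ⟨a, ha, rfl⟩ := List.mem_map.1 hb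
    exact ⟨a, ha, by rwa [hc k a ha] at h⟩
  · rintro ⟨a, ha, h⟩
    exact ⟨f a, List.mem_map_of_mem ha, by rwa [hc k a ha]⟩

/-- A sum over all sites, split into those already present and the new ones. -/
lemma sum_eq_sum_old_add_fresh {r : ℕ} {x : ℕ → Site d} (hx : ∀ i < r, x i ∈ Λ)
    (hinj : ∀ i < r, ∀ j < r, x i = x j → i = j) (f : Site d → ℝ) :
    ∑ y ∈ Λ, f y = ((List.range r).map fun i => f (x i)).sum +
      ∑ y ∈ Λ with ∀ i < r, x i ≠ y, f y := by
  classical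
  rw [← Finset.sum_filter_add_sum_filter_not Λ (fun y => ∃ i < r, x i = y)]
  congr 1
  · have : Λ.filter (fun y => ∃ i < r, x i = y) = (Finset.range r).image x := by
      ext y
      simp only [Finset.mem_filter, Finset.mem_image, Finset.mem_range]
      exact ⟨fun h => h.2, fun ⟨i, hi, e⟩ => ⟨e ▸ hx i hi, i, hi, e⟩⟩
    rw [this, Finset.sum_image fun i hi j hj e =>
      hinj i (Finset.mem_range.1 hi) j (Finset.mem_range.1 hj) e, Finset.sum_range]
    rw [← List.sum_ofFn, List.ofFn_eq_map, ← List.map_coe_finRange_eq_range, List.map_map]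
    rfl
  · refine Finset.sum_congr (Finset.filter_congr fun y _ => ?_) fun _ _ => rfl
    push Not
    rfl

/-- The symbolic expansion computes the value of a list of operations. -/
theorem sem_eq_expand (ops : List Op) : ∀ (r cur s : ℕ) (l : List ℕ) (x : ℕ → Site d),
    (∀ i < r, x i ∈ Λ) → (∀ i < r, ∀ j < r, x i = x j → i = j) → cur < r → s < r →
    (∀ i ∈ l, i < r) → sem Λ u ε (fun y _ _ => h y) ops (x cur) (x s) (l.map x)
      = ((expand ops r cur s l).map (Term.value Λ u ε h r x)).sum := by
  induction ops with
  | nil =>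
    intro r cur s l x _ _ _ _ _
    simp [sem, expand, Term.value, sumFresh, tokEval, Tok.eval]
  | cons op ops ih =>
    intro r cur s l x hx hinj hcur hs hl
    cases op with
    | pot k =>
      rw [sem, ih r cur s l x hx hinj hcur hs hl, expand,
        sum_value_mul (a := u (x cur) ^ k) 1 fun x' hx' => by
          rw [tokEval_replicate, Tok.eval, hx' cur hcur]]
      simp
    | sign =>
      rw [sem, ih r cur s l x hx hinj hcur hs hl, expand,
        sum_value_mul (a := ε (x cur)) 1 fun x' hx' => by
          simp [tokEval, Tok.eval, hx' cur hcur]]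
      simp
    | letter =>
      have hl' : ∀ i ∈ l ++ [cur], i < r := by
        intro i hi
        rcases List.mem_append.1 hi with hi | hi
        · exact hl i hi
        · rw [List.mem_singleton.1 hi]; exact hcur
      have e : l.map x ++ [x cur] = (l ++ [cur]).map x := by simp
      rw [sem, expand, e, okHist_map fun a ha b hb => hinj a (hl' a ha) b (hl' b hb)]
      split_ifs
      · rw [ih r cur s _ x hx hinj hcur hs hl',
          sum_value_mul (a := u (x cur) * ε (x cur)) 1 fun x' hx' => by
          simp [tokEval, Tok.eval, hx' cur hcur]]
        simp
      · simp
    | move k c =>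
      rw [sem, sum_eq_sum_old_add_fresh hx hinj, expand, List.map_append, List.sum_append,
        sum_map_flatMap]
      congr 1
      · congr 1
        refine List.map_congr_left fun i hi => ?_
        have hi := List.mem_range.1 hi
        rw [ih r i s l x hx hinj hi hs hl]
        by_cases hic : i = cur
        · rw [if_pos hic, sum_value_coef, moveKern, if_pos (by rw [hic])]
        · rw [if_neg hic, sum_value_mul (a := Gt d (x cur) (x i) ^ k) 1 fun x' hx' => by
              rw [tokEval_replicate, tok_eval_edgeTok, hx' cur hcur, hx' i hi],
            moveKern, if_neg fun e => hic (hinj i hi cur hcur e.symm)]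
          simp
      · rw [List.map_map]
        have key : ∀ y ∈ Λ.filter (fun y => ∀ i < r, x i ≠ y),
            moveKern d k c (x cur) y * sem Λ u ε (fun y _ _ => h y) ops y (x s) (l.map x)
            = ((expand ops (r + 1) r s l).map fun T => T.1 * sumFresh Λ T.2.1 (r + 1)
              (Function.update x r y)
                (tokEval u ε h (List.replicate k (edgeTok cur r) ++ T.2.2))).sum := by
          intro y hy
          rw [Finset.mem_filter] at hy
          have hup : ∀ i < r, Function.update x r y i = x i := fun i hi =>
            Function.update_of_ne (by omega) _ _
          have hupr : Function.update x r y r = y := Function.update_self _ _ _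
          have hmap : l.map (Function.update x r y) = l.map x :=
            List.map_congr_left fun i hi => hup i (hl i hi)
          have h1 := ih (r + 1) r s l (Function.update x r y) (fun i hi => by
              rcases Nat.lt_succ_iff_lt_or_eq.1 hi with hi | rfl
              · rw [hup i hi]; exact hx i hi
              · rw [hupr]; exact hy.1)
            (fun i hi j hj e => by
              rcases Nat.lt_succ_iff_lt_or_eq.1 hi with hi | rfl <;>
                rcases Nat.lt_succ_iff_lt_or_eq.1 hj with hj | rfl
              · rw [hup i hi, hup j hj] at e; exact hinj i hi j hj e
              · rw [hup i hi, hupr] at e; exact absurd e (hy.2 i hi)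
              · rw [hup j hj, hupr] at e; exact absurd e.symm (hy.2 j hj)
              · rfl)
            (by omega) (by omega) fun i hi => (hl i hi).trans (by omega)
          rw [hupr, hup s hs, hmap] at h1
          rw [h1, moveKern, if_neg (hy.2 cur hcur), ← List.sum_map_mul_left]
          congr 1
          refine List.map_congr_left fun T _ => ?_
          rw [sumFresh_congr (F' := fun x' => Gt d (x cur) y ^ k * tokEval u ε h T.2.2 x') _ _ _
            fun x' hx' => by
              rw [tokEval_append, tokEval_replicate, tok_eval_edgeTok, hx' cur (by omega),
                hx' r (by omega), hup cur hcur, hupr], sumFresh_const_mul, Term.value]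
          ring
        rw [Finset.sum_congr rfl key]
        rw [sum_list_sum]
        congr 1
        refine List.map_congr_left fun T _ => ?_
        simp only [Function.comp_apply, Term.value, Term.fresh, Term.mul, sumFresh, one_mul,
          Finset.mul_sum]
    | save => rw [sem, expand]; exact ih r cur cur l x hx hinj hcur hcur hl
    | edge k =>
      rw [sem, expand]
      by_cases hcs : cur = s
      · subst hcs; simp
      · rw [if_neg hcs, if_neg fun e => hcs (hinj cur hcur s hs e),
          ih r cur s l x hx hinj hcur hs hl,
          sum_value_mul (a := Gt d (x cur) (x s) ^ k) 1 fun x' hx' => by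
            rw [tokEval_replicate, tok_eval_edgeTok, hx' cur hcur, hx' s hs]]
        simp
    | back => rw [sem, expand]; exact ih r s s l x hx hinj hs hs hl

/-! ### Soundness of the normal form -/

lemma tokEval_cons (t : Tok) (l : List Tok) (x : ℕ → Site d) :
    tokEval u ε h (t :: l) x = Tok.eval u ε h x t * tokEval u ε h l x := by
  simp [tokEval]

lemma tokEval_insertTok (hε : ∀ x, ε x ^ 2 = 1) (t : Tok) (l : List Tok) (x : ℕ → Site d) :
    tokEval u ε h (insertTok t l) x = Tok.eval u ε h x t * tokEval u ε h l x := by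
  induction l with
  | nil => rw [insertTok, tokEval_cons]
  | cons a l ih =>
    rw [insertTok]
    split_ifs with h1 h2
    · rw [tokEval_cons]
    · obtain ⟨h3, rfl⟩ := h2
      obtain ⟨k, i, j⟩ := t
      obtain rfl : k = 1 := h3
      rw [tokEval_cons, ← mul_assoc, Tok.eval, ← pow_two, hε, one_mul]
    · rw [tokEval_cons, ih, tokEval_cons]; ring

lemma tokEval_sortToks (hε : ∀ x, ε x ^ 2 = 1) (l : List Tok) (x : ℕ → Site d) :
    tokEval u ε h (sortToks l) x = tokEval u ε h l x := by
  induction l with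
  | nil => rfl
  | cons a l ih =>
    rw [sortToks, List.foldr_cons, tokEval_insertTok hε, tokEval_cons, ← ih]; rfl

lemma tokEval_map_swapTok (l : List Tok) (x : ℕ → Site d) :
    tokEval u ε h (l.map swapTok) x = tokEval u ε h l fun i => x (swapIdx i) := by
  rw [tokEval, tokEval, List.map_map]
  congr 1
  refine List.map_congr_left fun t _ => ?_
  obtain ⟨k, i, j⟩ := t
  simp only [Function.comp_apply, swapTok]
  split_ifs with hk
  · obtain rfl : k = 2 := hk
    exact tok_eval_edgeTok _ _ _
  · obtain _ | _ | _ | _ | _ | _ | k := k <;> first | rfl | exact absurd rfl hk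

/-- The sum over distinct sites is invariant under the interchange of two of them. -/
lemma sumFresh_swap (m : ℕ) (x : ℕ → Site d) (F : (ℕ → Site d) → ℝ) :
    sumFresh Λ (m + 2) 1 x (fun x' => F fun i => x' (swapIdx i)) = sumFresh Λ (m + 2) 1 x F := by
  have hidx : ∀ (y z : Site d) (i : ℕ), Function.update (Function.update x 1 y) 2 z (swapIdx i)
      = Function.update (Function.update x 1 z) 2 y i := by
    intro y z i
    unfold swapIdx
    split_ifs with h1 h2
    · subst h1; simp
    · subst h2; simp
    · rw [Function.update_of_ne h2, Function.update_of_ne h1, Function.update_of_ne h2,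
        Function.update_of_ne h1]
  have hpull : ∀ (m r : ℕ) (x x₁ : ℕ → Site d), 3 ≤ r → (∀ i, x (swapIdx i) = x₁ i) →
      sumFresh Λ m r x (fun x' => F fun i => x' (swapIdx i)) = sumFresh Λ m r x₁ F := by
    intro m
    induction m with
    | zero => intro r x x₁ _ hx; exact congrArg F (funext hx)
    | succ m ih =>
      intro r x x₁ hr hx
      have hlt : ∀ i, i < r → swapIdx i < r := by
        intro i hi; unfold swapIdx; split_ifs <;> omega
      have hss : ∀ i, swapIdx (swapIdx i) = i := by
        intro i; unfold swapIdx; split_ifs <;> omega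
      refine Finset.sum_congr (Finset.filter_congr fun y _ => ⟨fun h i hi => ?_, fun h i hi => ?_⟩)
        fun y _ => ih _ _ _ (by omega) fun i => ?_
      · rw [← hx]; exact h _ (hlt i hi)
      · rw [← hss i, hx]; exact h _ (hlt i hi)
      · by_cases hi : i = r
        · have : swapIdx r = r := by unfold swapIdx; split_ifs <;> omega
          rw [hi, this, Function.update_self, Function.update_self]
        · have : swapIdx i ≠ r := fun e => hi (by
            have := hss i; rw [e] at this; rw [← this]; unfold swapIdx; split_ifs <;> omega)
          rw [Function.update_of_ne this, Function.update_of_ne hi, hx]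
  have hexp : ∀ F : (ℕ → Site d) → ℝ, sumFresh Λ (m + 2) 1 x F = ∑ y ∈ Λ, ∑ z ∈ Λ,
      if x 0 ≠ y ∧ x 0 ≠ z ∧ y ≠ z then
        sumFresh Λ m 3 (Function.update (Function.update x 1 y) 2 z) F else 0 := by
    intro F
    simp only [sumFresh, Finset.sum_filter]
    refine Finset.sum_congr rfl fun y _ => ?_
    by_cases hy : x 0 = y
    · rw [if_neg fun h => h 0 one_pos hy]
      simp [hy]
    · rw [if_pos fun i hi => by rwa [Nat.lt_one_iff.1 hi]]
      refine Finset.sum_congr rfl fun z _ => if_congr ⟨fun h => ?_, fun h i hi => ?_⟩ rfl rfl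
      · have h0 := h 0 (by norm_num)
        have h1 := h 1 (by norm_num)
        rw [Function.update_of_ne (by norm_num)] at h0
        rw [Function.update_self] at h1
        exact ⟨hy, h0, h1⟩
      · have : i = 0 ∨ i = 1 := by omega
        rcases this with rfl | rfl
        · rw [Function.update_of_ne (by norm_num)]; exact h.2.1
        · rw [Function.update_self]; exact h.2.2
  rw [hexp, hexp, Finset.sum_comm]
  refine Finset.sum_congr rfl fun y _ => Finset.sum_congr rfl fun z _ =>
    if_congr ⟨fun h => ⟨h.2.1, h.1, h.2.2.symm⟩, fun h => ⟨h.2.1, h.1, h.2.2.symm⟩⟩ ?_ rfl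
  exact hpull m 3 _ _ le_rfl (hidx z y)

lemma Term.value_canon (hε : ∀ x, ε x ^ 2 = 1) (x : ℕ → Site d) (T : Term) :
    T.canon.2.value Λ u ε h 1 x = T.value Λ u ε h 1 x := by
  have hsort : ∀ l, tokEval u ε h (sortToks l) = tokEval u ε h l :=
    fun l => funext (tokEval_sortToks hε l)
  unfold Term.canon
  split_ifs with h1 h2
  · simp only [Term.value, hsort]
  · simp only [Term.value, hsort]
  · obtain ⟨m, hm⟩ := Nat.exists_eq_add_of_le' (not_lt.1 h1)
    simp only [Term.value, hsort, hm]
    rw [← sumFresh_swap m x (tokEval u ε h T.2.2)]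
    congr 2
    exact funext (tokEval_map_swapTok T.2.2)

/-- The sum that a tree represents. -/
def TermTree.value (Λ : Finset (Site d)) (u ε h : Site d → ℝ) (x : ℕ → Site d) : TermTree → ℝ
  | leaf => 0
  | node l T r => l.value Λ u ε h x + T.2.value Λ u ε h 1 x + r.value Λ u ε h x

lemma TermTree.value_insert (x : ℕ → Site d) (T : ℕ × Term) (t : TermTree) :
    (t.insert T).value Λ u ε h x = T.2.value Λ u ε h 1 x + t.value Λ u ε h x := by
  induction t with
  | leaf => simp [TermTree.insert, TermTree.value]
  | node l S r ihl ihr =>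
    rw [TermTree.insert]
    split_ifs with h1 h2
    · rw [TermTree.value, ihl, TermTree.value]; ring
    · simp only [TermTree.value, Term.value, h2]
      push_cast; ring
    · rw [TermTree.value, ihr, TermTree.value]; ring

lemma TermTree.value_eq_zero (x : ℕ → Site d) {t : TermTree} (ht : t.isZero = true) :
    t.value Λ u ε h x = 0 := by
  induction t with
  | leaf => rfl
  | node l S r ihl ihr =>
    simp only [TermTree.isZero, Bool.and_eq_true, beq_iff_eq] at ht
    rw [TermTree.value, ihl ht.1.2, ihr ht.2, Term.value, ht.1.1]
    simp

lemma sum_value_of_checkZero (hε : ∀ x, ε x ^ 2 = 1) (x : ℕ → Site d) {L : List Term}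
    (hL : checkZero L = true) : (L.map (Term.value Λ u ε h 1 x)).sum = 0 := by
  rw [← TermTree.value_eq_zero (Λ := Λ) (u := u) (ε := ε) (h := h) x hL]
  clear hL
  induction L with
  | nil => rfl
  | cons T L ih =>
    rw [List.map_cons, List.sum_cons, ih, List.foldr_cons, TermTree.value_insert,
      Term.value_canon hε]

/-- A linear combination of lists of operations vanishes if its expansion cancels. -/
lemma sum_sem_eq_zero (hε : ∀ x, ε x ^ 2 = 1) {L : List (Coef × List Op)}
    (hL : checkZero (allTerms L) = true) {x : Site d} (hx : x ∈ Λ) :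
    (L.map fun p => p.1.eval (sigma d) (rho d) (eta d)
      * sem Λ u ε (fun y _ _ => h y) p.2 x x []).sum = 0 := by
  rw [← sum_value_of_checkZero (Λ := Λ) (u := u) (h := h) hε (fun _ => x) hL, allTerms,
    sum_map_flatMap]
  congr 1
  refine List.map_congr_left fun p _ => ?_
  rw [sum_value_coef, ← sem_eq_expand p.2 1 0 0 [] (fun _ => x) (fun _ _ => hx)
    (fun i hi j hj _ => by omega) one_pos one_pos (by simp)]
  rfl

/-! ### Operations and kernels -/

lemma sem_append (K : Site d → Site d → List (Site d) → ℝ) (ops ops' : List Op) (x s : Site d)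
    (l : List (Site d)) :
    sem Λ u ε K (ops ++ ops') x s l = sem Λ u ε (sem Λ u ε K ops') ops x s l := by
  induction ops generalizing x s l with
  | nil => rfl
  | cons op ops ih => cases op <;> simp only [List.cons_append, sem, ih]

lemma sem_congr {K K' : Site d → Site d → List (Site d) → ℝ}
    (hK : ∀ x ∈ Λ, ∀ s ∈ Λ, ∀ l, K x s l = K' x s l) (ops : List Op) {x s : Site d}
    (hx : x ∈ Λ) (hs : s ∈ Λ) (l : List (Site d)) :
    sem Λ u ε K ops x s l = sem Λ u ε K' ops x s l := by
  induction ops generalizing x s l with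
  | nil => exact hK x hx s hs l
  | cons op ops ih =>
    cases op with
    | move k c => exact Finset.sum_congr rfl fun y hy => by rw [ih hy hs]
    | save => exact ih hx hx l
    | back => exact ih hs hs l
    | _ => simp only [sem, ih hx hs]

lemma sem_sum {ι : Type*} (L : List ι) (c : ι → ℝ) (K : ι → Site d → Site d → List (Site d) → ℝ)
    (ops : List Op) (x s : Site d) (l : List (Site d)) :
    sem Λ u ε (fun x s l => (L.map fun i => c i * K i x s l).sum) ops x s l
      = (L.map fun i => c i * sem Λ u ε (K i) ops x s l).sum := by
  induction ops generalizing x s l with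
  | nil => rfl
  | cons op ops ih =>
    cases op with
    | move k e =>
      simp only [sem, ih, ← List.sum_map_mul_left, sum_list_sum, Finset.mul_sum]
      congr 1
      refine List.map_congr_left fun i _ => Finset.sum_congr rfl fun y _ => by ring
    | letter =>
      simp only [sem, ih]
      split_ifs
      · rw [← List.sum_map_mul_left]; simp only [mul_left_comm]
      · simp
    | save => exact ih x x l
    | back => exact ih s s l
    | _ =>
      simp only [sem, ih]
      rw [← List.sum_map_mul_left]; simp only [mul_left_comm]

lemma Coef.eval_mul (a b e : ℝ) (c c' : Coef) :
    (c.mul c').eval a b e = c.eval a b e * c'.eval a b e := by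
  rw [Coef.mul, Coef.eval, sum_map_flatMap, Coef.eval, ← List.sum_map_mul_right]
  congr 2
  funext m
  rw [List.map_map, Coef.eval, ← List.sum_map_mul_left]
  congr 2
  funext m'
  simp only [Function.comp_apply]
  push_cast; ring

/-- The action of a sequence of kernels and letters on a function of the current site and of the
list of letters. -/
def run (Λ : Finset (Site d)) (u ε h : Site d → ℝ) :
    List (Option Atom) → Site d → List (Site d) → ℝ
  | [], x, _ => h x
  | none :: L, x, l =>
    if okHist (l ++ [x]) then u x * ε x * run Λ u ε h L x (l ++ [x]) else 0
  | some a :: L, x, l => ∑ y ∈ Λ, a.kern u x y * run Λ u ε h L y l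

lemma tsum_eq_sum_of_support (hu : ∀ x, x ∉ Λ → u x = 0) {f : Site d → ℝ}
    (hf : ∀ x, u x = 0 → f x = 0) : ∑' x, f x = ∑ x ∈ Λ, f x :=
  tsum_eq_sum fun x hx => hf x (hu x hx)

lemma tsum_eq_sum_of_support₂ (hu : ∀ x, x ∉ Λ → u x = 0) {f : Site d × Site d → ℝ}
    (hf : ∀ p, u p.1 = 0 ∨ u p.2 = 0 → f p = 0) : ∑' p, f p = ∑ x ∈ Λ, ∑ y ∈ Λ, f (x, y) := by
  rw [← Finset.sum_product' Λ Λ fun x y => f (x, y)]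
  refine tsum_eq_sum fun p hp => hf p ?_
  rw [Finset.mem_product, not_and_or] at hp
  exact hp.imp (hu _) (hu _)

lemma Gt_self (x : Site d) : Gt d x x = 0 := by rw [Gt_eq_greenT, sub_self, greenT_zero]

lemma moveKern_M (x y : Site d) : moveKern d 3 coefM x y = M d x y := by
  simp only [moveKern, M, M4, coefM, Coef.eval]
  split_ifs with hxy
  · subst hxy
    rw [Gt_self]; simp; ring
  · ring

lemma moveKern_nil {k : ℕ} (hk : k ≠ 0) (x y : Site d) : moveKern d k [] x y = Gt d x y ^ k := by
  rw [moveKern]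
  split_ifs with hxy
  · subst hxy
    rw [Gt_self, zero_pow hk]; simp [Coef.eval]
  · rfl

lemma moveKern_G0 (x y : Site d) : moveKern d 1 [(1, 1, 0, 0)] x y = G0 d x y := by
  rw [moveKern]
  split_ifs with hxy
  · subst hxy
    have := Gt_self (d := d) x
    rw [Gt, if_pos rfl] at this
    simp [Coef.eval]; linarith
  · simp [Gt, hxy]

lemma ite_edge {k : ℕ} (hk : k ≠ 0) (x y : Site d) :
    (if x = y then 0 else Gt d x y ^ k) = Gt d x y ^ k := by
  split_ifs with hxy
  · subst hxy
    rw [Gt_self, zero_pow hk]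
  · rfl

lemma sum_diag_mul {x : Site d} (hx : x ∈ Λ) (f k : Site d → ℝ) :
    ∑ y ∈ Λ, diag f x y * k y = f x * k x := by
  simp only [diag, ite_mul, zero_mul]
  rw [Finset.sum_ite_eq, if_pos hx]

lemma rFun_eq_sum (hd : 5 ≤ d) {κ : ℝ} (hκ : ∀ x, |u x| ≤ κ) (hu : ∀ x, x ∉ Λ → u x = 0)
    (x : Site d) : rFun u x = u x ^ 2 * ∑ y ∈ Λ, Gt d x y * (u y ^ 2 *
      ∑ z ∈ Λ, M d y z * (u z ^ 2 * Gt d z x)) := by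
  have hb := isBdd_epath hd hκ (L := [.gt, .W, .gt]) (by simp) (by decide)
  have hb' := isBdd_epath hd hκ (L := [.W, .gt]) (by simp) (by decide)
  simp only [List.map_cons, List.map_nil, Atom.kern] at hb hb'
  rw [rFun, kprod_three hb hb', tsum_eq_sum_of_support₂ hu fun p hp => ?_]
  · simp only [Finset.mul_sum, wKern]
    refine Finset.sum_congr rfl fun y _ => Finset.sum_congr rfl fun z _ => by ring
  · simp only [wKern]
    rcases hp with hp | hp <;> simp [hp]

/-- The operations that belong to a name act by the kernel with this name. -/
lemma Atom.sum_sem_ops (hd : 5 ≤ d) {κ : ℝ} (hκ : ∀ x, |u x| ≤ κ) (hu : ∀ x, x ∉ Λ → u x = 0)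
    (a : Atom) (k : Site d → List (Site d) → ℝ) {x : Site d} (hx : x ∈ Λ) (s : Site d)
    (l : List (Site d)) :
    (a.ops.map fun q => q.1.eval (sigma d) (rho d) (eta d)
      * sem Λ u ε (fun y _ l => k y l) q.2 x s l).sum = ∑ y ∈ Λ, a.kern u x y * k y l := by
  have hone : Coef.eval (sigma d) (rho d) (eta d) [(1, 0, 0, 0)] = 1 := by simp [Coef.eval]
  cases a with
  | g => simp [Atom.ops, sem, hone, moveKern_G0, Atom.kern]
  | gt => simp [Atom.ops, sem, hone, moveKern_nil, Atom.kern]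
  | vpow j => simp [Atom.ops, sem, hone, Atom.kern, sum_diag_mul hx]
  | M4 => simp [Atom.ops, sem, hone, moveKern_nil, Atom.kern, Renorm.M4]
  | W =>
    simp only [Atom.ops, sem, hone, moveKern_M, Atom.kern, wKern, List.map_cons, List.map_nil,
      List.sum_cons, List.sum_nil, Finset.mul_sum, add_zero, one_mul]
    exact Finset.sum_congr rfl fun y _ => by ring
  | C =>
    have hη : Coef.eval (sigma d) (rho d) (eta d) [(-1, 0, 0, 1)] = -eta d := by simp [Coef.eval]
    have ht : ∀ y, ∑' z, Gt d x z ^ 2 * u z ^ 2 * Gt d z y ^ 2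
        = ∑ z ∈ Λ, Gt d x z ^ 2 * u z ^ 2 * Gt d z y ^ 2 := fun y =>
      tsum_eq_sum_of_support hu fun z hz => by simp [hz]
    have hδ : ∑ y ∈ Λ, (if x = y then eta d * u x ^ 6 else 0) * k y l
        = eta d * u x ^ 6 * k x l := by
      simp only [ite_mul, zero_mul]
      rw [Finset.sum_ite_eq, if_pos hx]
    simp only [Atom.ops, sem, hone, hη, moveKern_nil two_ne_zero, ite_edge one_ne_zero, Atom.kern,
      cKern, ht, sub_mul, Finset.sum_sub_distrib, hδ, List.map_cons, List.map_nil, List.sum_cons,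
      List.sum_nil, Finset.mul_sum, Finset.sum_mul, one_mul, add_zero]
    rw [Finset.sum_comm, sub_eq_add_neg]
    congr 1
    · refine Finset.sum_congr rfl fun y _ => Finset.sum_congr rfl fun z _ => ?_
      rw [Gt_comm y x]; ring
    · ring
  | D4 =>
    have ht : dFun 2 u x = u x ^ 2 * ∑ z ∈ Λ, u z ^ 2 * Gt d x z ^ 4 := by
      rw [dFun, tsum_eq_sum_of_support hu fun z hz => by simp [hz]]
    simp only [Atom.ops, sem, hone, moveKern_nil four_ne_zero, Atom.kern, sum_diag_mul hx, ht,
      List.map_cons, List.map_nil, List.sum_cons, List.sum_nil, Finset.mul_sum, Finset.sum_mul,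
      one_mul, add_zero]
    exact Finset.sum_congr rfl fun y _ => by ring
  | D61 =>
    have ht : dFun 4 u x = u x ^ 2 * ∑ z ∈ Λ, u z ^ 4 * Gt d x z ^ 4 := by
      rw [dFun, tsum_eq_sum_of_support hu fun z hz => by simp [hz]]
    simp only [Atom.ops, sem, hone, moveKern_nil four_ne_zero, Atom.kern, sum_diag_mul hx, ht,
      List.map_cons, List.map_nil, List.sum_cons, List.sum_nil, Finset.mul_sum, Finset.sum_mul,
      one_mul, add_zero]
    exact Finset.sum_congr rfl fun y _ => by ring
  | D62 =>
    have ht : triangleFun u x = u x ^ 2 * ∑ y ∈ Λ, ∑ z ∈ Λ,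
        u y ^ 2 * u z ^ 2 * Gt d x y ^ 2 * Gt d x z ^ 2 * Gt d y z ^ 2 := by
      rw [triangleFun, tsum_eq_sum_of_support₂ hu fun p hp => by rcases hp with hp | hp <;> simp [hp]]
    simp only [Atom.ops, sem, hone, moveKern_nil two_ne_zero, ite_edge two_ne_zero, Atom.kern,
      sum_diag_mul hx, ht, List.map_cons, List.map_nil, List.sum_cons, List.sum_nil,
      Finset.mul_sum, Finset.sum_mul, one_mul, add_zero]
    refine Finset.sum_congr rfl fun y _ => Finset.sum_congr rfl fun z _ => ?_
    rw [Gt_comm z x]; ring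
  | R6 =>
    simp only [Atom.ops, sem, hone, moveKern_nil one_ne_zero, moveKern_M, ite_edge one_ne_zero,
      Atom.kern, sum_diag_mul hx, rFun_eq_sum hd hκ hu, List.map_cons, List.map_nil, List.sum_cons,
      List.sum_nil, Finset.mul_sum, Finset.sum_mul, one_mul, add_zero]
    exact Finset.sum_congr rfl fun y _ => Finset.sum_congr rfl fun z _ => by ring
  | S =>
    have ht : ∀ y, ∑' z, Gt d x z ^ 3 * u z ^ 2 * Gt d z y
        = ∑ z ∈ Λ, Gt d x z ^ 3 * u z ^ 2 * Gt d z y := fun y =>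
      tsum_eq_sum_of_support hu fun z hz => by simp [hz]
    simp only [Atom.ops, sem, hone, moveKern_nil three_ne_zero, moveKern_nil one_ne_zero,
      ite_edge two_ne_zero, Atom.kern, sKern, ht, List.map_cons, List.map_nil, List.sum_cons,
      List.sum_nil, Finset.mul_sum, Finset.sum_mul, one_mul, add_zero]
    rw [Finset.sum_comm]
    refine Finset.sum_congr rfl fun y _ => Finset.sum_congr rfl fun z _ => ?_
    rw [Gt_comm y x]; ring
  | St =>
    have ht : ∀ y, ∑' z, Gt d y z ^ 3 * u z ^ 2 * Gt d z x
        = ∑ z ∈ Λ, Gt d y z ^ 3 * u z ^ 2 * Gt d z x := fun y =>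
      tsum_eq_sum_of_support hu fun z hz => by simp [hz]
    simp only [Atom.ops, sem, hone, moveKern_nil three_ne_zero, moveKern_nil one_ne_zero,
      ite_edge two_ne_zero, Atom.kern, transp, sKern, ht, List.map_cons, List.map_nil,
      List.sum_cons, List.sum_nil, Finset.mul_sum, Finset.sum_mul, one_mul, add_zero]
    rw [Finset.sum_comm]
    refine Finset.sum_congr rfl fun y _ => Finset.sum_congr rfl fun z _ => ?_
    rw [Gt_comm z y, Gt_comm x z]; ring

/-- The operations of a sequence of kernels and letters act like the sequence. -/
lemma sum_sem_programs (hd : 5 ≤ d) {κ : ℝ} (hκ : ∀ x, |u x| ≤ κ) (hu : ∀ x, x ∉ Λ → u x = 0)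
    (L : List (Option Atom)) {x s : Site d} (hx : x ∈ Λ) (hs : s ∈ Λ) (l : List (Site d)) :
    ((programs L).map fun p => p.1.eval (sigma d) (rho d) (eta d)
      * sem Λ u ε (fun y _ _ => h y) p.2 x s l).sum = run Λ u ε h L x l := by
  induction L generalizing x s l with
  | nil => simp [programs, sem, run, Coef.eval]
  | cons a L ih =>
    cases a with
    | none =>
      simp only [programs, run, List.map_map, Function.comp_def, sem]
      split_ifs
      · rw [← ih hx hs (l ++ [x]), ← List.sum_map_mul_left]
        simp only [mul_left_comm]
      · simp
    | some a =>
      rw [run, programs, sum_map_flatMap, ← Atom.sum_sem_ops hd hκ hu a _ hx s l]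
      congr 1
      refine List.map_congr_left fun q _ => ?_
      rw [sem_congr (K' := fun y s l => ((programs L).map fun p =>
        p.1.eval (sigma d) (rho d) (eta d) * sem Λ u ε (fun y _ _ => h y) p.2 y s l).sum)
        (fun y hy s hs l => (ih hy hs l).symm) q.2 hx hs, sem_sum, List.map_map,
        ← List.sum_map_mul_left]
      congr 1
      refine List.map_congr_left fun p _ => ?_
      simp only [Function.comp_apply, Coef.eval_mul, sem_append]
      ring

end Symbolic

/-! ### Finite admissible sums -/

section Finite

variable {s : ℕ}

/-- The tuple `L` extends `l` to an admissible tuple. -/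
def admFrom (l : List (Site d)) : List (Site d) → Bool
  | [] => true
  | y :: L => okHist (l ++ [y]) && admFrom (l ++ [y]) L

lemma admFrom_iff (l L : List (Site d)) :
    admFrom l L = true ↔ ∀ j < L.length, okHist (l ++ L.take (j + 1)) = true := by
  induction L generalizing l with
  | nil => simp [admFrom]
  | cons y L ih =>
    rw [admFrom, Bool.and_eq_true, ih]
    constructor
    · rintro ⟨h1, h2⟩ j hj
      obtain _ | j := j
      · simpa using h1
      · have := h2 j (by simpa using hj)
        simpa using this
    · intro h
      refine ⟨by simpa using h 0 (by simp), fun j hj => ?_⟩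
      have := h (j + 1) (by simpa using hj)
      simpa using this

lemma okHist_iff (l : List (Site d)) :
    okHist l = true ↔ ∀ k, k + 2 ≤ l.length → ∃ x, Odd ((l.drop k).count x) := by
  simp only [okHist, List.all_eq_true, List.any_eq_true, List.mem_range, beq_iff_eq,
    ← Nat.odd_iff]
  refine forall_congr' fun k => ⟨fun h hk => ?_, fun h hk => ?_⟩
  · obtain ⟨x, -, hx⟩ := h (by omega)
    exact ⟨x, hx⟩
  · obtain ⟨x, hx⟩ := h (by omega)
    exact ⟨x, List.count_pos_iff.1 hx.pos, hx⟩

lemma count_slice (t : Fin s → Site d) (x : Site d) {k m : ℕ} (hkm : k ≤ m) (hm : m ≤ s) :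
    (((List.ofFn t).take m).drop k).count x
      = (Finset.univ.filter fun i : Fin s => k ≤ (i : ℕ) ∧ (i : ℕ) < m ∧ t i = x).card := by
  induction m, hkm using Nat.le_induction with
  | base =>
    rw [List.drop_eq_nil_of_le (by simp), List.count_nil, eq_comm, Finset.card_eq_zero]
    exact Finset.filter_eq_empty_iff.2 fun i _ h => by omega
  | succ m hkm ih =>
    have hlen : m < (List.ofFn t).length := by simpa using hm
    rw [← List.take_concat_get' _ _ hlen, List.drop_append_of_le_length (by simp; omega),
      List.count_append, ih (by omega), List.getElem_ofFn]
    have e : (Finset.univ.filter fun i : Fin s => k ≤ (i : ℕ) ∧ (i : ℕ) < m + 1 ∧ t i = x)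
        = (Finset.univ.filter fun i : Fin s => k ≤ (i : ℕ) ∧ (i : ℕ) < m ∧ t i = x) ∪
          (if t ⟨m, hm⟩ = x then {⟨m, hm⟩} else ∅) := by
      ext i
      by_cases hi : i = ⟨m, hm⟩
      · subst hi
        split_ifs with h <;> simp [h, hkm]
      · have : (i : ℕ) ≠ m := fun h => hi (Fin.ext h)
        have h2 : (i : ℕ) < m + 1 ↔ (i : ℕ) < m := by omega
        split_ifs <;> simp [hi] <;> omega
    rw [e, Finset.card_union_of_disjoint]
    · congr 1
      split_ifs with h <;> simp [h]
    · split_ifs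
      · simp
      · simp

lemma admFrom_ofFn_iff (t : Fin s → Site d) : admFrom [] (List.ofFn t) = true ↔
    ∀ a b : Fin s, a < b → oddSet (Finset.Icc a b) t ≠ ∅ := by
  have hset : ∀ (a b : Fin s) (x : Site d), (Finset.Icc a b).filter (fun i => t i = x)
      = Finset.univ.filter fun i : Fin s => (a : ℕ) ≤ i ∧ (i : ℕ) < b + 1 ∧ t i = x := by
    intro a b x
    ext i
    simp only [Finset.mem_filter, Finset.mem_Icc, Finset.mem_univ, true_and, Fin.le_def,
      Nat.lt_succ_iff, and_assoc]
  simp only [admFrom_iff, okHist_iff, List.nil_append, List.length_ofFn]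
  constructor
  · intro h a b hab
    obtain ⟨x, hx⟩ := h b b.2 a (by simp; omega)
    rw [count_slice t x (by omega) (by omega), ← hset] at hx
    exact Finset.ne_empty_of_mem (mem_oddSet.2 hx)
  · intro h j hj k hk
    rw [List.length_take, List.length_ofFn] at hk
    obtain ⟨x, hx⟩ := Finset.nonempty_iff_ne_empty.2 (h ⟨k, by omega⟩ ⟨j, hj⟩ (by
      rw [Fin.lt_def]; simp only; omega))
    refine ⟨x, ?_⟩
    rw [count_slice t x (by omega) (by omega)]
    rw [mem_oddSet, hset] at hx
    exact hx

lemma edgeProd_zero (K : ℕ → Kern d) (n n' : Site d) (t : Fin 0 → Site d) :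
    edgeProd K 0 n n' t = K 0 n n' := by
  simp [edgeProd, vertex]

lemma edgeProd_cons (K : ℕ → Kern d) (n n' z : Site d) (t : Fin s → Site d) :
    edgeProd K (s + 1) n n' (Fin.cons z t : Fin (s + 1) → Site d)
      = K 0 n z * edgeProd (fun j => K (j + 1)) s z n' t := by
  refine (Finset.prod_range_succ' (fun j => K j
    (vertex (s := s + 1) n n' (Fin.cons z t) j)
    (vertex (s := s + 1) n n' (Fin.cons z t) (j + 1))) (s + 1)).trans ?_
  rw [mul_comm, edgeProd]
  congr 1
  refine Finset.prod_congr rfl fun j _ => ?_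
  exact congrArg₂ _ (vertex_cons_succ n n' z t j) (vertex_cons_succ n n' z t (j + 1))

/-- The sum over the tuples with entries in `Λ` that extend `l` to an admissible tuple. -/
def walkSum (Λ : Finset (Site d)) (u ε : Site d → ℝ) (K : ℕ → Kern d) (s : ℕ) (n n' : Site d)
    (l : List (Site d)) : ℝ :=
  ∑ t ∈ Fintype.piFinset fun _ : Fin s => Λ,
    if admFrom l (List.ofFn t) then edgeProd K s n n' t * ∏ i, (u (t i) * ε (t i)) else 0

variable {Λ : Finset (Site d)} {u ε : Site d → ℝ}

lemma walkSum_zero (K : ℕ → Kern d) (n n' : Site d) (l : List (Site d)) :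
    walkSum Λ u ε K 0 n n' l = K 0 n n' := by
  have : (Fintype.piFinset fun _ : Fin 0 => Λ) = {finZeroElim} := by
    ext t
    rw [Fintype.mem_piFinset, Finset.mem_singleton]
    exact ⟨fun _ => Subsingleton.elim _ _, fun _ i => i.elim0⟩
  rw [walkSum, this, Finset.sum_singleton, edgeProd_zero]
  simp [admFrom]

lemma walkSum_succ (K : ℕ → Kern d) (s : ℕ) (n n' : Site d) (l : List (Site d)) :
    walkSum Λ u ε K (s + 1) n n' l = ∑ y ∈ Λ, K 0 n y * if okHist (l ++ [y]) then
      u y * ε y * walkSum Λ u ε (fun j => K (j + 1)) s y n' (l ++ [y]) else 0 := by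
  have e := Finset.sum_equiv (Fin.consEquiv fun _ : Fin (s + 1) => Site d)
    (s := Λ ×ˢ Fintype.piFinset fun _ : Fin s => Λ) (t := Fintype.piFinset fun _ => Λ)
    (f := fun p => if admFrom l (p.1 :: List.ofFn p.2) then K 0 n p.1 *
      edgeProd (fun j => K (j + 1)) s p.1 n' p.2 * (u p.1 * ε p.1 * ∏ i, (u (p.2 i) * ε (p.2 i)))
      else 0)
    (g := fun t => if admFrom l (List.ofFn t) then
      edgeProd K (s + 1) n n' t * ∏ i, (u (t i) * ε (t i)) else 0)
    (fun p => by simp [Fintype.mem_piFinset, Fin.forall_fin_succ, Fin.consEquiv])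
    fun p _ => by
      simp only [Fin.consEquiv, Equiv.coe_fn_mk, List.ofFn_cons, edgeProd_cons,
        Fin.prod_univ_succ, Fin.cons_zero, Fin.cons_succ]
  rw [walkSum, ← e, Finset.sum_product]
  refine Finset.sum_congr rfl fun y _ => ?_
  simp only [admFrom, Bool.and_eq_true]
  split_ifs with h
  · simp only [h, true_and, walkSum, Finset.mul_sum]
    refine Finset.sum_congr rfl fun t _ => ?_
    split_ifs <;> ring
  · simp [h]

/-! ### Words as sequences of kernels and letters -/

/-- The kernels that vanish outside of the support of the potential. -/
def Atom.supported : Atom → Bool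
  | .g | .gt | .M4 => false
  | .vpow k => k != 0
  | _ => true

lemma Atom.kern_eq_zero {a : Atom} (ha : a.supported = true) {x y : Site d}
    (h : u x = 0 ∨ u y = 0) : a.kern u x y = 0 := by
  have hdiag : ∀ f : Site d → ℝ, (∀ x, u x = 0 → f x = 0) → diag f x y = 0 := by
    intro f hf
    rw [diag]
    split_ifs with hxy
    · subst hxy; exact hf x (h.elim id id)
    · rfl
  cases a with
  | g => cases ha
  | gt => cases ha
  | M4 => cases ha
  | vpow k =>
    have hk : k ≠ 0 := by simpa [Atom.supported] using ha
    exact hdiag (fun x => u x ^ k) fun x hx => by simp [hx, hk]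
  | W => simp only [Atom.kern, wKern]; rcases h with h | h <;> simp [h]
  | C =>
    simp only [Atom.kern, cKern]
    split_ifs with hxy
    · subst hxy; simp [h.elim id id]
    · rcases h with h | h <;> simp [h]
  | D4 => exact hdiag _ fun x hx => by simp [dFun, hx]
  | D61 => exact hdiag _ fun x hx => by simp [dFun, hx]
  | D62 => exact hdiag _ fun x hx => by simp [triangleFun, hx]
  | R6 => exact hdiag _ fun x hx => by simp [rFun, hx]
  | S => simp only [Atom.kern, sKern]; rcases h with h | h <;> simp [h]
  | St => simp only [Atom.kern, transp, sKern]; rcases h with h | h <;> simp [h]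

/-- Of two consecutive kernels at least one is supported. The sums inside of such a product
extend over the support of the potential only. -/
def interior : List Atom → Bool
  | a :: b :: L => (a.supported || b.supported) && interior (b :: L)
  | _ => true

lemma kprod_cons_finite (hd : 5 ≤ d) {κ : ℝ} (hκ : ∀ x, |u x| ≤ κ) (hu : ∀ x, x ∉ Λ → u x = 0)
    {a b : Atom} {L : List Atom} (hg : greenCount (a :: b :: L) ≤ 2)
    (hi : interior (a :: b :: L) = true) (x y : Site d) :
    kprod ((a :: b :: L).map fun a => a.kern u) x y
      = ∑ z ∈ Λ, a.kern u x z * kprod ((b :: L).map fun a => a.kern u) z y := by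
  have hb : ∀ L : List Atom, L ≠ [] → greenCount L ≤ 2 → epath (L.map fun a => a.kern u) x y ≠ ∞ :=
    fun L hL hg => epath_ne_top_of_isBdd (isBdd_epath hd hκ hL hg) x y
  have hcount : ∀ (a : Atom) L, greenCount L ≤ greenCount (a :: L) := fun a L => by
    simp [greenCount]
  rw [List.map_cons, kprod_cons _ (by simp) (hb _ (by simp) hg)]
  refine tsum_eq_sum fun z hz => ?_
  have hz := hu z hz
  simp only [interior, Bool.and_eq_true, Bool.or_eq_true] at hi
  rcases hi.1 with h | h
  · simp only [Atom.kern_eq_zero h (Or.inr hz), zero_mul]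
  · have : kprod ((b :: L).map fun a => a.kern u) z y = 0 := by
      obtain _ | ⟨c, L⟩ := L
      · rw [List.map_cons, List.map_nil, kprod_singleton, Atom.kern_eq_zero h (Or.inl hz)]
      · rw [List.map_cons, kprod_cons _ (by simp) (epath_ne_top_of_isBdd (isBdd_epath hd hκ
          (L := b :: c :: L) (by simp) ((hcount a _).trans hg)) z y)]
        simp [Atom.kern_eq_zero h (Or.inl hz)]
    rw [this, mul_zero]

lemma greenCount_tail_le {a : Atom} {L : List Atom} (h : greenCount (a :: L) ≤ 2) :
    greenCount L ≤ 2 := le_trans (by simp [greenCount]) h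

/-- Consecutive kernels act like their product. -/
lemma run_append (hd : 5 ≤ d) {κ : ℝ} (hκ : ∀ x, |u x| ≤ κ) (hu : ∀ x, x ∉ Λ → u x = 0)
    (h : Site d → ℝ) (R : List (Option Atom)) : ∀ (L : List Atom), L ≠ [] → greenCount L ≤ 2 →
    interior L = true → ∀ (x : Site d) (l : List (Site d)),
    run Λ u ε h (L.map some ++ R) x l
      = ∑ y ∈ Λ, kprod (L.map fun a => a.kern u) x y * run Λ u ε h R y l
  | [], hL, _, _, _, _ => absurd rfl hL
  | [a], _, _, _, x, l => by
    simp only [List.map_cons, List.map_nil, List.cons_append, List.nil_append, run,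
      kprod_singleton]
  | a :: b :: L, _, hg, hi, x, l => by
    have hi' : interior (b :: L) = true := by
      simp only [interior, Bool.and_eq_true] at hi; exact hi.2
    rw [List.map_cons, List.cons_append, run]
    simp only [kprod_cons_finite hd hκ hu hg hi]
    have ih := run_append hd hκ hu h R (b :: L) (by simp) (greenCount_tail_le hg) hi'
    simp only [ih, Finset.mul_sum, Finset.sum_mul]
    rw [Finset.sum_comm]
    exact Finset.sum_congr rfl fun y _ => Finset.sum_congr rfl fun z _ => by ring

lemma run_dropLast (hd : 5 ≤ d) {κ : ℝ} (hκ : ∀ x, |u x| ≤ κ) (hu : ∀ x, x ∉ Λ → u x = 0)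
    (n' : Site d) : ∀ (L : List Atom), L.getLast? = some .g → greenCount L ≤ 2 →
    interior L = true → ∀ (x : Site d) (l : List (Site d)),
    run Λ u ε (fun y => G0 d y n') (L.dropLast.map some) x l
      = kprod (L.map fun a => a.kern u) x n'
  | [], hL, _, _, _, _ => by simp at hL
  | [a], hL, _, _, x, l => by
    obtain rfl : a = .g := by simpa using hL
    simp [run, kprod_singleton, Atom.kern]
  | a :: b :: L, hL, hg, hi, x, l => by
    have hi' : interior (b :: L) = true := by
      simp only [interior, Bool.and_eq_true] at hi; exact hi.2
    rw [List.dropLast_cons_cons, List.map_cons, run, kprod_cons_finite hd hκ hu hg hi]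
    refine Finset.sum_congr rfl fun y _ => ?_
    rw [run_dropLast hd hκ hu n' (b :: L) (by simpa using hL) (greenCount_tail_le hg) hi']

/-- The form of the words of the expansion: all of their products are `interior`, and the last
one ends with `G₀`. -/
def Word.regular (A : Word) : Bool :=
  A.all (fun L => !L.isEmpty && decide (greenCount L ≤ 2) && interior L) &&
    match A.getLast?.bind List.getLast? with
    | some .g => true
    | _ => false

/-- For potentials of finite support, a word acts as the corresponding sum over admissible tuples. -/
lemma run_flat (hd : 5 ≤ d) {κ : ℝ} (hκ : ∀ x, |u x| ≤ κ) (hu : ∀ x, x ∉ Λ → u x = 0)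
    (n' : Site d) : ∀ (A : Word) (s : ℕ), A.length = s + 1 → A.regular = true →
    ∀ (x : Site d) (l : List (Site d)), run Λ u ε (fun y => G0 d y n') (Word.flat A) x l
      = walkSum Λ u ε (A.edge u) s x n' l
  | [], s, hs, _, _, _ => by simp at hs
  | [L], s, hs, hA, x, l => by
    obtain rfl : s = 0 := by simpa using hs.symm
    have hlast : L.getLast? = some .g := by
      simp only [Word.regular, Bool.and_eq_true] at hA
      have := hA.2
      simp only [List.getLast?_singleton, Option.bind_some] at this
      split at this
      · assumption
      · cases this
    simp only [Word.regular, List.all_cons, Bool.and_eq_true, decide_eq_true_eq] at hA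
    rw [walkSum_zero, Word.flat, run_dropLast hd hκ hu n' L hlast hA.1.1.1.2 hA.1.1.2]
    rfl
  | L :: L' :: A, s, hs, hA, x, l => by
    obtain _ | s := s
    · simp at hs
    have hA' : Word.regular (L' :: A) = true := by
      simp only [Word.regular, Bool.and_eq_true, List.all_cons, List.getLast?_cons_cons] at hA ⊢
      exact ⟨hA.1.2, hA.2⟩
    simp only [Word.regular, List.all_cons, Bool.and_eq_true, decide_eq_true_eq,
      Bool.not_eq_true', List.isEmpty_eq_false_iff] at hA
    have hL := hA.1.1
    rw [Word.flat.eq_3 _ _ (by simp), run_append hd hκ hu _ _ L hL.1.1 hL.1.2 hL.2, walkSum_succ]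
    refine Finset.sum_congr rfl fun y _ => ?_
    simp only [run]
    rw [run_flat hd hκ hu n' (L' :: A) s (by simpa using hs) hA']
    rfl

lemma wordTerms_regular {i : ℕ} (hi : i ≤ 7) {p : Coef × Word} (hp : p ∈ wordTerms i) :
    Word.regular p.2 = true := by
  have h : ∀ i ≤ 7, (wordTerms i).all (fun p => Word.regular p.2) = true := by decide +kernel
  exact List.all_eq_true.1 (h i hi) p hp

lemma wordTerms_flat {i : ℕ} (hi : i ≤ 7) (hi0 : i ≠ 0) {p : Coef × Word} (hp : p ∈ wordTerms i) :
    Word.flat p.2 = some .g :: (Word.flat p.2).tail := by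
  have h : ∀ i ≤ 7, i ≠ 0 → (wordTerms i).all (fun p =>
      match Word.flat p.2 with
      | some .g :: _ => true
      | _ => false) = true := by decide +kernel
  have := List.all_eq_true.1 (h i hi hi0) p hp
  split at this
  · rename_i heq; rw [heq]; rfl
  · cases this

end Finite

section Field

variable {Ω : Type*} [MeasurableSpace Ω] {P : Measure Ω} [IsProbabilityMeasure P]
  {ω : Site d → Ω → ℝ}

/-- For potentials of finite support the admissible sums are finite. -/
lemma admLp_ae_eq (hω : IsBernoulliField P ω) {Λ : Finset (Site d)} {u : Site d → ℝ}
    (hu : ∀ x, x ∉ Λ → u x = 0) (K : ℕ → Kern d) (s : ℕ) (n n' : Site d) :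
    admLp hω K s u n n' =ᵐ[P] fun w => walkSum Λ u (fun x => ω x w) K s n n' [] := by
  classical
  have hzero : ∀ t : {t : Fin s → Site d // Admissible P ω t},
      t ∉ (Fintype.piFinset fun _ : Fin s => Λ).subtype (Admissible P ω) →
      (edgeProd K s n n' t.1 * ∏ i, u (t.1 i)) • eSign hω (oddSet Finset.univ t.1) = 0 := by
    intro t ht
    rw [Finset.mem_subtype, Fintype.mem_piFinset] at ht
    push Not at ht
    obtain ⟨i, hi⟩ := ht
    rw [Finset.prod_eq_zero (Finset.mem_univ i) (hu _ hi), mul_zero, zero_smul]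
  rw [admLp, tsum_eq_sum hzero]
  refine (coeFn_sum_eSign hω (f := fun t w => edgeProd K s n n' t.1 * (∏ i, u (t.1 i)) *
    chi ω (oddSet Finset.univ t.1) w) (fun t => EventuallyEq.rfl) _).symm.trans ?_
  filter_upwards [hω.ae_sq_eq_one] with w hw
  rw [walkSum, Finset.sum_subtype_eq_sum_filter (s := Fintype.piFinset fun _ : Fin s => Λ)
    (fun t => edgeProd K s n n' t * (∏ i, u (t i)) * chi ω (oddSet Finset.univ t) w),
    Finset.sum_filter]
  refine Finset.sum_congr rfl fun t _ => ?_
  refine if_congr ?_ ?_ rfl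
  · rw [hω.admissible_iff, admFrom_ofFn_iff]
  · rw [Finset.prod_mul_distrib, ← prod_eq_chi_oddSet hw]; ring

end Field

/-! ### The expansion for potentials of finite support -/

section Order

variable {Λ : Finset (Site d)} {u ε h : Site d → ℝ}

/-- `D₇` for an arbitrary function `u` in place of `v` and signs `ε`. -/
def sevenFun (u ε : Site d → ℝ) (x : Site d) : ℝ :=
  u x ^ 4 * ∑' y, u y ^ 3 * ε y * Gt d x y ^ 6

/-- The terms of order `i`, for a potential with support in `Λ`; the final Green's function is
replaced by `h`. -/
def orderSum (Λ : Finset (Site d)) (u ε h : Site d → ℝ) (i : ℕ) (x : Site d) : ℝ :=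
  ((wordTerms i).map fun p => p.1.eval (sigma d) (rho d) (eta d) *
    run Λ u ε h (Word.flat p.2) x []).sum -
  if i = 7 then ∑ y ∈ Λ, G0 d x y * (sevenFun u ε y * h y) else 0

/-- The terms of order `i`, without the first Green's function. -/
def strippedSum (Λ : Finset (Site d)) (u ε h : Site d → ℝ) (i : ℕ) (x : Site d) : ℝ :=
  ((wordTerms i).map fun p => p.1.eval (sigma d) (rho d) (eta d) *
    run Λ u ε h (Word.flat p.2).tail x []).sum -
  if i = 7 then sevenFun u ε x * h x else 0

lemma orderSum_eq_sum {i : ℕ} (hi : i ≤ 7) (hi0 : i ≠ 0) (x : Site d) :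
    orderSum Λ u ε h i x = ∑ y ∈ Λ, G0 d x y * strippedSum Λ u ε h i y := by
  simp only [strippedSum, mul_sub, Finset.sum_sub_distrib, orderSum, ← List.sum_map_mul_left,
    sum_list_sum]
  congr 1
  · congr 1
    refine List.map_congr_left fun p hp => ?_
    rw [wordTerms_flat hi hi0 hp, run, Finset.mul_sum]
    refine Finset.sum_congr rfl fun y _ => ?_
    simp only [Atom.kern, List.tail_cons]
    ring
  · split_ifs <;> simp

lemma sum_strippedPrograms (hd : 5 ≤ d) {κ : ℝ} (hκ : ∀ x, |u x| ≤ κ)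
    (hu : ∀ x, x ∉ Λ → u x = 0) (i : ℕ) {x : Site d} (hx : x ∈ Λ) :
    ((strippedPrograms i).map fun p => p.1.eval (sigma d) (rho d) (eta d)
      * sem Λ u ε (fun y _ _ => h y) p.2 x x []).sum = strippedSum Λ u ε h i x := by
  rw [strippedPrograms, List.map_append, List.sum_append, sum_map_flatMap, strippedSum,
    sub_eq_add_neg]
  congr 1
  · congr 1
    refine List.map_congr_left fun p _ => ?_
    rw [← sum_sem_programs hd hκ hu _ hx hx [], List.map_map, ← List.sum_map_mul_left]
    congr 1
    refine List.map_congr_left fun q _ => ?_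
    simp only [Function.comp_apply, Coef.eval_mul]; ring
  · split_ifs
    · have ht : sevenFun u ε x = u x ^ 4 * ∑ y ∈ Λ, u y ^ 3 * ε y * Gt d x y ^ 6 := by
        rw [sevenFun, tsum_eq_sum_of_support hu fun z hz => by simp [hz]]
      simp only [opsD7, sem, moveKern_nil (show 6 ≠ 0 by norm_num), ht, List.map_cons,
        List.map_nil, List.sum_cons, List.sum_nil, Coef.eval, Finset.mul_sum, Finset.sum_mul]
      rw [add_zero, ← Finset.sum_neg_distrib]
      refine Finset.sum_congr rfl fun y _ => ?_
      push_cast; ring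
    · simp

lemma sum_prefixedPrograms (hd : 5 ≤ d) {κ : ℝ} (hκ : ∀ x, |u x| ≤ κ)
    (hu : ∀ x, x ∉ Λ → u x = 0) (c : Coef) (ops : List Op) {i : ℕ} {x : Site d} (hx : x ∈ Λ) :
    ((prefixedPrograms c ops i).map fun p => p.1.eval (sigma d) (rho d) (eta d)
      * sem Λ u ε (fun y _ _ => h y) p.2 x x []).sum
    = c.eval (sigma d) (rho d) (eta d) * sem Λ u ε (fun y _ l =>
      ((wordTerms i).map fun p => p.1.eval (sigma d) (rho d) (eta d) *
        run Λ u ε h (Word.flat p.2) y l).sum) ops x x [] := by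
  rw [prefixedPrograms, sum_map_flatMap, sem_sum, ← List.sum_map_mul_left]
  congr 1
  refine List.map_congr_left fun p _ => ?_
  rw [sem_congr (fun y hy s hs l => (sum_sem_programs hd hκ hu (Word.flat p.2) hy hs l).symm) ops
    hx hx, sem_sum, List.map_map, ← mul_assoc, ← List.sum_map_mul_left]
  congr 1
  refine List.map_congr_left fun q _ => ?_
  simp only [Function.comp_apply, Coef.eval_mul, sem_append]; ring

lemma orderSum_of_ne {i : ℕ} (hi : i ≠ 7) (x : Site d) : orderSum Λ u ε h i x
    = ((wordTerms i).map fun p => p.1.eval (sigma d) (rho d) (eta d) *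
      run Λ u ε h (Word.flat p.2) x []).sum := by
  rw [orderSum, if_neg hi, sub_zero]

/-- The terms of order `i` cancel in the product of the Hamiltonian with the expansion. -/
theorem strippedSum_add (hd : 5 ≤ d) {κ : ℝ} (hκ : ∀ x, |u x| ≤ κ)
    (hu : ∀ x, x ∉ Λ → u x = 0) (hε : ∀ x, ε x ^ 2 = 1) {i : ℕ} (hi0 : i ≠ 0) (hi : i ≤ 7)
    {x : Site d} (hx : x ∈ Λ) :
    strippedSum Λ u ε h i x + u x * ε x * orderSum Λ u ε h (i - 1) x
      + (if 2 ≤ i then sigma d * u x ^ 2 * orderSum Λ u ε h (i - 2) x else 0)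
      + (if 4 ≤ i then -rho d * u x ^ 4 * orderSum Λ u ε h (i - 4) x else 0)
      + (if 6 ≤ i then ((4 * eta d - 3 * sigma d ^ 5 + 5 * sigma d ^ 2 * rho d) * u x ^ 6
        + rFun u x) * orderSum Λ u ε h (i - 6) x else 0) = 0 := by
  have hmem : i ∈ [1, 2, 3, 4, 5, 6, 7] := by
    simp only [List.mem_cons, List.not_mem_nil, or_false]; omega
  have h0 := sum_sem_eq_zero (Λ := Λ) (u := u) (h := h) hε (checkZero_orderPrograms i hmem) hx
  have hif : ∀ (q : Prop) [Decidable q] (L : List (Coef × List Op)) (r : ℝ),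
      (q → (L.map fun p => p.1.eval (sigma d) (rho d) (eta d)
        * sem Λ u ε (fun y _ _ => h y) p.2 x x []).sum = r) →
      ((if q then L else []).map fun p => p.1.eval (sigma d) (rho d) (eta d)
        * sem Λ u ε (fun y _ _ => h y) p.2 x x []).sum = if q then r else 0 := by
    intro q _ L r hL
    by_cases hq : q
    · rw [if_pos hq, if_pos hq, hL hq]
    · rw [if_neg hq, if_neg hq, List.map_nil, List.sum_nil]
  have hR : ∀ j, j ≠ 7 → (((Atom.R6.ops.flatMap fun q => prefixedPrograms q.1 q.2 j).map
      fun p => p.1.eval (sigma d) (rho d) (eta d)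
        * sem Λ u ε (fun y _ _ => h y) p.2 x x []).sum) = rFun u x * orderSum Λ u ε h j x := by
    intro j hj
    rw [sum_map_flatMap]
    simp only [sum_prefixedPrograms hd hκ hu _ _ hx]
    rw [Atom.sum_sem_ops hd hκ hu _ (fun y l => ((wordTerms j).map fun p =>
      p.1.eval (sigma d) (rho d) (eta d) * run Λ u ε h (Word.flat p.2) y l).sum) hx,
      Atom.kern, sum_diag_mul hx, orderSum_of_ne hj]
  rw [orderPrograms, List.map_append, List.sum_append, List.map_append, List.sum_append,
    List.map_append, List.sum_append, List.map_append, List.sum_append,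
    sum_strippedPrograms hd hκ hu i hx, sum_prefixedPrograms hd hκ hu _ _ hx] at h0
  rw [hif (2 ≤ i) _ (sigma d * u x ^ 2 * orderSum Λ u ε h (i - 2) x) fun _ => ?_,
    hif (4 ≤ i) _ (-rho d * u x ^ 4 * orderSum Λ u ε h (i - 4) x) fun _ => ?_,
    hif (6 ≤ i) _ (((4 * eta d - 3 * sigma d ^ 5 + 5 * sigma d ^ 2 * rho d) * u x ^ 6
        + rFun u x) * orderSum Λ u ε h (i - 6) x) fun _ => ?_] at h0
  · have h1 : Coef.eval (sigma d) (rho d) (eta d) [(1, 0, 0, 0)] = 1 := by simp [Coef.eval]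
    rw [h1, one_mul] at h0
    refine Eq.trans ?_ h0
    rw [orderSum_of_ne (by omega : i - 1 ≠ 7)]
    simp only [sem, pow_one, mul_assoc]
  · rw [List.map_append, List.sum_append, hR _ (by omega),
      sum_prefixedPrograms hd hκ hu _ _ hx, orderSum_of_ne (by omega)]
    simp only [sem, Coef.eval, coef6, List.map_cons, List.map_nil, List.sum_cons, List.sum_nil]
    push_cast; ring
  all_goals
    rw [sum_prefixedPrograms hd hκ hu _ _ hx, orderSum_of_ne (by omega)]
    simp only [sem, Coef.eval, List.map_cons, List.map_nil, List.sum_cons, List.sum_nil]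
    push_cast; ring

/-- The product of the Hamiltonian with the expansion, for a potential of finite support. -/
theorem negLap_orderSum_add (hd : 5 ≤ d) {κ : ℝ} (hκ : ∀ x, |u x| ≤ κ)
    (hu : ∀ x, x ∉ Λ → u x = 0) (hε : ∀ x, ε x ^ 2 = 1) {i : ℕ} (hi0 : i ≠ 0) (hi : i ≤ 7)
    (x : Site d) :
    negLap (orderSum Λ u ε h i) x + u x * ε x * orderSum Λ u ε h (i - 1) x
      + (if 2 ≤ i then sigma d * u x ^ 2 * orderSum Λ u ε h (i - 2) x else 0)
      + (if 4 ≤ i then -rho d * u x ^ 4 * orderSum Λ u ε h (i - 4) x else 0)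
      + (if 6 ≤ i then ((4 * eta d - 3 * sigma d ^ 5 + 5 * sigma d ^ 2 * rho d) * u x ^ 6
        + rFun u x) * orderSum Λ u ε h (i - 6) x else 0) = 0 := by
  have e : negLap (orderSum Λ u ε h i) x = if x ∈ Λ then strippedSum Λ u ε h i x else 0 := by
    rw [show orderSum Λ u ε h i = fun x => ∑ y ∈ Λ, strippedSum Λ u ε h i y * G0 d x y from
      funext fun x => by rw [orderSum_eq_sum hi hi0]; simp only [mul_comm], negLap_sum_green hd]
  rw [e]
  by_cases hx : x ∈ Λ
  · rw [if_pos hx]; exact strippedSum_add hd hκ hu hε hi0 hi hx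
  · have h0 := hu x hx
    simp [hx, h0, rFun]

end Order

/-! ### Removal of the cutoff -/

lemma enorm_eq_one_of_sq {a : ℝ} (h : a ^ 2 = 1) : ‖a‖ₑ = 1 := by
  rcases mul_self_eq_one_iff.1 ((sq a).symm.trans h) with rfl | rfl <;> simp

lemma enorm_seven_le {ε : Site d → ℝ} (hε : ∀ x, ε x ^ 2 = 1) {κ : ℝ} {u : Site d → ℝ}
    (hu : ∀ x, |u x| ≤ κ) (x z : Site d) :
    ‖u z ^ 3 * ε z * Gt d x z ^ 6‖ₑ ≤ ENNReal.ofReal κ ^ 3 * ‖Gt d x z‖ₑ ^ 6 := by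
  rw [enorm_mul, enorm_mul, enorm_eq_one_of_sq (hε z), mul_one, enorm_pow (Gt d x z)]
  gcongr
  exact enorm_pow_le_of_abs_le hu 3 z

lemma tsum_seven_ne_top (hd : 5 ≤ d) (κ : ℝ) (x : Site d) :
    ∑' z, ENNReal.ofReal κ ^ 3 * ‖Gt d x z‖ₑ ^ 6 ≠ ∞ := by
  obtain ⟨c, hc, hb⟩ := (isSchur_gt_pow hd (k := 6) (by norm_num)).1
  rw [ENNReal.tsum_mul_left]
  exact ENNReal.mul_ne_top (by finiteness) (ne_top_of_le_ne_top hc (hb x))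

lemma exists_dominated_sevenFun (hd : 5 ≤ d) (κ : ℝ) {ε : Site d → ℝ} (hε : ∀ x, ε x ^ 2 = 1) :
    ∃ A : EKern d, IsSchur A ∧ Dominated κ (fun u => diag (sevenFun u ε)) A := by
  obtain ⟨c, hc, hb⟩ := (isSchur_gt_pow hd (k := 6) (by norm_num)).1
  refine ⟨_, isSchur_ediag (c := ENNReal.ofReal κ ^ 4 * (ENNReal.ofReal κ ^ 3 * c))
    (by finiteness) fun _ => le_rfl, dominated_diag (fun u hu x => ?_) fun u u' hu h x => ?_⟩
  · rw [sevenFun, enorm_mul]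
    refine mul_le_mul' (enorm_pow_le_of_abs_le hu 4 x) ((enorm_tsum_le _).trans ?_)
    refine (ENNReal.tsum_le_tsum (enorm_seven_le hε hu x)).trans ?_
    rw [ENNReal.tsum_mul_left]
    gcongr
    exact hb x
  · exact ((h x).pow 4).mul (tendsto_tsum_of_enorm_le (tsum_seven_ne_top hd κ x)
      (fun z => (((h z).pow 3).mul_const _).mul_const _) fun N z => enorm_seven_le hε (hu N) x z)

lemma exists_dominatedPath_seven (hd : 5 ≤ d) (κ : ℝ) {ε : Site d → ℝ} (hε : ∀ x, ε x ^ 2 = 1) :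
    ∃ A : EKern d, IsBdd A ∧
      DominatedPath κ [fun _ => G0 d, fun u => diag (sevenFun u ε), fun _ => G0 d] A := by
  obtain ⟨A, hA, hdom⟩ := exists_dominated_sevenFun hd κ hε
  have hG := dominated_const κ (G0 d)
  have h1 := hA.emul_isSq (isSq_G0 hd)
  have h2 := (isSq_G0 hd).emul h1
  have ne : ∀ {A : EKern d}, IsBdd A → ∀ x y, A x y ≠ ∞ := fun ⟨c, hc, h⟩ x y =>
    ne_top_of_le_ne_top hc (h x y)
  exact ⟨_, h2, (DominatedPath.cons hG ((DominatedPath.cons hdom hG.path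
    (by simp) (ne h1.isBdd))) (by simp) (ne h2))⟩

lemma isSchur_sevenFun (hd : 5 ≤ d) {κ : ℝ} {ε : Site d → ℝ} (hε : ∀ x, ε x ^ 2 = 1)
    {u : Site d → ℝ} (hu : ∀ x, |u x| ≤ κ) : IsSchur (eabs (diag (sevenFun u ε))) := by
  obtain ⟨A, hA, hdom⟩ := exists_dominated_sevenFun hd κ hε
  exact hA.mono (hdom.bound u hu)

lemma kprod_seven (hd : 5 ≤ d) {κ : ℝ} {ε : Site d → ℝ} (hε : ∀ x, ε x ^ 2 = 1)
    {u : Site d → ℝ} (hu : ∀ x, |u x| ≤ κ) (x y : Site d) :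
    kprod [G0 d, diag (sevenFun u ε), G0 d] x y
      = ∑' z, G0 d x z * (sevenFun u ε z * G0 d z y) := by
  have hS := isSchur_sevenFun hd hε hu
  rw [kprod_cons _ (by simp)
    (epath_ne_top_of_isBdd (isBdd_epath_three (isSq_G0 hd) hS (isSq_G0 hd)) x y)]
  refine tsum_congr fun z => ?_
  rw [kprod_diag_cons _ (by simp) (isSq_epath_two hS (isSq_G0 hd)).isBdd, kprod_singleton]

/-- A sequence of finite boxes that exhausts the lattice. -/
def cube (d N : ℕ) : Finset (Site d) := Fintype.piFinset fun _ => Finset.Icc (-(N : ℤ)) N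

/-- The restriction of a function to a box. -/
def cutoff (u : Site d → ℝ) (N : ℕ) (x : Site d) : ℝ := if x ∈ cube d N then u x else 0

lemma cutoff_of_notMem (u : Site d → ℝ) {N : ℕ} {x : Site d} (hx : x ∉ cube d N) :
    cutoff u N x = 0 := if_neg hx

lemma abs_cutoff_le {κ : ℝ} (hκ : 0 ≤ κ) {u : Site d → ℝ} (hu : ∀ x, |u x| ≤ κ) (N : ℕ)
    (x : Site d) : |cutoff u N x| ≤ κ := by
  rw [cutoff]
  split_ifs
  · exact hu x
  · simpa using hκ

lemma mem_cube {x : Site d} {N : ℕ} (hN : siteL1 x ≤ N) : x ∈ cube d N := by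
  rw [cube, Fintype.mem_piFinset]
  intro i
  have h : (x i).natAbs ≤ siteL1 x :=
    Finset.single_le_sum (f := fun i => (x i).natAbs) (fun _ _ => Nat.zero_le _) (Finset.mem_univ i)
  rw [Finset.mem_Icc]
  omega

lemma tendsto_cutoff (u : Site d → ℝ) (x : Site d) :
    Tendsto (fun N => cutoff u N x) atTop (𝓝 (u x)) := by
  refine tendsto_const_nhds.congr' ?_
  filter_upwards [eventually_ge_atTop (siteL1 x)] with N hN
  rw [cutoff, if_pos (mem_cube hN)]

lemma ite_tendsto {f : ℕ → ℝ} {a : ℝ} {q : Prop} [Decidable q] (h : Tendsto f atTop (𝓝 a)) :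
    Tendsto (fun N => if q then f N else 0) atTop (𝓝 (if q then a else 0)) := by
  split_ifs
  · exact h
  · exact tendsto_const_nhds

section Limit

variable {Ω : Type*} [MeasurableSpace Ω] {P : Measure Ω}

/-- Finitely many sequences that converge in measure converge almost surely along a common
subsequence. -/
lemma exists_common_seq_tendsto_ae {ι : Type*} {f : ι → ℕ → Ω → ℝ} {g : ι → Ω → ℝ} (l : List ι)
    (h : ∀ i ∈ l, TendstoInMeasure P (f i) atTop (g i)) : ∃ ns : ℕ → ℕ, StrictMono ns ∧
      ∀ i ∈ l, ∀ᵐ w ∂P, Tendsto (fun N => f i (ns N) w) atTop (𝓝 (g i w)) := by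
  induction l with
  | nil => exact ⟨id, strictMono_id, by simp⟩
  | cons i l ih =>
    obtain ⟨ns, hns, h1⟩ := ih fun j hj => h j (List.mem_cons_of_mem _ hj)
    have h2 : TendstoInMeasure P (fun N => f i (ns N)) atTop (g i) :=
      fun δ hδ => (h i List.mem_cons_self δ hδ).comp hns.tendsto_atTop
    obtain ⟨ms, hms, h3⟩ := h2.exists_seq_tendsto_ae
    refine ⟨ns ∘ ms, hns.comp hms, fun j hj => ?_⟩
    rcases List.mem_cons.1 hj with rfl | hj
    · exact h3
    · filter_upwards [h1 j hj] with w hw using hw.comp hms.tendsto_atTop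

variable {ω : Site d → Ω → ℝ} {α κ : ℝ}

lemma evalExp_terms {i : ℕ} (hi : i ≤ 7) (n n' : Site d) (w : Ω) :
    evalExp P ω α κ (terms d α κ i) n n' w = ((wordTerms i).map fun p =>
      p.1.eval (sigma d) (rho d) (eta d) * admSum P ω α κ (Word.kern (v α κ) p.2) n n' w).sum := by
  rw [evalExp, terms_eq d α κ hi, List.map_map]
  rfl

variable [IsProbabilityMeasure P]

lemma tendstoInMeasure_walkSum (hd : 5 ≤ d) (hα : 0 ≤ α) (hκ : 0 ≤ κ) (hω : IsBernoulliField P ω)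
    {i : ℕ} (hi : i ≤ 7) {p : Coef × Word} (hp : p ∈ wordTerms i) (n n' : Site d) :
    TendstoInMeasure P (fun N w => walkSum (cube d N) (cutoff (v α κ) N) (fun x => ω x w)
      (p.2.edge (cutoff (v α κ) N)) (p.2.length - 1) n n' []) atTop
      (admSum P ω α κ (Word.kern (v α κ) p.2) n n') := by
  have hv := abs_v_le (d := d) hα hκ
  have hA := wordTerms_isGood hi hp rfl
  have hs : ((Word.kern (v (d := d) α κ) p.2).map kprod).length - 1 = p.2.length - 1 := by
    simp [Word.kern]
  refine (tendstoInMeasure_of_tendsto_Lp (hA.tendsto_admLp hd hω (abs_cutoff_le hκ hv)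
    (tendsto_cutoff _) n n')).congr (fun N => ?_) ((hA.admConverges hd hω hs hv).2 n n').symm
  exact admLp_ae_eq hω (fun x hx => cutoff_of_notMem _ hx) _ _ _ _

/-- The boxed terms are limits of the terms with a potential of finite support. -/
lemma ae_exists_tendsto_orderSum (hd : 5 ≤ d) (hα : 0 ≤ α) (hκ : 0 ≤ κ)
    (hω : IsBernoulliField P ω) (l : List (Site d)) (n' : Site d) :
    ∃ ns : ℕ → ℕ, StrictMono ns ∧ ∀ᵐ w ∂P, ∀ i ≤ 7, ∀ x ∈ l, Tendsto (fun N =>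
      orderSum (cube d (ns N)) (cutoff (v α κ) (ns N)) (fun x => ω x w) (fun y => G0 d y n') i x)
      atTop (𝓝 (box P ω α κ i x n' w)) := by
  have hv := abs_v_le (d := d) hα hκ
  have hc := abs_cutoff_le hκ hv
  obtain ⟨ns, hns, h1⟩ := exists_common_seq_tendsto_ae (P := P)
    (f := fun (q : (Coef × Word) × Site d) N w => walkSum (cube d N) (cutoff (v α κ) N)
      (fun x => ω x w) (q.1.2.edge (cutoff (v α κ) N)) (q.1.2.length - 1) q.2 n' [])
    (g := fun q => admSum P ω α κ (Word.kern (v α κ) q.1.2) q.2 n')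
    (List.product ((List.range 8).flatMap wordTerms) l) (by
      rintro ⟨p, x⟩ hq
      rw [List.pair_mem_product, List.mem_flatMap] at hq
      obtain ⟨⟨i, hi, hp⟩, -⟩ := hq
      rw [List.mem_range] at hi
      exact tendstoInMeasure_walkSum hd hα hκ hω (by omega) hp x n')
  refine ⟨ns, hns, ?_⟩
  have h2 := (ae_ball_iff (List.finite_toSet _).countable).2 h1
  filter_upwards [h2, hω.ae_sq_eq_one] with w hw hε i hi x hx
  have hword : Tendsto (fun N => ((wordTerms i).map fun p =>
      p.1.eval (sigma d) (rho d) (eta d) * run (cube d (ns N)) (cutoff (v α κ) (ns N))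
        (fun x => ω x w) (fun y => G0 d y n') (Word.flat p.2) x []).sum) atTop
      (𝓝 (evalExp P ω α κ (terms d α κ i) x n' w)) := by
    rw [evalExp_terms hi]
    refine tendsto_list_sum _ fun p hp => ?_
    have hg := wordTerms_isGood hi hp (s := p.2.length - 1) rfl
    simp only [run_flat hd (hc _) (fun x hx => cutoff_of_notMem _ hx) n' p.2 (p.2.length - 1)
      hg.length (wordTerms_regular hi hp)]
    exact (hw (p, x) (List.pair_mem_product.2 ⟨List.mem_flatMap.2
      ⟨i, List.mem_range.2 (by omega), hp⟩, hx⟩)).const_mul _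
  refine hword.sub ?_
  split_ifs
  · obtain ⟨A, -, hdom⟩ := exists_dominatedPath_seven hd κ hε
    refine ((hdom.tendsto _ _ hc (tendsto_cutoff _) x n').comp hns.tendsto_atTop).congr fun N => ?_
    simp only [Function.comp_apply, List.map_cons, List.map_nil]
    rw [kprod_seven hd hε (hc _), tsum_eq_sum]
    intro z hz
    simp [sevenFun, cutoff_of_notMem _ hz]
  · exact tendsto_const_nhds

lemma ae_box_zero (hd : 5 ≤ d) (hα : 0 ≤ α) (hκ : 0 ≤ κ)
    (hω : IsBernoulliField P ω) : ∀ᵐ w ∂P, ∀ n n', box P ω α κ 0 n n' w = G0 d n n' := by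
  rw [ae_all_iff]; intro n
  rw [ae_all_iff]; intro n'
  obtain ⟨ns, -, h⟩ := ae_exists_tendsto_orderSum hd hα hκ hω [n] n'
  filter_upwards [h] with w hw
  refine tendsto_nhds_unique (hw 0 (by norm_num) n (by simp)) ?_
  refine tendsto_const_nhds.congr fun N => ?_
  simp [orderSum, wordTerms, Coef.eval, Word.flat, run]

/-- The recursion for the boxed terms that makes the Hamiltonian cancel all terms of orders
`1, …, 7`. -/
theorem ae_negLap_box (hd : 5 ≤ d) (hα : 0 ≤ α) (hκ : 0 ≤ κ)
    (hω : IsBernoulliField P ω) : ∀ᵐ w ∂P, ∀ n' x, ∀ i, i ≠ 0 → i ≤ 7 →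
    negLap (fun n => box P ω α κ i n n' w) x + potV ω α κ w x * box P ω α κ (i - 1) x n' w
      + (if 2 ≤ i then delta2V α κ x * box P ω α κ (i - 2) x n' w else 0)
      + (if 4 ≤ i then delta4V α κ x * box P ω α κ (i - 4) x n' w else 0)
      + (if 6 ≤ i then delta6V α κ x * box P ω α κ (i - 6) x n' w else 0) = 0 := by
  rw [ae_all_iff]; intro n'
  rw [ae_all_iff]; intro x
  have hv := abs_v_le (d := d) hα hκ
  have hc := abs_cutoff_le hκ hv
  obtain ⟨ns, hns, h⟩ := ae_exists_tendsto_orderSum hd hα hκ hω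
    (x :: (List.finRange d).flatMap fun j => [x + Pi.single j 1, x - Pi.single j 1]) n'
  filter_upwards [h, hω.ae_sq_eq_one] with w hw hε i hi0 hi
  have hx : ∀ i ≤ 7, Tendsto (fun N => orderSum (cube d (ns N)) (cutoff (v α κ) (ns N))
      (fun x => ω x w) (fun y => G0 d y n') i x) atTop (𝓝 (box P ω α κ i x n' w)) :=
    fun i hi => hw i hi x (by simp)
  have hu : Tendsto (fun N => cutoff (v α κ) (ns N) x) atTop (𝓝 (v α κ x)) :=
    (tendsto_cutoff _ x).comp hns.tendsto_atTop
  have hr : Tendsto (fun N => rFun (cutoff (v α κ) (ns N)) x) atTop (𝓝 (R6 d α κ x)) := by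
    obtain ⟨A, -, hdom⟩ := exists_dominated_rFun hd κ
    have := hdom.tendsto _ _ hc (tendsto_cutoff (v α κ)) x x
    simp only [diag, if_true] at this
    exact this.comp hns.tendsto_atTop
  have hL : Tendsto (fun N => negLap (orderSum (cube d (ns N)) (cutoff (v α κ) (ns N))
      (fun x => ω x w) (fun y => G0 d y n') i) x) atTop
      (𝓝 (negLap (fun n => box P ω α κ i n n' w) x)) := by
    refine ((hx i hi).const_mul _).sub (tendsto_finsetSum _ fun j _ => Tendsto.add ?_ ?_) <;>
    · refine hw i hi _ (List.mem_cons_of_mem _ (List.mem_flatMap.2 ⟨j, List.mem_finRange j, ?_⟩))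
      simp
  have hlim := (((hL.add ((hu.mul_const (ω x w)).mul (hx (i - 1) (by omega)))).add
    (ite_tendsto (q := 2 ≤ i) (((hu.pow 2).const_mul (sigma d)).mul (hx (i - 2) (by omega))))).add
    (ite_tendsto (q := 4 ≤ i) (((hu.pow 4).const_mul (-rho d)).mul (hx (i - 4) (by omega))))).add
    (ite_tendsto (q := 6 ≤ i) ((((hu.pow 6).const_mul
      (4 * eta d - 3 * sigma d ^ 5 + 5 * sigma d ^ 2 * rho d)).add hr).mul (hx (i - 6) (by omega))))
  refine tendsto_nhds_unique hlim (tendsto_const_nhds.congr fun N => ?_)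
  exact (negLap_orderSum_add hd (hc _) (fun x hx => cutoff_of_notMem _ hx) hε hi0 hi x).symm

end Limit

/-! ### The columns of the expansion are square-summable -/

section Columns

variable {Ω : Type*} [MeasurableSpace Ω] {P : Measure Ω}

/-- A random function with square-summable norms in `L²(P)` is almost surely square-summable. -/
lemma ae_sqSummable {X : Site d → Ω → ℝ} {Y : Site d → Lp ℝ 2 P} (h : ∀ n, X n =ᵐ[P] Y n)
    (hY : ∑' n, ‖Y n‖ₑ ^ 2 ≠ ∞) : ∀ᵐ w ∂P, SqSummable fun n => X n w := by
  have hm : ∀ n, AEMeasurable (fun w => ‖Y n w‖ₑ ^ 2) P := fun n =>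
    (Lp.aestronglyMeasurable (Y n)).enorm.pow_const 2
  have hi : ∀ n, ∫⁻ w, ‖Y n w‖ₑ ^ 2 ∂P = ‖Y n‖ₑ ^ 2 := by
    intro n
    rw [Lp.enorm_def, eLpNorm_eq_lintegral_rpow_enorm_toReal (by simp) (by simp),
      ← ENNReal.rpow_natCast, ← ENNReal.rpow_mul]
    norm_num
  have hfin : ∫⁻ w, ∑' n, ‖Y n w‖ₑ ^ 2 ∂P ≠ ∞ := by
    rw [lintegral_tsum hm]
    simpa only [hi] using hY
  filter_upwards [ae_lt_top' (AEMeasurable.tsum hm) hfin, ae_all_iff.2 h] with w hw he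
  refine sqSummable_of_tsum_ne_top ?_
  simp only [he]
  exact hw.ne

lemma monotone_cube : Monotone (cube d) := fun N M h _ hx => by
  rw [cube, Fintype.mem_piFinset] at hx ⊢
  intro i
  have := Finset.mem_Icc.1 (hx i)
  rw [Finset.mem_Icc]
  omega

lemma tendsto_cube (d : ℕ) : Tendsto (cube d) atTop atTop :=
  tendsto_atTop_finset_of_monotone monotone_cube fun _ => ⟨_, mem_cube le_rfl⟩

lemma pairSum_singleton (a : Site d → ℝ) :
    pairSum a (fun z => ({z} : Finset (Site d))) = ∑' z, ‖a z‖ₑ ^ 2 := by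
  refine tsum_congr fun z => ?_
  rw [tsum_eq_single z fun y hy => by simp [hy.symm], if_pos rfl, sq]

variable [IsProbabilityMeasure P] {ω : Site d → Ω → ℝ} {α κ : ℝ}

/-- A random series `∑ a z ω_z` that converges absolutely is the sum of the series in `L²`. -/
lemma tsum_ae_eq_tsum_eSign (hω : IsBernoulliField P ω) {a : Site d → ℝ}
    (ha : ∑' z, ‖a z‖ₑ ^ 2 ≠ ∞) (hs : Summable a) :
    (fun w => ∑' z, a z * ω z w) =ᵐ[P] ⇑(∑' z, a z • eSign hω {z}) := by
  have h1 := (hasSum_eSign hω (O := fun z => {z}) (by rwa [pairSum_singleton])).1.hasSum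
  have hf : ∀ z, (fun w => a z * ω z w) =ᵐ[P] fun w => a z * chi ω {z} w := fun z =>
    EventuallyEq.of_eq (funext fun w => by simp [chi])
  have h2 := (tendstoInMeasure_of_tendsto_Lp (h1.comp (tendsto_cube d))).congr
    (fun N => (coeFn_sum_eSign hω hf (cube d N)).symm) EventuallyEq.rfl
  refine tendstoInMeasure_ae_unique (tendstoInMeasure_of_tendsto_ae (fun N => ?_) ?_) h2
  · exact (Finset.measurable_fun_sum _ fun z _ =>
      (hω.measurable z).const_mul _).aestronglyMeasurable
  · filter_upwards [hω.ae_sq_eq_one] with w hw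
    have hsw : Summable fun z => a z * ω z w := summable_of_tsum_enorm_ne_top (by
      simp only [enorm_mul, enorm_eq_one_of_sq (hw _), mul_one]
      exact tsum_enorm_ne_top hs)
    exact hsw.hasSum.comp (tendsto_cube d)

lemma ae_sqSummable_admSum (hd : 5 ≤ d) (hα : 1 / 4 < α) (hκ : 0 ≤ κ) (hω : IsBernoulliField P ω)
    {i : ℕ} (hi : i ≤ 7) {p : Coef × Word} (hp : p ∈ wordTerms i) (n' : Site d) :
    ∀ᵐ w ∂P, SqSummable fun n => admSum P ω α κ (Word.kern (v α κ) p.2) n n' w := by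
  have hu := slowlyVarying_v (d := d) hα hκ
  have hA := wordTerms_isGood hi hp rfl
  exact ae_sqSummable ((hA.admConverges hd hω (by simp [Word.kern]) hu.bound).2 · n')
    (hA.tsum_enorm_admLp_sq hd hω hu n')

/-- The coefficient of `ω_z` in `(G₀ D₇ G₀)(n, n')`. -/
def sevenCoef (u : Site d → ℝ) (n n' z : Site d) : ℝ :=
  ∑' y, G0 d n y * (u y ^ 4 * (u z ^ 3 * Gt d y z ^ 6)) * G0 d y n'

lemma enorm_sevenCoef_term_le {u : Site d → ℝ} (hu : ∀ x, |u x| ≤ κ) (n n' y z : Site d) :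
    ‖G0 d n y * (u y ^ 4 * (u z ^ 3 * Gt d y z ^ 6)) * G0 d y n'‖ₑ
      ≤ ENNReal.ofReal κ ^ 7 * (‖G0 d n y‖ₑ * (‖Gt d y z‖ₑ ^ 6 * ‖G0 d y n'‖ₑ)) := by
  simp only [enorm_mul]
  rw [enorm_pow (Gt d y z)]
  calc _ ≤ ‖G0 d n y‖ₑ * (ENNReal.ofReal κ ^ 4 * (ENNReal.ofReal κ ^ 3 * ‖Gt d y z‖ₑ ^ 6))
        * ‖G0 d y n'‖ₑ := by
        gcongr <;> exact enorm_pow_le_of_abs_le hu _ _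
    _ = _ := by ring

lemma tsum_sevenCoef_term_ne_top (hd : 5 ≤ d) {u : Site d → ℝ} (hu : ∀ x, |u x| ≤ κ)
    (n n' : Site d) : ∑' q : Site d × Site d,
      ‖G0 d n q.1 * (u q.1 ^ 4 * (u q.2 ^ 3 * Gt d q.1 q.2 ^ 6)) * G0 d q.1 n'‖ₑ ≠ ∞ := by
  obtain ⟨c, hc, hb⟩ := (isSchur_gt_pow hd (k := 6) (by norm_num)).1
  obtain ⟨b, hb0, hbb⟩ := (isSq_G0 hd).emul (isSq_G0 hd)
  have hfin : ENNReal.ofReal κ ^ 7 * (c * b) ≠ ∞ := by finiteness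
  have hy : ∀ y, ∑' z, ‖G0 d n y‖ₑ * (‖Gt d y z‖ₑ ^ 6 * ‖G0 d y n'‖ₑ)
      ≤ c * (‖G0 d n y‖ₑ * ‖G0 d y n'‖ₑ) := by
    intro y
    rw [ENNReal.tsum_mul_left, ENNReal.tsum_mul_right, mul_left_comm]
    exact mul_le_mul' (hb y) le_rfl
  refine ne_top_of_le_ne_top hfin ?_
  calc _ ≤ ∑' q : Site d × Site d, ENNReal.ofReal κ ^ 7 *
        (‖G0 d n q.1‖ₑ * (‖Gt d q.1 q.2‖ₑ ^ 6 * ‖G0 d q.1 n'‖ₑ)) :=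
        ENNReal.tsum_le_tsum fun q => enorm_sevenCoef_term_le hu n n' q.1 q.2
    _ = ENNReal.ofReal κ ^ 7 *
        ∑' y, ∑' z, ‖G0 d n y‖ₑ * (‖Gt d y z‖ₑ ^ 6 * ‖G0 d y n'‖ₑ) := by
        rw [ENNReal.tsum_mul_left, ENNReal.tsum_prod']
    _ ≤ ENNReal.ofReal κ ^ 7 * ∑' y, c * (‖G0 d n y‖ₑ * ‖G0 d y n'‖ₑ) :=
        mul_le_mul' le_rfl (ENNReal.tsum_le_tsum hy)
    _ ≤ _ := by
        rw [ENNReal.tsum_mul_left]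
        exact mul_le_mul' le_rfl (mul_le_mul' le_rfl (hbb n n'))

lemma summable_sevenCoef (hd : 5 ≤ d) {u : Site d → ℝ} (hu : ∀ x, |u x| ≤ κ)
    (n n' : Site d) : Summable (sevenCoef u n n') := by
  refine summable_of_tsum_enorm_ne_top (ne_top_of_le_ne_top
    (tsum_sevenCoef_term_ne_top hd hu n n') ?_)
  rw [ENNReal.tsum_prod', ENNReal.tsum_comm]
  exact ENNReal.tsum_le_tsum fun z => enorm_tsum_le _

/-- In `∑_n ∑_z |sevenCoef n n' z|²` the sum over `n` is bounded by the `ℓ²` norm of `G₀`; what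
remains is a bounded operator on `ℓ²`, applied to `G₀`. -/
lemma tsum_sevenCoef_sq_ne_top (hd : 5 ≤ d) {u : Site d → ℝ} (hu : ∀ x, |u x| ≤ κ)
    (n' : Site d) : ∑' n, ∑' z, ‖sevenCoef u n n' z‖ₑ ^ 2 ≠ ∞ := by
  obtain ⟨c, hc, hcb⟩ := (isSq_G0 hd).2
  obtain ⟨b, hb, hbb⟩ := ((isSchur_gt_pow hd (k := 6) (by norm_num)).etransp.emul_isSq
    (isSq_G0 hd)).2
  refine ne_top_of_le_ne_top (b := (ENNReal.ofReal κ ^ 7) ^ 2 * (b * c)) (by finiteness) ?_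
  rw [ENNReal.tsum_comm]
  calc _ ≤ ∑' z, (ENNReal.ofReal κ ^ 7) ^ 2 *
        ((∑' y, ‖Gt d y z‖ₑ ^ 6 * ‖G0 d y n'‖ₑ * 1) ^ 2 * c) := by
        refine ENNReal.tsum_le_tsum fun z => ?_
        calc _ ≤ ∑' n, (ENNReal.ofReal κ ^ 7) ^ 2 *
              (∑' y, ‖Gt d y z‖ₑ ^ 6 * ‖G0 d y n'‖ₑ * ‖G0 d n y‖ₑ) ^ 2 := by
              refine ENNReal.tsum_le_tsum fun n => ?_
              rw [← mul_pow, ← ENNReal.tsum_mul_left]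
              refine pow_le_pow_left' ((enorm_tsum_le _).trans
                (ENNReal.tsum_le_tsum fun y => ?_)) 2
              refine (enorm_sevenCoef_term_le hu n n' y z).trans (le_of_eq ?_)
              ring
          _ ≤ _ := by
              rw [ENNReal.tsum_mul_left]
              gcongr
              refine ennreal_tsum_superposition_sq_le _ (fun _ => 1) (fun y n => ‖G0 d n y‖ₑ)
                (by simp) (by simp) fun y => ?_
              rw [one_pow, one_mul]
              exact hcb y
    _ ≤ _ := by
        rw [ENNReal.tsum_mul_left, ENNReal.tsum_mul_right]
        gcongr
        simp only [mul_one]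
        exact hbb n'

lemma kprod_seven_eq (hd : 5 ≤ d) {u ε : Site d → ℝ} (hu : ∀ x, |u x| ≤ κ)
    (hε : ∀ x, ε x ^ 2 = 1) (n n' : Site d) :
    kprod [G0 d, diag (sevenFun u ε), G0 d] n n' = ∑' z, sevenCoef u n n' z * ε z := by
  have hs : Summable (Function.uncurry fun y z : Site d =>
      G0 d n y * (u y ^ 4 * (u z ^ 3 * Gt d y z ^ 6)) * G0 d y n' * ε z) :=
    summable_of_tsum_enorm_ne_top (by
      refine ne_top_of_le_ne_top (tsum_sevenCoef_term_ne_top hd hu n n')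
        (ENNReal.tsum_le_tsum fun q => ?_)
      rw [Function.uncurry, enorm_mul, enorm_eq_one_of_sq (hε _), mul_one])
  rw [kprod_seven hd hε hu]
  calc _ = ∑' y, ∑' z, G0 d n y * (u y ^ 4 * (u z ^ 3 * Gt d y z ^ 6)) * G0 d y n' * ε z := by
        refine tsum_congr fun y => ?_
        rw [sevenFun, mul_assoc (u y ^ 4), ← tsum_mul_right, ← tsum_mul_left, ← tsum_mul_left]
        refine tsum_congr fun z => ?_
        ring
    _ = _ := by
        rw [← hs.tsum_comm]
        simp only [sevenCoef, ← tsum_mul_right]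

lemma D7_eq {Ω : Type*} (ω : Site d → Ω → ℝ) (α κ : ℝ) (w : Ω) :
    D7 ω α κ w = sevenFun (v α κ) fun x => ω x w := rfl

lemma ae_sqSummable_seven (hd : 5 ≤ d) (hα : 0 ≤ α) (hκ : 0 ≤ κ) (hω : IsBernoulliField P ω)
    (n' : Site d) : ∀ᵐ w ∂P, SqSummable fun n => kprod [G0 d, diag (D7 ω α κ w), G0 d] n n' := by
  have hv := abs_v_le (d := d) hα hκ
  have h2 := tsum_sevenCoef_sq_ne_top hd hv n'
  have h2' := ENNReal.ne_top_of_tsum_ne_top h2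
  refine ae_sqSummable (Y := fun n => ∑' z, sevenCoef (v α κ) n n' z • eSign hω {z})
    (fun n => ?_) (ne_top_of_le_ne_top h2 (ENNReal.tsum_le_tsum fun n => ?_))
  · have h1 : (fun w => kprod [G0 d, diag (D7 ω α κ w), G0 d] n n')
        =ᵐ[P] fun w => ∑' z, sevenCoef (v α κ) n n' z * ω z w := by
      filter_upwards [hω.ae_sq_eq_one] with w hw
      rw [D7_eq]
      exact kprod_seven_eq hd hv hw n n'
    exact h1.trans (tsum_ae_eq_tsum_eSign hω (h2' n) (summable_sevenCoef hd hv n n'))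
  · rw [← pairSum_singleton]
    exact (hasSum_eSign hω (by rw [pairSum_singleton]; exact h2' n)).2

lemma ae_sqSummable_box (hd : 5 ≤ d) (hα : 1 / 4 < α) (hκ : 0 ≤ κ) (hω : IsBernoulliField P ω) :
    ∀ᵐ w ∂P, ∀ n', ∀ i ≤ 7, SqSummable fun n => box P ω α κ i n n' w := by
  rw [ae_all_iff]; intro n'
  rw [ae_all_iff]; intro i
  by_cases hi : i ≤ 7
  swap
  · exact Eventually.of_forall fun w h => absurd h hi
  have h1 : ∀ᵐ w ∂P, ∀ p ∈ wordTerms i,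
      SqSummable fun n => admSum P ω α κ (Word.kern (v α κ) p.2) n n' w :=
    (ae_ball_iff (List.finite_toSet _).countable).2 fun p hp =>
      ae_sqSummable_admSum hd hα hκ hω hi hp n'
  filter_upwards [h1, ae_sqSummable_seven (α := α) hd (by linarith) hκ hω n'] with w hw h7 _
  have h2 : SqSummable fun n => evalExp P ω α κ (terms d α κ i) n n' w := by
    simp only [evalExp_terms hi]
    generalize wordTerms i = l at hw
    induction l with
    | nil => simp [SqSummable]
    | cons p l ih =>
      simp only [List.map_cons, List.sum_cons]
      exact ((hw p List.mem_cons_self).const_mul _).add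
        (ih fun q hq => hw q (List.mem_cons_of_mem _ hq))
  by_cases h : i = 7
  · simp only [box, if_pos h]
    exact h2.sub h7
  · simp only [box, if_neg h, sub_zero]
    exact h2

end Columns

/-! ### The Hamiltonian on square-summable functions -/

lemma eq_add_or_sub_single_of_sum_abs_eq_one {m k : Site d} (h : ∑ i, |m i - k i| = 1) :
    ∃ i, m = k + Pi.single i 1 ∨ m = k - Pi.single i 1 := by
  obtain ⟨i, -, hi⟩ : ∃ i ∈ Finset.univ, |m i - k i| ≠ 0 := by
    by_contra hc
    push Not at hc
    rw [Finset.sum_eq_zero hc] at h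
    exact zero_ne_one h
  rw [← Finset.add_sum_erase _ _ (Finset.mem_univ i)] at h
  have h0 : 0 ≤ ∑ j ∈ Finset.univ.erase i, |m j - k j| :=
    Finset.sum_nonneg fun j _ => abs_nonneg _
  have h1 : 0 < |m i - k i| := lt_of_le_of_ne (abs_nonneg _) (Ne.symm hi)
  have h2 : ∑ j ∈ Finset.univ.erase i, |m j - k j| = 0 := by omega
  have h3 : ∀ j, j ≠ i → m j = k j := fun j hj => by
    have := (Finset.sum_eq_zero_iff_of_nonneg fun j _ => abs_nonneg _).1 h2 j
      (Finset.mem_erase.2 ⟨hj, Finset.mem_univ j⟩)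
    exact sub_eq_zero.1 (abs_eq_zero.1 this)
  have h4 : |m i - k i| = 1 := by omega
  refine ⟨i, ?_⟩
  rcases (abs_eq zero_le_one).1 h4 with h5 | h5
  · left
    ext j
    by_cases hj : j = i
    · subst hj; simp; omega
    · simp [hj, h3 j hj]
  · right
    ext j
    by_cases hj : j = i
    · subst hj; simp; omega
    · simp [hj, h3 j hj]

lemma neighbour_indicator_eq (m k : Site d) : (if ∑ i, |m i - k i| = 1 then (1 : ℝ) else 0)
    = ∑ i, ((if m = k + Pi.single i 1 then 1 else 0) + if m = k - Pi.single i 1 then 1 else 0) := by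
  have hs : ∀ i : Fin d, ∑ j, |(Pi.single i (1 : ℤ) : Site d) j| = 1 := fun i => by
    rw [Finset.sum_eq_single i (fun j _ hj => by simp [hj]) (by simp)]; simp
  have hinj : ∀ i j : Fin d, (Pi.single i (1 : ℤ) : Site d) = Pi.single j 1 ↔ i = j := by
    intro i j
    refine ⟨fun h => ?_, fun h => h ▸ rfl⟩
    by_contra hne
    have := congrFun h i
    simp [hne] at this
  have hne : ∀ i j : Fin d, (Pi.single i (1 : ℤ) : Site d) ≠ -Pi.single j 1 := by
    intro i j h
    have := congrFun h i
    by_cases hij : i = j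
    · subst hij; simp at this
    · simp [hij] at this
  split_ifs with h
  · obtain ⟨i, rfl | rfl⟩ := eq_add_or_sub_single_of_sum_abs_eq_one h
    · simp only [sub_eq_add_neg k, add_right_inj, hinj, hne, if_false, add_zero]
      simp
    · simp only [sub_eq_add_neg k, add_right_inj, neg_inj, hinj]
      have : ∀ j, ¬ (-Pi.single i (1 : ℤ) : Site d) = Pi.single j 1 := fun j hj => hne j i hj.symm
      simp [this]
  · symm
    refine Finset.sum_eq_zero fun i _ => ?_
    rw [if_neg, if_neg, add_zero]
    · rintro rfl; exact h (by simpa using hs i)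
    · rintro rfl; exact h (by simpa using hs i)

/-- The columns of the Hamiltonian have finite support. -/
lemma tsum_mul_ham {Ω : Type*} [MeasurableSpace Ω] (ω : Site d → Ω → ℝ) (α κ : ℝ) (w : Ω)
    (f : Site d → ℝ) (k : Site d) :
    ∑' m, f m * ham ω α κ w m k = negLap f k + V6 ω α κ w k * f k := by
  have hsing : ∀ z : Site d, HasSum (fun m => f m * if m = z then 1 else 0) (f z) := fun z => by
    have := hasSum_single (f := fun m => f m * if m = z then 1 else 0) z fun m hm => by simp [hm]
    simpa using this
  have e : ∀ m, f m * ham ω α κ w m k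
      = (2 * d + V6 ω α κ w k) * (f m * if m = k then 1 else 0)
        - ∑ i, ((f m * if m = k + Pi.single i 1 then 1 else 0)
          + f m * if m = k - Pi.single i 1 then 1 else 0) := by
    intro m
    simp only [← mul_add, ← Finset.mul_sum, ← neighbour_indicator_eq]
    rw [ham, Pi.add_apply, Pi.add_apply, Pi.neg_apply, Pi.neg_apply, laplacian, diag]
    by_cases hm : m = k
    · subst hm; simp; ring
    · simp only [hm, if_false]; ring
  simp only [e]
  rw [(((hsing k).mul_left _).sub (hasSum_sum fun i _ => (hsing _).add (hsing _))).tsum_eq, negLap]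
  ring

/-- Summation by parts in `ℓ²`. -/
lemma tsum_mul_negLap_comm {f g : Site d → ℝ} (hf : SqSummable f) (hg : SqSummable g) :
    ∑' x, f x * negLap g x = ∑' x, negLap f x * g x := by
  have h1 : ∀ z : Site d, ∑' x, f x * g (x + z) = ∑' x, f (x - z) * g x := fun z => by
    rw [← (Equiv.subRight z).tsum_eq fun x => f x * g (x + z)]
    simp
  have h2 : ∀ z : Site d, ∑' x, f x * g (x - z) = ∑' x, f (x + z) * g x := fun z => by
    rw [← (Equiv.addRight z).tsum_eq fun x => f x * g (x - z)]
    simp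
  have s1 : ∀ z, Summable fun x => f x * g (x + z) := fun z => hf.mul (hg.shift z)
  have s2 : ∀ z, Summable fun x => f x * g (x - z) := fun z => hf.mul (hg.shift_sub z)
  have s3 : ∀ z, Summable fun x => f (x + z) * g x := fun z => (hf.shift z).mul hg
  have s4 : ∀ z, Summable fun x => f (x - z) * g x := fun z => (hf.shift_sub z).mul hg
  have s0 : Summable fun x => f x * g x := hf.mul hg
  have e1 : ∀ x, f x * negLap g x = 2 * d * (f x * g x)
      - ∑ i : Fin d, (f x * g (x + Pi.single i 1) + f x * g (x - Pi.single i 1)) := fun x => by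
    rw [negLap, mul_sub, Finset.mul_sum]; simp only [mul_add]; ring
  have e2 : ∀ x, negLap f x * g x = 2 * d * (f x * g x)
      - ∑ i : Fin d, (f (x + Pi.single i 1) * g x + f (x - Pi.single i 1) * g x) := fun x => by
    rw [negLap, sub_mul, Finset.sum_mul]; simp only [add_mul]; ring
  simp only [e1, e2]
  rw [(s0.mul_left _).tsum_sub (summable_sum fun i _ => (s1 _).add (s2 _)),
    (s0.mul_left _).tsum_sub (summable_sum fun i _ => (s3 _).add (s4 _)),
    Summable.tsum_finsetSum fun i _ => (s1 _).add (s2 _),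
    Summable.tsum_finsetSum fun i _ => (s3 _).add (s4 _)]
  congr 1
  refine Finset.sum_congr rfl fun i _ => ?_
  rw [(s1 _).tsum_add (s2 _), (s3 _).tsum_add (s4 _), h1, h2, add_comm]

lemma exists_abs_V6_le (hd : 5 ≤ d) {Ω : Type*} [MeasurableSpace Ω] {ω : Site d → Ω → ℝ} {α κ : ℝ}
    (hv : ∀ x : Site d, |v α κ x| ≤ κ) {w : Ω} (hw : ∀ x, ω x w ^ 2 = 1) :
    ∃ c, ∀ x, |V6 ω α κ w x| ≤ c := by
  obtain ⟨A, hA, hdom⟩ := exists_dominated_rFun hd κ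
  obtain ⟨b, hb, hAb⟩ := hA.1
  have hr : ∀ x : Site d, |R6 d α κ x| ≤ b.toReal := fun x => by
    have h := (hdom.bound _ hv x x).trans ((ENNReal.le_tsum x).trans (hAb x))
    simp only [diag, if_true] at h
    rw [← Real.norm_eq_abs, ← toReal_enorm]
    exact ENNReal.toReal_mono hb h
  have hp : ∀ (k : ℕ) (x : Site d), |v α κ x ^ k| ≤ κ ^ k := fun k x => by
    rw [abs_pow]; exact pow_le_pow_left₀ (abs_nonneg _) (hv x) k
  have hε : ∀ x, |ω x w| = 1 := fun x => by
    rw [← sq_eq_sq₀ (abs_nonneg _) zero_le_one, sq_abs, hw, one_pow]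
  refine ⟨κ + |sigma d| * κ ^ 2 + |-rho d| * κ ^ 4 +
    (|4 * eta d - 3 * sigma d ^ 5 + 5 * sigma d ^ 2 * rho d| * κ ^ 6 + b.toReal), fun x => ?_⟩
  refine (abs_add_le _ _).trans (add_le_add ((abs_add_le _ _).trans (add_le_add
    ((abs_add_le _ _).trans (add_le_add ?_ ?_)) ?_)) ((abs_add_le _ _).trans (add_le_add ?_ (hr x))))
  · rw [potV, abs_mul, hε, mul_one]; exact hv x
  · rw [delta2V, abs_mul]; gcongr; exact hp 2 x
  · rw [delta4V, abs_mul]; gcongr; exact hp 4 x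
  · rw [abs_mul]; gcongr; exact hp 6 x

end Renorm
end

open Renorm in
theorem theorem4p2 (d : ℕ) (hd : 5 ≤ d) (α κ : ℝ) (hα : 1 / 4 < α) (hκ : 0 ≤ κ)
    {Ω : Type*} [MeasurableSpace Ω] (P : Measure Ω) [IsProbabilityMeasure P]
    (ω : Site d → Ω → ℝ) (hω : IsBernoulliField P ω) :
    CoefficientSeriesConverge d α κ ∧
    (∀ i ≤ 7, ∀ p ∈ terms d α κ i, AdmConverges P ω α κ p.2) ∧
    ∀ᵐ w ∂P,
      (∀ n₁, Summable (D7summand ω α κ n₁ w)) ∧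
      ProdConverges [G0 d, diag (D7 ω α κ w), G0 d] ∧
      ∀ G : Kern d, IsInverse (ham ω α κ w) G → ∀ n n',
        Summable (fun m => G n m * opB P ω α κ m n' w) ∧
        G n n' = opA P ω α κ n n' w + ∑' m, G n m * opB P ω α κ m n' w := by
  have hα0 : 0 ≤ α := by linarith
  have hv := (slowlyVarying_v (d := d) hα hκ).bound
  refine ⟨coefficientSeriesConverge hd hα0 hκ, fun i hi p hp => ?_, ?_⟩
  · rw [terms_eq d α κ hi, List.mem_map] at hp
    obtain ⟨q, hq, rfl⟩ := hp
    exact ((wordTerms_isGood hi hq rfl).admConverges hd hω (by simp [Word.kern]) hv).1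
  filter_upwards [hω.ae_sq_eq_one, ae_box_zero hd hα0 hκ hω, ae_negLap_box hd hα0 hκ hω,
    ae_sqSummable_box hd hα hκ hω] with w hε h0 hrec hsq
  refine ⟨fun x => ?_, ?_, fun G hG n n' => ?_⟩
  · exact summable_of_tsum_enorm_ne_top (ne_top_of_le_ne_top (tsum_seven_ne_top hd κ x)
      (ENNReal.tsum_le_tsum fun z => enorm_seven_le hε hv x z))
  · rw [D7_eq]
    exact prodConverges_of_isBdd (by simp)
      (isBdd_epath_three (isSq_G0 hd) (isSchur_sevenFun hd hε hv) (isSq_G0 hd))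
  obtain ⟨c, hc⟩ := exists_abs_V6_le hd hv hε
  have hg : SqSummable (G n) := hG.row_sq n
  have hA : SqSummable fun m => opA P ω α κ m n' w := by
    refine ((SqSummable.sum _ fun i hi => ?_).add (hsq n' 6 (by norm_num))).add
      (hsq n' 7 le_rfl)
    exact hsq n' i (by rw [Finset.mem_Icc] at hi; omega)
  -- the Hamiltonian maps the `n'`-th column of `A` to that of `I - B`
  have hcol : ∀ m, negLap (fun m => opA P ω α κ m n' w) m + V6 ω α κ w m * opA P ω α κ m n' w
      = (if m = n' then 1 else 0) - opB P ω α κ m n' w := by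
    intro m
    have e0 : negLap (fun m => box P ω α κ 0 m n' w) m = if m = n' then 1 else 0 := by
      simp only [h0]; exact negLap_G0 hd m n'
    have e05 : Finset.Icc 0 5 = {0, 1, 2, 3, 4, 5} := by decide
    have e67 : Finset.Icc 6 7 = {6, 7} := by decide
    have e47 : Finset.Icc 4 7 = {4, 5, 6, 7} := by decide
    have e27 : Finset.Icc 2 7 = {2, 3, 4, 5, 6, 7} := by decide
    have hA7 : (fun m => opA P ω α κ m n' w) = fun m => box P ω α κ 0 m n' w +
        (box P ω α κ 1 m n' w + (box P ω α κ 2 m n' w + (box P ω α κ 3 m n' w +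
        (box P ω α κ 4 m n' w + (box P ω α κ 5 m n' w + (box P ω α κ 6 m n' w +
        box P ω α κ 7 m n' w)))))) := by
      funext m
      rw [opA, calR5, e05]
      norm_num
      ring
    have hAm := congrFun hA7 m
    rw [hAm, hA7]
    simp only [negLap_add, e0]
    have r1 := hrec n' m 1 (by norm_num) (by norm_num)
    have r2 := hrec n' m 2 (by norm_num) (by norm_num)
    have r3 := hrec n' m 3 (by norm_num) (by norm_num)
    have r4 := hrec n' m 4 (by norm_num) (by norm_num)
    have r5 := hrec n' m 5 (by norm_num) (by norm_num)
    have r6 := hrec n' m 6 (by norm_num) (by norm_num)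
    have r7 := hrec n' m 7 (by norm_num) (by norm_num)
    norm_num at r1 r2 r3 r4 r5 r6 r7
    rw [opB, V6, e67, e47, e27]
    norm_num
    linear_combination r1 + r2 + r3 + r4 + r5 + r6 + r7
  have hB : SqSummable fun m => opB P ω α κ m n' w := by
    have hδ : SqSummable fun m : Site d => if m = n' then (1 : ℝ) else 0 := by
      refine summable_of_hasFiniteSupport ((Set.finite_singleton n').subset fun m hm => ?_)
      by_contra hne
      exact hm (by simp [Set.mem_singleton_iff.not.1 hne])
    refine (hδ.sub (hA.negLap.add (hA.mul_bounded hc))).of_abs_le fun m => le_of_eq ?_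
    congr 1
    linarith [hcol m]
  have hGB := hg.mul hB
  refine ⟨hGB, ?_⟩
  have hδ : ∀ f : Site d → ℝ, ∀ k, HasSum (fun m => f m * if m = k then 1 else 0) (f k) :=
    fun f k => by
      have := hasSum_single (f := fun m => f m * if m = k then 1 else 0) k fun m hm => by simp [hm]
      simpa using this
  have hinv : ∀ m, negLap (G n) m + V6 ω α κ w m * G n m = if m = n then 1 else 0 := fun m => by
    rw [← tsum_mul_ham, hG.left_inv]; simp only [eq_comm]
  have hbd := hA.mul_bounded hc
  have key : ∑' m, G n m * ((if m = n' then 1 else 0) - opB P ω α κ m n' w)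
      = opA P ω α κ n n' w := by
    simp only [← hcol, mul_add]
    rw [(hg.mul hA.negLap).tsum_add (hg.mul hbd), tsum_mul_negLap_comm hg hA,
      ← (hg.negLap.mul hA).tsum_add (hg.mul hbd), ← (hδ (fun m => opA P ω α κ m n' w) n).tsum_eq]
    refine tsum_congr fun m => ?_
    rw [← hinv]; ring
  simp only [mul_sub] at key
  rw [(hδ (G n) n').summable.tsum_sub hGB, (hδ (G n) n').tsum_eq] at key
  linarith
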